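/- Let $n\in\mathbb N$, $T>0$. For a field $v\in L^2(\mathbb R^n)$ its pressure is the tempered distribution $p=-\sum_{l,k}R_lR_k(v_lv_k)$, where $R_l$ is the Fourier multiplier with symbol $\xi_l/|\xi|$; that is, $\hat p(\xi)=-\sum_{l,k}\frac{\xi_l\xi_k}{|\xi|^2}\widehat{v_lv_k}(\xi)$. Let $u\in C_w([0,T];L^2(\mathbb R^n))$ (weakly continuous in time, jointly measurable) be a weak solution of the Euler equations with initial data $u_0\in L^2(\mathbb R^n)$: $\nabla\cdot u(t)=0$ in the sense of distributions for every $t\in[0,T]$, and for every vector field $\psi\in C_0^\infty(\mathbb R^n\times[0,T])$ with $\nabla_x\cdot\psi=0$ and every $t\in[0,T]$, $$\int_{\mathbb R^n}u(t)\cdot\psi(t)\,dx-\int_{\mathbb R^n}u_0\cdot\psi(0)\,dx-\int_0^t\!\!\int_{\mathbb R^n}u\cdot\partial_s\psi\,dx\,ds=\int_0^t\!\!\int_{\mathbb R^n}\sum_{i,j}u_iu_j\,\partial_i\psi_j\,dx\,ds .$$ For an interval $I\subset[0,T]$ let $\mathcal R(\mathbb R^n\times I)$ be the class of fields $v\in L^3(\mathbb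 R^n\times I)$ with $$\lim_{y\to0}\frac1{|y|}\int_{\mathbb R^n\times I}|v(x-y,t)-v(x,t)|^3\,dx\,dt=0 ,$$ and for open $U\subset\mathbb R^n$ let $u\in\mathcal R(U\times I)$ mean that $u\alpha\in\mathcal R(\mathbb R^n\times I)$ for every $\alpha\in C_0^\infty(U)$. Let $D\subset\mathbb R^n\times[0,T]$ be relatively open and regular: every $(x_0,t_0)\in D$ has an open neighbourhood $U$ of $x_0$ and a relatively open interval $I\subset[0,T]$ containing $t_0$ with $u\in\mathcal R(U\times I)$. Then on $D$ the pressure $p$ of $u$, i.e. the distribution $\chi\mapsto\int_0^T\langle p(t),\chi(t)\rangle\,dt$, $\chi\in C_0^\infty(D)$, where $p(t)$ is the pressure of $u(t)$, is given by a function $p\in L^{3/2}_{\mathrm{loc}}(D)$. For every scalar $\varphi\in C_0^\infty(D)$, the functions $|u|^2\partial_t\varphi$ and $(|u|^2+2p)\,u\cdot\nabla\varphi$ are integrable on $D$, and for all $t',t''\in[0,T]$ $$\int_{D(t'')}|u(t'')|^2\varphi(t'')\,dx-\int_{D(t')}|u(t')|^2\varphi(t')\,dx-\int_{t'}^{t''}\!\!\int_{D(t)}|u|^2\partial_t\varphi\,dx\,dt=\int_{t'}^{t''}\!\!\int_{D(t)}(|u|^2+2p)\,u\cdot\nabla\varphi\,dx\,dt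 ,$$ where $D(t)=\{x:(x,t)\in D\}$. Here $C_0^\infty(D)$ and $C_0^\infty(\mathbb R^n\times[0,T])$ consist of restrictions to $\mathbb R^n\times[0,T]$ of smooth compactly supported functions on $\mathbb R^n\times\mathbb R$, with support in $D$ in the first case; they need not vanish at times $0$ and $T$. For $t''<t'$ the time integral $\int_{t'}^{t''}$ is $-\int_{t''}^{t'}$. -/

import Mathlib

open MeasureTheory Set Filter Topology
open scoped ContDiff FourierTransform

noncomputable section

namespace EulerLocal

/-- Euclidean space `ℝⁿ`. Space-time points are written `(x, t) : Space n × ℝ`. -/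
abbrev Space (n : ℕ) : Type := EuclideanSpace ℝ (Fin n)

/-- The closed space-time slab `ℝⁿ × [0, T]`. -/
def slab (n : ℕ) (T : ℝ) : Set (Space n × ℝ) := univ ×ˢ Icc 0 T

/-- The slice `A(t) = {x | (x, t) ∈ A}`. -/
def slice {n : ℕ} (A : Set (Space n × ℝ)) (t : ℝ) : Set (Space n) := {x | (x, t) ∈ A}

/-- Spatial gradient of a space-time function. -/
def gradX {n : ℕ} (φ : Space n × ℝ → ℝ) (z : Space n × ℝ) : Space n :=
  gradient (fun y => φ (y, z.2)) z.1

/-- Spatial derivative (Jacobian) of a space-time vector field. -/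
def jacX {n : ℕ} (ψ : Space n × ℝ → Space n) (z : Space n × ℝ) : Space n →L[ℝ] Space n :=
  fderiv ℝ (fun y => ψ (y, z.2)) z.1

/-- Spatial divergence of a space-time vector field: the trace of its spatial Jacobian. -/
def divX {n : ℕ} (ψ : Space n × ℝ → Space n) (z : Space n × ℝ) : ℝ :=
  ∑ i : Fin n, (jacX ψ z (EuclideanSpace.single i 1)) i

/-- Time derivative of a space-time function. -/
def dt {n : ℕ} {F : Type} [NormedAddCommGroup F] [NormedSpace ℝ F]
    (φ : Space n × ℝ → F) (z : Space n × ℝ) : F :=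
  deriv (fun s => φ (z.1, s)) z.2

/-- `u ∈ C_w([0,T]; L²(ℝⁿ))` is a weak solution of the Euler equations on `[0, T]` with initial
data `u₀ ∈ L²`. The contraction `(u ⊗ u) : ∇ψ = ∑ᵢⱼ uᵢ uⱼ ∂ᵢψⱼ` is written `⟪u, (Dψ) u⟫`.
Test fields in `C₀^∞` of the slab are restrictions of smooth compactly supported fields on
`ℝⁿ × ℝ`; they need to be divergence free only on the slab. -/
structure IsWeakSolution {n : ℕ} (T : ℝ) (u₀ : Space n → Space n)
    (u : Space n × ℝ → Space n) : Prop where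
  /-- joint measurability on the slab -/
  aestronglyMeasurable : AEStronglyMeasurable u (volume.restrict (slab n T))
  /-- `u(t) ∈ L²` for every `t ∈ [0,T]` -/
  memLp : ∀ t ∈ Icc (0 : ℝ) T, MemLp (fun x => u (x, t)) 2 volume
  /-- weak continuity into `L²` -/
  weakly_continuous : ∀ g : Space n → Space n, MemLp g 2 volume →
    ContinuousOn (fun t => ∫ x, inner ℝ (u (x, t)) (g x)) (Icc 0 T)
  /-- the initial data are in `L²` -/
  memLp_initial : MemLp u₀ 2 volume
  /-- the weak form of the momentum equation -/
  weak_form : ∀ ψ : Space n × ℝ → Space n, ContDiff ℝ ∞ ψ → HasCompactSupport ψ →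
    (∀ z ∈ slab n T, divX ψ z = 0) → ∀ t ∈ Icc (0 : ℝ) T,
      (∫ x, inner ℝ (u (x, t)) (ψ (x, t))) - (∫ x, inner ℝ (u₀ x) (ψ (x, 0)))
        - (∫ s in (0 : ℝ)..t, ∫ x, inner ℝ (u (x, s)) (dt ψ (x, s)))
      = ∫ s in (0 : ℝ)..t, ∫ x, inner ℝ (u (x, s)) (jacX ψ (x, s) (u (x, s)))
  /-- `∇ · u(t) = 0` in the sense of distributions for every `t ∈ [0,T]` -/
  div_free : ∀ t ∈ Icc (0 : ℝ) T, ∀ χ : Space n → ℝ, ContDiff ℝ ∞ χ → HasCompactSupport χ →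
    ∫ x, inner ℝ (u (x, t)) (gradient χ x) = 0

/-- The Fourier symbol `ξ_l / |ξ|` of the `l`-th Riesz projection `R_l`. -/
def rieszSymbol {n : ℕ} (l : Fin n) (ξ : Space n) : ℝ := ξ l / ‖ξ‖

/-- The Fourier transform of the pressure `p = - ∑_{l,k} R_l R_k (v_l v_k)` of a field `v ∈ L²`,
a bounded function of `ξ`, because `v_l v_k ∈ L¹`. -/
def pressureHat {n : ℕ} (v : Space n → Space n) (ξ : Space n) : ℂ :=
  -∑ l : Fin n, ∑ k : Fin n, ((rieszSymbol l ξ * rieszSymbol k ξ : ℝ) : ℂ) *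
    𝓕 (fun x : Space n => ((v x l * v x k : ℝ) : ℂ)) ξ

/-- The value `⟨p, χ⟩ = ⟨𝓕 p, 𝓕⁻¹ χ⟩` of the (tempered) pressure distribution of `v ∈ L²` on a
test function `χ`. -/
def pressurePairing {n : ℕ} (v : Space n → Space n) (χ : Space n → ℝ) : ℂ :=
  ∫ ξ : Space n, pressureHat v ξ * 𝓕⁻ (fun x : Space n => (χ x : ℂ)) ξ

/-- The global class `𝓡(ℝⁿ × I)`: `v ∈ L³(ℝⁿ × I)` and
`(1/|y|) ∫_{ℝⁿ × I} |v(x - y, t) - v(x, t)|³ dx dt → 0` as `y → 0`. -/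
def MemRegClass {n : ℕ} (v : Space n × ℝ → Space n) (I : Set ℝ) : Prop :=
  MemLp v 3 (volume.restrict (univ ×ˢ I)) ∧
  Tendsto (fun y : Space n =>
      (1 / ‖y‖) * ∫ z in (univ : Set (Space n)) ×ˢ I, ‖v (z.1 - y, z.2) - v z‖ ^ 3)
    (𝓝[≠] 0) (𝓝 0)

/-- The class `𝓡(U × I)`: `u α ∈ 𝓡(ℝⁿ × I)` for every `α ∈ C₀^∞(U)`. -/
def MemRegClassOn {n : ℕ} (u : Space n × ℝ → Space n) (U : Set (Space n)) (I : Set ℝ) : Prop :=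
  ∀ α : Space n → ℝ, ContDiff ℝ ∞ α → HasCompactSupport α → tsupport α ⊆ U →
    MemRegClass (fun z => α z.1 • u z) I

/-- A point of the slab is regular if `u ∈ 𝓡(U × I)` for some open neighbourhood `U` of its space
component and some relatively open interval `I = J ∩ [0,T]` around its time component. -/
def IsRegularPoint {n : ℕ} (T : ℝ) (u : Space n × ℝ → Space n) (z : Space n × ℝ) : Prop :=
  ∃ (U : Set (Space n)) (J : Set ℝ), IsOpen U ∧ z.1 ∈ U ∧ IsOpen J ∧ J.OrdConnected ∧ z.2 ∈ J ∧
    MemRegClassOn u U (J ∩ Icc 0 T)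

/-- A regular set: a relatively open subset of the slab all of whose points are regular. -/
def IsRegularSet {n : ℕ} (T : ℝ) (u : Space n × ℝ → Space n) (D : Set (Space n × ℝ)) : Prop :=
  (∃ O : Set (Space n × ℝ), IsOpen O ∧ D = O ∩ slab n T) ∧ ∀ z ∈ D, IsRegularPoint T u z

/-- `C₀^∞(D)` for a relatively open subset `D` of the slab: smooth compactly supported functions
on `ℝⁿ × ℝ` whose support meets the slab inside `D` (so they may be nonzero at times `0`
and `T`). -/
def IsTestFunctionOn {n : ℕ} (T : ℝ) (D : Set (Space n × ℝ)) (φ : Space n × ℝ → ℝ) : Prop :=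
  ContDiff ℝ ∞ φ ∧ HasCompactSupport φ ∧ tsupport φ ∩ slab n T ⊆ D

/-- The function `p ∈ L^{3/2}_loc(D)` is the pressure of `u` on `D`: it represents there the
space-time distribution `χ ↦ ∫₀ᵀ ⟨p(t), χ(t)⟩ dt`, which determines it a.e. on `D`. -/
def IsPressureOn {n : ℕ} (T : ℝ) (u : Space n × ℝ → Space n) (D : Set (Space n × ℝ))
    (p : Space n × ℝ → ℝ) : Prop :=
  (∀ K : Set (Space n × ℝ), IsCompact K → K ⊆ D → MemLp p (3 / 2) (volume.restrict K)) ∧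
  ∀ χ : Space n × ℝ → ℝ, IsTestFunctionOn T D χ →
    ((∫ z in D, p z * χ z : ℝ) : ℂ) =
      ∫ t in (0 : ℝ)..T, pressurePairing (fun x => u (x, t)) (fun x => χ (x, t))

end EulerLocal

end

open EulerLocal

/-! ### Uniform energy bound and a jointly measurable version of the solution. -/

noncomputable section
namespace EulerLocal

/-! The equation is mollified in space, its `j`-th component is multiplied by the mollified velocity
and by `φ`, and the scale `ε` tends to `0`. What could survive is the commutator defect of
Constantin, E and Titi. With `V` the mollified velocity and `S` the mollified products, it is `φ
∂ᵢVⱼ (Sᵢⱼ - VᵢVⱼ)`. Let `α` (`amp`) be the local `L³` size of the increments of the velocity at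
scale `ε`. The gradient is `O(α/ε)` because the derivative of the mollifier has mean zero, and the
bracket is `O(α²)` because it is a covariance. Regularity of `D` says that on a compact `K ⊆ D` the
cube of the increment by `y` has integral `o(|y|)` (`CubicRegularOn`), so the defect, of size
`α³/ε`, tends to `0` in `L¹(K)`. All other terms converge because `α` tends to `0` in `L³(K)`
(`IsMollifier.exists_density_bound`, `CubicRegularOn.tendsto_integral_density`).

The pressure is nonlocal, and it has to be a function in `L^{3/2}` on `K` although the products
`wₗwₖ` are globally only in `L¹`. The symbol of `RₗRₖ` is an integral `∫ K̂(sξ) ds/s`, up to a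
constant, with a Schwartz kernel `K` of mean zero. Scales `s ≥ 1` and distant points are controlled
by the `L¹` norm, that is, by the energy. At small scales and nearby points the mean zero leaves
increments of `wₗwₖ`. Their `L^{3/2}(K)` norm is `O(|h|^{1/3})`, which makes `∫ ds/s` converge at
`0` (`lintegral_nearSingular_rpow_lt_top`). The scale integral therefore defines a function
`pressureFn`, and by Fubini it represents the distribution (`isPressureOn_pressureFn`).

The weak formulation admits only solenoidal test fields, so the pressure must be brought into the
equation. The fields `ΔB eⱼ - ∇∂ⱼB` are solenoidal, and their gradient part is invisible to the
divergence-free `u`. Letting `ΔB` approach a given `H` yields the balance of each component against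
`H`, in which `RᵢRₖ∂ⱼH` is tested against `wᵢwₖ` (`IsWeakSolution.momentumIdentity`). With `H` a
translate of the mollifier, the mollified velocity at a fixed point is a Lipschitz function of time,
so no mollification in time is needed: the chain rule for the square gives the energy balance
(`IsWeakSolution.mollified_energy`).

Weak continuity enters through the energy bound, uniform in time by Banach–Steinhaus. The terms at
`t'` and `t''` converge at every time because `u(t) ∈ L²`. -/

lemma integral_norm_sq_eq_toLp {n : ℕ} {v : Space n → Space n} (hv : MemLp v 2 volume) :
    ∫ x, ‖v x‖ ^ 2 = ‖hv.toLp v‖ ^ 2 := by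
  rw [← real_inner_self_eq_norm_sq, L2.inner_def]
  refine integral_congr_ae ?_
  filter_upwards [hv.coeFn_toLp] with x hx
  rw [hx, real_inner_self_eq_norm_sq]

/-- A weakly continuous field is bounded in `L²`, uniformly in time. -/
lemma IsWeakSolution.exists_energy_bound {n : ℕ} {T : ℝ} {u₀ : Space n → Space n}
    {u : Space n × ℝ → Space n} (hu : IsWeakSolution T u₀ u) :
    ∃ C : ℝ, 0 ≤ C ∧ ∀ t ∈ Icc (0 : ℝ) T, ∫ x, ‖u (x, t)‖ ^ 2 ≤ C := by
  let g : Icc (0 : ℝ) T → (Lp (Space n) 2 (volume : Measure (Space n))) →L[ℝ] ℝ :=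
    fun t => innerSL ℝ ((hu.memLp t t.2).toLp _)
  -- Against a fixed field the pairing is continuous on a compact interval, hence bounded; uniform
  -- boundedness then bounds the norms of the functionals.
  have hb : ∀ f, ∃ C, ∀ t, ‖g t f‖ ≤ C := by
    intro f
    obtain ⟨C, hC⟩ := isCompact_Icc.exists_bound_of_continuousOn
      (hu.weakly_continuous f (Lp.memLp f))
    refine ⟨C, fun t => ?_⟩
    refine le_trans (le_of_eq ?_) (hC t t.2)
    congr 1
    simp only [g, innerSL_apply_apply, L2.inner_def]
    refine integral_congr_ae ?_
    filter_upwards [(hu.memLp t t.2).coeFn_toLp] with x hx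
    rw [hx]
  obtain ⟨C, hC⟩ := banach_steinhaus hb
  refine ⟨C ^ 2, sq_nonneg C, fun t ht => ?_⟩
  rw [integral_norm_sq_eq_toLp (hu.memLp t ht)]
  have := hC ⟨t, ht⟩
  simp only [g, innerSL_apply_norm] at this
  gcongr

/-- `w` is a jointly measurable version of `u` on the slab with all time slices bounded in `L²`. -/
structure IsVersion {n : ℕ} (T : ℝ) (u w : Space n × ℝ → Space n) (C : ℝ) : Prop where
  stronglyMeasurable : StronglyMeasurable w
  memLp : ∀ t, MemLp (fun x => w (x, t)) 2 volume
  energy : ∀ t, ∫ x, ‖w (x, t)‖ ^ 2 ≤ C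
  ae_eq : ∀ᵐ t ∂(volume.restrict (Icc (0 : ℝ) T)),
    (fun x => w (x, t)) =ᵐ[volume] fun x => u (x, t)
  ae_eq_slab : w =ᵐ[volume.restrict (slab n T)] u

lemma volume_restrict_slab (n : ℕ) (I : Set ℝ) :
    (volume : Measure (Space n × ℝ)).restrict (univ ×ˢ I)
      = (volume : Measure (Space n)).prod (volume.restrict I) := by
  rw [Measure.volume_eq_prod, ← Measure.prod_restrict, Measure.restrict_univ]

/-- The measurable modification is kept at those times at which its slice agrees with that of `u`,
and replaced by `0` at all others. Slice integrability and the energy bound then hold at every time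
without exception, which Fubini arguments need. At fixed times, such as the end points of the
balance, `u` itself stays in use. -/
lemma IsWeakSolution.exists_version {n : ℕ} {T : ℝ} {u₀ : Space n → Space n}
    {u : Space n × ℝ → Space n} (hu : IsWeakSolution T u₀ u) :
    ∃ (w : Space n × ℝ → Space n) (C : ℝ), IsVersion T u w C := by
  obtain ⟨C, hC0, hC⟩ := hu.exists_energy_bound
  have hm := hu.aestronglyMeasurable
  set w0 := hm.mk u with hw0
  have hae : ∀ᵐ z ∂(volume : Measure (Space n)).prod (volume.restrict (Icc (0 : ℝ) T)),
      u z = w0 z := by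
    rw [← volume_restrict_slab]
    exact hm.ae_eq_mk
  have hswap : ∀ᵐ t ∂(volume.restrict (Icc (0 : ℝ) T)), ∀ᵐ x ∂(volume : Measure (Space n)),
      u (x, t) = w0 (x, t) := by
    have := (Measure.measurePreserving_swap (μ := volume.restrict (Icc (0 : ℝ) T))
      (ν := (volume : Measure (Space n)))).quasiMeasurePreserving.ae hae
    exact Measure.ae_ae_of_ae_prod this
  set μ := (volume : Measure ℝ).restrict (Icc (0 : ℝ) T)
  set N : Set ℝ := {t | ¬ ∀ᵐ x ∂(volume : Measure (Space n)), u (x, t) = w0 (x, t)}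
  have hN : μ N = 0 := hswap
  -- The set of bad times need not be measurable, so a measurable null set containing it is removed.
  set G : Set ℝ := (toMeasurable μ N)ᶜ ∩ Icc 0 T
  have hGm : MeasurableSet G := (measurableSet_toMeasurable μ N).compl.inter measurableSet_Icc
  have hGae : ∀ᵐ t ∂μ, t ∈ G := by
    have h1 : ∀ᵐ t ∂μ, t ∈ (toMeasurable μ N)ᶜ := by
      rw [ae_iff]
      simp only [mem_compl_iff, not_not, ofPred_mem_eq, measure_toMeasurable, hN]
    filter_upwards [h1, ae_restrict_mem measurableSet_Icc] with t h1 h2 using ⟨h1, h2⟩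
  have hGgood : ∀ t ∈ G, ∀ᵐ x ∂(volume : Measure (Space n)), u (x, t) = w0 (x, t) := by
    intro t ht
    by_contra hcon
    exact ht.1 (subset_toMeasurable μ N hcon)
  set w : Space n × ℝ → Space n := (univ ×ˢ G).indicator w0 with hw
  have hin : ∀ t ∈ G, (fun x => w (x, t)) = fun x => w0 (x, t) := by
    intro t ht; funext x; simp [hw, ht]
  have hout : ∀ t ∉ G, (fun x => w (x, t)) = fun x => 0 := by
    intro t ht; funext x; simp [hw, ht]
  have hG2 : ∀ t ∈ G, (fun x => w (x, t)) =ᵐ[volume] fun x => u (x, t) := by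
    intro t ht
    rw [hin t ht]
    filter_upwards [hGgood t ht] with x hx using hx.symm
  refine ⟨w, C, ?_, ?_, ?_, ?_, ?_⟩
  · exact hm.stronglyMeasurable_mk.indicator (MeasurableSet.univ.prod hGm)
  · intro t
    by_cases ht : t ∈ G
    · exact (memLp_congr_ae (hG2 t ht)).2 (hu.memLp t ht.2)
    · rw [hout t ht]; exact MemLp.zero'
  · intro t
    by_cases ht : t ∈ G
    · rw [integral_congr_ae (g := fun x => ‖u (x, t)‖ ^ 2)]
      · exact hC t ht.2
      · filter_upwards [hG2 t ht] with x hx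
        rw [hx]
    · have := hout t ht
      have h2 : ∀ x, ‖w (x, t)‖ ^ 2 = 0 := fun x => by
        rw [show w (x, t) = 0 from congrFun this x]; simp
      rw [integral_congr_ae (ae_of_all _ h2)]
      simpa using hC0
  · filter_upwards [hGae] with t ht using hG2 t ht
  · rw [slab, volume_restrict_slab]
    have h3 : ∀ᵐ z ∂(volume : Measure (Space n)).prod μ, z.2 ∈ G :=
      Measure.quasiMeasurePreserving_snd.ae hGae
    filter_upwards [hae, h3] with z hz hzG
    rw [hz]
    have : z ∈ (univ : Set (Space n)) ×ˢ G := ⟨mem_univ _, hzG⟩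
    exact indicator_of_mem this w0

end EulerLocal
end

/-! ### Cubic regularity on compact subsets of a regular set. -/

noncomputable section
namespace EulerLocal

/-- `w` is cubically integrable on `S`, with spatial increments of order `o(|y|^{1/3})` in `L³`. -/
def CubicRegularOn {n : ℕ} (w : Space n × ℝ → Space n) (S : Set (Space n × ℝ)) : Prop :=
  ∫⁻ z in S, ‖w z‖ₑ ^ 3 < ⊤ ∧ ∀ η : ℝ, 0 < η → ∃ r : ℝ, 0 < r ∧ ∀ y : Space n, ‖y‖ < r →
    ∫⁻ z in S, ‖w (z.1 + y, z.2) - w z‖ₑ ^ 3 ≤ ENNReal.ofReal (η * ‖y‖)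

lemma CubicRegularOn.mono {n : ℕ} {w : Space n × ℝ → Space n} {S S' : Set (Space n × ℝ)}
    (h : CubicRegularOn w S) (hS : S' ⊆ S) : CubicRegularOn w S' := by
  refine ⟨(lintegral_mono_set hS).trans_lt h.1, fun η hη => ?_⟩
  obtain ⟨r, hr, h2⟩ := h.2 η hη
  exact ⟨r, hr, fun y hy => (lintegral_mono_set hS).trans (h2 y hy)⟩

lemma CubicRegularOn.union {n : ℕ} {w : Space n × ℝ → Space n} {S S' : Set (Space n × ℝ)}
    (h : CubicRegularOn w S) (h' : CubicRegularOn w S') : CubicRegularOn w (S ∪ S') := by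
  refine ⟨(lintegral_union_le _ _ _).trans_lt (ENNReal.add_lt_top.2 ⟨h.1, h'.1⟩), fun η hη => ?_⟩
  obtain ⟨r, hr, h2⟩ := h.2 (η / 2) (by positivity)
  obtain ⟨r', hr', h2'⟩ := h'.2 (η / 2) (by positivity)
  refine ⟨min r r', lt_min hr hr', fun y hy => ?_⟩
  refine (lintegral_union_le _ _ _).trans ((add_le_add (h2 y (hy.trans_le (min_le_left _ _)))
    (h2' y (hy.trans_le (min_le_right _ _)))).trans_eq ?_)
  rw [← ENNReal.ofReal_add (by positivity) (by positivity)]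
  congr 1; ring

lemma measurePreserving_shift {n : ℕ} (I : Set ℝ) (y : Space n) :
    MeasurePreserving (fun z : Space n × ℝ => (z.1 + y, z.2))
      ((volume : Measure (Space n × ℝ)).restrict (univ ×ˢ I))
      ((volume : Measure (Space n × ℝ)).restrict (univ ×ˢ I)) := by
  rw [volume_restrict_slab]
  exact (measurePreserving_add_right (volume : Measure (Space n)) y).prod (MeasurePreserving.id _)

/-- The class is tested with a cutoff that equals `1` within `δ/4` of the point. For base points
within `δ/8` and shifts of length at most `δ/8`, both ends of an increment lie where the cutoff is
`1`, so the increment of the product is that of the field. -/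
lemma cubicRegularOn_nhds {n : ℕ} {T : ℝ} {u w : Space n × ℝ → Space n} {C : ℝ}
    (hw : IsVersion T u w C) {z : Space n × ℝ} (hz : IsRegularPoint T u z) :
    ∃ S ∈ 𝓝[slab n T] z, CubicRegularOn w S := by
  obtain ⟨U, J, hU, hzU, hJ, hJo, hzJ, hreg⟩ := hz
  obtain ⟨δ, hδ, hball⟩ := Metric.isOpen_iff.1 hU z.1 hzU
  let b : ContDiffBump z.1 := ⟨δ / 4, δ / 2, by positivity, by linarith⟩
  set α : Space n → ℝ := fun x => b x with hα
  set I : Set ℝ := J ∩ Icc 0 T with hI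
  have hIm : MeasurableSet I := hJo.measurableSet.inter measurableSet_Icc
  set μ := (volume : Measure (Space n × ℝ)).restrict (univ ×ˢ I) with hμ
  set v : Space n × ℝ → Space n := fun z => α z.1 • u z with hv
  obtain ⟨hv3, hlim⟩ := hreg α b.contDiff b.hasCompactSupport (by
    rw [hα, b.tsupport_eq]
    exact (Metric.closedBall_subset_ball (by change δ / 2 < δ; linarith)).trans hball)
  have hα1 : ∀ x, dist x z.1 ≤ δ / 4 → α x = 1 := fun x hx =>
    b.one_of_mem_closedBall (Metric.mem_closedBall.2 hx)
  set S : Set (Space n × ℝ) := Metric.ball z.1 (δ / 8) ×ˢ I with hS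
  have hSm : MeasurableSet S := Metric.isOpen_ball.measurableSet.prod hIm
  have hSI : S ⊆ univ ×ˢ I := prod_mono (subset_univ _) le_rfl
  have hwu : w =ᵐ[μ] u := ae_restrict_of_ae_restrict_of_subset
    (prod_mono le_rfl inter_subset_right) hw.ae_eq_slab
  have hwu' : ∀ y : Space n, ∀ᵐ z ∂μ, w (z.1 + y, z.2) = u (z.1 + y, z.2) := fun y =>
    (measurePreserving_shift I y).quasiMeasurePreserving.ae hwu
  refine ⟨S, ?_, ?_, ?_⟩
  · rw [mem_nhdsWithin]
    refine ⟨Metric.ball z.1 (δ / 8) ×ˢ J, Metric.isOpen_ball.prod hJ,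
      ⟨Metric.mem_ball_self (by positivity), hzJ⟩, ?_⟩
    rintro ⟨x, t⟩ ⟨⟨hx, ht⟩, -, ht'⟩
    exact ⟨hx, ht, ht'⟩
  · have h1 : ∫⁻ z in S, ‖w z‖ₑ ^ 3 ≤ ∫⁻ z, ‖v z‖ₑ ^ 3 ∂μ := by
      refine le_trans (le_of_eq ?_) (lintegral_mono_set hSI)
      refine setLIntegral_congr_fun_ae hSm ?_
      have := ae_restrict_of_ae_restrict_of_subset hSI hwu
      filter_upwards [(ae_restrict_iff' hSm).1 this] with z' h1 h2
      rw [h1 h2, hv]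
      simp only
      rw [hα1 _ ((Metric.mem_ball.1 h2.1).le.trans (by linarith)), one_smul]
    refine h1.trans_lt ?_
    have := lintegral_rpow_enorm_lt_top_of_eLpNorm_lt_top (p := 3) (by norm_num) (by norm_num)
      hv3.eLpNorm_lt_top
    have h3 : (ENNReal.toReal 3) = ((3 : ℕ) : ℝ) := by norm_num
    simpa only [h3, ENNReal.rpow_natCast] using this
  · intro η hη
    have hlim' := (Metric.tendsto_nhdsWithin_nhds.1 hlim) η hη
    obtain ⟨r, hr, hr'⟩ := hlim'
    refine ⟨min r (δ / 8), by positivity, fun y hy => ?_⟩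
    -- The hypothesis is a limit over nonzero shifts, so the trivial shift is separated.
    by_cases hy0 : y = 0
    · simp [hy0]
    have hle : ∫⁻ z in S, ‖w (z.1 + y, z.2) - w z‖ₑ ^ 3
        ≤ ∫⁻ z, ‖v (z.1 - -y, z.2) - v z‖ₑ ^ 3 ∂μ := by
      refine le_trans (le_of_eq ?_) (lintegral_mono_set hSI)
      refine setLIntegral_congr_fun_ae hSm ?_
      have h1 := ae_restrict_of_ae_restrict_of_subset hSI hwu
      have h2 := ae_restrict_of_ae_restrict_of_subset hSI (hwu' y)
      filter_upwards [(ae_restrict_iff' hSm).1 h1, (ae_restrict_iff' hSm).1 h2] with z' h1 h2 h3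
      rw [h1 h3, h2 h3, hv]
      simp only
      have h4 := Metric.mem_ball.1 h3.1
      have h5 : ‖y‖ ≤ δ / 8 := hy.le.trans (min_le_right _ _)
      rw [hα1 z'.1 (h4.le.trans (by linarith)), hα1 (z'.1 - -y), one_smul, one_smul, sub_neg_eq_add]
      rw [sub_neg_eq_add]
      calc dist (z'.1 + y) z.1 ≤ dist (z'.1 + y) z'.1 + dist z'.1 z.1 := dist_triangle _ _ _
        _ ≤ δ / 8 + δ / 8 := by
          gcongr
          simpa using h5
        _ = δ / 4 := by ring
    have hv3' : MemLp (fun z : Space n × ℝ => v (z.1 - -y, z.2)) 3 μ := by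
      have := hv3.comp_measurePreserving (measurePreserving_shift I y)
      simpa [Function.comp_def] using this
    have hint : Integrable (fun z : Space n × ℝ => ‖v (z.1 - -y, z.2) - v z‖ ^ 3) μ :=
      (hv3'.sub hv3).integrable_norm_pow (by norm_num)
    have heq : ∫⁻ z, ‖v (z.1 - -y, z.2) - v z‖ₑ ^ 3 ∂μ
        = ENNReal.ofReal (∫ z, ‖v (z.1 - -y, z.2) - v z‖ ^ 3 ∂μ) := by
      rw [ofReal_integral_eq_lintegral_ofReal hint (ae_of_all _ fun z => by positivity)]
      refine lintegral_congr fun z => ?_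
      rw [ENNReal.ofReal_pow (norm_nonneg _), ofReal_norm]
    refine hle.trans (heq.trans_le (ENNReal.ofReal_le_ofReal ?_))
    have hyr := hr' (x := -y) (by simpa using hy0) (by
      rw [dist_zero_right, norm_neg]; exact hy.trans_le (min_le_left _ _))
    have hyp : 0 < ‖y‖ := norm_pos_iff.2 hy0
    rw [dist_zero_right, norm_neg] at hyr
    have h6 := (le_abs_self _).trans_lt hyr
    rw [one_div, inv_mul_lt_iff₀ hyp] at h6
    rw [mul_comm]
    exact h6.le

/-- A regular set has cubic regularity on its compact subsets. -/
lemma IsRegularSet.cubicRegularOn {n : ℕ} {T : ℝ} {u w : Space n × ℝ → Space n} {C : ℝ}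
    (hw : IsVersion T u w C) {D K : Set (Space n × ℝ)} (hD : IsRegularSet T u D)
    (hK : IsCompact K) (hKD : K ⊆ D) : CubicRegularOn w K := by
  obtain ⟨⟨O, -, hDO⟩, hreg⟩ := hD
  refine hK.induction_on (p := CubicRegularOn w) ⟨by simp, fun η _ => ⟨1, one_pos, by simp⟩⟩
    (fun _ _ h h' => h'.mono h) (fun _ _ => CubicRegularOn.union) fun z hz => ?_
  obtain ⟨S, hS, h⟩ := cubicRegularOn_nhds hw (hreg z (hKD hz))
  refine ⟨S, nhdsWithin_mono _ (hKD.trans ?_) hS, h⟩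
  rw [hDO]; exact inter_subset_right

lemma IsRegularSet.measurableSet {n : ℕ} {T : ℝ} {u : Space n × ℝ → Space n}
    {D : Set (Space n × ℝ)} (hD : IsRegularSet T u D) : MeasurableSet D := by
  obtain ⟨⟨O, hO, rfl⟩, -⟩ := hD
  exact hO.measurableSet.inter (MeasurableSet.univ.prod measurableSet_Icc)

end EulerLocal
end

/-! ### Double Riesz transforms of Schwartz functions and the pressure pairing. -/

noncomputable section
namespace EulerLocal
open scoped SchwartzMap LineDeriv

section Riesz

variable {n : ℕ}

/-- The integrable-function version of `∫ 𝓕 f * g = ∫ f * 𝓕 g`. -/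
lemma integral_fourier_mul {f g : Space n → ℂ} (hf : Integrable f) (hg : Integrable g) :
    ∫ ξ, 𝓕 f ξ * g ξ = ∫ x, f x * 𝓕 g x := by
  simpa using! VectorFourier.integral_bilin_fourierIntegral_eq_flip (ContinuousLinearMap.mul ℂ ℂ)
    (L := innerₗ (Space n)) Real.continuous_fourierChar continuous_inner hf hg

lemma norm_fourier_le (f : Space n → ℂ) (x : Space n) : ‖𝓕 f x‖ ≤ ∫ ξ, ‖f ξ‖ :=
  VectorFourier.norm_fourierIntegral_le_integral_norm _ _ _ _ _

lemma continuous_fourier {f : Space n → ℂ} (hf : Integrable f) : Continuous (𝓕 f) :=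
  VectorFourier.fourierIntegral_continuous Real.continuous_fourierChar
    (L := innerₗ (Space n)) continuous_inner hf

/-- The symbol of `R_l R_k`. -/
def rieszMul (l k : Fin n) (ξ : Space n) : ℂ := ((rieszSymbol l ξ * rieszSymbol k ξ : ℝ) : ℂ)

lemma abs_rieszSymbol_le (l : Fin n) (ξ : Space n) : |rieszSymbol l ξ| ≤ 1 := by
  rw [rieszSymbol, abs_div, abs_norm]
  exact div_le_one_of_le₀ (by simpa using PiLp.norm_apply_le ξ l) (norm_nonneg _)

lemma norm_rieszMul_le (l k : Fin n) (ξ : Space n) : ‖rieszMul l k ξ‖ ≤ 1 := by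
  rw [rieszMul, Complex.norm_real, Real.norm_eq_abs, abs_mul]
  exact mul_le_one₀ (abs_rieszSymbol_le l ξ) (abs_nonneg _) (abs_rieszSymbol_le k ξ)

lemma measurable_rieszMul (l k : Fin n) : Measurable (rieszMul (n := n) l k) := by
  unfold rieszMul rieszSymbol
  fun_prop

lemma integrable_rieszMul_mul (l k : Fin n) {g : Space n → ℂ} (hg : Integrable g) :
    Integrable fun ξ => rieszMul l k ξ * g ξ :=
  hg.bdd_mul (c := 1) (measurable_rieszMul l k).aestronglyMeasurable
    (ae_of_all _ (norm_rieszMul_le l k))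

/-- `R_l R_k` applied to a Schwartz function. -/
def riesz (l k : Fin n) (X : 𝓢(Space n, ℂ)) : Space n → ℂ :=
  𝓕 (fun ξ => rieszMul l k ξ * (𝓕⁻ X) ξ)

lemma norm_riesz_le (l k : Fin n) (X : 𝓢(Space n, ℂ)) (x : Space n) :
    ‖riesz l k X x‖ ≤ ∫ ξ, ‖(𝓕⁻ X) ξ‖ := by
  refine (norm_fourier_le _ x).trans (integral_mono (integrable_rieszMul_mul l k
    (𝓕⁻ X).integrable).norm (𝓕⁻ X).integrable.norm fun ξ => ?_)
  simp only [norm_mul]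
  exact mul_le_of_le_one_left (norm_nonneg _) (norm_rieszMul_le l k ξ)

lemma continuous_riesz (l k : Fin n) (X : 𝓢(Space n, ℂ)) : Continuous (riesz l k X) :=
  continuous_fourier (integrable_rieszMul_mul l k (𝓕⁻ X).integrable)

lemma differentiable_riesz (l k : Fin n) (X : 𝓢(Space n, ℂ)) :
    Differentiable ℝ (riesz l k X) := by
  refine Real.differentiable_fourier (integrable_rieszMul_mul l k (𝓕⁻ X).integrable) ?_
  refine ((𝓕⁻ X).integrable_pow_mul volume 1).mono ?_ (ae_of_all _ fun ξ => ?_)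
  · exact (continuous_norm.aestronglyMeasurable).mul
      (integrable_rieszMul_mul l k (𝓕⁻ X).integrable).aestronglyMeasurable.norm
  · simp only [pow_one, norm_mul, norm_norm]
    gcongr
    exact mul_le_of_le_one_left (norm_nonneg _) (norm_rieszMul_le l k ξ)

/-- Both operations are Fourier multipliers and hence commute. Only boundedness of the Riesz symbol
is used, together with the rapid decay of the transform of `X`. -/
lemma fderiv_riesz (l k : Fin n) (X : 𝓢(Space n, ℂ)) (x e : Space n) :
    fderiv ℝ (riesz l k X) x e = riesz l k (∂_{e} X) x := by
  have h1 := integrable_rieszMul_mul l k (𝓕⁻ X).integrable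
  have h2 : Integrable (fun ξ => ‖ξ‖ * ‖rieszMul l k ξ * (𝓕⁻ X) ξ‖) := by
    refine ((𝓕⁻ X).integrable_pow_mul volume 1).mono ?_ (ae_of_all _ fun ξ => ?_)
    · exact (continuous_norm.aestronglyMeasurable).mul
        (integrable_rieszMul_mul l k (𝓕⁻ X).integrable).aestronglyMeasurable.norm
    · simp only [pow_one, norm_mul, norm_norm]
      gcongr
      exact mul_le_of_le_one_left (norm_nonneg _) (norm_rieszMul_le l k ξ)
  rw [riesz, Real.fderiv_fourier h1 h2, Real.fourier_continuousLinearMap_apply, riesz]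
  · refine Real.fourier_congr_ae (ae_of_all _ fun ξ => ?_) x
    beta_reduce
    rw [SchwartzMap.fourierInv_lineDerivOp_eq]
    have : (inner ℝ · e : Space n → ℝ).HasTemperateGrowth := by fun_prop
    simp only [VectorFourier.fourierSMulRight_apply, innerSL_apply_apply ℝ,
      smul_apply, SchwartzMap.smulLeftCLM_apply_apply this]
    simp only [smul_eq_mul, Complex.real_smul]
    ring
  · refine ((h2.const_mul (2 * Real.pi * ‖innerSL ℝ (E := Space n)‖)).mono' ?_
      (ae_of_all _ fun ξ => ?_))
    · exact h1.aestronglyMeasurable.fourierSMulRight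
    · refine (VectorFourier.norm_fourierSMulRight_le _ _ _).trans (le_of_eq (by ring))

lemma fourierInv_compSubConst (X : 𝓢(Space n, ℂ)) (a ξ : Space n) :
    (𝓕⁻ (X.compSubConstCLM ℂ a)) ξ = Real.fourierChar (inner ℝ a ξ) • (𝓕⁻ X) ξ := by
  rw [SchwartzMap.fourierInv_coe, SchwartzMap.fourierInv_coe, Real.fourierInv_eq,
    Real.fourierInv_eq]
  rw [← integral_add_right_eq_self _ a, Circle.smul_def, ← integral_smul]
  refine integral_congr_ae (ae_of_all _ fun x => ?_)
  simp only [SchwartzMap.compSubConstCLM_apply, add_sub_cancel_right, inner_add_left]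
  rw [AddChar.map_add_eq_mul, mul_comm, mul_smul, Circle.smul_def (Real.fourierChar _)]

lemma riesz_compSubConst (l k : Fin n) (X : 𝓢(Space n, ℂ)) (a x : Space n) :
    riesz l k (X.compSubConstCLM ℂ a) x = riesz l k X (x - a) := by
  rw [riesz, riesz, Real.fourier_eq, Real.fourier_eq]
  refine integral_congr_ae (ae_of_all _ fun ξ => ?_)
  simp only [fourierInv_compSubConst]
  rw [mul_smul_comm, smul_smul, ← AddChar.map_add_eq_mul]
  congr 2
  rw [inner_sub_right, real_inner_comm a ξ]
  ring_nf

lemma integrable_mul_coord {v : Space n → Space n} (hv : MemLp v 2 volume) (l k : Fin n) :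
    Integrable fun x => v x l * v x k := by
  have h : ∀ i : Fin n, MemLp (fun x => v x i) 2 volume := fun i =>
    hv.mono ((EuclideanSpace.proj (𝕜 := ℝ) i).continuous.comp_aestronglyMeasurable
      hv.aestronglyMeasurable) (ae_of_all _ fun x => PiLp.norm_apply_le (v x) i)
  exact (h l).integrable_mul (h k)

/-- Fourier duality puts the multiplier on the test function. The products `vₗvₖ` are only
integrable, and their images under `RₗRₖ` need not be functions. -/
lemma pressurePairing_eq_riesz {v : Space n → Space n} (hv : MemLp v 2 volume)
    (χ : Space n → ℝ) (X : 𝓢(Space n, ℂ)) (hX : ∀ x, X x = χ x) :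
    pressurePairing v χ
      = -∑ l, ∑ k, ∫ x, ((v x l * v x k : ℝ) : ℂ) * riesz l k X x := by
  have hXχ : (fun x => (χ x : ℂ)) = X := funext fun x => (hX x).symm
  have hint : ∀ l k : Fin n, Integrable fun x => ((v x l * v x k : ℝ) : ℂ) :=
    fun l k => (integrable_mul_coord hv l k).ofReal
  have hterm : ∀ l k : Fin n, Integrable fun ξ =>
      𝓕 (fun x : Space n => ((v x l * v x k : ℝ) : ℂ)) ξ * (rieszMul l k ξ * (𝓕⁻ X) ξ) :=
    fun l k => (integrable_rieszMul_mul l k (𝓕⁻ X).integrable).bdd_mul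
      (c := ∫ x, ‖((v x l * v x k : ℝ) : ℂ)‖)
      (continuous_fourier (hint l k)).aestronglyMeasurable (ae_of_all _ (norm_fourier_le _))
  unfold pressurePairing pressureHat
  rw [hXχ, ← SchwartzMap.fourierInv_coe]
  simp only [neg_mul, Finset.sum_mul, integral_neg]
  congr 1
  have h3 : ∀ l k : Fin n, ∀ ξ, ((rieszSymbol l ξ * rieszSymbol k ξ : ℝ) : ℂ) *
      𝓕 (fun x : Space n => ((v x l * v x k : ℝ) : ℂ)) ξ * (𝓕⁻ X) ξ
      = 𝓕 (fun x : Space n => ((v x l * v x k : ℝ) : ℂ)) ξ * (rieszMul l k ξ * (𝓕⁻ X) ξ) := by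
    intro l k ξ; rw [rieszMul]; ring
  simp only [h3]
  rw [integral_finsetSum _ fun l _ => integrable_finsetSum _ fun k _ => hterm l k]
  refine Finset.sum_congr rfl fun l _ => ?_
  rw [integral_finsetSum _ fun k _ => hterm l k]
  refine Finset.sum_congr rfl fun k _ => ?_
  rw [integral_fourier_mul (hint l k) (integrable_rieszMul_mul l k (𝓕⁻ X).integrable)]
  rfl

end Riesz

end EulerLocal
end

/-! ### Resolution of the double Riesz transform into scales. -/

noncomputable section
namespace EulerLocal
open scoped SchwartzMap LineDeriv

section Kernel

variable {n : ℕ}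

/-- A fixed smooth bump function on the line. -/
def lineBump : ContDiffBump (0 : ℝ) := ⟨1, 2, one_pos, one_lt_two⟩

/-- The symbol `ξ_l ξ_k ρ(|ξ|²)` from whose dilations the symbol of `R_l R_k` is assembled. -/
def kerHat (l k : Fin n) (ξ : Space n) : ℂ := ((ξ l * ξ k * lineBump (‖ξ‖ ^ 2) : ℝ) : ℂ)

lemma contDiff_kerHat (l k : Fin n) : ContDiff ℝ ∞ (kerHat l k) := by
  unfold kerHat
  have h1 : ∀ i : Fin n, ContDiff ℝ ∞ fun ξ : Space n => ξ i := fun i =>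
    (EuclideanSpace.proj (𝕜 := ℝ) i).contDiff
  exact Complex.ofRealCLM.contDiff.comp (((h1 l).mul (h1 k)).mul
    (lineBump.contDiff.comp (contDiff_norm_sq ℝ)))

lemma hasCompactSupport_kerHat (l k : Fin n) : HasCompactSupport (kerHat l k) := by
  refine HasCompactSupport.intro (isCompact_closedBall (0 : Space n) 2) fun ξ hξ => ?_
  have h : 2 < ‖ξ‖ := by simpa using hξ
  have : lineBump (‖ξ‖ ^ 2) = 0 := by
    refine lineBump.zero_of_le_dist ?_
    rw [Real.dist_eq, sub_zero, abs_of_nonneg (by positivity)]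
    change (2 : ℝ) ≤ _
    nlinarith
  simp [kerHat, this]

/-- The kernel whose Fourier transform is `kerHat`. -/
def kerC (l k : Fin n) : 𝓢(Space n, ℂ) :=
  𝓕⁻ ((hasCompactSupport_kerHat l k).toSchwartzMap (contDiff_kerHat l k))

/-- The real kernel. -/
def ker (l k : Fin n) (y : Space n) : ℝ := (kerC l k y).re

lemma fourier_kerC (l k : Fin n) : 𝓕 (kerC l k : Space n → ℂ) = kerHat l k := by
  rw [← SchwartzMap.fourier_coe, kerC, FourierTransform.fourier_fourierInv_eq]
  rfl

/-- The symbol is real and even, so its inverse transform is invariant under conjugation. -/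
lemma ofReal_ker (l k : Fin n) (y : Space n) : (ker l k y : ℂ) = kerC l k y := by
  have h1 : ∀ z, kerC l k z = 𝓕⁻ (kerHat l k) z := fun z => by
    rw [kerC, SchwartzMap.fourierInv_coe]; rfl
  have h2 : (starRingEnd ℂ) (kerC l k y) = kerC l k y := by
    rw [h1, Real.fourierInv_eq, ← integral_conj]
    have h3 : ∀ ξ : Space n, (starRingEnd ℂ) (Real.fourierChar (inner ℝ ξ y) • kerHat l k ξ)
        = Real.fourierChar (inner ℝ (-ξ) y) • kerHat l k (-ξ) := by
      intro ξ
      have : kerHat l k (-ξ) = kerHat l k ξ := by simp [kerHat]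
      rw [this, Circle.smul_def, Circle.smul_def, smul_eq_mul, smul_eq_mul, map_mul,
        inner_neg_left, AddChar.map_neg_eq_inv, Circle.coe_inv_eq_conj]
      congr 1
      exact Complex.conj_ofReal _
    simp only [h3]
    exact integral_neg_eq_self (fun ξ => Real.fourierChar (inner ℝ ξ y) • kerHat l k ξ) _
  rw [ker]
  exact Complex.conj_eq_iff_re.1 h2

lemma continuous_ker (l k : Fin n) : Continuous (ker (n := n) l k) :=
  Complex.continuous_re.comp (kerC l k).continuous

lemma abs_ker (l k : Fin n) (y : Space n) : |ker l k y| = ‖kerC l k y‖ := by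
  rw [← ofReal_ker, Complex.norm_real, Real.norm_eq_abs]

lemma integrable_ker (l k : Fin n) : Integrable (ker (n := n) l k) :=
  (kerC l k).integrable.re

lemma integrable_pow_mul_ker (l k : Fin n) (m : ℕ) :
    Integrable fun y : Space n => ‖y‖ ^ m * |ker l k y| := by
  simp only [abs_ker]
  exact (kerC l k).integrable_pow_mul volume m

/-- The symbol vanishes at the origin. This cancellation turns averages against the kernel into
averages of increments. -/
lemma integral_ker (l k : Fin n) : ∫ y : Space n, ker l k y = 0 := by
  have h := congrFun (fourier_kerC l k) 0
  rw [Real.fourier_eq] at h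
  simp only [inner_zero_right, neg_zero, AddChar.map_zero_eq_one, one_smul] at h
  have h2 : kerHat l k (0 : Space n) = 0 := by simp [kerHat]
  rw [h2] at h
  simp only [← ofReal_ker] at h
  rw [integral_complex_ofReal] at h
  exact_mod_cast h

lemma exists_ker_bound (l k : Fin n) (m : ℕ) :
    ∃ C : ℝ, 0 ≤ C ∧ ∀ y : Space n, ‖y‖ ^ m * |ker l k y| ≤ C :=
  ⟨SchwartzMap.seminorm ℝ m 0 (kerC l k), apply_nonneg _ _, fun y => by
    rw [abs_ker]; exact (kerC l k).norm_pow_mul_le_seminorm ℝ m y⟩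

/-- The normalizing constant of the resolution of the symbol of `R_l R_k`. -/
def lineConst : ℝ := ∫ r in Ioi (0 : ℝ), r * lineBump (r ^ 2)

lemma integrable_line : Integrable fun r : ℝ => r * lineBump (r ^ 2) := by
  refine Continuous.integrable_of_hasCompactSupport
    (continuous_id.mul (lineBump.continuous.comp (continuous_pow 2))) ?_
  refine HasCompactSupport.intro (isCompact_Icc (a := (-2 : ℝ)) (b := 2)) fun r hr => ?_
  have h : 2 ≤ |r| := by
    by_contra hcon
    exact hr (abs_le.1 (le_of_not_ge hcon))
  have : lineBump (r ^ 2) = 0 := by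
    refine lineBump.zero_of_le_dist ?_
    rw [Real.dist_eq, sub_zero, abs_of_nonneg (by positivity), ← sq_abs]
    change (2 : ℝ) ≤ _
    nlinarith
  simp [this]

lemma lineConst_pos : 0 < lineConst := by
  rw [lineConst, setIntegral_pos_iff_support_of_nonneg_ae]
  · refine lt_of_lt_of_le ?_ (measure_mono (s := Ioo (0 : ℝ) 1) ?_)
    · simp
    · intro r hr
      refine ⟨?_, hr.1⟩
      rw [Function.mem_support]
      refine mul_ne_zero hr.1.ne' (lineBump.pos_of_mem_ball ?_).ne'
      rw [Metric.mem_ball, Real.dist_eq, sub_zero, abs_of_nonneg (by positivity)]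
      change _ < (2 : ℝ)
      nlinarith [hr.1, hr.2]
  · filter_upwards [ae_restrict_mem measurableSet_Ioi] with r hr
    exact mul_nonneg (le_of_lt hr) lineBump.nonneg
  · exact integrable_line.integrableOn

lemma inv_mul_kerHat_smul (l k : Fin n) (ξ : Space n) {s : ℝ} (hs : 0 < s) :
    ((s⁻¹ : ℝ) : ℂ) * kerHat l k (s • ξ)
      = ((ξ l * ξ k * ‖ξ‖⁻¹ * (s * ‖ξ‖ * lineBump ((s * ‖ξ‖) ^ 2)) : ℝ) : ℂ) := by
  by_cases hξ : ξ = 0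
  · simp [hξ, kerHat]
  have : ‖ξ‖ ≠ 0 := norm_ne_zero_iff.2 hξ
  rw [kerHat, ← Complex.ofReal_mul]
  congr 1
  rw [norm_smul, Real.norm_eq_abs, abs_of_pos hs]
  simp only [PiLp.smul_apply, smul_eq_mul]
  field_simp

lemma integrableOn_inv_mul_kerHat (l k : Fin n) (ξ : Space n) :
    IntegrableOn (fun s : ℝ => ((s⁻¹ : ℝ) : ℂ) * kerHat l k (s • ξ)) (Ioi 0) := by
  have h : IntegrableOn (fun s : ℝ =>
      ((ξ l * ξ k * ‖ξ‖⁻¹ * (s * ‖ξ‖ * lineBump ((s * ‖ξ‖) ^ 2)) : ℝ) : ℂ)) (Ioi 0) := by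
    refine Integrable.ofReal (Integrable.const_mul ?_ _)
    by_cases hξ : ξ = 0
    · simp [hξ]
    · exact (integrable_line.comp_mul_right' (norm_ne_zero_iff.2 hξ)).integrableOn
  exact h.congr_fun (fun s hs => (inv_mul_kerHat_smul l k ξ hs).symm) measurableSet_Ioi

lemma setIntegral_line (R : ℝ) (hR : 0 < R) :
    ∫ s in Ioi (0 : ℝ), s * R * lineBump ((s * R) ^ 2) = R⁻¹ * lineConst := by
  have := integral_comp_mul_right_Ioi (fun r : ℝ => r * lineBump (r ^ 2)) 0 hR
  simpa [lineConst] using this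

/-- The integrand is `ξₗξₖ s ρ(s²|ξ|²)`, and the substitution `r = s|ξ|` produces the factor `|ξ|⁻²`
and the constant. At `ξ = 0` both sides vanish. -/
lemma integral_inv_mul_kerHat (l k : Fin n) (ξ : Space n) :
    ∫ s in Ioi (0 : ℝ), ((s⁻¹ : ℝ) : ℂ) * kerHat l k (s • ξ) = lineConst * rieszMul l k ξ := by
  rw [setIntegral_congr_fun measurableSet_Ioi fun s hs => inv_mul_kerHat_smul l k ξ hs]
  rw [integral_complex_ofReal, integral_const_mul]
  by_cases hξ : ξ = 0
  · simp [hξ, rieszMul, rieszSymbol]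
  have : ‖ξ‖ ≠ 0 := norm_ne_zero_iff.2 hξ
  rw [setIntegral_line _ (norm_pos_iff.2 hξ), rieszMul, rieszSymbol, rieszSymbol,
    ← Complex.ofReal_mul]
  congr 1
  field_simp

/-- The same substitution with absolute values. Uniformity in `ξ` is what permits Fubini between
scales and frequencies. -/
lemma integral_norm_inv_mul_kerHat_le (l k : Fin n) (ξ : Space n) :
    ∫ s in Ioi (0 : ℝ), ‖((s⁻¹ : ℝ) : ℂ) * kerHat l k (s • ξ)‖ ≤ lineConst := by
  rw [setIntegral_congr_fun (g := fun s => |ξ l * ξ k * ‖ξ‖⁻¹| *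
    (s * ‖ξ‖ * lineBump ((s * ‖ξ‖) ^ 2))) measurableSet_Ioi fun s hs => ?_]
  · rw [integral_const_mul]
    by_cases hξ : ξ = 0
    · simp [hξ, lineConst_pos.le]
    have h0 : 0 < ‖ξ‖ := norm_pos_iff.2 hξ
    rw [setIntegral_line _ h0, abs_mul, abs_mul, abs_inv, abs_norm]
    have h1 : |ξ l| ≤ ‖ξ‖ := PiLp.norm_apply_le ξ l
    have h2 : |ξ k| ≤ ‖ξ‖ := PiLp.norm_apply_le ξ k
    have := lineConst_pos
    calc |ξ l| * |ξ k| * ‖ξ‖⁻¹ * (‖ξ‖⁻¹ * lineConst)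
        ≤ ‖ξ‖ * ‖ξ‖ * ‖ξ‖⁻¹ * (‖ξ‖⁻¹ * lineConst) := by gcongr
      _ = lineConst := by field_simp
  · beta_reduce
    rw [inv_mul_kerHat_smul l k ξ hs, Complex.norm_real, Real.norm_eq_abs, abs_mul]
    congr 1
    exact abs_of_nonneg (mul_nonneg (mul_nonneg (le_of_lt hs) (norm_nonneg _)) lineBump.nonneg)

/-- The average of `f` against the kernel at scale `s`. -/
def kerAvg (l k : Fin n) (f : Space n → ℝ) (s : ℝ) (x : Space n) : ℝ :=
  ∫ y, f (x - s • y) * ker l k y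

/-- The dilated kernel. -/
def kerS (l k : Fin n) (s : ℝ) (y : Space n) : ℂ := ((s ^ n)⁻¹ : ℝ) • kerC l k (s⁻¹ • y)

lemma integrable_kerS (l k : Fin n) {s : ℝ} (hs : 0 < s) : Integrable (kerS (n := n) l k s) := by
  have := ((kerC (n := n) l k).integrable (μ := volume)).comp_smul (inv_ne_zero hs.ne')
  exact this.smul ((s ^ n)⁻¹ : ℝ)

lemma integral_dilate {s : ℝ} (hs : 0 < s) (g : Space n → ℂ) :
    ∫ y, ((s ^ n)⁻¹ : ℝ) • g (s⁻¹ • y) = ∫ y, g y := by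
  rw [integral_smul, Measure.integral_comp_smul, finrank_euclideanSpace_fin, smul_smul, inv_pow,
    inv_inv, abs_of_pos (pow_pos hs n), inv_mul_cancel₀ (pow_pos hs n).ne', one_smul]

lemma fourier_kerS (l k : Fin n) {s : ℝ} (hs : 0 < s) (ξ : Space n) :
    𝓕 (kerS l k s) ξ = kerHat l k (s • ξ) := by
  rw [← fourier_kerC, Real.fourier_eq, Real.fourier_eq]
  conv_rhs => rw [← integral_dilate hs]
  refine integral_congr_ae (ae_of_all _ fun y => ?_)
  simp only [kerS]
  rw [smul_comm, show inner ℝ (s⁻¹ • y) (s • ξ) = inner ℝ y ξ by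
    rw [real_inner_smul_left, real_inner_smul_right, inv_mul_cancel_left₀ hs.ne']]

lemma ofReal_kerAvg (l k : Fin n) (f : Space n → ℝ) {s : ℝ} (hs : 0 < s) (x : Space n) :
    (kerAvg l k f s x : ℂ)
      = convolution (kerS l k s) (fun y => (f y : ℂ)) (ContinuousLinearMap.mul ℂ ℂ) volume x := by
  rw [kerAvg, convolution, ← integral_complex_ofReal, ← integral_dilate hs]
  refine integral_congr_ae (ae_of_all _ fun y => ?_)
  simp only [kerS, ContinuousLinearMap.mul_apply', smul_smul, mul_inv_cancel₀ hs.ne', one_smul]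
  push_cast
  rw [ofReal_ker, smul_mul_assoc, mul_comm]

lemma integrable_kerAvg (l k : Fin n) {f : Space n → ℝ} (hf : Integrable f) {s : ℝ} (hs : 0 < s) :
    Integrable fun x => (kerAvg l k f s x : ℂ) := by
  simp only [ofReal_kerAvg l k f hs]
  exact (integrable_kerS l k hs).integrable_convolution _ hf.ofReal

lemma integral_fourier_mul_kerHat (l k : Fin n) {f : Space n → ℝ} (hf : Integrable f)
    (X : 𝓢(Space n, ℂ)) {s : ℝ} (hs : 0 < s) :
    ∫ ξ, 𝓕 (fun x => (f x : ℂ)) ξ * (kerHat l k (s • ξ) * (𝓕⁻ X) ξ)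
      = ∫ x, (kerAvg l k f s x : ℂ) * X x := by
  have h1 : ∀ ξ, 𝓕 (fun x => (f x : ℂ)) ξ * (kerHat l k (s • ξ) * (𝓕⁻ X) ξ)
      = 𝓕 (fun x => (kerAvg l k f s x : ℂ)) ξ * (𝓕⁻ X) ξ := by
    intro ξ
    simp only [ofReal_kerAvg l k f hs]
    have h := Real.fourier_mul_convolution_eq (integrable_kerS l k hs) (hf.ofReal (𝕜 := ℂ)) ξ
    rw [fourier_kerS l k hs] at h
    refine Eq.trans ?_ (congrArg (· * (𝓕⁻ X) ξ) h.symm)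
    simp only [Complex.coe_algebraMap]
    exact (mul_left_comm _ _ _).trans (mul_assoc _ _ _).symm
  simp only [h1]
  rw [integral_fourier_mul (integrable_kerAvg l k hf hs) (𝓕⁻ X).integrable,
    ← SchwartzMap.fourier_coe, FourierTransform.fourier_fourierInv_eq]

lemma integral_mul_rieszMul (l k : Fin n) {F g : Space n → ℂ} (hFc : Continuous F) {M : ℝ}
    (hM : ∀ ξ, ‖F ξ‖ ≤ M) (hgc : Continuous g) (hg : Integrable g) :
    lineConst * ∫ ξ, F ξ * (rieszMul l k ξ * g ξ)
      = ∫ s in Ioi (0 : ℝ), ((s⁻¹ : ℝ) : ℂ) * ∫ ξ, F ξ * (kerHat l k (s • ξ) * g ξ) := by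
  have hint : Integrable (fun z : Space n × ℝ =>
      F z.1 * ((((z.2⁻¹ : ℝ) : ℂ) * kerHat l k (z.2 • z.1)) * g z.1))
      (volume.prod (volume.restrict (Ioi 0))) := by
    have hmeas : AEStronglyMeasurable (fun z : Space n × ℝ =>
        F z.1 * ((((z.2⁻¹ : ℝ) : ℂ) * kerHat l k (z.2 • z.1)) * g z.1))
        (volume.prod (volume.restrict (Ioi 0))) := by
      have h1 : Measurable fun z : Space n × ℝ => ((z.2⁻¹ : ℝ) : ℂ) := by fun_prop
      have h2 : Continuous fun z : Space n × ℝ => kerHat l k (z.2 • z.1) :=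
        (contDiff_kerHat l k).continuous.comp (by fun_prop)
      exact ((hFc.comp continuous_fst).measurable.mul
        ((h1.mul h2.measurable).mul (hgc.comp continuous_fst).measurable)).aestronglyMeasurable
    rw [integrable_prod_iff hmeas]
    constructor
    · refine ae_of_all _ fun ξ => ?_
      exact ((integrableOn_inv_mul_kerHat l k ξ).mul_const (g ξ)).const_mul (F ξ)
    · have hb : Integrable fun ξ => M * (lineConst * ‖g ξ‖) := (hg.norm.const_mul _).const_mul _
      refine hb.mono' hmeas.norm.integral_prod_right' (ae_of_all _ fun ξ => ?_)
      rw [Real.norm_of_nonneg (integral_nonneg fun _ => norm_nonneg _)]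
      simp only [norm_mul (F _)]
      rw [integral_const_mul]
      simp only [norm_mul _ (g ξ)]
      rw [integral_mul_const]
      have h4 := integral_norm_inv_mul_kerHat_le l k ξ
      have h5 := hM ξ
      have h6 : 0 ≤ M := (norm_nonneg _).trans h5
      gcongr
  have hswap := integral_integral_swap (f := fun (ξ : Space n) (s : ℝ) =>
      F ξ * ((((s⁻¹ : ℝ) : ℂ) * kerHat l k (s • ξ)) * g ξ)) hint
  calc (lineConst : ℂ) * ∫ ξ, F ξ * (rieszMul l k ξ * g ξ)
      = ∫ ξ, ∫ s in Ioi (0 : ℝ), F ξ * ((((s⁻¹ : ℝ) : ℂ) * kerHat l k (s • ξ)) * g ξ) := by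
        rw [← integral_const_mul]
        refine integral_congr_ae (ae_of_all _ fun ξ => ?_)
        beta_reduce
        rw [integral_const_mul, integral_mul_const, integral_inv_mul_kerHat]
        ring
    _ = ∫ s in Ioi (0 : ℝ), ∫ ξ, F ξ * ((((s⁻¹ : ℝ) : ℂ) * kerHat l k (s • ξ)) * g ξ) :=
        hswap
    _ = _ := by
        refine setIntegral_congr_fun measurableSet_Ioi fun s hs => ?_
        beta_reduce
        rw [← integral_const_mul]
        refine integral_congr_ae (ae_of_all _ fun ξ => ?_)
        beta_reduce
        ring

/-- This moves the operator from the test function back to `f`, one scale at a time. At a fixed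
scale it is a convolution with an integrable kernel. Since `f` is only integrable, the integral over
all scales is taken after pairing with `X`. -/
lemma integral_mul_riesz (l k : Fin n) {f : Space n → ℝ} (hf : Integrable f)
    (X : 𝓢(Space n, ℂ)) :
    lineConst * ∫ x, (f x : ℂ) * riesz l k X x
      = ∫ s in Ioi (0 : ℝ), ((s⁻¹ : ℝ) : ℂ) * ∫ x, (kerAvg l k f s x : ℂ) * X x := by
  have hfc : Integrable fun x => (f x : ℂ) := hf.ofReal
  have h1 : ∫ x, (f x : ℂ) * riesz l k X x
      = ∫ ξ, 𝓕 (fun x => (f x : ℂ)) ξ * (rieszMul l k ξ * (𝓕⁻ X) ξ) :=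
    (integral_fourier_mul hfc (integrable_rieszMul_mul l k (𝓕⁻ X).integrable)).symm
  rw [h1, integral_mul_rieszMul l k (continuous_fourier hfc) (norm_fourier_le _) (𝓕⁻ X).continuous
    (𝓕⁻ X).integrable]
  refine setIntegral_congr_fun measurableSet_Ioi fun s hs => ?_
  exact congrArg _ (integral_fourier_mul_kerHat l k hf X hs)

/-- The pressure of `v` as a singular integral. -/
def locPressure (v : Space n → Space n) (x : Space n) : ℝ :=
  -∑ l, ∑ k, lineConst⁻¹ *
    ∫ s in Ioi (0 : ℝ), s⁻¹ * kerAvg l k (fun y => v y l * v y k) s x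

lemma stronglyMeasurable_kerAvg {P : Type*} [MeasurableSpace P] (l k : Fin n)
    {f : Space n → P → ℝ} (hf : StronglyMeasurable (Function.uncurry f)) :
    StronglyMeasurable fun z : (Space n × P) × ℝ =>
      kerAvg l k (fun y => f y z.1.2) z.2 z.1.1 := by
  unfold kerAvg
  refine StronglyMeasurable.integral_prod_right (f := fun (z : (Space n × P) × ℝ) (y : Space n) =>
    f (z.1.1 - z.2 • y) z.1.2 * ker l k y) ?_
  refine StronglyMeasurable.mul ?_ ?_
  · exact hf.comp_measurable (g := fun q : ((Space n × P) × ℝ) × Space n =>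
      (q.1.1.1 - q.1.2 • q.2, q.1.1.2)) (by fun_prop)
  · exact (continuous_ker l k).stronglyMeasurable.comp_measurable measurable_snd

/-- Absolute convergence on the support of `χ` allows the scale integral to be taken first, at fixed
`x`, so that it defines a function there. The hypothesis `hfin` concerns only points where `χ` does
not vanish, so local regularity can supply it. -/
lemma pressurePairing_eq_locPressure {v : Space n → Space n} (hvm : StronglyMeasurable v)
    (hv : MemLp v 2 volume) (χ : Space n → ℝ) (X : 𝓢(Space n, ℂ)) (hX : ∀ x, X x = χ x)
    (hfin : ∀ l k : Fin n, ∫⁻ x, ∫⁻ s in Ioi (0 : ℝ),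
      ‖χ x * (s⁻¹ * kerAvg l k (fun y => v y l * v y k) s x)‖ₑ < ⊤) :
    pressurePairing v χ = ((∫ x, locPressure v x * χ x : ℝ) : ℂ) := by
  have hcoord : ∀ i : Fin n, StronglyMeasurable fun x => v x i := fun i =>
    (EuclideanSpace.proj (𝕜 := ℝ) i).continuous.comp_stronglyMeasurable hvm
  have hχ : Continuous χ := by
    have : χ = fun x => (X x).re := funext fun x => by rw [hX, Complex.ofReal_re]
    rw [this]; exact Complex.continuous_re.comp X.continuous
  have hint : ∀ l k : Fin n, Integrable (fun z : Space n × ℝ =>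
      χ z.1 * (z.2⁻¹ * kerAvg l k (fun y => v y l * v y k) z.2 z.1))
      (volume.prod (volume.restrict (Ioi 0))) := by
    intro l k
    have hm : StronglyMeasurable (fun z : Space n × ℝ =>
        χ z.1 * (z.2⁻¹ * kerAvg l k (fun y => v y l * v y k) z.2 z.1)) := by
      refine (hχ.comp continuous_fst).stronglyMeasurable.mul (StronglyMeasurable.mul ?_ ?_)
      · exact (by fun_prop : Measurable fun z : Space n × ℝ => z.2⁻¹).stronglyMeasurable
      -- There is no time parameter here, so the parameter space is a point.
      · have := stronglyMeasurable_kerAvg (P := Unit) l k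
          (f := fun y _ => v y l * v y k) (((hcoord l).mul (hcoord k)).comp_measurable
            measurable_fst)
        exact this.comp_measurable (g := fun z : Space n × ℝ => ((z.1, ()), z.2)) (by fun_prop)
    refine ⟨hm.aestronglyMeasurable, ?_⟩
    rw [HasFiniteIntegral, lintegral_prod _ hm.enorm.aemeasurable]
    exact hfin l k
  rw [pressurePairing_eq_riesz hv χ X hX]
  have hterm : ∀ l k : Fin n, ∫ x, ((v x l * v x k : ℝ) : ℂ) * riesz l k X x
      = ((lineConst⁻¹ * ∫ x, χ x * ∫ s in Ioi (0 : ℝ),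
          s⁻¹ * kerAvg l k (fun y => v y l * v y k) s x : ℝ) : ℂ) := by
    intro l k
    have hf := integrable_mul_coord hv l k
    have h1 := integral_mul_riesz l k hf X
    have hc : (lineConst : ℂ) ≠ 0 := by exact_mod_cast lineConst_pos.ne'
    have h2 : ∫ x, ((v x l * v x k : ℝ) : ℂ) * riesz l k X x
        = (lineConst : ℂ)⁻¹ * ∫ s in Ioi (0 : ℝ), ((s⁻¹ : ℝ) : ℂ) *
          ∫ x, (kerAvg l k (fun y => v y l * v y k) s x : ℂ) * X x := by
      rw [← h1, inv_mul_cancel_left₀ hc]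
    rw [h2]
    push_cast
    congr 1
    have hsw := integral_integral_swap (f := fun (x : Space n) (s : ℝ) =>
      χ x * (s⁻¹ * kerAvg l k (fun y => v y l * v y k) s x)) (hint l k)
    simp only [integral_const_mul] at hsw
    rw [hsw, ← integral_complex_ofReal]
    refine integral_congr_ae (ae_of_all _ fun s => ?_)
    beta_reduce
    rw [← integral_const_mul, ← integral_complex_ofReal]
    refine integral_congr_ae (ae_of_all _ fun x => ?_)
    simp only [hX]
    push_cast
    ring
  simp only [hterm]
  rw [← Complex.ofReal_inj.2 rfl]
  have hI : ∀ l k : Fin n, Integrable fun x => lineConst⁻¹ * (χ x * ∫ s in Ioi (0 : ℝ),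
      s⁻¹ * kerAvg l k (fun y => v y l * v y k) s x) := by
    intro l k
    have := (hint l k).integral_prod_left
    simp only [integral_const_mul] at this
    exact this.const_mul _
  have hR : ∫ x, locPressure v x * χ x = -∑ l, ∑ k, lineConst⁻¹ * ∫ x, χ x *
      ∫ s in Ioi (0 : ℝ), s⁻¹ * kerAvg l k (fun y => v y l * v y k) s x := by
    have h3 : ∀ x, locPressure v x * χ x = -∑ l, ∑ k, lineConst⁻¹ * (χ x *
      ∫ s in Ioi (0 : ℝ), s⁻¹ * kerAvg l k (fun y => v y l * v y k) s x) := by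
      intro x
      rw [locPressure, neg_mul, Finset.sum_mul]
      congr 1
      refine Finset.sum_congr rfl fun l _ => ?_
      rw [Finset.sum_mul]
      refine Finset.sum_congr rfl fun k _ => ?_
      ring
    simp only [h3]
    rw [integral_neg, integral_finsetSum _ fun l _ => integrable_finsetSum _ fun k _ => hI l k]
    congr 1
    refine Finset.sum_congr rfl fun l _ => ?_
    rw [integral_finsetSum _ fun k _ => hI l k]
    refine Finset.sum_congr rfl fun k _ => ?_
    rw [integral_const_mul]
  rw [hR]
  push_cast
  rfl

end Kernel

end EulerLocal
end

/-! ### Pointwise bounds for the scale averages, and increments of products. -/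

noncomputable section
namespace EulerLocal

section Estimate

variable {n : ℕ}

/-- Jensen's inequality for powers of a lower integral. -/
lemma lintegral_rpow_le {α : Type*} [MeasurableSpace α] (ν : Measure α) {g : α → ENNReal}
    (hg : AEMeasurable g ν) {p q : ℝ} (hpq : p.HolderConjugate q) :
    (∫⁻ a, g a ∂ν) ^ p ≤ ν univ ^ (p / q) * ∫⁻ a, g a ^ p ∂ν := by
  have h := ENNReal.lintegral_mul_le_Lp_mul_Lq ν hpq hg (aemeasurable_const (b := (1 : ENNReal)))
  simp only [Pi.mul_apply, mul_one, ENNReal.one_rpow, lintegral_const, one_mul] at h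
  have hp := hpq.pos
  calc (∫⁻ a, g a ∂ν) ^ p
      ≤ ((∫⁻ a, g a ^ p ∂ν) ^ (1 / p) * ν univ ^ (1 / q)) ^ p := by gcongr
    _ = ν univ ^ (p / q) * ∫⁻ a, g a ^ p ∂ν := by
        rw [ENNReal.mul_rpow_of_nonneg _ _ hp.le, ← ENNReal.rpow_mul, ← ENNReal.rpow_mul,
          one_div_mul_cancel hp.ne', ENNReal.rpow_one, mul_comm]
        congr 2
        ring

lemma integral_abs_comp_sub_smul (f : Space n → ℝ) (x : Space n) {s : ℝ} (hs : 0 < s) :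
    ∫ y, |f (x - s • y)| = (s ^ n)⁻¹ * ∫ y, |f y| := by
  have h := Measure.integral_comp_smul (volume : Measure (Space n)) (fun y => |f (x - y)|) s
  rw [h, finrank_euclideanSpace_fin, abs_of_pos (inv_pos.2 (pow_pos hs n)), smul_eq_mul]
  congr 1
  exact integral_sub_left_eq_self (fun y => |f y|) _ x

lemma integrable_comp_sub_smul {f : Space n → ℝ} (hf : Integrable f) (x : Space n) {s : ℝ}
    (hs : 0 < s) : Integrable fun y => f (x - s • y) :=
  (hf.comp_sub_left x).comp_smul hs.ne'

lemma integrable_kerAvg_integrand (l k : Fin n) {f : Space n → ℝ} (hf : Integrable f) (x : Space n)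
    {s : ℝ} (hs : 0 < s) : Integrable fun y => f (x - s • y) * ker l k y := by
  obtain ⟨C, -, hC⟩ := exists_ker_bound l k 0
  exact (integrable_comp_sub_smul hf x hs).mul_bdd (c := C)
    (continuous_ker l k).aestronglyMeasurable (ae_of_all _ fun y => by simpa using hC y)

/-- A bounded kernel and a change of variables give decay `s⁻ⁿ`, and `n ≥ 1` because there is an
index `l`. Together with the weight `s⁻¹` this is integrable at infinity. -/
lemma exists_kerAvg_large_bound (l k : Fin n) :
    ∃ c : ℝ, 0 ≤ c ∧ ∀ (f : Space n → ℝ), Integrable f → ∀ (x : Space n) (s : ℝ), 1 ≤ s →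
      |kerAvg l k f s x| ≤ c * (∫ y, |f y|) * s⁻¹ := by
  obtain ⟨C, hC0, hC⟩ := exists_ker_bound l k 0
  refine ⟨C, hC0, fun f hf x s hs => ?_⟩
  have hs0 : 0 < s := one_pos.trans_le hs
  have hn : 1 ≤ n := Nat.one_le_iff_ne_zero.2 fun h => by subst h; exact l.elim0
  calc |kerAvg l k f s x| ≤ ∫ y, |f (x - s • y) * ker l k y| := abs_integral_le_integral_abs
    _ ≤ ∫ y, |f (x - s • y)| * C := by
        refine integral_mono (integrable_kerAvg_integrand l k hf x hs0).abs
          ((integrable_comp_sub_smul hf x hs0).abs.mul_const C) fun y => ?_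
        beta_reduce
        rw [abs_mul]
        gcongr
        simpa using hC y
    _ = C * (∫ y, |f y|) * (s ^ n)⁻¹ := by
        rw [integral_mul_const, integral_abs_comp_sub_smul f x hs0]; ring
    _ ≤ C * (∫ y, |f y|) * s⁻¹ := by
        have : 0 ≤ ∫ y, |f y| := integral_nonneg fun _ => abs_nonneg _
        have h2 : s ≤ s ^ n := le_self_pow₀ hs (by omega)
        gcongr

/-- The mean zero of the kernel allows `f x` to be subtracted. Increments shorter than `r` are kept.
For the longer ones the decay of the kernel gains a full power of `s`, which compensates the weight
`s⁻¹`, at the cost of the `L¹` norm of `f` and of `|f x|` only. This is how the nonlocal part of the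
pressure is controlled by the energy. -/
lemma exists_kerAvg_small_bound (l k : Fin n) {r : ℝ} (hr : 0 < r) :
    ∃ c : ℝ, 0 ≤ c ∧ ∀ (f : Space n → ℝ), Integrable f → ∀ (x : Space n) (s : ℝ), 0 < s →
      ‖kerAvg l k f s x‖ₑ ≤ (∫⁻ y, {y | ‖s • y‖ < r}.indicator
          (fun y => ‖f (x - s • y) - f x‖ₑ * ‖ker l k y‖ₑ) y)
        + ENNReal.ofReal (c * ((∫ y, |f y|) + |f x|) * s) := by
  -- Decay of order `n + 1` gives `s^(n+1)` on the far region; the change of variables costs `s⁻ⁿ`,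
  -- and one power remains.
  obtain ⟨C, hC0, hC⟩ := exists_ker_bound l k (n + 1)
  have hK := integrable_pow_mul_ker (n := n) l k 1
  simp only [pow_one] at hK
  set M := ∫ y : Space n, ‖y‖ * |ker l k y| with hM
  have hM0 : 0 ≤ M := integral_nonneg fun y => by positivity
  refine ⟨C / r ^ (n + 1) + M / r, by positivity, fun f hf x s hs => ?_⟩
  have hf0 : 0 ≤ ∫ y, |f y| := integral_nonneg fun _ => abs_nonneg _
  set A : Set (Space n) := {y | ‖s • y‖ < r} with hA
  have hAm : MeasurableSet A := measurableSet_lt (by fun_prop) measurable_const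
  have hint : Integrable fun y => (f (x - s • y) - f x) * ker l k y := by
    simp only [sub_mul]
    exact (integrable_kerAvg_integrand l k hf x hs).sub ((integrable_ker l k).const_mul _)
  have h1 : kerAvg l k f s x = ∫ y, (f (x - s • y) - f x) * ker l k y := by
    simp only [sub_mul]
    rw [integral_sub (integrable_kerAvg_integrand l k hf x hs) ((integrable_ker l k).const_mul _),
      integral_const_mul, integral_ker, mul_zero, sub_zero, kerAvg]
  rw [h1, ← integral_add_compl hAm hint]
  refine (enorm_add_le _ _).trans (add_le_add ?_ ?_)
  · refine (enorm_integral_le_lintegral_enorm _).trans (le_of_eq ?_)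
    rw [lintegral_indicator hAm]
    simp only [enorm_mul]
  · rw [← ofReal_norm, Real.norm_eq_abs]
    refine ENNReal.ofReal_le_ofReal ?_
    have hb : Integrable fun y => (C * s ^ (n + 1) / r ^ (n + 1)) * |f (x - s • y)|
        + |f x| * (s / r) * (‖y‖ * |ker l k y|) :=
      ((integrable_comp_sub_smul hf x hs).abs.const_mul _).add (hK.const_mul _)
    calc |∫ y in Aᶜ, (f (x - s • y) - f x) * ker l k y|
        ≤ ∫ y in Aᶜ, |(f (x - s • y) - f x) * ker l k y| := abs_integral_le_integral_abs
      _ ≤ ∫ y in Aᶜ, ((C * s ^ (n + 1) / r ^ (n + 1)) * |f (x - s • y)|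
            + |f x| * (s / r) * (‖y‖ * |ker l k y|)) := by
          refine setIntegral_mono_on hint.abs.integrableOn hb.integrableOn hAm.compl fun y hy => ?_
          have hy' : r ≤ s * ‖y‖ := by
            have : r ≤ ‖s • y‖ := not_lt.1 hy
            rwa [norm_smul, Real.norm_eq_abs, abs_of_pos hs] at this
          have hk1 : |ker l k y| ≤ C * s ^ (n + 1) / r ^ (n + 1) := by
            rw [le_div_iff₀ (by positivity)]
            calc |ker l k y| * r ^ (n + 1) ≤ |ker l k y| * (s * ‖y‖) ^ (n + 1) := by gcongr
              _ = s ^ (n + 1) * (‖y‖ ^ (n + 1) * |ker l k y|) := by ring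
              _ ≤ s ^ (n + 1) * C := by gcongr; exact hC y
              _ = _ := by ring
          -- On the far region `s‖y‖/r ≥ 1`, so the first moment of the kernel also yields one power
          -- of `s`.
          have hk2 : |ker l k y| ≤ (s / r) * (‖y‖ * |ker l k y|) := by
            have : 1 ≤ s / r * ‖y‖ := by
              rw [div_mul_eq_mul_div, one_le_div hr]; exact hy'
            nlinarith [abs_nonneg (ker l k y)]
          rw [abs_mul]
          calc |f (x - s • y) - f x| * |ker l k y|
              ≤ (|f (x - s • y)| + |f x|) * |ker l k y| := by
                gcongr; exact abs_sub _ _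
            _ = |f (x - s • y)| * |ker l k y| + |f x| * |ker l k y| := by ring
            _ ≤ |f (x - s • y)| * (C * s ^ (n + 1) / r ^ (n + 1))
                + |f x| * ((s / r) * (‖y‖ * |ker l k y|)) := by gcongr
            _ = _ := by ring
      _ ≤ ∫ y, ((C * s ^ (n + 1) / r ^ (n + 1)) * |f (x - s • y)|
            + |f x| * (s / r) * (‖y‖ * |ker l k y|)) :=
          setIntegral_le_integral hb (ae_of_all _ fun y => by positivity)
      _ = (C * s ^ (n + 1) / r ^ (n + 1)) * ((s ^ n)⁻¹ * ∫ y, |f y|) + |f x| * (s / r) * M := by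
          rw [integral_add ((integrable_comp_sub_smul hf x hs).abs.const_mul _) (hK.const_mul _),
            integral_const_mul, integral_const_mul, integral_abs_comp_sub_smul f x hs]
      _ = (C / r ^ (n + 1) * (∫ y, |f y|) + M / r * |f x|) * s := by
          field_simp
          ring
      _ ≤ (C / r ^ (n + 1) + M / r) * ((∫ y, |f y|) + |f x|) * s := by
          have h3 : 0 ≤ C / r ^ (n + 1) := by positivity
          have h4 : 0 ≤ M / r := by positivity
          gcongr
          nlinarith [abs_nonneg (f x)]

/-- The product `w_l w_k` of two components of a space-time field. -/
def prodCoord (w : Space n × ℝ → Space n) (l k : Fin n) (z : Space n × ℝ) : ℝ := w z l * w z k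

lemma abs_prodCoord_le (w : Space n × ℝ → Space n) (l k : Fin n) (z : Space n × ℝ) :
    |prodCoord w l k z| ≤ ‖w z‖ ^ 2 := by
  rw [prodCoord, abs_mul, sq]
  exact mul_le_mul (PiLp.norm_apply_le (w z) l) (PiLp.norm_apply_le (w z) k) (abs_nonneg _) (norm_nonneg _)

lemma abs_mul_coord_sub_le (v v' : Space n) (l k : Fin n) :
    |v' l * v' k - v l * v k| ≤ ‖v' - v‖ * (‖v' - v‖ + 2 * ‖v‖) := by
  have h1 : v' l * v' k - v l * v k
      = (v' - v) l * (v' - v) k + (v' - v) l * v k + v l * (v' - v) k := by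
    simp only [PiLp.sub_apply]; ring
  have a1 : ∀ i, |(v' - v) i| ≤ ‖v' - v‖ := fun i => PiLp.norm_apply_le (v' - v) i
  have a2 : ∀ i, |v i| ≤ ‖v‖ := fun i => PiLp.norm_apply_le v i
  rw [h1]
  calc |(v' - v) l * (v' - v) k + (v' - v) l * v k + v l * (v' - v) k|
      ≤ |(v' - v) l| * |(v' - v) k| + |(v' - v) l| * |v k| + |v l| * |(v' - v) k| := by
        refine (abs_add_three _ _ _).trans (le_of_eq ?_)
        simp only [abs_mul]
    _ ≤ ‖v' - v‖ * ‖v' - v‖ + ‖v' - v‖ * ‖v‖ + ‖v‖ * ‖v' - v‖ := by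
        gcongr <;> first | exact a1 _ | exact a2 _
    _ = _ := by ring

lemma stronglyMeasurable_coord {P : Type*} [MeasurableSpace P] {w : P → Space n}
    (hw : StronglyMeasurable w) (i : Fin n) : StronglyMeasurable fun z => w z i :=
  (EuclideanSpace.proj (𝕜 := ℝ) i).continuous.comp_stronglyMeasurable hw

/-- Young's inequality with a free weight, applied to `a^{3/2}` and `(a + 2b)^{3/2}`, followed by
convexity of the cube. In the application `a` is the length of an increment and `b` that of the
velocity. -/
lemma rpow_three_halves_le {x a b lam : ℝ} (hx : 0 ≤ x) (ha : 0 ≤ a) (hb : 0 ≤ b) (hl : 0 < lam)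
    (h : x ≤ a * (a + 2 * b)) :
    x ^ (3 / 2 : ℝ) ≤ (lam⁻¹ + 4 * lam) * a ^ 3 + 32 * lam * b ^ 3 := by
  have key : ∀ c : ℝ, 0 ≤ c → (c ^ (3 / 2 : ℝ)) ^ 2 = c ^ 3 := by
    intro c hc
    rw [← Real.rpow_natCast, ← Real.rpow_mul hc, ← Real.rpow_natCast]
    norm_num
  have hc : 0 ≤ a + 2 * b := by positivity
  have h1 : x ^ (3 / 2 : ℝ) ≤ a ^ (3 / 2 : ℝ) * (a + 2 * b) ^ (3 / 2 : ℝ) := by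
    rw [← Real.mul_rpow ha hc]
    exact Real.rpow_le_rpow hx h (by norm_num)
  set X := a ^ (3 / 2 : ℝ)
  set Y := (a + 2 * b) ^ (3 / 2 : ℝ)
  have hX := key a ha
  have hY := key _ hc
  have h2 : X * Y ≤ lam⁻¹ * X ^ 2 + lam * Y ^ 2 := by
    have h3 : 0 ≤ lam * (lam⁻¹ * X - Y / 2) ^ 2 := by positivity
    have h4 : lam * (lam⁻¹ * X - Y / 2) ^ 2
        = lam⁻¹ * X ^ 2 - X * Y + lam * Y ^ 2 / 4 := by field_simp; ring
    nlinarith [mul_nonneg hl.le (sq_nonneg Y)]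
  have h5 : (a + 2 * b) ^ 3 ≤ 4 * a ^ 3 + 32 * b ^ 3 := by
    nlinarith [mul_nonneg (add_nonneg ha hb) (sq_nonneg (a - 2 * b)),
      mul_nonneg ha (sq_nonneg (a - 2 * b)), mul_nonneg hb (sq_nonneg (a - 2 * b))]
  rw [hX, hY] at h2
  have h6 : lam * (a + 2 * b) ^ 3 ≤ lam * (4 * a ^ 3 + 32 * b ^ 3) := by gcongr
  linarith [h1, h2, h6]

/-- The increments of `w_l w_k` on a cubic regular set are of order `|h|^{1/3}` in `L^{3/2}`. -/
lemma CubicRegularOn.exists_increment_bound {w : Space n × ℝ → Space n} {K : Set (Space n × ℝ)}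
    (hw : StronglyMeasurable w) (hK : CubicRegularOn w K) (l k : Fin n) :
    ∃ r : ℝ, 0 < r ∧ ∃ B : ENNReal, B < ⊤ ∧ ∀ h : Space n, ‖h‖ < r →
      ∫⁻ z in K, ‖prodCoord w l k (z.1 + h, z.2) - prodCoord w l k z‖ₑ ^ (3 / 2 : ℝ)
        ≤ B * ENNReal.ofReal (‖h‖ ^ (1 / 2 : ℝ)) := by
  -- For the pressure it suffices that the cubic increment is `O(|h|)`.
  obtain ⟨r, hr, hreg⟩ := hK.2 1 one_pos
  set W := ∫⁻ z in K, ‖w z‖ₑ ^ 3 with hW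
  refine ⟨min r 1, lt_min hr one_pos, 5 + 32 * W, ?_, fun h hh => ?_⟩
  · exact ENNReal.add_lt_top.2 ⟨by norm_num, ENNReal.mul_lt_top (by norm_num) hK.1⟩
  by_cases h0 : h = 0
  · simp [h0]
  have hp : 0 < ‖h‖ := norm_pos_iff.2 h0
  -- This weight balances `λ⁻¹ · O(|h|)`, from the cubic increment, against `λ · O(1)`, from the
  -- cubic norm.
  set lam := ‖h‖ ^ (1 / 2 : ℝ) with hlam
  have hl : 0 < lam := Real.rpow_pos_of_pos hp _
  have hl1 : lam ≤ 1 := Real.rpow_le_one hp.le (hh.le.trans (min_le_right _ _)) (by norm_num)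
  have hl2 : lam * lam = ‖h‖ := by
    rw [hlam, ← Real.rpow_add hp]; norm_num
  have hpt : ∀ z : Space n × ℝ,
      ‖prodCoord w l k (z.1 + h, z.2) - prodCoord w l k z‖ₑ ^ (3 / 2 : ℝ)
      ≤ ENNReal.ofReal (lam⁻¹ + 4 * lam) * ‖w (z.1 + h, z.2) - w z‖ₑ ^ 3
        + ENNReal.ofReal (32 * lam) * ‖w z‖ₑ ^ 3 := by
    intro z
    have h1 := rpow_three_halves_le (abs_nonneg _) (norm_nonneg _) (norm_nonneg _) hl
      (abs_mul_coord_sub_le (w z) (w (z.1 + h, z.2)) l k)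
    rw [← ofReal_norm, ← ofReal_norm (w z), ← ofReal_norm (w _ - _), Real.norm_eq_abs,
      ENNReal.ofReal_rpow_of_nonneg (abs_nonneg _) (by norm_num), ← ENNReal.ofReal_pow (by positivity),
      ← ENNReal.ofReal_pow (by positivity), ← ENNReal.ofReal_mul (by positivity),
      ← ENNReal.ofReal_mul (by positivity), ← ENNReal.ofReal_add (by positivity) (by positivity)]
    exact ENNReal.ofReal_le_ofReal h1
  have hm1 : Measurable fun z : Space n × ℝ => ‖w (z.1 + h, z.2) - w z‖ₑ ^ 3 := by
    have : StronglyMeasurable fun z : Space n × ℝ => w (z.1 + h, z.2) - w z :=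
      (hw.comp_measurable (g := fun z : Space n × ℝ => (z.1 + h, z.2)) (by fun_prop)).sub hw
    exact this.enorm.pow_const 3
  calc ∫⁻ z in K, ‖prodCoord w l k (z.1 + h, z.2) - prodCoord w l k z‖ₑ ^ (3 / 2 : ℝ)
      ≤ ∫⁻ z in K, (ENNReal.ofReal (lam⁻¹ + 4 * lam) * ‖w (z.1 + h, z.2) - w z‖ₑ ^ 3
        + ENNReal.ofReal (32 * lam) * ‖w z‖ₑ ^ 3) := lintegral_mono fun z => hpt z
    _ = ENNReal.ofReal (lam⁻¹ + 4 * lam) * (∫⁻ z in K, ‖w (z.1 + h, z.2) - w z‖ₑ ^ 3)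
        + ENNReal.ofReal (32 * lam) * W := by
        rw [lintegral_add_left (hm1.const_mul _), lintegral_const_mul _ hm1,
          lintegral_const_mul' _ _ ENNReal.ofReal_ne_top]
    _ ≤ ENNReal.ofReal (lam⁻¹ + 4 * lam) * ENNReal.ofReal (1 * ‖h‖)
        + ENNReal.ofReal (32 * lam) * W := by
        gcongr
        exact hreg h (hh.trans_le (min_le_left _ _))
    _ ≤ ENNReal.ofReal (5 * lam) + ENNReal.ofReal (32 * lam) * W := by
        gcongr
        rw [← ENNReal.ofReal_mul (by positivity)]
        refine ENNReal.ofReal_le_ofReal ?_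
        rw [one_mul, ← hl2]
        have : (lam⁻¹ + 4 * lam) * (lam * lam) = lam + 4 * lam ^ 3 := by field_simp
        rw [this]
        nlinarith [pow_le_one₀ hl.le hl1 (n := 2)]
    _ = (5 + 32 * W) * ENNReal.ofReal lam := by
        rw [ENNReal.ofReal_mul (by norm_num), ENNReal.ofReal_mul (by norm_num)]
        simp only [ENNReal.ofReal_ofNat]
        ring

end Estimate

end EulerLocal
end

/-! ### The absolute singular integral lies in `L^{3/2}` on compact regular sets. -/

noncomputable section
namespace EulerLocal

section Estimate

variable {n : ℕ}

/-- The absolute singular integral at a space-time point. -/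
def absSingular (w : Space n × ℝ → Space n) (l k : Fin n) (z : Space n × ℝ) : ENNReal :=
  ∫⁻ s in Ioi (0 : ℝ), ‖s⁻¹ * kerAvg l k (fun y => prodCoord w l k (y, z.2)) s z.1‖ₑ

/-- The part of `absSingular` from small scales and nearby points. -/
def nearSingular (w : Space n × ℝ → Space n) (l k : Fin n) (r : ℝ) (z : Space n × ℝ) : ENNReal :=
  ∫⁻ s in Ioc (0 : ℝ) 1, ENNReal.ofReal s⁻¹ * ∫⁻ y, {y | ‖s • y‖ < r}.indicator (fun y =>
    ‖prodCoord w l k (z.1 - s • y, z.2) - prodCoord w l k z‖ₑ * ‖ker l k y‖ₑ) y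

lemma integrable_prodCoord {T C : ℝ} {u w : Space n × ℝ → Space n} (hw : IsVersion T u w C)
    (l k : Fin n) (t : ℝ) : Integrable fun y => prodCoord w l k (y, t) :=
  integrable_mul_coord (hw.memLp t) l k

lemma integral_abs_prodCoord_le {T C : ℝ} {u w : Space n × ℝ → Space n} (hw : IsVersion T u w C)
    (l k : Fin n) (t : ℝ) : ∫ y, |prodCoord w l k (y, t)| ≤ C := by
  refine le_trans (integral_mono (integrable_prodCoord hw l k t).abs
    ((hw.memLp t).integrable_norm_pow (by norm_num)) fun y => ?_) (hw.energy t)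
  exact abs_prodCoord_le w l k (y, t)

lemma stronglyMeasurable_prodCoord {w : Space n × ℝ → Space n} (hw : StronglyMeasurable w)
    (l k : Fin n) : StronglyMeasurable (prodCoord w l k) :=
  (stronglyMeasurable_coord hw l).mul (stronglyMeasurable_coord hw k)

/-- The scales are cut at `1`. Beyond it the energy and `∫ s⁻² ds` bound everything; below it the
error `O(s)` of the small-scale bound cancels the weight `s⁻¹`, and only nearby increments remain.
-/
lemma exists_absSingular_le {T C : ℝ} {u w : Space n × ℝ → Space n} (hw : IsVersion T u w C)
    (l k : Fin n) {r : ℝ} (hr : 0 < r) : ∃ c : ENNReal, c < ⊤ ∧ ∀ z,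
      absSingular w l k z ≤ nearSingular w l k r z + c * (1 + ‖prodCoord w l k z‖ₑ) := by
  obtain ⟨c1, hc1, h1⟩ := exists_kerAvg_small_bound l k hr
  obtain ⟨c2, hc2, h2⟩ := exists_kerAvg_large_bound l k
  have hC0 : 0 ≤ C := (integral_nonneg fun _ => by positivity).trans (hw.energy 0)
  have hfinI : ∫⁻ s in Ioi (1 : ℝ), ENNReal.ofReal (s ^ (-2 : ℝ)) < ⊤ := by
    have := (integrableOn_Ioi_rpow_of_lt (a := -2) (by norm_num) (c := 1) one_pos)
    exact this.lintegral_lt_top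
  set I2 := ∫⁻ s in Ioi (1 : ℝ), ENNReal.ofReal (s ^ (-2 : ℝ)) with hI2
  refine ⟨ENNReal.ofReal (c1 * (C + 1)) + ENNReal.ofReal (c2 * C) * I2,
    ENNReal.add_lt_top.2 ⟨ENNReal.ofReal_lt_top, ENNReal.mul_lt_top ENNReal.ofReal_lt_top hfinI⟩,
    fun z => ?_⟩
  have hf := integrable_prodCoord hw l k z.2
  have hfC := integral_abs_prodCoord_le hw l k z.2
  have hsplit : Ioi (0 : ℝ) = Ioc 0 1 ∪ Ioi 1 := (Ioc_union_Ioi_eq_Ioi zero_le_one).symm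
  rw [absSingular, hsplit]
  refine (lintegral_union_le _ _ _).trans ?_
  have hlarge : ∫⁻ s in Ioi (1 : ℝ),
      ‖s⁻¹ * kerAvg l k (fun y => prodCoord w l k (y, z.2)) s z.1‖ₑ
      ≤ ENNReal.ofReal (c2 * C) * I2 := by
    rw [hI2, ← lintegral_const_mul' _ _ ENNReal.ofReal_ne_top]
    refine setLIntegral_mono' measurableSet_Ioi fun s hs => ?_
    have hs1 : (1 : ℝ) < s := hs
    have hs0 : 0 < s := one_pos.trans hs1
    rw [← ofReal_norm, Real.norm_eq_abs, ← ENNReal.ofReal_mul (by positivity), abs_mul,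
      abs_of_pos (inv_pos.2 hs0)]
    refine ENNReal.ofReal_le_ofReal ?_
    have h3 := h2 _ hf z.1 s hs1.le
    calc s⁻¹ * |kerAvg l k (fun y => prodCoord w l k (y, z.2)) s z.1|
        ≤ s⁻¹ * (c2 * (∫ y, |prodCoord w l k (y, z.2)|) * s⁻¹) := by gcongr
      _ ≤ s⁻¹ * (c2 * C * s⁻¹) := by gcongr
      _ = c2 * C * s ^ (-2 : ℝ) := by
        rw [Real.rpow_neg hs0.le, show (2 : ℝ) = ((2 : ℕ) : ℝ) by norm_num, Real.rpow_natCast]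
        field_simp
  have hsmall : ∫⁻ s in Ioc (0 : ℝ) 1,
      ‖s⁻¹ * kerAvg l k (fun y => prodCoord w l k (y, z.2)) s z.1‖ₑ
      ≤ nearSingular w l k r z + ENNReal.ofReal (c1 * (C + 1)) * (1 + ‖prodCoord w l k z‖ₑ) := by
    have hpt : ∀ s ∈ Ioc (0 : ℝ) 1,
        ‖s⁻¹ * kerAvg l k (fun y => prodCoord w l k (y, z.2)) s z.1‖ₑ
        ≤ (ENNReal.ofReal s⁻¹ * ∫⁻ y, {y | ‖s • y‖ < r}.indicator (fun y =>
          ‖prodCoord w l k (z.1 - s • y, z.2) - prodCoord w l k z‖ₑ * ‖ker l k y‖ₑ) y)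
          + ENNReal.ofReal (c1 * (C + 1)) * (1 + ‖prodCoord w l k z‖ₑ) := by
      intro s hs
      rw [enorm_mul, ← ofReal_norm (s⁻¹), Real.norm_of_nonneg (inv_pos.2 hs.1).le]
      refine (mul_le_mul_right (h1 _ hf z.1 s hs.1) _).trans ?_
      rw [mul_add]
      refine add_le_add le_rfl ?_
      rw [← ENNReal.ofReal_mul (inv_pos.2 hs.1).le]
      rw [← ofReal_norm, Real.norm_eq_abs, ← ENNReal.ofReal_one,
        ← ENNReal.ofReal_add zero_le_one (abs_nonneg _), ← ENNReal.ofReal_mul (by positivity)]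
      refine ENNReal.ofReal_le_ofReal ?_
      have hs0 := hs.1
      calc s⁻¹ * (c1 * ((∫ y, |prodCoord w l k (y, z.2)|) + |prodCoord w l k (z.1, z.2)|) * s)
          = c1 * ((∫ y, |prodCoord w l k (y, z.2)|) + |prodCoord w l k z|) := by
            field_simp
        _ ≤ c1 * (C + |prodCoord w l k z|) := by gcongr
        _ ≤ c1 * ((C + 1) * (1 + |prodCoord w l k z|)) := by
            gcongr
            nlinarith [abs_nonneg (prodCoord w l k z)]
        _ = _ := by ring
    refine (setLIntegral_mono' measurableSet_Ioc hpt).trans ?_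
    rw [lintegral_add_right _ measurable_const, nearSingular]
    refine add_le_add le_rfl ?_
    simp
  refine (add_le_add hsmall hlarge).trans ?_
  rw [add_assoc, add_mul]
  exact add_le_add le_rfl (add_le_add le_rfl (le_mul_of_one_le_right zero_le le_self_add))

/-- The weight is split as `s⁻¹ = s^{-1/2} s^{-1/2}`. One half, with the kernel, makes a finite
measure on scales and shifts, for which Jensen's inequality moves the power `3/2` inside. The other
half becomes `s^{-3/4}` under this power, while the increment contributes `s^{1/2}`. With the
density of the measure the total is `s^{-3/4}`, integrable at `0`. -/
lemma lintegral_nearSingular_rpow_lt_top {w : Space n × ℝ → Space n} {K : Set (Space n × ℝ)}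
    (hw : StronglyMeasurable w) (l k : Fin n) {r : ℝ} {B : ENNReal} (hB : B < ⊤)
    (hr : ∀ h : Space n, ‖h‖ < r →
      ∫⁻ z in K, ‖prodCoord w l k (z.1 + h, z.2) - prodCoord w l k z‖ₑ ^ (3 / 2 : ℝ)
        ≤ B * ENNReal.ofReal (‖h‖ ^ (1 / 2 : ℝ))) :
    ∫⁻ z in K, nearSingular w l k r z ^ (3 / 2 : ℝ) < ⊤ := by
  have hm1 : Measurable fun s : ℝ => ENNReal.ofReal (s ^ (-(1 / 2) : ℝ)) := by fun_prop
  have hm2 : Measurable fun y : Space n => ‖ker l k y‖ₑ := (continuous_ker l k).enorm.measurable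
  set ν₁ := ((volume : Measure ℝ).restrict (Ioc 0 1)).withDensity
    (fun s => ENNReal.ofReal (s ^ (-(1 / 2) : ℝ))) with hν₁
  set ν₂ := (volume : Measure (Space n)).withDensity (fun y => ‖ker l k y‖ₑ) with hν₂
  have hfin₁ : IsFiniteMeasure ν₁ := by
    refine isFiniteMeasure_withDensity_ofReal ?_
    have h : IntervalIntegrable (fun s : ℝ => s ^ (-(1 / 2) : ℝ)) volume 0 1 :=
      intervalIntegral.intervalIntegrable_rpow' (by norm_num)
    exact ((intervalIntegrable_iff_integrableOn_Ioc_of_le zero_le_one).1 h).2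
  have hfin₂ : IsFiniteMeasure ν₂ := isFiniteMeasure_withDensity (integrable_ker l k).2.ne
  set G : (Space n × ℝ) → ℝ × Space n → ENNReal := fun z q =>
    ENNReal.ofReal (q.1 ^ (-(1 / 2) : ℝ)) * {y | ‖q.1 • y‖ < r}.indicator (fun y =>
      ‖prodCoord w l k (z.1 - q.1 • y, z.2) - prodCoord w l k z‖ₑ) q.2 with hG
  have hGm : Measurable (Function.uncurry G) := by
    have hA : MeasurableSet {p : (Space n × ℝ) × ℝ × Space n | ‖p.2.1 • p.2.2‖ < r} :=
      measurableSet_lt (by fun_prop) measurable_const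
    have hf := stronglyMeasurable_prodCoord hw l k
    have h1 : Measurable fun p : (Space n × ℝ) × ℝ × Space n =>
        ‖prodCoord w l k (p.1.1 - p.2.1 • p.2.2, p.1.2) - prodCoord w l k p.1‖ₑ :=
      ((hf.comp_measurable (g := fun p : (Space n × ℝ) × ℝ × Space n =>
        (p.1.1 - p.2.1 • p.2.2, p.1.2)) (by fun_prop)).sub
        (hf.comp_measurable measurable_fst)).enorm
    exact (hm1.comp (measurable_fst.comp measurable_snd)).mul (h1.indicator hA)
  have hGz : ∀ z, Measurable (G z) := fun z => hGm.comp measurable_prodMk_left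
  have hGq : ∀ q, Measurable fun z => G z q := fun q => hGm.comp measurable_prodMk_right
  have hnear : ∀ z, nearSingular w l k r z = ∫⁻ q, G z q ∂(ν₁.prod ν₂) := by
    intro z
    rw [lintegral_prod _ (hGz z).aemeasurable, hν₁,
      lintegral_withDensity_eq_lintegral_mul _ hm1 (hGz z).lintegral_prod_right', nearSingular]
    refine setLIntegral_congr_fun measurableSet_Ioc fun s hs => ?_
    beta_reduce
    have hGs : Measurable fun y => G z (s, y) := (hGz z).comp measurable_prodMk_left
    rw [Pi.mul_apply, hν₂, lintegral_withDensity_eq_lintegral_mul _ hm2 hGs]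
    have h2 : ENNReal.ofReal s⁻¹ = ENNReal.ofReal (s ^ (-(1 / 2) : ℝ))
        * ENNReal.ofReal (s ^ (-(1 / 2) : ℝ)) := by
      rw [← ENNReal.ofReal_mul (by have := hs.1; positivity), ← Real.rpow_add hs.1,
        ← Real.rpow_neg_one]
      norm_num
    rw [h2, mul_assoc, ← lintegral_const_mul' _ _ ENNReal.ofReal_ne_top]
    congr 1
    refine lintegral_congr fun y => ?_
    simp only [hG, Pi.mul_apply, indicator]
    split_ifs
    · ring
    · simp
  have hpq : Real.HolderConjugate (3 / 2 : ℝ) 3 := by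
    rw [Real.holderConjugate_iff]; norm_num
  have hinner : ∀ s ∈ Ioc (0 : ℝ) 1, ∀ y : Space n,
      ∫⁻ z in K, G z (s, y) ^ (3 / 2 : ℝ)
        ≤ B * (ENNReal.ofReal (s ^ (-(1 / 4) : ℝ)) * ENNReal.ofReal (1 + ‖y‖)) := by
    intro s hs y
    have hs0 := hs.1
    by_cases hy : ‖s • y‖ < r
    · have h3 : ∀ z, G z (s, y) ^ (3 / 2 : ℝ) = ENNReal.ofReal (s ^ (-(3 / 4) : ℝ)) *
          ‖prodCoord w l k (z.1 + -(s • y), z.2) - prodCoord w l k z‖ₑ ^ (3 / 2 : ℝ) := by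
        intro z
        simp only [hG, indicator, hy, mem_ofPred_eq, if_true]
        rw [ENNReal.mul_rpow_of_nonneg _ _ (by norm_num), ENNReal.ofReal_rpow_of_nonneg
          (by positivity) (by norm_num), ← Real.rpow_mul hs0.le, sub_eq_add_neg z.1]
        norm_num
      simp only [h3]
      rw [lintegral_const_mul' _ _ ENNReal.ofReal_ne_top]
      refine (mul_le_mul_right (hr (-(s • y)) (by rwa [norm_neg])) _).trans ?_
      rw [mul_left_comm]
      refine mul_le_mul_right ?_ _
      rw [← ENNReal.ofReal_mul (by positivity), ← ENNReal.ofReal_mul (by positivity)]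
      refine ENNReal.ofReal_le_ofReal ?_
      rw [norm_neg, norm_smul, Real.norm_of_nonneg hs0.le, Real.mul_rpow hs0.le (norm_nonneg _),
        ← mul_assoc, ← Real.rpow_add hs0]
      norm_num
      refine mul_le_mul_of_nonneg_left ?_ (by positivity)
      -- Replacing the square root by `1 + ‖y‖` leaves moments of order `0` and `1` of the kernel.
      calc ‖y‖ ^ (1 / 2 : ℝ) ≤ (1 + ‖y‖) ^ (1 / 2 : ℝ) :=
            Real.rpow_le_rpow (norm_nonneg _) (by linarith) (by norm_num)
        _ ≤ (1 + ‖y‖) ^ (1 : ℝ) := Real.rpow_le_rpow_of_exponent_le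
            (by linarith [norm_nonneg y]) (by norm_num)
        _ = 1 + ‖y‖ := Real.rpow_one _
    · have h3 : ∀ z, G z (s, y) ^ (3 / 2 : ℝ) = 0 := by
        intro z
        simp [hG, indicator, hy]
      simp [h3]
  have hbase : (∫⁻ s in Ioc (0 : ℝ) 1, ENNReal.ofReal (s ^ (-(1 / 2) : ℝ)) *
      ENNReal.ofReal (s ^ (-(1 / 4) : ℝ))) < ⊤ := by
    have h : IntervalIntegrable (fun s : ℝ => s ^ (-(3 / 4) : ℝ)) volume 0 1 :=
      intervalIntegral.intervalIntegrable_rpow' (by norm_num)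
    have h' := ((intervalIntegrable_iff_integrableOn_Ioc_of_le zero_le_one).1 h).lintegral_lt_top
    refine lt_of_le_of_lt (le_of_eq ?_) h'
    refine setLIntegral_congr_fun measurableSet_Ioc fun s hs => ?_
    have hs0 := hs.1
    rw [← ENNReal.ofReal_mul (by positivity), ← Real.rpow_add hs0]
    norm_num
  have hbase2 : ∫⁻ y : Space n, ‖ker l k y‖ₑ * ENNReal.ofReal (1 + ‖y‖) < ⊤ := by
    have h := (integrable_ker (n := n) l k).abs.add (integrable_pow_mul_ker l k 1)
    refine lt_of_le_of_lt (le_of_eq ?_) h.lintegral_lt_top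
    refine lintegral_congr fun y => ?_
    rw [← ofReal_norm, Real.norm_eq_abs, ← ENNReal.ofReal_mul (abs_nonneg _)]
    congr 1
    simp only [Pi.add_apply]
    ring
  calc ∫⁻ z in K, nearSingular w l k r z ^ (3 / 2 : ℝ)
      ≤ ∫⁻ z in K, ((ν₁.prod ν₂) univ ^ ((3 / 2 : ℝ) / 3) *
          ∫⁻ q, G z q ^ (3 / 2 : ℝ) ∂(ν₁.prod ν₂)) := by
        refine lintegral_mono fun z => ?_
        beta_reduce
        rw [hnear]
        exact lintegral_rpow_le _ (hGz z).aemeasurable hpq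
    _ = (ν₁.prod ν₂) univ ^ ((3 / 2 : ℝ) / 3) *
          ∫⁻ q, (∫⁻ z in K, G z q ^ (3 / 2 : ℝ)) ∂(ν₁.prod ν₂) := by
        rw [lintegral_const_mul' _ _ (ENNReal.rpow_ne_top_of_nonneg (by norm_num)
          (measure_ne_top _ _))]
        congr 1
        exact lintegral_lintegral_swap (f := fun z q => G z q ^ (3 / 2 : ℝ)) (hGm.pow_const _).aemeasurable
    _ ≤ (ν₁.prod ν₂) univ ^ ((3 / 2 : ℝ) / 3) * (B *
          ((∫⁻ s in Ioc (0 : ℝ) 1, ENNReal.ofReal (s ^ (-(1 / 2) : ℝ)) *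
            ENNReal.ofReal (s ^ (-(1 / 4) : ℝ))) *
            ∫⁻ y : Space n, ‖ker l k y‖ₑ * ENNReal.ofReal (1 + ‖y‖))) := by
        refine mul_le_mul_right ?_ _
        have hmG : Measurable fun q => ∫⁻ z in K, G z q ^ (3 / 2 : ℝ) :=
          Measurable.lintegral_prod_left (hGm.pow_const _)
        rw [lintegral_prod _ hmG.aemeasurable, hν₁,
          lintegral_withDensity_eq_lintegral_mul _ hm1 hmG.lintegral_prod_right']
        have hstep : ∀ s ∈ Ioc (0 : ℝ) 1, (∫⁻ y, (∫⁻ z in K, G z (s, y) ^ (3 / 2 : ℝ)) ∂ν₂)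
            ≤ B * (ENNReal.ofReal (s ^ (-(1 / 4) : ℝ)) *
              ∫⁻ y : Space n, ‖ker l k y‖ₑ * ENNReal.ofReal (1 + ‖y‖)) := by
          intro s hs
          refine (lintegral_mono fun y => hinner s hs y).trans ?_
          rw [lintegral_const_mul' _ _ hB.ne, lintegral_const_mul' _ _ ENNReal.ofReal_ne_top, hν₂,
            lintegral_withDensity_eq_lintegral_mul _ hm2 (by fun_prop)]
          rfl
        refine (setLIntegral_mono' measurableSet_Ioc fun s hs =>
          mul_le_mul_right (hstep s hs) _).trans (le_of_eq ?_)
        rw [← lintegral_mul_const _ (by fun_prop), ← lintegral_const_mul' _ _ hB.ne]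
        refine lintegral_congr fun s => ?_
        ring
    _ < ⊤ := by
        refine ENNReal.mul_lt_top (ENNReal.rpow_lt_top_of_nonneg (by norm_num)
          (measure_ne_top _ _)) (ENNReal.mul_lt_top hB (ENNReal.mul_lt_top hbase hbase2))

lemma measurable_absSingular {w : Space n × ℝ → Space n} (hw : StronglyMeasurable w)
    (l k : Fin n) : Measurable (absSingular w l k) := by
  unfold absSingular
  have h := stronglyMeasurable_kerAvg (P := ℝ) l k (f := fun y t => prodCoord w l k (y, t))
    (stronglyMeasurable_prodCoord hw l k)
  refine Measurable.lintegral_prod_right' (f := fun q : (Space n × ℝ) × ℝ =>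
    ‖q.2⁻¹ * kerAvg l k (fun y => prodCoord w l k (y, q.1.2)) q.2 q.1.1‖ₑ) ?_
  exact (Measurable.mul (by fun_prop) h.measurable).enorm

/-- The absolute singular integral is in `L^{3/2}` on compact cubic regular sets. -/
lemma CubicRegularOn.lintegral_absSingular_lt_top {T C : ℝ} {u w : Space n × ℝ → Space n}
    (hw : IsVersion T u w C) {K : Set (Space n × ℝ)} (hKc : IsCompact K)
    (hK : CubicRegularOn w K) (l k : Fin n) :
    ∫⁻ z in K, absSingular w l k z ^ (3 / 2 : ℝ) < ⊤ := by
  obtain ⟨r, hr, B, hB, hinc⟩ := hK.exists_increment_bound hw.stronglyMeasurable l k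
  have hnear := lintegral_nearSingular_rpow_lt_top hw.stronglyMeasurable l k hB hinc
  obtain ⟨c, hc, hle⟩ := exists_absSingular_le hw l k hr
  -- The undifferenced product contributes at most `|w|³` under the power `3/2`, which is integrable
  -- on `K`.
  have hpt : ∀ z, absSingular w l k z ^ (3 / 2 : ℝ)
      ≤ 2 ^ ((3 / 2 : ℝ) - 1) * (nearSingular w l k r z ^ (3 / 2 : ℝ) + c ^ (3 / 2 : ℝ) *
        (2 ^ ((3 / 2 : ℝ) - 1) * (1 + ‖w z‖ₑ ^ 3))) := by
    intro z
    refine (ENNReal.rpow_le_rpow (hle z) (by norm_num)).trans ?_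
    refine (ENNReal.rpow_add_le_mul_rpow_add_rpow _ _ (by norm_num)).trans ?_
    refine mul_le_mul_right (add_le_add le_rfl ?_) _
    rw [ENNReal.mul_rpow_of_nonneg _ _ (by norm_num)]
    refine mul_le_mul_right ?_ _
    refine (ENNReal.rpow_add_le_mul_rpow_add_rpow _ _ (by norm_num)).trans ?_
    refine mul_le_mul_right ?_ _
    rw [ENNReal.one_rpow]
    refine add_le_add le_rfl ?_
    have : ‖prodCoord w l k z‖ₑ ≤ ‖w z‖ₑ ^ 2 := by
      rw [← ofReal_norm, ← ofReal_norm, ← ENNReal.ofReal_pow (norm_nonneg _)]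
      exact ENNReal.ofReal_le_ofReal (abs_prodCoord_le w l k z)
    refine (ENNReal.rpow_le_rpow this (by norm_num)).trans (le_of_eq ?_)
    rw [← ENNReal.rpow_natCast, ← ENNReal.rpow_mul, ← ENNReal.rpow_natCast]
    norm_num
  have h2 : ((2 : ENNReal) ^ ((3 / 2 : ℝ) - 1)) < ⊤ :=
    ENNReal.rpow_lt_top_of_nonneg (by norm_num) (by norm_num)
  have hc' : c ^ (3 / 2 : ℝ) < ⊤ := ENNReal.rpow_lt_top_of_nonneg (by norm_num) hc.ne
  have hm : Measurable fun z => 2 ^ ((3 / 2 : ℝ) - 1) * (1 + ‖w z‖ₑ ^ 3) :=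
    (measurable_const.add (hw.stronglyMeasurable.enorm.pow_const 3)).const_mul _
  refine (lintegral_mono hpt).trans_lt ?_
  rw [lintegral_const_mul' _ _ h2.ne, lintegral_add_right _ (hm.const_mul _),
    lintegral_const_mul' _ _ hc'.ne, lintegral_const_mul' _ _ h2.ne,
    lintegral_add_left measurable_const]
  refine ENNReal.mul_lt_top h2 (ENNReal.add_lt_top.2 ⟨hnear, ENNReal.mul_lt_top hc'
    (ENNReal.mul_lt_top h2 (ENNReal.add_lt_top.2 ⟨?_, hK.1⟩))⟩)
  simpa using hKc.measure_lt_top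

end Estimate

end EulerLocal
end

/-! ### The pressure function and its identification with the pressure distribution. -/

noncomputable section
namespace EulerLocal
open scoped SchwartzMap

section Pressure

variable {n : ℕ}

/-- The pressure of the time slices of `w`. -/
def pressureFn (w : Space n × ℝ → Space n) (z : Space n × ℝ) : ℝ :=
  locPressure (fun x => w (x, z.2)) z.1

lemma stronglyMeasurable_pressureFn {w : Space n × ℝ → Space n} (hw : StronglyMeasurable w) :
    StronglyMeasurable (pressureFn w) := by
  unfold pressureFn locPressure
  refine StronglyMeasurable.neg (Finset.stronglyMeasurable_fun_sum _ fun l _ =>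
    Finset.stronglyMeasurable_fun_sum _ fun k _ => StronglyMeasurable.const_mul ?_ _)
  have h := stronglyMeasurable_kerAvg (P := ℝ) l k (f := fun y t => prodCoord w l k (y, t))
    (stronglyMeasurable_prodCoord hw l k)
  refine StronglyMeasurable.integral_prod_right (f := fun (z : Space n × ℝ) (s : ℝ) =>
    s⁻¹ * kerAvg l k (fun y => prodCoord w l k (y, z.2)) s z.1) ?_
  exact StronglyMeasurable.mul (by fun_prop : Measurable fun q : (Space n × ℝ) × ℝ =>
    q.2⁻¹).stronglyMeasurable h

lemma enorm_pressureFn_le (w : Space n × ℝ → Space n) (z : Space n × ℝ) :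
    ‖pressureFn w z‖ₑ ≤ ∑ l, ∑ k, ‖lineConst⁻¹‖ₑ * absSingular w l k z := by
  unfold pressureFn locPressure
  rw [enorm_neg]
  refine (enorm_sum_le _ _).trans (Finset.sum_le_sum fun l _ => (enorm_sum_le _ _).trans
    (Finset.sum_le_sum fun k _ => ?_))
  rw [enorm_mul]
  exact mul_le_mul_right (enorm_integral_le_lintegral_enorm _) _

lemma CubicRegularOn.memLp_absSingular {T C : ℝ} {u w : Space n × ℝ → Space n}
    (hw : IsVersion T u w C) {K : Set (Space n × ℝ)} (hKc : IsCompact K)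
    (hK : CubicRegularOn w K) (l k : Fin n) :
    MemLp (absSingular w l k) (3 / 2) (volume.restrict K) := by
  refine ⟨(measurable_absSingular hw.stronglyMeasurable l k).aestronglyMeasurable, ?_⟩
  refine (eLpNorm_lt_top_iff_lintegral_rpow_enorm_lt_top (by norm_num)
    (ENNReal.div_ne_top (by norm_num) (by norm_num))).2 ?_
  have h := hK.lintegral_absSingular_lt_top hw hKc l k
  simpa using h

lemma CubicRegularOn.memLp_pressureFn {T C : ℝ} {u w : Space n × ℝ → Space n}
    (hw : IsVersion T u w C) {K : Set (Space n × ℝ)} (hKc : IsCompact K)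
    (hK : CubicRegularOn w K) : MemLp (pressureFn w) (3 / 2) (volume.restrict K) := by
  have h1 : MemLp (fun z => ∑ l, ∑ k, ‖lineConst⁻¹‖ₑ * absSingular w l k z) (3 / 2)
      (volume.restrict K) := by
    refine memLp_finsetSum _ fun l _ => memLp_finsetSum _ fun k _ => ?_
    have h2 := hK.memLp_absSingular hw hKc l k
    refine ⟨(measurable_absSingular hw.stronglyMeasurable l k).const_mul _
      |>.aestronglyMeasurable, ?_⟩
    refine (eLpNorm_lt_top_iff_lintegral_rpow_enorm_lt_top (by norm_num)
      (ENNReal.div_ne_top (by norm_num) (by norm_num))).2 ?_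
    have h := hK.lintegral_absSingular_lt_top hw hKc l k
    have e : (3 / 2 : ENNReal).toReal = (3 / 2 : ℝ) := by simp
    simp only [e, enorm_eq_self]
    simp_rw [ENNReal.mul_rpow_of_nonneg _ _ (show (0 : ℝ) ≤ 3 / 2 by norm_num)]
    have hf : ‖lineConst⁻¹‖ₑ ^ (3 / 2 : ℝ) < ⊤ :=
      ENNReal.rpow_lt_top_of_nonneg (by norm_num) enorm_ne_top
    rw [lintegral_const_mul' _ _ hf.ne]
    exact ENNReal.mul_lt_top hf h
  refine ⟨(stronglyMeasurable_pressureFn hw.stronglyMeasurable).aestronglyMeasurable,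
    (eLpNorm_mono_enorm fun z => ?_).trans_lt h1.2⟩
  rw [enorm_eq_self]
  exact enorm_pressureFn_le w z

lemma CubicRegularOn.ae_slice_lt_top {T C : ℝ} {u w : Space n × ℝ → Space n}
    (hw : IsVersion T u w C) {K : Set (Space n × ℝ)} (hKc : IsCompact K)
    (hK : CubicRegularOn w K) (l k : Fin n) :
    ∀ᵐ t : ℝ, ∫⁻ x, K.indicator (absSingular w l k) (x, t) < ⊤ := by
  have hm := (measurable_absSingular hw.stronglyMeasurable l k).indicator hKc.measurableSet
  have hfm : IsFiniteMeasure (volume.restrict K) := ⟨by simpa using hKc.measure_lt_top⟩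
  have h1 : MemLp (absSingular w l k) 1 (volume.restrict K) :=
    (hK.memLp_absSingular hw hKc l k).mono_exponent (by
      rw [ENNReal.le_div_iff_mul_le (by simp) (by simp)]; norm_num)
  have h2 : ∫⁻ z, K.indicator (absSingular w l k) z < ⊤ := by
    rw [lintegral_indicator hKc.measurableSet]
    have := h1.2
    rw [eLpNorm_one_eq_lintegral_enorm] at this
    simpa only [enorm_eq_self] using this
  rw [Measure.volume_eq_prod, lintegral_prod_symm _ hm.aemeasurable] at h2
  exact ae_lt_top hm.lintegral_prod_left' h2.ne

/-- For almost every time, the pressure distribution is represented by `pressureFn`, tested with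
functions supported in a compact cubic regular set. -/
lemma CubicRegularOn.ae_pressurePairing {T C : ℝ} {u w : Space n × ℝ → Space n}
    (hw : IsVersion T u w C) {K : Set (Space n × ℝ)} (hKc : IsCompact K)
    (hK : CubicRegularOn w K) :
    ∀ᵐ t : ℝ, ∀ (χ : Space n → ℝ) (X : 𝓢(Space n, ℂ)), (∀ x, X x = χ x) →
      (∀ x, (x, t) ∉ K → χ x = 0) →
      pressurePairing (fun x => w (x, t)) χ = ((∫ x, pressureFn w (x, t) * χ x : ℝ) : ℂ) := by
  have hae : ∀ᵐ t : ℝ, ∀ l k : Fin n, ∫⁻ x, K.indicator (absSingular w l k) (x, t) < ⊤ := by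
    simp only [ae_all_iff]
    exact fun l k => hK.ae_slice_lt_top hw hKc l k
  -- The exceptional null set of times depends only on `K`; the test function is chosen afterwards,
  -- so one set of good times serves all translates of all mollifiers.
  filter_upwards [hae] with t ht χ X hX hχ
  refine pressurePairing_eq_locPressure
    (hw.stronglyMeasurable.comp_measurable measurable_prodMk_right) (hw.memLp t) χ X hX
    fun l k => ?_
  obtain ⟨M, hM⟩ : ∃ M : NNReal, ∀ x, ‖χ x‖ₑ ≤ M := by
    refine ⟨(SchwartzMap.seminorm ℝ 0 0 X).toNNReal, fun x => ?_⟩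
    have := X.norm_le_seminorm ℝ x
    rw [hX, Complex.norm_real] at this
    rw [← ofReal_norm]
    exact ENNReal.ofReal_le_ofReal this
  calc ∫⁻ x, ∫⁻ s in Ioi (0 : ℝ), ‖χ x * (s⁻¹ * kerAvg l k (fun y => w (y, t) l * w (y, t) k) s x)‖ₑ
      ≤ ∫⁻ x, M * K.indicator (absSingular w l k) (x, t) := by
        refine lintegral_mono fun x => ?_
        simp only [enorm_mul (χ x)]
        rw [lintegral_const_mul' _ _ enorm_ne_top]
        by_cases hx : (x, t) ∈ K
        · rw [indicator_of_mem hx]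
          exact mul_le_mul_left (hM x) _
        · rw [hχ x hx]; simp
    _ = M * ∫⁻ x, K.indicator (absSingular w l k) (x, t) :=
        lintegral_const_mul' _ _ ENNReal.coe_ne_top
    _ < ⊤ := ENNReal.mul_lt_top ENNReal.coe_lt_top (ht l k)

lemma pressurePairing_congr {v v' : Space n → Space n} (h : v =ᵐ[volume] v') (χ : Space n → ℝ) :
    pressurePairing v χ = pressurePairing v' χ := by
  unfold pressurePairing pressureHat
  have : ∀ (l k : Fin n) (ξ : Space n), 𝓕 (fun x : Space n => ((v x l * v x k : ℝ) : ℂ)) ξ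
      = 𝓕 (fun x : Space n => ((v' x l * v' x k : ℝ) : ℂ)) ξ := fun l k ξ =>
    Real.fourier_congr_ae (by filter_upwards [h] with x hx; rw [hx]) ξ
  simp only [this]

lemma hasCompactSupport_slice {F : Type*} [Zero F] {φ : Space n × ℝ → F}
    (h : HasCompactSupport φ) (t : ℝ) : HasCompactSupport fun x => φ (x, t) :=
  h.comp_isClosedEmbedding (g := fun x : Space n => (x, t))
    ⟨isEmbedding_prodMkLeft t, by
      have : range (fun x : Space n => (x, t)) = univ ×ˢ {t} := by
        ext ⟨a, b⟩; simp [eq_comm]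
      rw [this]; exact isClosed_univ.prod isClosed_singleton⟩

lemma contDiff_slice {F : Type*} [NormedAddCommGroup F] [NormedSpace ℝ F] {φ : Space n × ℝ → F}
    (h : ContDiff ℝ ∞ φ) (t : ℝ) : ContDiff ℝ ∞ fun x => φ (x, t) :=
  h.comp (contDiff_id.prodMk contDiff_const)

/-- A real test function as a complex Schwartz function. -/
def toSchwartz (χ : Space n → ℝ) (h1 : HasCompactSupport χ) (h2 : ContDiff ℝ ∞ χ) :
    𝓢(Space n, ℂ) :=
  HasCompactSupport.toSchwartzMap (f := fun x => (χ x : ℂ))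
    (h1.comp_left (g := fun r : ℝ => (r : ℂ)) Complex.ofReal_zero)
    (Complex.ofRealCLM.contDiff.comp h2)

@[simp] lemma toSchwartz_apply (χ : Space n → ℝ) (h1 : HasCompactSupport χ)
    (h2 : ContDiff ℝ ∞ χ) (x : Space n) : toSchwartz χ h1 h2 x = χ x := rfl

/-- The part in the slab of the support of a test function. -/
lemma IsTestFunctionOn.isCompact {T : ℝ} {D : Set (Space n × ℝ)} {φ : Space n × ℝ → ℝ}
    (h : IsTestFunctionOn T D φ) : IsCompact (tsupport φ ∩ slab n T) :=
  IsCompact.inter_right h.2.1 (isClosed_univ.prod isClosed_Icc)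

/-- Integration over a set `D` of the slab of a function that vanishes on the slab off a subset. -/
lemma setIntegral_eq_iterated {T : ℝ} (hT : 0 ≤ T) {K D : Set (Space n × ℝ)} (hK : MeasurableSet K)
    (hKD : K ⊆ D) (hD : MeasurableSet D) (hDs : D ⊆ slab n T) {g : Space n × ℝ → ℝ}
    (hg : ∀ z ∈ slab n T, z ∉ K → g z = 0) (hint : IntegrableOn g K) :
    ∫ z in D, g z = ∫ t in (0 : ℝ)..T, ∫ x, g (x, t) := by
  have h1 : ∫ z in D, g z = ∫ z, K.indicator g z := by
    rw [integral_indicator hK]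
    exact setIntegral_eq_of_subset_of_forall_sdiff_eq_zero hD hKD fun z hz => hg z (hDs hz.1) hz.2
  have h2 : Integrable (K.indicator g) (volume.prod volume) := hint.integrable_indicator hK
  rw [h1, Measure.volume_eq_prod, integral_prod_symm _ h2,
    intervalIntegral.integral_of_le hT, ← integral_Icc_eq_integral_Ioc,
    ← integral_indicator measurableSet_Icc]
  refine integral_congr_ae (ae_of_all _ fun t => ?_)
  beta_reduce
  by_cases ht : t ∈ Icc (0 : ℝ) T
  · rw [indicator_of_mem ht]
    refine integral_congr_ae (ae_of_all _ fun x => ?_)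
    beta_reduce
    by_cases hx : (x, t) ∈ K
    · rw [indicator_of_mem hx]
    · rw [indicator_of_notMem hx, hg _ ⟨mem_univ _, ht⟩ hx]
  · rw [indicator_of_notMem ht]
    have : ∀ x, K.indicator g (x, t) = 0 := fun x =>
      indicator_of_notMem (fun hx => ht (hDs (hKD hx)).2) _
    simp [this]

lemma IsRegularSet.subset_slab {T : ℝ} {u : Space n × ℝ → Space n} {D : Set (Space n × ℝ)}
    (hD : IsRegularSet T u D) : D ⊆ slab n T := by
  obtain ⟨⟨O, -, rfl⟩, -⟩ := hD
  exact inter_subset_right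

lemma integrableOn_pressureFn_mul {T C : ℝ} {u w : Space n × ℝ → Space n}
    (hw : IsVersion T u w C) {K : Set (Space n × ℝ)} (hKc : IsCompact K)
    (hK : CubicRegularOn w K) {χ : Space n × ℝ → ℝ} (hχ : Continuous χ) :
    IntegrableOn (fun z => pressureFn w z * χ z) K := by
  have hfm : IsFiniteMeasure (volume.restrict K) := ⟨by simpa using hKc.measure_lt_top⟩
  have h1 : IntegrableOn (pressureFn w) K := memLp_one_iff_integrable.1
    ((hK.memLp_pressureFn hw hKc).mono_exponent (by
      rw [ENNReal.le_div_iff_mul_le (by simp) (by simp)]; norm_num))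
  exact h1.mul_continuousOn_of_subset hχ.continuousOn hKc.measurableSet hKc le_rfl

/-- Local integrability is the `L^{3/2}` bound. The representation is checked on almost every time
slice, where `u` and its version have the same pairing, and integrated in time by Fubini over the
compact part of the support of `χ` in the slab. -/
theorem isPressureOn_pressureFn {T C : ℝ} (hT : 0 ≤ T) {u w : Space n × ℝ → Space n}
    (hw : IsVersion T u w C) {D : Set (Space n × ℝ)} (hD : IsRegularSet T u D) :
    IsPressureOn T u D (pressureFn w) := by
  refine ⟨fun K hKc hKD => (hD.cubicRegularOn hw hKc hKD).memLp_pressureFn hw hKc,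
    fun χ hχ => ?_⟩
  have hKc := hχ.isCompact
  set K := tsupport χ ∩ slab n T
  have hK := hD.cubicRegularOn hw hKc hχ.2.2
  have hoff : ∀ z ∈ slab n T, z ∉ K → χ z = 0 := fun z hz hzK =>
    image_eq_zero_of_notMem_tsupport fun h => hzK ⟨h, hz⟩
  rw [setIntegral_eq_iterated hT hKc.measurableSet hχ.2.2 hD.measurableSet hD.subset_slab
    (fun z hz hzK => by rw [hoff z hz hzK, mul_zero])
    (integrableOn_pressureFn_mul hw hKc hK hχ.1.continuous)]
  rw [intervalIntegral.integral_of_le hT, intervalIntegral.integral_of_le hT,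
    ← integral_complex_ofReal]
  refine integral_congr_ae ?_
  filter_upwards [ae_restrict_of_ae (hK.ae_pressurePairing hw hKc),
    ae_restrict_of_ae_restrict_of_subset Ioc_subset_Icc_self hw.ae_eq,
    ae_restrict_mem measurableSet_Ioc] with t h1 h2 h3
  rw [← pressurePairing_congr h2]
  refine (h1 _ (toSchwartz (fun x => χ (x, t)) (hasCompactSupport_slice hχ.2.1 t)
    (contDiff_slice hχ.1 t)) (fun x => rfl) fun x hx => ?_).symm
  exact hoff _ ⟨mem_univ _, Ioc_subset_Icc_self h3⟩ hx

end Pressure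

end EulerLocal
end

/-! ### Momentum balance from solenoidal test fields. -/

noncomputable section
namespace EulerLocal
open scoped SchwartzMap LineDeriv
open LineDeriv

section Momentum

variable {n : ℕ}

/-- The standard unit vectors. -/
abbrev stdVec (i : Fin n) : Space n := EuclideanSpace.single i (1 : ℝ)

lemma eq_sum_stdVec (v : Space n) : v = ∑ i, v i • stdVec i := by
  ext k
  simp [stdVec, Pi.single_apply]

lemma lineDerivOp_comm {F : Type*} [NormedAddCommGroup F] [NormedSpace ℝ F]
    (X : 𝓢(Space n, F)) (a b : Space n) : ∂_{a} (∂_{b} X) = ∂_{b} (∂_{a} X) := by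
  ext x
  have h : ∀ a b : Space n, (∂_{a} (∂_{b} X)) x = fderiv ℝ (fderiv ℝ X) x a b := by
    intro a b
    rw [SchwartzMap.lineDerivOp_apply_eq_fderiv]
    have : ((∂_{b} X : 𝓢(Space n, F)) : Space n → F) = fun y => fderiv ℝ X y b :=
      funext fun y => SchwartzMap.lineDerivOp_apply_eq_fderiv ..
    rw [this, fderiv_clm_apply
      (((X.smooth 2).fderiv_right (m := 1) le_rfl).differentiable one_ne_zero x) (by fun_prop)]
    simp
  rw [h, h]
  exact (((X.smooth 2).contDiffAt (x := x)).isSymmSndFDerivAt (by simp)) a b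

/-- The Laplacian in coordinates. -/
def lapS (B : 𝓢(Space n, ℝ)) : 𝓢(Space n, ℝ) := ∑ k : Fin n, ∂_{stdVec k} (∂_{stdVec k} B)

/-- The coordinates of the divergence-free field `ΔB e_j - ∇ ∂_j B`. -/
def solField (j : Fin n) (B : 𝓢(Space n, ℝ)) (k : Fin n) : 𝓢(Space n, ℝ) :=
  (if k = j then lapS B else 0) - ∂_{stdVec k} (∂_{stdVec j} B)

lemma sum_lineDeriv_solField (j : Fin n) (B : 𝓢(Space n, ℝ)) :
    ∑ k, ∂_{stdVec k} (solField j B k) = 0 := by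
  have h : ∀ k, ∂_{stdVec k} (solField j B k)
      = (if k = j then ∂_{stdVec j} (lapS B) else 0)
        - ∂_{stdVec j} (∂_{stdVec k} (∂_{stdVec k} B)) := by
    intro k
    rw [solField, sub_eq_add_neg, lineDerivOp_add, lineDerivOp_neg, ← sub_eq_add_neg]
    congr 1
    · split_ifs with hk
      · rw [hk]
      · exact lineDerivOp_zero _
    · rw [lineDerivOp_comm _ (stdVec k) (stdVec j), lineDerivOp_comm _ (stdVec k) (stdVec j)]
  simp only [h, Finset.sum_sub_distrib, Finset.sum_ite_eq', Finset.mem_univ, if_true]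
  rw [lapS, lineDerivOp_sum, sub_self]

/-- The momentum balance of the `j`-th component tested against `φ`, with the flux tested
against `A`. -/
def MomentumIdentity (T : ℝ) (u w : Space n × ℝ → Space n) (j : Fin n) (φ : Space n → ℝ)
    (A : Fin n → Fin n → Space n → ℝ) : Prop :=
  ∀ t ∈ Icc (0 : ℝ) T, (∫ x, u (x, t) j * φ x) - (∫ x, u (x, 0) j * φ x)
    = ∫ s in (0 : ℝ)..t, ∑ i, ∑ k, ∫ x, w (x, s) i * w (x, s) k * A i k x

lemma memLp_coord {v : Space n → Space n} (hv : MemLp v 2 volume) (i : Fin n) :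
    MemLp (fun x => v x i) 2 volume :=
  hv.mono ((EuclideanSpace.proj (𝕜 := ℝ) i).continuous.comp_aestronglyMeasurable
    hv.aestronglyMeasurable) (ae_of_all _ fun x => PiLp.norm_apply_le (v x) i)

/-- Makes a stationary test field compactly supported in time. Being `1` near each time of the slab,
end points included, it contributes no time derivative there. -/
lemma exists_time_cutoff (T : ℝ) : ∃ θ : ℝ → ℝ, ContDiff ℝ ∞ θ ∧ HasCompactSupport θ ∧
    ∀ s ∈ Icc (0 : ℝ) T, θ =ᶠ[𝓝 s] fun _ => 1 := by
  let f : ContDiffBump (0 : ℝ) := ⟨|T| + 1, |T| + 2, by positivity, by linarith⟩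
  refine ⟨f, f.contDiff, f.hasCompactSupport, fun s hs => ?_⟩
  refine f.eventuallyEq_one_of_mem_ball ?_
  rw [Metric.mem_ball, Real.dist_eq, sub_zero]
  change _ < |T| + 1
  rw [abs_of_nonneg hs.1]
  linarith [hs.2, le_abs_self T]

/-- The solenoidal test field made of `solField`. -/
def solTest (j : Fin n) (B : 𝓢(Space n, ℝ)) (x : Space n) : Space n :=
  WithLp.toLp 2 fun k => solField j B k x

lemma contDiff_solTest (j : Fin n) (B : 𝓢(Space n, ℝ)) : ContDiff ℝ ∞ (solTest j B) := by
  rw [contDiff_euclidean]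
  exact fun k => (solField j B k).smooth ⊤

lemma hasCompactSupport_solTest (j : Fin n) {B : 𝓢(Space n, ℝ)} (hB : HasCompactSupport B) :
    HasCompactSupport (solTest j B) := by
  refine HasCompactSupport.intro hB fun x hx => ?_
  have h1 : ∀ a b : Space n, (∂_{a} (∂_{b} B)) x = 0 := fun a b =>
    image_eq_zero_of_notMem_tsupport fun h => hx
      (SchwartzMap.tsupport_lineDerivOp_subset b B
        (SchwartzMap.tsupport_lineDerivOp_subset a _ h))
  ext k
  simp only [solTest, solField, sub_apply, h1, PiLp.zero_apply]
  split_ifs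
  · simp [lapS, h1]
  · simp

lemma fderiv_solTest_apply (j : Fin n) (B : 𝓢(Space n, ℝ)) (x e : Space n) (k : Fin n) :
    fderiv ℝ (solTest j B) x e k = (∂_{e} (solField j B k)) x := by
  have h := ((contDiff_solTest j B).differentiable (by simp) x).hasFDerivAt
  have h2 := ((EuclideanSpace.proj (𝕜 := ℝ) k).hasFDerivAt (x := solTest j B x)).comp x h
  rw [SchwartzMap.lineDerivOp_apply_eq_fderiv]
  have h3 : (solField j B k : Space n → ℝ) = (EuclideanSpace.proj (𝕜 := ℝ) k) ∘ solTest j B := by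
    ext x; simp [solTest]
  rw [h3, h2.fderiv]
  simp

lemma inner_fderiv_solTest (j : Fin n) (B : 𝓢(Space n, ℝ)) (x v : Space n) :
    inner ℝ v (fderiv ℝ (solTest j B) x v)
      = ∑ i, ∑ k, v i * v k * (∂_{stdVec i} (solField j B k)) x := by
  have h1 : fderiv ℝ (solTest j B) x v = ∑ i, v i • fderiv ℝ (solTest j B) x (stdVec i) := by
    conv_lhs => rw [eq_sum_stdVec v]
    simp
  rw [h1, inner_sum]
  refine Finset.sum_congr rfl fun i _ => ?_
  rw [inner_smul_right, PiLp.inner_apply, Finset.mul_sum]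
  refine Finset.sum_congr rfl fun k _ => ?_
  rw [fderiv_solTest_apply]
  simp
  ring

/-- The solenoidal field differs from `ΔB eⱼ` by a gradient, and a divergence-free field does not
see gradients: only the `j`-th component is tested, against `ΔB`. -/
lemma inner_solTest (j : Fin n) (B : 𝓢(Space n, ℝ)) (x v : Space n) :
    inner ℝ v (solTest j B x)
      = v j * lapS B x - inner ℝ v (gradient (∂_{stdVec j} B : 𝓢(Space n, ℝ)) x) := by
  have h1 : inner ℝ v (gradient (∂_{stdVec j} B : 𝓢(Space n, ℝ)) x)
      = ∑ k, v k * (∂_{stdVec k} (∂_{stdVec j} B)) x := by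
    rw [real_inner_comm, inner_gradient_left]
    conv_lhs => rw [eq_sum_stdVec v]
    simp [SchwartzMap.lineDerivOp_apply_eq_fderiv]
  rw [h1, PiLp.inner_apply]
  simp only [solTest, solField, sub_apply]
  have h2 : ∀ k : Fin n, ((if k = j then lapS B else 0 : 𝓢(Space n, ℝ)) x)
      = if k = j then lapS B x else 0 := fun k => by split_ifs <;> rfl
  simp [h2, mul_sub, Finset.sum_sub_distrib, mul_comm]

/-- The flux tested in the momentum balance of the potential `B`. -/
def solFlux (j : Fin n) (B : 𝓢(Space n, ℝ)) (i k : Fin n) : 𝓢(Space n, ℝ) :=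
  ∂_{stdVec i} (solField j B k)

lemma MemLp.integrable_inner_two {v g : Space n → Space n} (hv : MemLp v 2 volume)
    (hg : MemLp g 2 volume) : Integrable fun x => inner ℝ (v x) (g x) :=
  (hv.norm.integrable_mul hg.norm).mono' (hv.aestronglyMeasurable.inner hg.aestronglyMeasurable)
    (ae_of_all _ fun _ => norm_inner_le_norm _ _)

/-- The weak formulation is applied to the stationary solenoidal field times the time cutoff. The
flux, integrated in time, may be written with the version `w`, whereas the terms at fixed times keep
`u`. -/
lemma IsWeakSolution.momentumIdentity_of_hasCompactSupport {T C : ℝ} (hT : 0 ≤ T)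
    {u₀ : Space n → Space n} {u w : Space n × ℝ → Space n} (hu : IsWeakSolution T u₀ u)
    (hw : IsVersion T u w C) (j : Fin n) {B : 𝓢(Space n, ℝ)} (hB : HasCompactSupport B) :
    MomentumIdentity T u w j (lapS B) fun i k => solFlux j B i k := by
  obtain ⟨θ, hθ, hθc, hθ1⟩ := exists_time_cutoff T
  have hθe : ∀ s ∈ Icc (0 : ℝ) T, θ s = 1 := fun s hs => (hθ1 s hs).self_of_nhds
  let ψ : Space n × ℝ → Space n := fun z => θ z.2 • solTest j B z.1
  have hψ : ContDiff ℝ ∞ ψ :=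
    (hθ.comp contDiff_snd).smul ((contDiff_solTest j B).comp contDiff_fst)
  have hψc : HasCompactSupport ψ := by
    refine HasCompactSupport.intro ((hasCompactSupport_solTest j hB).prod hθc) fun z hz => ?_
    rw [mem_prod, not_and_or] at hz
    rcases hz with hz | hz
    · simp [ψ, image_eq_zero_of_notMem_tsupport hz]
    · simp [ψ, image_eq_zero_of_notMem_tsupport hz]
  have hjac : ∀ s ∈ Icc (0 : ℝ) T, ∀ x, jacX ψ (x, s) = fderiv ℝ (solTest j B) x := by
    intro s hs x
    simp only [jacX, ψ, hθe s hs, one_smul]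
  have hdiv : ∀ z ∈ slab n T, divX ψ z = 0 := by
    rintro ⟨x, s⟩ hz
    have hs : s ∈ Icc (0 : ℝ) T := hz.2
    simp only [divX, hjac s hs, fderiv_solTest_apply]
    have := congrArg (fun X : 𝓢(Space n, ℝ) => X x) (sum_lineDeriv_solField j B)
    simpa using this
  have hdt : ∀ s ∈ Icc (0 : ℝ) T, ∀ x, dt ψ (x, s) = 0 := by
    intro s hs x
    have : (fun r => ψ (x, r)) =ᶠ[𝓝 s] fun _ => solTest j B x := by
      filter_upwards [hθ1 s hs] with r hr
      simp [ψ, hr]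
    rw [dt]
    exact (this.deriv_eq).trans (deriv_const _ _)
  have h0 : (0 : ℝ) ∈ Icc (0 : ℝ) T := ⟨le_rfl, hT⟩
  have hsub : ∀ t ∈ Icc (0 : ℝ) T, ∀ s ∈ uIcc 0 t, s ∈ Icc (0 : ℝ) T := by
    intro t ht s hs
    rw [uIcc_of_le ht.1] at hs
    exact ⟨hs.1, hs.2.trans ht.2⟩
  have hχ : ContDiff ℝ ∞ (∂_{stdVec j} B : 𝓢(Space n, ℝ)) := (∂_{stdVec j} B : 𝓢(Space n, ℝ)).smooth ⊤
  have hχc : HasCompactSupport (∂_{stdVec j} B : 𝓢(Space n, ℝ)) :=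
    hB.of_isClosed_subset (isClosed_tsupport _) (SchwartzMap.tsupport_lineDerivOp_subset _ _)
  have hlc : HasCompactSupport (lapS B) := by
    refine HasCompactSupport.intro hB fun x hx => ?_
    have h1 : ∀ a b : Space n, (∂_{a} (∂_{b} B)) x = 0 := fun a b =>
      image_eq_zero_of_notMem_tsupport fun h => hx
        (SchwartzMap.tsupport_lineDerivOp_subset b B
          (SchwartzMap.tsupport_lineDerivOp_subset a _ h))
    simp [lapS, h1]
  have hpair : ∀ t ∈ Icc (0 : ℝ) T, ∫ x, inner ℝ (u (x, t)) (ψ (x, t))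
      = ∫ x, u (x, t) j * lapS B x := by
    intro t ht
    have e1 : ∀ x, inner ℝ (u (x, t)) (ψ (x, t)) = u (x, t) j * lapS B x
        - inner ℝ (u (x, t)) (gradient (∂_{stdVec j} B : 𝓢(Space n, ℝ)) x) := fun x => by
      simp only [ψ, hθe t ht, one_smul, inner_solTest]
    simp only [e1]
    rw [integral_sub, hu.div_free t ht _ hχ hχc, sub_zero]
    · exact (memLp_coord (hu.memLp t ht) j).integrable_mul
        ((lapS B).continuous.memLp_of_hasCompactSupport (p := 2) hlc)
    · refine MemLp.integrable_inner_two (hu.memLp t ht) (Continuous.memLp_of_hasCompactSupport ?_ ?_)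
      · exact (InnerProductSpace.toDual ℝ (Space n)).symm.continuous.comp
          (hχ.continuous_fderiv (by simp))
      · exact (hχc.fderiv ℝ).comp_left (map_zero _)
  have hflux : ∀ t ∈ Icc (0 : ℝ) T, ∫ s in (0 : ℝ)..t, ∫ x, inner ℝ (u (x, s)) (jacX ψ (x, s) (u (x, s)))
      = ∫ s in (0 : ℝ)..t, ∑ i, ∑ k, ∫ x, w (x, s) i * w (x, s) k * solFlux j B i k x := by
    intro t ht
    have hae := (ae_restrict_iff' measurableSet_Icc).1 hw.ae_eq
    refine intervalIntegral.integral_congr_ae ?_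
    filter_upwards [hae] with s hs hst
    have hsT := hsub t ht s (uIoc_subset_uIcc hst)
    rw [integral_congr_ae (g := fun x => ∑ i, ∑ k, w (x, s) i * w (x, s) k * solFlux j B i k x)]
    · have hint : ∀ i k, Integrable fun x => w (x, s) i * w (x, s) k * solFlux j B i k x := by
        intro i k
        obtain ⟨M, hM⟩ := (solFlux j B i k).toBoundedContinuousFunction.isBounded_range.exists_norm_le
        exact (integrable_mul_coord (hw.memLp s) i k).mul_bdd (c := M)
          (solFlux j B i k).continuous.aestronglyMeasurable
          (ae_of_all _ fun x => hM _ (mem_range_self x))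
      rw [integral_finsetSum _ fun i _ => integrable_finsetSum _ fun k _ => hint i k]
      exact Finset.sum_congr rfl fun i _ => integral_finsetSum _ fun k _ => hint i k
    · filter_upwards [hs hsT] with x hx
      rw [hjac s hsT, ← hx, inner_fderiv_solTest]
      rfl
  have hdt0 : ∀ t ∈ Icc (0 : ℝ) T, ∫ s in (0 : ℝ)..t, ∫ x, inner ℝ (u (x, s)) (dt ψ (x, s)) = 0 := by
    intro t ht
    rw [intervalIntegral.integral_congr (g := fun _ => (0 : ℝ))]
    · simp
    · intro s hs
      simp [hdt s (hsub t ht s hs)]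
  intro t ht
  have e1 := hu.weak_form ψ hψ hψc hdiv t ht
  -- At time `0` the formulation says that `u₀` and `u(0)` have the same pairing with the test
  -- field, so the initial data can be replaced by `u(0)`.
  have e2 := hu.weak_form ψ hψ hψc hdiv 0 h0
  rw [hpair t ht, hdt0 t ht, hflux t ht] at e1
  rw [hpair 0 h0, intervalIntegral.integral_same, intervalIntegral.integral_same] at e2
  linarith

end Momentum
end EulerLocal
end

/-! ### Extension of the momentum balance to Schwartz potentials. -/

noncomputable section
namespace EulerLocal
open scoped SchwartzMap LineDeriv
open LineDeriv

section Closure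

variable {n : ℕ}

/-- The two sides need different convergence. The velocity is in `L²`, so weak convergence of the
test functions in `L²` is enough. The products `wᵢwₖ` are bounded in `L¹` uniformly in time, so
bounded pointwise convergence of the tested fluxes is enough, by dominated convergence in space and
then in time. -/
lemma MomentumIdentity.of_tendsto {T C : ℝ} {u₀ : Space n → Space n}
    {u w : Space n × ℝ → Space n} (hu : IsWeakSolution T u₀ u) (hw : IsVersion T u w C)
    {j : Fin n} {φ : ℕ → Space n → ℝ} {A : ℕ → Fin n → Fin n → Space n → ℝ} {φ' : Space n → ℝ}
    {A' : Fin n → Fin n → Space n → ℝ} (h : ∀ m, MomentumIdentity T u w j (φ m) (A m))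
    (hφ : ∀ v : Space n → ℝ, MemLp v 2 volume →
      Tendsto (fun m => ∫ x, v x * φ m x) atTop (𝓝 (∫ x, v x * φ' x)))
    (hAc : ∀ m i k, Continuous (A m i k)) {M : ℝ} (hAM : ∀ m i k x, |A m i k x| ≤ M)
    (hA : ∀ i k x, Tendsto (fun m => A m i k x) atTop (𝓝 (A' i k x))) :
    MomentumIdentity T u w j φ' A' := by
  intro t ht
  have h0 : (0 : ℝ) ∈ Icc (0 : ℝ) T := ⟨le_rfl, ht.1.trans ht.2⟩
  have hl := (hφ _ (memLp_coord (hu.memLp t ht) j)).sub (hφ _ (memLp_coord (hu.memLp 0 h0) j))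
  have hM : ∀ i k : Fin n, ∀ m s, |∫ x, w (x, s) i * w (x, s) k * A m i k x| ≤ M * C := by
    intro i k m s
    have h1 : ∀ x, |w (x, s) i * w (x, s) k * A m i k x| ≤ M * |prodCoord w i k (x, s)| := by
      intro x
      rw [abs_mul, mul_comm]
      exact mul_le_mul_of_nonneg_right (hAM m i k x) (abs_nonneg _)
    have hM0 : 0 ≤ M := (abs_nonneg _).trans (hAM 0 i k 0)
    calc _ ≤ ∫ x, |w (x, s) i * w (x, s) k * A m i k x| := abs_integral_le_integral_abs
      _ ≤ ∫ x, M * |prodCoord w i k (x, s)| :=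
        integral_mono_of_nonneg (ae_of_all _ fun x => abs_nonneg _)
          ((integrable_prodCoord hw i k s).abs.const_mul M) (ae_of_all _ h1)
      _ ≤ M * C := by
        rw [integral_const_mul]
        exact mul_le_mul_of_nonneg_left (integral_abs_prodCoord_le hw i k s) hM0
  have hr : Tendsto (fun m => ∫ s in (0 : ℝ)..t,
      ∑ i, ∑ k, ∫ x, w (x, s) i * w (x, s) k * A m i k x) atTop
      (𝓝 (∫ s in (0 : ℝ)..t, ∑ i, ∑ k, ∫ x, w (x, s) i * w (x, s) k * A' i k x)) := by
    refine intervalIntegral.tendsto_integral_filter_of_dominated_convergence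
      (fun _ => ∑ _i : Fin n, ∑ _k : Fin n, M * C) (Eventually.of_forall fun m => ?_)
      (Eventually.of_forall fun m => ae_of_all _ fun s _ => ?_) (by simp) (ae_of_all _ fun s _ => ?_)
    · refine StronglyMeasurable.aestronglyMeasurable (Finset.stronglyMeasurable_fun_sum _ fun i _ =>
        Finset.stronglyMeasurable_fun_sum _ fun k _ => ?_)
      refine StronglyMeasurable.integral_prod_left (f := fun x s =>
        w (x, s) i * w (x, s) k * A m i k x) ?_
      exact (stronglyMeasurable_prodCoord hw.stronglyMeasurable i k).mul
        ((hAc m i k).comp continuous_fst).stronglyMeasurable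
    · rw [Real.norm_eq_abs]
      refine (Finset.abs_sum_le_sum_abs _ _).trans (Finset.sum_le_sum fun i _ => ?_)
      exact (Finset.abs_sum_le_sum_abs _ _).trans (Finset.sum_le_sum fun k _ => hM i k m s)
    · refine tendsto_finsetSum _ fun i _ => tendsto_finsetSum _ fun k _ => ?_
      refine tendsto_integral_of_dominated_convergence (fun x => |prodCoord w i k (x, s)| * M)
        (fun m => ?_) ((integrable_prodCoord hw i k s).abs.mul_const M)
        (fun m => ae_of_all _ fun x => ?_) (ae_of_all _ fun x => (hA i k x).const_mul _)
      · exact (integrable_prodCoord hw i k s).aestronglyMeasurable.mul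
          (hAc m i k).aestronglyMeasurable
      · rw [Real.norm_eq_abs, abs_mul]
        exact mul_le_mul_of_nonneg_left (hAM m i k x) (abs_nonneg _)
  refine tendsto_nhds_unique (hl.congr fun m => ?_) hr
  exact h m t ht

lemma abs_integral_mul_le_sqrt {f g : Space n → ℝ} (hf : MemLp f 2 volume)
    (hg : MemLp g 2 volume) :
    |∫ x, f x * g x| ≤ Real.sqrt (∫ x, f x ^ 2) * Real.sqrt (∫ x, g x ^ 2) := by
  have h := integral_mul_norm_le_Lp_mul_Lq (μ := (volume : Measure (Space n)))
    Real.HolderConjugate.two_two (f := f) (g := g) (by simpa using hf) (by simpa using hg)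
  have h2 : |∫ x, f x * g x| ≤ ∫ x, ‖f x‖ * ‖g x‖ := by
    simpa only [Real.norm_eq_abs, abs_mul] using
      norm_integral_le_integral_norm (fun x => f x * g x)
  refine h2.trans (h.trans (le_of_eq ?_))
  simp [Real.sqrt_eq_rpow]

/-- Weak `L²` convergence from `L²` convergence. -/
lemma tendsto_integral_mul_of_sq {φ : ℕ → Space n → ℝ} {φ' : Space n → ℝ}
    (hφ : ∀ m, MemLp (φ m) 2 volume) (hφ' : MemLp φ' 2 volume)
    (h : Tendsto (fun m => ∫ x, (φ m x - φ' x) ^ 2) atTop (𝓝 0)) {v : Space n → ℝ}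
    (hv : MemLp v 2 volume) :
    Tendsto (fun m => ∫ x, v x * φ m x) atTop (𝓝 (∫ x, v x * φ' x)) := by
  rw [tendsto_iff_norm_sub_tendsto_zero]
  have h2 : Tendsto (fun m => Real.sqrt (∫ x, v x ^ 2) * Real.sqrt (∫ x, (φ m x - φ' x) ^ 2))
      atTop (𝓝 0) := by
    simpa using (h.sqrt).const_mul (Real.sqrt (∫ x, v x ^ 2))
  refine squeeze_zero (fun _ => norm_nonneg _) (fun m => ?_) h2
  rw [Real.norm_eq_abs]
  have e : (∫ x, v x * φ m x) - ∫ x, v x * φ' x = ∫ x, v x * (φ m x - φ' x) := by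
    simp only [mul_sub]
    exact (integral_sub (hv.integrable_mul (hφ m)) (hv.integrable_mul hφ')).symm
  rw [e]
  exact abs_integral_mul_le_sqrt hv ((hφ m).sub hφ')

/-- Compactly supported approximation of a Schwartz function. -/
lemma exists_compactSupport_approx (B : 𝓢(Space n, ℝ)) :
    ∃ b : ℕ → 𝓢(Space n, ℝ), (∀ m, HasCompactSupport (b m)) ∧
      (∀ x, ∀ᶠ m in atTop, (b m : Space n → ℝ) =ᶠ[𝓝 x] B) ∧
      ∀ k d : ℕ, ∃ M, ∀ m x, (1 + ‖x‖) ^ d * ‖iteratedFDeriv ℝ k (b m) x‖ ≤ M := by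
  let β : ContDiffBump (0 : Space n) := ⟨1, 2, one_pos, one_lt_two⟩
  let βS : 𝓢(Space n, ℝ) := β.hasCompactSupport.toSchwartzMap β.contDiff
  -- Cutoffs dilated by maps of norm at most `1` have all their derivatives bounded uniformly in
  -- `m`.
  let g : ℕ → Space n →L[ℝ] Space n := fun m => ((m : ℝ) + 1)⁻¹ • ContinuousLinearMap.id ℝ _
  have hg : ∀ m, ‖g m‖ ≤ 1 := fun m => by
    refine ContinuousLinearMap.opNorm_le_bound _ zero_le_one fun x => ?_
    have : ((m : ℝ) + 1)⁻¹ ≤ 1 := inv_le_one_of_one_le₀ (by linarith [m.cast_nonneg (α := ℝ)])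
    simp only [g, smul_apply, ContinuousLinearMap.coe_id', id_eq, norm_smul]
    rw [Real.norm_of_nonneg (by positivity)]
    gcongr
  let χ : ℕ → Space n → ℝ := fun m => βS ∘ g m
  have hχ : ∀ m, ContDiff ℝ ∞ (χ m) := fun m => (βS.smooth ⊤).comp (g m).contDiff
  have hχ1 : ∀ (m : ℕ) x, ‖x‖ < m → χ m x = 1 := by
    intro m x hx
    refine β.one_of_mem_closedBall ?_
    rw [mem_closedBall_zero_iff]
    simp only [g, smul_apply, ContinuousLinearMap.coe_id', id_eq, norm_smul]
    rw [Real.norm_of_nonneg (by positivity), inv_mul_le_iff₀ (by positivity)]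
    change ‖x‖ ≤ ((m : ℝ) + 1) * 1
    linarith
  have hχc : ∀ m, HasCompactSupport (χ m) := by
    intro m
    refine HasCompactSupport.intro (isCompact_closedBall (0 : Space n) (2 * (m + 1))) fun x hx => ?_
    refine β.zero_of_le_dist ?_
    rw [mem_closedBall_zero_iff, not_le] at hx
    rw [dist_zero_right]
    simp only [g, smul_apply, ContinuousLinearMap.coe_id', id_eq, norm_smul]
    rw [Real.norm_of_nonneg (by positivity), le_inv_mul_iff₀ (by positivity)]
    change ((m : ℝ) + 1) * 2 ≤ _
    linarith
  refine ⟨fun m => ((hχc m).mul_right (f' := B)).toSchwartzMap ((hχ m).mul (B.smooth ⊤)),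
    fun m => (hχc m).mul_right, fun x => ?_, fun k d => ?_⟩
  · obtain ⟨N, hN⟩ := exists_nat_gt (‖x‖ + 1)
    filter_upwards [eventually_ge_atTop N] with m hm
    filter_upwards [Metric.ball_mem_nhds x one_pos] with y hy
    have : ‖y‖ < m := by
      have h1 : ‖y‖ ≤ ‖x‖ + ‖y - x‖ := by simpa using norm_add_le x (y - x)
      rw [Metric.mem_ball, dist_eq_norm] at hy
      have : (N : ℝ) ≤ m := by exact_mod_cast hm
      linarith
    change χ m y * B y = B y
    rw [hχ1 m y this, one_mul]
  · refine ⟨∑ i ∈ Finset.range (k + 1), (k.choose i : ℝ) * SchwartzMap.seminorm ℝ 0 i βS *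
      (2 ^ d * (Finset.Iic (d, k)).sup (schwartzSeminormFamily ℝ (Space n) ℝ) B), fun m x => ?_⟩
    have h1 := norm_iteratedFDeriv_mul_le (n := k) (hχ m) (B.smooth ⊤) x (by exact_mod_cast le_top)
    refine (mul_le_mul_of_nonneg_left h1 (by positivity)).trans ?_
    rw [Finset.mul_sum]
    refine Finset.sum_le_sum fun i hi => ?_
    have h2 : ‖iteratedFDeriv ℝ i (χ m) x‖ ≤ SchwartzMap.seminorm ℝ 0 i βS := by
      have : iteratedFDeriv ℝ i (χ m) x = _ :=
        ContinuousLinearMap.iteratedFDeriv_comp_right (g m) (βS.smooth ⊤) x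
          (i := i) (by exact_mod_cast le_top)
      rw [this]
      refine (ContinuousMultilinearMap.norm_compContinuousLinearMap_le _ _).trans ?_
      refine le_trans (mul_le_of_le_one_right (norm_nonneg _) ?_)
        (by simpa using SchwartzMap.le_seminorm ℝ 0 i βS (g m x))
      simpa using pow_le_one₀ (norm_nonneg _) (hg m)
    have h3 := SchwartzMap.one_add_le_sup_seminorm_apply (𝕜 := ℝ) (m := (d, k)) (k := d)
      (n := k - i) le_rfl (Nat.sub_le _ _) B x
    calc _ = (k.choose i : ℝ) * ‖iteratedFDeriv ℝ i (χ m) x‖ *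
          ((1 + ‖x‖) ^ d * ‖iteratedFDeriv ℝ (k - i) B x‖) := by ring
      _ ≤ _ := mul_le_mul (mul_le_mul_of_nonneg_left h2 (by positivity)) h3 (by positivity)
        (by positivity)

lemma lineDeriv_two_eq (B : 𝓢(Space n, ℝ)) (a b x : Space n) :
    (∂_{a} (∂_{b} B)) x = iteratedFDeriv ℝ 2 B x ![a, b] := by
  rw [← SchwartzMap.iteratedLineDerivOp_eq_iteratedFDeriv]
  rfl

lemma lineDeriv_three_eq (B : 𝓢(Space n, ℝ)) (a b c x : Space n) :
    (∂_{a} (∂_{b} (∂_{c} B))) x = iteratedFDeriv ℝ 3 B x ![a, b, c] := by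
  rw [← SchwartzMap.iteratedLineDerivOp_eq_iteratedFDeriv]
  rfl

lemma lapS_apply (B : 𝓢(Space n, ℝ)) (x : Space n) :
    lapS B x = ∑ l, iteratedFDeriv ℝ 2 B x ![stdVec l, stdVec l] := by
  simp [lapS, lineDeriv_two_eq]

lemma solFlux_apply (j : Fin n) (B : 𝓢(Space n, ℝ)) (i k : Fin n) (x : Space n) :
    solFlux j B i k x
      = (if k = j then ∑ l, iteratedFDeriv ℝ 3 B x ![stdVec i, stdVec l, stdVec l] else 0)
        - iteratedFDeriv ℝ 3 B x ![stdVec i, stdVec k, stdVec j] := by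
  have h : solFlux j B i k = (if k = j then ∂_{stdVec i} (lapS B) else 0)
      - ∂_{stdVec i} (∂_{stdVec k} (∂_{stdVec j} B)) := by
    rw [solFlux, solField, sub_eq_add_neg, lineDerivOp_add, lineDerivOp_neg, ← sub_eq_add_neg]
    congr 1
    split_ifs
    · rfl
    · exact lineDerivOp_zero _
  rw [h, sub_apply, lineDeriv_three_eq]
  congr 1
  split_ifs
  · simp [lapS, lineDerivOp_sum, lineDeriv_three_eq]
  · rfl

lemma abs_lapS_le (B : 𝓢(Space n, ℝ)) (x : Space n) :
    |lapS B x| ≤ n * ‖iteratedFDeriv ℝ 2 B x‖ := by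
  rw [lapS_apply]
  refine (Finset.abs_sum_le_sum_abs _ _).trans ?_
  refine (Finset.sum_le_card_nsmul _ _ ‖iteratedFDeriv ℝ 2 B x‖ fun l _ => ?_).trans
    (le_of_eq (by simp))
  refine ((iteratedFDeriv ℝ 2 B x).le_opNorm _).trans (le_of_eq ?_)
  simp [Fin.prod_univ_succ]

lemma abs_solFlux_le (j : Fin n) (B : 𝓢(Space n, ℝ)) (i k : Fin n) (x : Space n) :
    |solFlux j B i k x| ≤ (n + 1) * ‖iteratedFDeriv ℝ 3 B x‖ := by
  have h : ∀ a b c : Fin n, |iteratedFDeriv ℝ 3 B x ![stdVec a, stdVec b, stdVec c]|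
      ≤ ‖iteratedFDeriv ℝ 3 B x‖ := fun a b c => by
    refine ((iteratedFDeriv ℝ 3 B x).le_opNorm _).trans (le_of_eq ?_)
    simp [Fin.prod_univ_succ]
  rw [solFlux_apply, add_mul, one_mul]
  refine (abs_sub _ _).trans (add_le_add ?_ (h _ _ _))
  split_ifs
  · refine (Finset.abs_sum_le_sum_abs _ _).trans ?_
    exact (Finset.sum_le_card_nsmul _ _ ‖iteratedFDeriv ℝ 3 B x‖ fun l _ => h _ _ _).trans
      (le_of_eq (by simp))
  · rw [abs_zero]; positivity

/-- Potentials obtained from a Fourier multiplier are Schwartz functions but not compactly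
supported, hence this truncation. -/
lemma IsWeakSolution.momentumIdentity_schwartz {T C : ℝ} (hT : 0 ≤ T)
    {u₀ : Space n → Space n} {u w : Space n × ℝ → Space n} (hu : IsWeakSolution T u₀ u)
    (hw : IsVersion T u w C) (j : Fin n) (B : 𝓢(Space n, ℝ)) :
    MomentumIdentity T u w j (lapS B) fun i k => solFlux j B i k := by
  obtain ⟨b, hbc, hbe, hbM⟩ := exists_compactSupport_approx B
  -- The second derivatives need a common majorant in `L²`, and `(1 + ‖x‖)^{-(n+1)}` is one; the
  -- third derivatives need only be bounded.
  obtain ⟨M2, hM2⟩ := hbM 2 (n + 1)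
  obtain ⟨M3, hM3⟩ := hbM 3 0
  refine MomentumIdentity.of_tendsto hu hw
    (fun m => hu.momentumIdentity_of_hasCompactSupport hT hw j (hbc m)) (fun v hv => ?_)
    (fun m i k => (solFlux j (b m) i k).continuous) (M := (n + 1) * M3) (fun m i k x => ?_)
    (fun i k x => ?_)
  · have hdec : ∀ m x, |lapS (b m) x| ≤ n * M2 * (1 + ‖x‖) ^ (-(n + 1 : ℝ)) := by
      intro m x
      refine (abs_lapS_le _ x).trans ?_
      rw [mul_assoc]
      refine mul_le_mul_of_nonneg_left ?_ (Nat.cast_nonneg n)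
      have hp : (1 + ‖x‖) ^ (-(n + 1 : ℝ)) = ((1 + ‖x‖) ^ (n + 1))⁻¹ := by
        rw [Real.rpow_neg (by positivity)]
        exact_mod_cast rfl
      rw [hp, le_mul_inv_iff₀ (by positivity), mul_comm]
      exact hM2 m x
    have hL2 : MemLp (fun x : Space n => (1 + ‖x‖) ^ (-(n + 1 : ℝ))) 2 volume := by
      rw [memLp_two_iff_integrable_sq]
      · refine (integrable_one_add_norm (r := n + 1) (by simp)).mono' ?_ (ae_of_all _ fun x => ?_)
        · exact Measurable.aestronglyMeasurable (by fun_prop)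
        · rw [Real.norm_of_nonneg (by positivity), sq]
          refine mul_le_of_le_one_right (by positivity) ?_
          exact Real.rpow_le_one_of_one_le_of_nonpos (by simp) (by linarith [n.cast_nonneg (α := ℝ)])
      · exact Measurable.aestronglyMeasurable (by fun_prop)
    refine tendsto_integral_of_dominated_convergence
      (fun x => |v x| * (n * M2 * (1 + ‖x‖) ^ (-(n + 1 : ℝ)))) (fun m => ?_)
      (hv.abs.integrable_mul (hL2.const_mul _)) (fun m => ae_of_all _ fun x => ?_)
      (ae_of_all _ fun x => ?_)
    · exact hv.aestronglyMeasurable.mul (lapS (b m)).continuous.aestronglyMeasurable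
    · rw [Real.norm_eq_abs, abs_mul]
      exact mul_le_mul_of_nonneg_left (hdec m x) (abs_nonneg _)
    · refine tendsto_const_nhds.congr' ?_
      filter_upwards [hbe x] with m hm
      rw [lapS_apply, lapS_apply, (hm.iteratedFDeriv ℝ 2).self_of_nhds]
  · refine (abs_solFlux_le _ _ _ _ x).trans ?_
    refine mul_le_mul_of_nonneg_left ?_ (by positivity)
    simpa using hM3 m x
  · refine tendsto_const_nhds.congr' ?_
    filter_upwards [hbe x] with m hm
    rw [solFlux_apply, solFlux_apply, (hm.iteratedFDeriv ℝ 3).self_of_nhds]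

end Closure
end EulerLocal
end

/-! ### Inverting the Laplacian: the momentum balance with pressure. -/

noncomputable section
namespace EulerLocal
open scoped SchwartzMap LineDeriv
open LineDeriv

section Regularization

variable {n : ℕ}

/-- Real part of a Schwartz function. -/
def reS (X : 𝓢(Space n, ℂ)) : 𝓢(Space n, ℝ) := X.postcompCLM Complex.reCLM

@[simp] lemma reS_apply (X : 𝓢(Space n, ℂ)) (x : Space n) : reS X x = (X x).re := rfl

lemma lineDeriv_reS (X : 𝓢(Space n, ℂ)) (e : Space n) : ∂_{e} (reS X) = reS (∂_{e} X) := by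
  ext x
  rw [reS_apply, SchwartzMap.lineDerivOp_apply_eq_fderiv, SchwartzMap.lineDerivOp_apply_eq_fderiv]
  have h := (Complex.reCLM.hasFDerivAt (x := X x)).comp x X.differentiableAt.hasFDerivAt
  have h2 : (reS X : Space n → ℝ) = Complex.reCLM ∘ X := rfl
  rw [h2, h.fderiv]
  rfl

lemma reS_sub (X Y : 𝓢(Space n, ℂ)) : reS (X - Y) = reS X - reS Y := by ext; simp

lemma reS_zero : reS (0 : 𝓢(Space n, ℂ)) = 0 := by ext; simp

/-- Complex version of `lapS`. -/
def lapC (X : 𝓢(Space n, ℂ)) : 𝓢(Space n, ℂ) := ∑ k : Fin n, ∂_{stdVec k} (∂_{stdVec k} X)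

/-- Complex version of `solFlux`. -/
def solFluxC (j : Fin n) (X : 𝓢(Space n, ℂ)) (i k : Fin n) : 𝓢(Space n, ℂ) :=
  ∂_{stdVec i} ((if k = j then lapC X else 0) - ∂_{stdVec k} (∂_{stdVec j} X))

lemma lapS_reS (X : 𝓢(Space n, ℂ)) : lapS (reS X) = reS (lapC X) := by
  ext x
  simp [lapS, lapC, lineDeriv_reS]

lemma solFlux_reS (j : Fin n) (X : 𝓢(Space n, ℂ)) (i k : Fin n) :
    solFlux j (reS X) i k = reS (solFluxC j X i k) := by
  rw [solFlux, solFluxC, ← lineDeriv_reS, solField, reS_sub, lapS_reS, lineDeriv_reS, lineDeriv_reS]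
  congr 2
  split_ifs
  · rfl
  · exact reS_zero.symm

lemma fourierInv_lineDeriv_apply (X : 𝓢(Space n, ℂ)) (e ξ : Space n) :
    (𝓕⁻ (∂_{e} X)) ξ = -(2 * Real.pi * Complex.I) * ((inner ℝ ξ e : ℝ) * (𝓕⁻ X) ξ) := by
  rw [SchwartzMap.fourierInv_lineDerivOp_eq]
  have : (inner ℝ · e : Space n → ℝ).HasTemperateGrowth := by fun_prop
  simp only [smul_apply, SchwartzMap.smulLeftCLM_apply_apply this, smul_eq_mul, Complex.real_smul]

lemma inner_stdVec (ξ : Space n) (k : Fin n) : inner ℝ ξ (stdVec k) = ξ k := by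
  simp [stdVec, EuclideanSpace.inner_single_right]

lemma fourierInv_lineDeriv_two (X : 𝓢(Space n, ℂ)) (a b : Fin n) (ξ : Space n) :
    (𝓕⁻ (∂_{stdVec a} (∂_{stdVec b} X))) ξ = -((4 * Real.pi ^ 2 * (ξ a * ξ b) : ℝ) : ℂ) * (𝓕⁻ X) ξ := by
  rw [fourierInv_lineDeriv_apply, fourierInv_lineDeriv_apply, inner_stdVec, inner_stdVec]
  push_cast
  linear_combination (4 * Real.pi ^ 2 * (ξ a * ξ b) * (𝓕⁻ X) ξ) * Complex.I_sq

lemma sum_mul_self (ξ : Space n) : ∑ k, ξ k * ξ k = ‖ξ‖ ^ 2 := by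
  rw [EuclideanSpace.real_norm_sq_eq]
  exact Finset.sum_congr rfl fun k _ => (sq _).symm

lemma fourierInv_lapC (X : 𝓢(Space n, ℂ)) (ξ : Space n) :
    (𝓕⁻ (lapC X)) ξ = -((4 * Real.pi ^ 2 * ‖ξ‖ ^ 2 : ℝ) : ℂ) * (𝓕⁻ X) ξ := by
  have h : 𝓕⁻ (lapC X) = ∑ k : Fin n, 𝓕⁻ (∂_{stdVec k} (∂_{stdVec k} X)) := by
    rw [lapC]
    exact map_sum (FourierTransform.fourierCLE ℂ 𝓢(Space n, ℂ)).symm _ _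
  rw [h, sum_apply]
  simp only [fourierInv_lineDeriv_two]
  rw [← Finset.sum_mul, Finset.sum_neg_distrib, ← sum_mul_self, Finset.mul_sum]
  push_cast
  rfl

lemma fourierInv_solFluxC (j : Fin n) (X : 𝓢(Space n, ℂ)) (i k : Fin n) (ξ : Space n) :
    (𝓕⁻ (solFluxC j X i k)) ξ = -(2 * Real.pi * Complex.I) * (ξ i *
      (-((4 * Real.pi ^ 2 * ((if k = j then ‖ξ‖ ^ 2 else 0) - ξ k * ξ j) : ℝ) : ℂ) * (𝓕⁻ X) ξ)) := by
  have h : ∀ Y Z : 𝓢(Space n, ℂ), 𝓕⁻ (Y - Z) = 𝓕⁻ Y - 𝓕⁻ Z :=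
    fun Y Z => map_sub (FourierTransform.fourierCLE ℂ 𝓢(Space n, ℂ)).symm _ _
  have h0 : 𝓕⁻ (0 : 𝓢(Space n, ℂ)) = 0 := map_zero (FourierTransform.fourierCLE ℂ 𝓢(Space n, ℂ)).symm
  rw [solFluxC, fourierInv_lineDeriv_apply, inner_stdVec, h, sub_apply, fourierInv_lineDeriv_two]
  congr 2
  split_ifs
  · rw [fourierInv_lapC]; push_cast; ring
  · rw [h0]; simp

/-- A regularization of the symbol `|ξ|⁻²`. -/
def regSymbol (m : ℕ) (ξ : Space n) : ℝ :=
  (m + 1 : ℝ) ^ 2 * (1 + ‖(m + 1 : ℝ) • ξ‖ ^ 2) ^ (-1 : ℝ)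

lemma regSymbol_eq (m : ℕ) (ξ : Space n) :
    regSymbol m ξ = (m + 1 : ℝ) ^ 2 / (1 + (m + 1 : ℝ) ^ 2 * ‖ξ‖ ^ 2) := by
  rw [regSymbol, Real.rpow_neg_one, norm_smul, mul_pow, Real.norm_of_nonneg (by positivity)]
  rfl

lemma regSymbol_nonneg (m : ℕ) (ξ : Space n) : 0 ≤ regSymbol m ξ := by
  rw [regSymbol_eq]; positivity

lemma regSymbol_mul_le (m : ℕ) (ξ : Space n) : regSymbol m ξ * ‖ξ‖ ^ 2 ≤ 1 := by
  rw [regSymbol_eq, div_mul_eq_mul_div, div_le_one (by positivity)]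
  linarith

lemma tendsto_regSymbol {ξ : Space n} (hξ : ξ ≠ 0) :
    Tendsto (fun m => regSymbol m ξ) atTop (𝓝 (‖ξ‖ ^ 2)⁻¹) := by
  have hr : 0 < ‖ξ‖ ^ 2 := by positivity
  have h : ∀ m : ℕ, regSymbol m ξ = (1 / ((m : ℝ) + 1) * (1 / ((m : ℝ) + 1)) + ‖ξ‖ ^ 2)⁻¹ := by
    intro m
    rw [regSymbol_eq]
    have : (0 : ℝ) < m + 1 := by positivity
    field_simp
  simp only [h]
  have := (tendsto_one_div_add_atTop_nhds_zero_nat (𝕜 := ℝ))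
  have h2 := ((this.mul this).add_const (‖ξ‖ ^ 2)).inv₀ (by simpa using hr.ne')
  simpa using h2

/-- The reason for the regularization and for its form as a power of `1 + ‖·‖²`: it multiplies
Schwartz functions, while `|ξ|⁻²` is singular at the origin. -/
lemma hasTemperateGrowth_regSymbol (m : ℕ) : (regSymbol (n := n) m).HasTemperateGrowth := by
  have h := (Function.hasTemperateGrowth_one_add_norm_sq_rpow (Space n) (-1)).comp
    (((m + 1 : ℝ) • ContinuousLinearMap.id ℝ (Space n)).hasTemperateGrowth)
  exact (Function.HasTemperateGrowth.const ((m + 1 : ℝ) ^ 2)).mul h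

/-- The regularized potential of `H`. -/
def regPot (H : 𝓢(Space n, ℂ)) (m : ℕ) : 𝓢(Space n, ℂ) :=
  𝓕 (-((4 * Real.pi ^ 2 : ℝ)⁻¹ : ℝ) • SchwartzMap.smulLeftCLM ℂ (regSymbol m) (𝓕⁻ H))

lemma fourierInv_regPot (H : 𝓢(Space n, ℂ)) (m : ℕ) (ξ : Space n) :
    (𝓕⁻ (regPot H m)) ξ = -(((4 * Real.pi ^ 2 : ℝ)⁻¹ * regSymbol m ξ : ℝ) : ℂ) * (𝓕⁻ H) ξ := by
  rw [regPot, FourierTransform.fourierInv_fourier_eq, smul_apply,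
    SchwartzMap.smulLeftCLM_apply_apply (hasTemperateGrowth_regSymbol m)]
  simp only [Complex.real_smul]
  push_cast
  ring

lemma fourierInv_lapC_regPot (H : 𝓢(Space n, ℂ)) (m : ℕ) (ξ : Space n) :
    (𝓕⁻ (lapC (regPot H m))) ξ = ((regSymbol m ξ * ‖ξ‖ ^ 2 : ℝ) : ℂ) * (𝓕⁻ H) ξ := by
  rw [fourierInv_lapC, fourierInv_regPot]
  have : (Real.pi : ℂ) ≠ 0 := by exact_mod_cast Real.pi_ne_zero
  push_cast
  field_simp

lemma fourierInv_solFluxC_regPot (j : Fin n) (H : 𝓢(Space n, ℂ)) (m : ℕ) (i k : Fin n)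
    (ξ : Space n) :
    (𝓕⁻ (solFluxC j (regPot H m) i k)) ξ = -(2 * Real.pi * Complex.I) * (ξ i *
      (((regSymbol m ξ * ((if k = j then ‖ξ‖ ^ 2 else 0) - ξ k * ξ j) : ℝ) : ℂ) * (𝓕⁻ H) ξ)) := by
  rw [fourierInv_solFluxC, fourierInv_regPot]
  have : (Real.pi : ℂ) ≠ 0 := by exact_mod_cast Real.pi_ne_zero
  push_cast
  field_simp

lemma eq_fourier_fourierInv (S : 𝓢(Space n, ℂ)) (x : Space n) :
    S x = 𝓕 ((𝓕⁻ S : 𝓢(Space n, ℂ)) : Space n → ℂ) x := by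
  have h : 𝓕 (𝓕⁻ S : 𝓢(Space n, ℂ)) = S := FourierTransform.fourier_fourierInv_eq S
  rw [← SchwartzMap.fourier_coe, h]

lemma tendsto_fourier {g : ℕ → Space n → ℂ} {g' : Space n → ℂ} {b : Space n → ℝ}
    (hg : ∀ m, AEStronglyMeasurable (g m) volume) (hb : Integrable b)
    (hgb : ∀ m ξ, ‖g m ξ‖ ≤ b ξ) (hlim : ∀ ξ, Tendsto (fun m => g m ξ) atTop (𝓝 (g' ξ)))
    (x : Space n) : Tendsto (fun m => 𝓕 (g m) x) atTop (𝓝 (𝓕 g' x)) := by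
  simp only [Real.fourier_eq]
  refine tendsto_integral_of_dominated_convergence b (fun m => ?_) hb
    (fun m => ae_of_all _ fun ξ => ?_) (ae_of_all _ fun ξ => ?_)
  · have : Continuous fun ξ : Space n => (Real.fourierChar (-inner ℝ ξ x) : ℂ) := by fun_prop
    exact this.aestronglyMeasurable.smul (hg m)
  · rw [Circle.norm_smul]; exact hgb m ξ
  · exact (hlim ξ).const_smul _

lemma abs_coord_le (ξ : Space n) (i : Fin n) : |ξ i| ≤ ‖ξ‖ := PiLp.norm_apply_le ξ i

/-- The regularized symbol times `‖ξ‖²` is at most `1`, so the bound is uniform in `m`. It serves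
both as the majorant in the limit and as the uniform bound on the fluxes. -/
lemma norm_solFluxC_symbol_le (j i k : Fin n) (m : ℕ) (ξ : Space n) (z : ℂ) :
    ‖-(2 * Real.pi * Complex.I) * (ξ i * (((regSymbol m ξ *
      ((if k = j then ‖ξ‖ ^ 2 else 0) - ξ k * ξ j) : ℝ) : ℂ) * z))‖
      ≤ 4 * Real.pi * (‖ξ‖ ^ 1 * ‖z‖) := by
  have h1 : |(if k = j then ‖ξ‖ ^ 2 else 0) - ξ k * ξ j| ≤ 2 * ‖ξ‖ ^ 2 := by
    have h2 : |ξ k * ξ j| ≤ ‖ξ‖ ^ 2 := by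
      rw [abs_mul, sq]
      exact mul_le_mul (abs_coord_le ξ k) (abs_coord_le ξ j) (abs_nonneg _) (norm_nonneg _)
    have h3 : |(if k = j then ‖ξ‖ ^ 2 else 0)| ≤ ‖ξ‖ ^ 2 := by
      split_ifs
      · rw [abs_of_nonneg (by positivity)]
      · rw [abs_zero]; positivity
    linarith [abs_sub (if k = j then ‖ξ‖ ^ 2 else 0) (ξ k * ξ j)]
  have h2 : |regSymbol m ξ * ((if k = j then ‖ξ‖ ^ 2 else 0) - ξ k * ξ j)| ≤ 2 := by
    rw [abs_mul, abs_of_nonneg (regSymbol_nonneg m ξ)]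
    have := mul_le_mul_of_nonneg_left h1 (regSymbol_nonneg m ξ)
    linarith [regSymbol_mul_le m ξ]
  simp only [norm_mul, norm_neg, Complex.norm_real, Real.norm_eq_abs, Complex.norm_I, mul_one,
    pow_one, abs_of_pos Real.pi_pos, Complex.norm_ofNat]
  have h3 := mul_le_mul (abs_coord_le ξ i) h2 (abs_nonneg _) (norm_nonneg _)
  have h4 := mul_le_mul_of_nonneg_right h3 (norm_nonneg z)
  have h5 := mul_le_mul_of_nonneg_left h4 (show 0 ≤ 2 * Real.pi by positivity)
  rw [abs_mul] at h5 h2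
  simp only [abs_mul] at *
  linarith

/-- In the limit `δₖⱼ - ξₖξⱼ/|ξ|²` appears, the symbol of the Leray projection. The product
`ξᵢξₖξⱼ/|ξ|²` is regrouped as `RᵢRₖ` acting on `∂ⱼ`, which is the `j`-th derivative of the pressure.
-/
lemma tendsto_solFluxC_symbol (j i k : Fin n) (ξ : Space n) (z : ℂ) :
    Tendsto (fun m => -(2 * Real.pi * Complex.I) * (ξ i * (((regSymbol m ξ *
      ((if k = j then ‖ξ‖ ^ 2 else 0) - ξ k * ξ j) : ℝ) : ℂ) * z))) atTop
      (𝓝 ((if k = j then -(2 * Real.pi * Complex.I) * (ξ i * z) else 0)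
        - rieszMul i k ξ * (-(2 * Real.pi * Complex.I) * (ξ j * z)))) := by
  by_cases hξ : ξ = 0
  · simp [hξ]
  have h := (((tendsto_regSymbol hξ).mul_const
    ((if k = j then ‖ξ‖ ^ 2 else 0) - ξ k * ξ j)).ofReal)
  have h2 := ((h.mul_const z).const_mul (ξ i : ℂ)).const_mul (-(2 * Real.pi * Complex.I))
  refine h2.congr' EventuallyEq.rfl |>.trans (le_of_eq ?_)
  congr 1
  have hn : (‖ξ‖ : ℂ) ≠ 0 := by exact_mod_cast norm_ne_zero_iff.2 hξ
  simp only [rieszMul, rieszSymbol]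
  split_ifs <;> push_cast <;> field_simp <;> ring

lemma tendsto_solFluxC_regPot (j : Fin n) (H : 𝓢(Space n, ℂ)) (i k : Fin n) (x : Space n) :
    Tendsto (fun m => solFluxC j (regPot H m) i k x) atTop
      (𝓝 ((if k = j then ∂_{stdVec i} H else 0 : 𝓢(Space n, ℂ)) x
        - riesz i k (∂_{stdVec j} H) x)) := by
  have hb : Integrable fun ξ : Space n => 4 * Real.pi * (‖ξ‖ ^ 1 * ‖(𝓕⁻ H) ξ‖) :=
    ((𝓕⁻ H).integrable_pow_mul volume 1).const_mul _
  have h := tendsto_fourier (fun m => (𝓕⁻ (solFluxC j (regPot H m) i k)).continuous.aestronglyMeasurable)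
    hb (fun m ξ => by
      rw [fourierInv_solFluxC_regPot]; exact norm_solFluxC_symbol_le j i k m ξ _)
    (g' := fun ξ => (𝓕⁻ (if k = j then ∂_{stdVec i} H else 0 : 𝓢(Space n, ℂ))) ξ
        - rieszMul i k ξ * (𝓕⁻ (∂_{stdVec j} H)) ξ) (fun ξ => by
      simp only [fourierInv_solFluxC_regPot]
      convert tendsto_solFluxC_symbol j i k ξ ((𝓕⁻ H) ξ) using 3
      · split_ifs
        · rw [fourierInv_lineDeriv_apply, inner_stdVec]
        · have h0 : 𝓕⁻ (0 : 𝓢(Space n, ℂ)) = 0 :=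
            map_zero (FourierTransform.fourierCLE ℂ 𝓢(Space n, ℂ)).symm
          rw [h0]; rfl
      · rw [fourierInv_lineDeriv_apply, inner_stdVec]) x
  have e := fun m => eq_fourier_fourierInv (solFluxC j (regPot H m) i k) x
  simp only [← e] at h
  refine h.trans (le_of_eq ?_)
  congr 1
  rw [eq_fourier_fourierInv (if k = j then _ else _), riesz]
  have hi := integrable_rieszMul_mul i k (𝓕⁻ (∂_{stdVec j} H)).integrable
  simp only [Real.fourier_eq]
  rw [← integral_sub]
  · simp only [smul_sub]
  · exact (Real.fourierIntegral_convergent_iff x).2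
      (𝓕⁻ (if k = j then ∂_{stdVec i} H else 0 : 𝓢(Space n, ℂ))).integrable
  · exact (Real.fourierIntegral_convergent_iff x).2 hi

lemma norm_solFluxC_regPot_le (j : Fin n) (H : 𝓢(Space n, ℂ)) (m : ℕ) (i k : Fin n) (x : Space n) :
    ‖solFluxC j (regPot H m) i k x‖ ≤ ∫ ξ, 4 * Real.pi * (‖ξ‖ ^ 1 * ‖(𝓕⁻ H) ξ‖) := by
  rw [eq_fourier_fourierInv]
  refine (norm_fourier_le _ x).trans (integral_mono (𝓕⁻ (solFluxC j (regPot H m) i k)).integrable.norm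
    (((𝓕⁻ H).integrable_pow_mul volume 1).const_mul _) fun ξ => ?_)
  beta_reduce
  rw [fourierInv_solFluxC_regPot]
  exact norm_solFluxC_symbol_le j i k m ξ _

lemma integral_norm_sq_eq_fourierInv (S : 𝓢(Space n, ℂ)) :
    ∫ x, ‖S x‖ ^ 2 = ∫ ξ, ‖(𝓕⁻ S) ξ‖ ^ 2 := by
  rw [← SchwartzMap.integral_norm_sq_fourier (𝓕⁻ S), FourierTransform.fourier_fourierInv_eq]

/-- By Plancherel: the error has symbol `regSymbol · ‖ξ‖² - 1`, which is bounded by `1` and tends to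
`0` except at the origin. Positive dimension makes the origin a null set. -/
lemma tendsto_lapC_regPot (hn : 0 < n) (H : 𝓢(Space n, ℂ)) :
    Tendsto (fun m => ∫ x, ‖(lapC (regPot H m) - H) x‖ ^ 2) atTop (𝓝 0) := by
  have hsub : ∀ Y Z : 𝓢(Space n, ℂ), 𝓕⁻ (Y - Z) = 𝓕⁻ Y - 𝓕⁻ Z :=
    fun Y Z => map_sub (FourierTransform.fourierCLE ℂ 𝓢(Space n, ℂ)).symm _ _
  have h1 : ∀ m ξ, (𝓕⁻ (lapC (regPot H m) - H)) ξ
      = ((regSymbol m ξ * ‖ξ‖ ^ 2 - 1 : ℝ) : ℂ) * (𝓕⁻ H) ξ := by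
    intro m ξ
    rw [hsub, sub_apply, fourierInv_lapC_regPot]
    push_cast
    ring
  have h2 := fun m => integral_norm_sq_eq_fourierInv (lapC (regPot H m) - H)
  simp only [h2]
  have : Nonempty (Fin n) := ⟨⟨0, hn⟩⟩
  have : Nontrivial (Space n) := inferInstance
  have hG : Integrable fun ξ => ‖(𝓕⁻ H) ξ‖ ^ 2 :=
    ((𝓕⁻ H).memLp 2 volume).integrable_norm_pow (by norm_num)
  rw [show (0 : ℝ) = ∫ _ : Space n, (0 : ℝ) by simp]
  refine tendsto_integral_of_dominated_convergence (fun ξ => ‖(𝓕⁻ H) ξ‖ ^ 2)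
    (fun m => ((𝓕⁻ (lapC (regPot H m) - H)).continuous.norm.pow 2).aestronglyMeasurable) hG
    (fun m => ae_of_all _ fun ξ => ?_) ?_
  · rw [h1, Real.norm_of_nonneg (by positivity), norm_mul]
    gcongr
    refine mul_le_of_le_one_left (norm_nonneg _) ?_
    rw [Complex.norm_real, Real.norm_eq_abs, abs_le]
    have := regSymbol_mul_le m ξ
    have := mul_nonneg (regSymbol_nonneg m ξ) (sq_nonneg ‖ξ‖)
    constructor <;> linarith
  · have h0 : ∀ᵐ ξ : Space n, ξ ≠ 0 := by
      simp [ae_iff]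
    filter_upwards [h0] with ξ hξ
    have h2 := ((tendsto_regSymbol hξ).mul_const (‖ξ‖ ^ 2)).sub_const 1
    rw [inv_mul_cancel₀ (by positivity), sub_self] at h2
    have h3 := (((h2.ofReal).mul_const ((𝓕⁻ H) ξ)).norm).pow 2
    simp only [h1]
    simpa using h3

/-- The momentum balance against a general test function, with pressure. -/
lemma IsWeakSolution.momentumIdentity {T C : ℝ} (hT : 0 ≤ T)
    {u₀ : Space n → Space n} {u w : Space n × ℝ → Space n} (hu : IsWeakSolution T u₀ u)
    (hw : IsVersion T u w C) (j : Fin n) (H : 𝓢(Space n, ℂ)) :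
    MomentumIdentity T u w j (reS H) fun i k x =>
      (if k = j then (∂_{stdVec i} H) x else 0).re - (riesz i k (∂_{stdVec j} H) x).re := by
  have hn : 0 < n := Fin.pos j
  have key : ∀ m, MomentumIdentity T u w j (lapS (reS (regPot H m)))
      fun i k => solFlux j (reS (regPot H m)) i k :=
    fun m => hu.momentumIdentity_schwartz hT hw j _
  refine MomentumIdentity.of_tendsto hu hw key (fun v hv => ?_)
    (fun m i k => (solFlux j _ i k).continuous)
    (M := ∫ ξ, 4 * Real.pi * (‖ξ‖ ^ 1 * ‖(𝓕⁻ H) ξ‖)) (fun m i k x => ?_) (fun i k x => ?_)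
  · refine tendsto_integral_mul_of_sq (fun m => (lapS _).memLp 2 volume) ((reS H).memLp 2 volume)
      ?_ hv
    refine squeeze_zero (fun m => integral_nonneg fun x => sq_nonneg _) (fun m => ?_)
      (tendsto_lapC_regPot hn H)
    have hint : Integrable fun x => ‖(lapC (regPot H m) - H) x‖ ^ 2 :=
      ((lapC (regPot H m) - H).memLp 2 volume).integrable_norm_pow (by norm_num)
    refine integral_mono_of_nonneg (ae_of_all _ fun x => sq_nonneg _) hint
      (ae_of_all _ fun x => ?_)
    beta_reduce
    rw [lapS_reS, ← sub_apply, ← reS_sub, ← sq_abs]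
    exact pow_le_pow_left₀ (abs_nonneg _)
      (Complex.abs_re_le_norm ((lapC (regPot H m) - H) x)) 2
  · rw [solFlux_reS]
    exact (Complex.abs_re_le_norm _).trans (norm_solFluxC_regPot_le j H m i k x)
  · have h := (Complex.continuous_re.tendsto _).comp (tendsto_solFluxC_regPot j H i k x)
    simp only [solFlux_reS]
    refine h.trans (le_of_eq ?_)
    congr 1
    rw [Complex.sub_re]
    congr 2
    split_ifs <;> rfl

end Regularization
end EulerLocal
end

/-! ### The chain rule in time, and correlations with a kernel. -/

noncomputable section
namespace EulerLocal
open scoped SchwartzMap LineDeriv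
open LineDeriv

/-- The chain rule for the square of an absolutely continuous function, integrated. -/
lemma sq_mul_sub_sq_mul {G : ℝ → ℝ} (hG : LocallyIntegrable G) (Y0 : ℝ) {θ : ℝ → ℝ}
    (hθ : ContDiff ℝ 1 θ) (a b : ℝ) :
    (Y0 + ∫ r in (0 : ℝ)..b, G r) ^ 2 * θ b - (Y0 + ∫ r in (0 : ℝ)..a, G r) ^ 2 * θ a
      = ∫ s in a..b, ((Y0 + ∫ r in (0 : ℝ)..s, G r) ^ 2 * deriv θ s
          + 2 * (Y0 + ∫ r in (0 : ℝ)..s, G r) * G s * θ s) := by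
  set Y : ℝ → ℝ := fun t => Y0 + ∫ r in (0 : ℝ)..t, G r with hY
  have hGi : ∀ c d, IntervalIntegrable G volume c d := fun c d =>
    (hG.integrableOn_isCompact isCompact_uIcc).intervalIntegrable
  have hYac : AbsolutelyContinuousOnInterval Y a b := by
    have h1 := (hGi a b).absolutelyContinuousOnInterval_intervalIntegral (c := a) (by simp)
    have h2 : AbsolutelyContinuousOnInterval (fun _ : ℝ => Y a) a b :=
      (contDiff_const.contDiffOn (n := 1)).absolutelyContinuousOnInterval
    have h3 := h2.add h1
    have heq : Y = (fun _ : ℝ => Y a) + fun x => ∫ v in a..x, G v := by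
      funext t
      simp only [hY, Pi.add_apply]
      rw [add_assoc, intervalIntegral.integral_add_adjacent_intervals (hGi _ _) (hGi _ _)]
    rw [heq]
    exact h3
  have hθac : AbsolutelyContinuousOnInterval θ a b := hθ.contDiffOn.absolutelyContinuousOnInterval
  have h := ((hYac.mul hYac).mul hθac).integral_deriv_eq_sub
  -- Lebesgue differentiation; an almost everywhere derivative suffices because `Y` is absolutely
  -- continuous.
  have hYd : ∀ᵐ s, HasDerivAt Y (G s) s := by
    filter_upwards [_root_.LocallyIntegrable.ae_hasDerivAt_integral hG] with s hs
    exact (hs 0).const_add Y0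
  have e : ∫ s in a..b, deriv (Y * Y * θ) s = ∫ s in a..b, (Y s ^ 2 * deriv θ s
      + 2 * Y s * G s * θ s) := by
    refine intervalIntegral.integral_congr_ae ?_
    filter_upwards [hYd] with s hs _
    have hd := ((hs.mul hs).mul (hθ.differentiable one_ne_zero s).hasDerivAt).deriv
    refine hd.trans ?_
    simp only [Pi.mul_apply]
    ring
  rw [← e, h]
  simp only [Pi.mul_apply]
  ring

section Correlation

variable {n : ℕ}

/-- The correlation `x ↦ ∫ f(y) K(y - x) dy`. -/
def corr (K f : Space n → ℝ) (x : Space n) : ℝ := ∫ y, f y * K (y - x)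

lemma integrable_prod_corr {K f b : Space n → ℝ} (hf : Integrable f) (hK : Continuous K) {M : ℝ}
    (hM : ∀ z, |K z| ≤ M) (hb : Integrable b) :
    Integrable (fun z : Space n × Space n => b z.1 * (f z.2 * K (z.2 - z.1)))
      (volume.prod volume) := by
  have h := (hb.mul_prod hf).mul_bdd (c := M) (g := fun z : Space n × Space n => K (z.2 - z.1))
    (hK.comp (continuous_snd.sub continuous_fst)).aestronglyMeasurable
    (ae_of_all _ fun z => hM _)
  exact h.congr (ae_of_all _ fun z => by simp only [mul_assoc])

lemma integral_mul_corr_swap {K f b : Space n → ℝ} (hf : Integrable f) (hK : Continuous K) {M : ℝ}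
    (hM : ∀ z, |K z| ≤ M) (hb : Integrable b) :
    ∫ x, b x * corr K f x = ∫ y, f y * ∫ x, b x * K (y - x) := by
  simp only [corr, ← integral_const_mul]
  rw [integral_integral_swap (integrable_prod_corr hf hK hM hb)]
  refine integral_congr_ae (ae_of_all _ fun y => integral_congr_ae (ae_of_all _ fun x => ?_))
  simp only
  ring

/-- Fubini frees the kernel from the merely integrable `f`. The sign of the integration by parts
then cancels that of differentiating `K (y - x)` in `x`. -/
lemma integral_mul_corr_fderiv {K K' f c : Space n → ℝ} {e : Space n} (hf : Integrable f)
    (hKd : Differentiable ℝ K) {M : ℝ} (hM : ∀ z, |K z| ≤ M) (hK' : Continuous K') {M' : ℝ}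
    (hM' : ∀ z, |K' z| ≤ M') (hKK' : ∀ z, fderiv ℝ K z e = K' z) (hc : ContDiff ℝ 1 c)
    (hcc : HasCompactSupport c) :
    ∫ x, c x * corr K' f x = ∫ x, fderiv ℝ c x e * corr K f x := by
  have hci : Integrable c := hc.continuous.integrable_of_hasCompactSupport hcc
  have hdc : Continuous fun x => fderiv ℝ c x e :=
    (hc.continuous_fderiv one_ne_zero).clm_apply continuous_const
  have hdi : Integrable fun x => fderiv ℝ c x e :=
    hdc.integrable_of_hasCompactSupport (hcc.fderiv_apply ℝ e)
  rw [integral_mul_corr_swap hf hK' hM' hci, integral_mul_corr_swap hf hKd.continuous hM hdi]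
  refine integral_congr_ae (ae_of_all _ fun y => ?_)
  simp only
  congr 1
  have hG : ∀ x, HasFDerivAt (fun x => K (y - x)) (-(fderiv ℝ K (y - x))) x := by
    intro x
    have h1 : HasFDerivAt (fun x : Space n => y - x) (-(ContinuousLinearMap.id ℝ (Space n))) x :=
      (hasFDerivAt_id x).const_sub y
    have := (hKd (y - x)).hasFDerivAt.comp x h1
    simpa using! this
  have hGe : ∀ x, fderiv ℝ (fun x => K (y - x)) x e = -K' (y - x) := fun x => by
    rw [(hG x).fderiv, neg_apply, hKK']
  have hsub : Continuous fun x : Space n => y - x := by fun_prop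
  have h := integral_mul_fderiv_eq_neg_fderiv_mul_of_integrable (μ := volume) (f := c)
    (g := fun x => K (y - x)) (v := e)
    (hdi.mul_bdd (c := M) (hKd.continuous.comp hsub).aestronglyMeasurable
      (ae_of_all _ fun x => hM _))
    (by
      simp only [hGe]
      exact hci.mul_bdd (c := M') (hK'.comp hsub).neg.aestronglyMeasurable
        (ae_of_all _ fun x => by simpa using hM' _))
    (hci.mul_bdd (c := M) (hKd.continuous.comp hsub).aestronglyMeasurable
      (ae_of_all _ fun x => hM _))
    (fun x _ => hc.differentiable one_ne_zero x) (fun x _ => (hG x).differentiableAt)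
  simp only [hGe, mul_neg, integral_neg, neg_inj] at h
  exact h

end Correlation

end EulerLocal
end

/-! ### The mollified momentum equation. -/

noncomputable section
namespace EulerLocal
open scoped SchwartzMap LineDeriv
open LineDeriv

section Mollification

variable {n : ℕ}

/-- The mollification `x ↦ ∫ f(y) h(x - y) dy`. -/
def mol (h f : Space n → ℝ) (x : Space n) : ℝ := ∫ y, f y * h (x - y)

lemma mol_eq_convolution (h f : Space n → ℝ) :
    mol h f = convolution f h (ContinuousLinearMap.mul ℝ ℝ) volume := rfl

lemma mol_eq_corr {h : Space n → ℝ} (he : ∀ z, h (-z) = h z) (f : Space n → ℝ) :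
    mol h f = corr h f := by
  funext x
  refine integral_congr_ae (ae_of_all _ fun y => ?_)
  simp only
  rw [← neg_sub, he]

lemma contDiff_mol {h f : Space n → ℝ} (hh : ContDiff ℝ ∞ h) (hc : HasCompactSupport h)
    (hf : LocallyIntegrable f) : ContDiff ℝ ∞ (mol h f) := by
  rw [mol_eq_convolution]
  exact hc.contDiff_convolution_right (n := ⊤) _ hf hh

lemma fderiv_mol_apply {h f : Space n → ℝ} (hh : ContDiff ℝ ∞ h) (hc : HasCompactSupport h)
    (hf : LocallyIntegrable f) (x e : Space n) :
    fderiv ℝ (mol h f) x e = mol (fun z => fderiv ℝ h z e) f x := by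
  have h1 := hc.hasFDerivAt_convolution_right (ContinuousLinearMap.mul ℝ ℝ) hf
    (hh.of_le (by exact_mod_cast le_top)) x
  rw [mol_eq_convolution, h1.fderiv, convolution_precompR_apply (ContinuousLinearMap.mul ℝ ℝ) hf
    (hc.fderiv ℝ) (hh.continuous_fderiv (by simp))]
  rfl

lemma abs_mol_le {h f : Space n → ℝ} (hh : MemLp h 2 volume) (hf : MemLp f 2 volume)
    (x : Space n) : |mol h f x| ≤ Real.sqrt (∫ y, f y ^ 2) * Real.sqrt (∫ y, h y ^ 2) := by
  have hm : MeasurePreserving (fun y : Space n => x - y) := Measure.measurePreserving_sub_left volume x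
  have h1 := abs_integral_mul_le_sqrt hf (hh.comp_measurePreserving hm)
  have h2 : ∫ y, h (x - y) ^ 2 = ∫ y, h y ^ 2 := integral_sub_left_eq_self (fun y => h y ^ 2) volume x
  simp only [Function.comp_apply, h2] at h1
  exact h1

lemma MemLp.locallyIntegrable_two {f : Space n → ℝ} (hf : MemLp f 2 volume) :
    LocallyIntegrable f := hf.locallyIntegrable (by norm_num)

/-- The `j`-th component of the mollified field. -/
def velMol (h : Space n → ℝ) (w : Space n × ℝ → Space n) (j : Fin n) (z : Space n × ℝ) : ℝ :=
  mol h (fun y => w (y, z.2) j) z.1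

/-- The mollified products of components. -/
def strMol (h : Space n → ℝ) (w : Space n × ℝ → Space n) (i k : Fin n) (z : Space n × ℝ) : ℝ :=
  mol h (fun y => prodCoord w i k (y, z.2)) z.1

/-- The mollified pressure. -/
def presMol (H : 𝓢(Space n, ℂ)) (w : Space n × ℝ → Space n) (z : Space n × ℝ) : ℝ :=
  -∑ i, ∑ k, corr (fun x => (riesz i k H x).re) (fun y => prodCoord w i k (y, z.2)) z.1

/-- The kernels of the right-hand side of the mollified momentum equation. -/
def fluxKer (H : 𝓢(Space n, ℂ)) (j i k : Fin n) (z : Space n) : ℝ :=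
  (if k = j then (∂_{stdVec i} H) z else 0).re - (riesz i k (∂_{stdVec j} H) z).re

/-- The right-hand side of the mollified momentum equation. -/
def accMol (H : 𝓢(Space n, ℂ)) (w : Space n × ℝ → Space n) (j : Fin n) (z : Space n × ℝ) : ℝ :=
  ∑ i, ∑ k, corr (fluxKer H j i k) (fun y => prodCoord w i k (y, z.2)) z.1

lemma continuous_fluxKer (H : 𝓢(Space n, ℂ)) (j i k : Fin n) : Continuous (fluxKer H j i k) := by
  refine Continuous.sub (Complex.continuous_re.comp ?_)
    (Complex.continuous_re.comp (continuous_riesz i k _))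
  split_ifs
  · exact (∂_{stdVec i} H).continuous
  · exact continuous_const

lemma exists_bound_schwartz {F : Type*} [NormedAddCommGroup F] [NormedSpace ℝ F]
    (X : 𝓢(Space n, F)) : ∃ M, 0 ≤ M ∧ ∀ x, ‖X x‖ ≤ M :=
  ⟨SchwartzMap.seminorm ℝ 0 0 X, apply_nonneg _ _, fun x => by
    simpa using SchwartzMap.le_seminorm ℝ 0 0 X x⟩

lemma exists_bound_re_riesz (X : 𝓢(Space n, ℂ)) (i k : Fin n) :
    ∃ M, 0 ≤ M ∧ ∀ x, |(riesz i k X x).re| ≤ M :=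
  ⟨_, integral_nonneg fun _ => norm_nonneg _, fun x =>
    (Complex.abs_re_le_norm _).trans (norm_riesz_le i k X x)⟩

lemma exists_bound_fluxKer (H : 𝓢(Space n, ℂ)) (j : Fin n) :
    ∃ M, 0 ≤ M ∧ ∀ i k z, |fluxKer H j i k z| ≤ M := by
  have h1 : ∀ i k, ∃ M, 0 ≤ M ∧ ∀ z, |fluxKer H j i k z| ≤ M := by
    intro i k
    obtain ⟨M1, h1, hM1⟩ := exists_bound_schwartz (∂_{stdVec i} H : 𝓢(Space n, ℂ))
    obtain ⟨M2, h2, hM2⟩ := exists_bound_re_riesz (∂_{stdVec j} H : 𝓢(Space n, ℂ)) i k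
    refine ⟨M1 + M2, by positivity, fun z => (abs_sub _ _).trans (add_le_add ?_ (hM2 z))⟩
    split_ifs
    · exact (Complex.abs_re_le_norm _).trans (hM1 z)
    · simpa using h1
  choose M hM0 hM using h1
  refine ⟨∑ i, ∑ k, M i k, Finset.sum_nonneg fun i _ => Finset.sum_nonneg fun k _ => hM0 i k,
    fun i k z => (hM i k z).trans ?_⟩
  refine (Finset.single_le_sum (fun k _ => hM0 i k) (Finset.mem_univ k)).trans ?_
  exact Finset.single_le_sum (f := fun i => ∑ k, M i k)
    (fun i _ => Finset.sum_nonneg fun k _ => hM0 i k) (Finset.mem_univ i)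

lemma stronglyMeasurable_corr {K : Space n → ℝ} (hK : Continuous K)
    {f : Space n × ℝ → ℝ} (hf : StronglyMeasurable f) :
    StronglyMeasurable fun z : Space n × ℝ => corr K (fun y => f (y, z.2)) z.1 := by
  refine StronglyMeasurable.integral_prod_right (f := fun (z : Space n × ℝ) (y : Space n) =>
    f (y, z.2) * K (y - z.1)) ?_
  refine StronglyMeasurable.mul (hf.comp_measurable (by fun_prop)) ?_
  exact (hK.comp (by fun_prop : Continuous fun p : (Space n × ℝ) × Space n => p.2 - p.1.1)).stronglyMeasurable

lemma stronglyMeasurable_mol {K : Space n → ℝ} (hK : Continuous K)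
    {f : Space n × ℝ → ℝ} (hf : StronglyMeasurable f) :
    StronglyMeasurable fun z : Space n × ℝ => mol K (fun y => f (y, z.2)) z.1 := by
  refine StronglyMeasurable.integral_prod_right (f := fun (z : Space n × ℝ) (y : Space n) =>
    f (y, z.2) * K (z.1 - y)) ?_
  refine StronglyMeasurable.mul (hf.comp_measurable (by fun_prop)) ?_
  exact (hK.comp (by fun_prop : Continuous fun p : (Space n × ℝ) × Space n => p.1.1 - p.2)).stronglyMeasurable

lemma stronglyMeasurable_velMol {h : Space n → ℝ} (hh : Continuous h)
    {w : Space n × ℝ → Space n} (hw : StronglyMeasurable w) (j : Fin n) :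
    StronglyMeasurable (velMol h w j) :=
  stronglyMeasurable_mol hh (stronglyMeasurable_coord hw j)

lemma stronglyMeasurable_accMol (H : 𝓢(Space n, ℂ))
    {w : Space n × ℝ → Space n} (hw : StronglyMeasurable w) (j : Fin n) :
    StronglyMeasurable (accMol H w j) :=
  Finset.stronglyMeasurable_fun_sum _ fun i _ => Finset.stronglyMeasurable_fun_sum _ fun k _ =>
    stronglyMeasurable_corr (continuous_fluxKer H j i k) (stronglyMeasurable_prodCoord hw i k)

lemma abs_corr_le {K f : Space n → ℝ} (hf : Integrable f) {M : ℝ} (hM : ∀ z, |K z| ≤ M)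
    (x : Space n) : |corr K f x| ≤ M * ∫ y, |f y| := by
  rw [corr, ← integral_const_mul]
  refine abs_integral_le_integral_abs.trans (integral_mono_of_nonneg
    (ae_of_all _ fun y => abs_nonneg _) (hf.abs.const_mul M) (ae_of_all _ fun y => ?_))
  simp only [abs_mul]
  rw [mul_comm]
  exact mul_le_mul_of_nonneg_right (hM _) (abs_nonneg _)

lemma IsVersion.exists_bound_accMol {T C : ℝ} {u w : Space n × ℝ → Space n}
    (hw : IsVersion T u w C) (H : 𝓢(Space n, ℂ)) (j : Fin n) :
    ∃ M, 0 ≤ M ∧ ∀ z, |accMol H w j z| ≤ M := by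
  obtain ⟨M, hM0, hM⟩ := exists_bound_fluxKer H j
  have hC : 0 ≤ C := (integral_nonneg fun _ => by positivity).trans (hw.energy 0)
  refine ⟨∑ _i : Fin n, ∑ _k : Fin n, M * C, by positivity, fun z => ?_⟩
  refine (Finset.abs_sum_le_sum_abs _ _).trans (Finset.sum_le_sum fun i _ => ?_)
  refine (Finset.abs_sum_le_sum_abs _ _).trans (Finset.sum_le_sum fun k _ => ?_)
  refine (abs_corr_le (integrable_prodCoord hw i k z.2) (hM i k) z.1).trans ?_
  exact mul_le_mul_of_nonneg_left (integral_abs_prodCoord_le hw i k z.2) hM0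

lemma IsVersion.integral_coord_sq_le {T C : ℝ} {u w : Space n × ℝ → Space n}
    (hw : IsVersion T u w C) (j : Fin n) (t : ℝ) : ∫ y, w (y, t) j ^ 2 ≤ C := by
  refine le_trans (integral_mono_of_nonneg (ae_of_all _ fun y => sq_nonneg _)
    ((hw.memLp t).integrable_norm_pow (by norm_num)) (ae_of_all _ fun y => ?_)) (hw.energy t)
  simp only
  rw [← sq_abs]
  exact pow_le_pow_left₀ (abs_nonneg _) (abs_coord_le _ j) 2

lemma IsVersion.exists_bound_velMol {T C : ℝ} {u w : Space n × ℝ → Space n}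
    (hw : IsVersion T u w C) {h : Space n → ℝ} (hh : MemLp h 2 volume) (j : Fin n) :
    ∃ M, 0 ≤ M ∧ ∀ z, |velMol h w j z| ≤ M :=
  ⟨Real.sqrt C * Real.sqrt (∫ y, h y ^ 2), by positivity, fun z =>
    (abs_mol_le hh (memLp_coord (hw.memLp z.2) j) z.1).trans
      (mul_le_mul_of_nonneg_right (Real.sqrt_le_sqrt (hw.integral_coord_sq_le j z.2))
        (Real.sqrt_nonneg _))⟩

lemma lineDeriv_compSubConst (X : 𝓢(Space n, ℂ)) (a e : Space n) :
    ∂_{e} (X.compSubConstCLM ℂ a) = (∂_{e} X).compSubConstCLM ℂ a := by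
  ext x
  rw [SchwartzMap.lineDerivOp_apply_eq_fderiv, SchwartzMap.compSubConstCLM_apply,
    SchwartzMap.lineDerivOp_apply_eq_fderiv]
  have : (X.compSubConstCLM ℂ a : Space n → ℂ) = fun y => X (y - a) :=
    funext fun y => SchwartzMap.compSubConstCLM_apply ..
  rw [this, fderiv_comp_sub]

/-- The mollified momentum equation. -/
lemma IsWeakSolution.velMol_eq {T C : ℝ} (hT : 0 ≤ T)
    {u₀ : Space n → Space n} {u w : Space n × ℝ → Space n} (hu : IsWeakSolution T u₀ u)
    (hw : IsVersion T u w C) {h : Space n → ℝ} (hh : ContDiff ℝ ∞ h) (hc : HasCompactSupport h)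
    (he : ∀ z, h (-z) = h z) (j : Fin n) (x : Space n) {t : ℝ} (ht : t ∈ Icc (0 : ℝ) T) :
    velMol h u j (x, t) = velMol h u j (x, 0)
      + ∫ s in (0 : ℝ)..t, accMol (toSchwartz h hc hh) w j (x, s) := by
  -- The balance is tested with the mollifier translated to `x`; derivatives and Riesz transforms
  -- commute with the translation, and evenness identifies correlation with mollification.
  have hm := hu.momentumIdentity hT hw j ((toSchwartz h hc hh).compSubConstCLM ℂ x) t ht
  have h1 : ∀ t, ∫ y, u (y, t) j * reS ((toSchwartz h hc hh).compSubConstCLM ℂ x) y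
      = velMol h u j (x, t) := by
    intro t
    rw [velMol, mol_eq_corr he]
    refine integral_congr_ae (ae_of_all _ fun y => ?_)
    simp
  rw [h1, h1] at hm
  rw [← sub_eq_iff_eq_add', hm]
  refine intervalIntegral.integral_congr fun s _ => ?_
  refine Finset.sum_congr rfl fun i _ => Finset.sum_congr rfl fun k _ => ?_
  refine integral_congr_ae (ae_of_all _ fun y => ?_)
  simp only [prodCoord, fluxKer, lineDeriv_compSubConst, riesz_compSubConst,
    SchwartzMap.compSubConstCLM_apply]

end Mollification
end EulerLocal
end

/-! ### Energy balance of the mollified field. -/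

noncomputable section
namespace EulerLocal
open scoped SchwartzMap LineDeriv
open LineDeriv

section MollifiedEnergy

variable {n : ℕ}

lemma contDiff_velMol {h : Space n → ℝ} (hh : ContDiff ℝ ∞ h) (hc : HasCompactSupport h)
    {w : Space n × ℝ → Space n} {s : ℝ} (hw : MemLp (fun x => w (x, s)) 2 volume) (j : Fin n) :
    ContDiff ℝ ∞ fun x => velMol h w j (x, s) :=
  contDiff_mol hh hc (MemLp.locallyIntegrable_two (memLp_coord hw j))

/-- Integration by parts in the mollified momentum equation. -/
lemma IsVersion.integral_mul_accMol {T C : ℝ} {u w : Space n × ℝ → Space n}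
    (hw : IsVersion T u w C) {h : Space n → ℝ} (hh : ContDiff ℝ ∞ h) (hc : HasCompactSupport h)
    (he : ∀ z, h (-z) = h z) (j : Fin n) (s : ℝ) {c : Space n → ℝ} (hcd : ContDiff ℝ 1 c)
    (hcc : HasCompactSupport c) :
    ∫ x, c x * accMol (toSchwartz h hc hh) w j (x, s)
      = ∑ i, (∫ x, fderiv ℝ c x (stdVec i) * strMol h w i j (x, s))
        + ∫ x, fderiv ℝ c x (stdVec j) * presMol (toSchwartz h hc hh) w (x, s) := by
  set H := toSchwartz h hc hh with hH
  have hf := fun i k => integrable_prodCoord hw i k s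
  have hci : Integrable c := hcd.continuous.integrable_of_hasCompactSupport hcc
  have hdi : ∀ e, Integrable fun x => fderiv ℝ c x e := fun e =>
    ((hcd.continuous_fderiv one_ne_zero).clm_apply
      continuous_const).integrable_of_hasCompactSupport (hcc.fderiv_apply ℝ e)
  have hmul : ∀ {b K f : Space n → ℝ} {M : ℝ}, Integrable b → Integrable f → Continuous K →
      (∀ z, |K z| ≤ M) → Integrable fun x => b x * corr K f x := by
    intro b K f M hb hf hK hM
    have := (integrable_prod_corr hf hK hM hb).integral_prod_left
    simpa only [corr, integral_const_mul] using this
  have hKr : ∀ i k, Differentiable ℝ fun x => (riesz i k H x).re := fun i k =>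
    Complex.reCLM.differentiable.comp (differentiable_riesz i k H)
  have hKr' : ∀ i k (e : Space n) z, fderiv ℝ (fun x => (riesz i k H x).re) z e
      = (riesz i k (∂_{e} H) z).re := by
    intro i k e z
    have := (Complex.reCLM.hasFDerivAt (x := riesz i k H z)).comp z
      (differentiable_riesz i k H z).hasFDerivAt
    have h2 : (fun x => (riesz i k H x).re) = Complex.reCLM ∘ riesz i k H := rfl
    rw [h2, this.fderiv]
    simp [fderiv_riesz]
  have hKh' : ∀ (e : Space n) z, fderiv ℝ h z e = ((∂_{e} H) z).re := by
    intro e z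
    rw [SchwartzMap.lineDerivOp_apply_eq_fderiv]
    have := (Complex.ofRealCLM.hasFDerivAt (x := h z)).comp z
      (hh.differentiable (by simp) z).hasFDerivAt
    have h2 : (H : Space n → ℂ) = Complex.ofRealCLM ∘ h := rfl
    rw [h2, this.fderiv]
    simp
  obtain ⟨Mh, -, hMh⟩ := exists_bound_schwartz H
  have hMh' : ∀ z, |h z| ≤ Mh := fun z => by simpa [hH] using hMh z
  have key1 : ∀ i, ∫ x, c x * corr (fun z => ((∂_{stdVec i} H) z).re)
      (fun y => prodCoord w i j (y, s)) x
      = ∫ x, fderiv ℝ c x (stdVec i) * strMol h w i j (x, s) := by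
    intro i
    obtain ⟨M, -, hM⟩ := exists_bound_schwartz (∂_{stdVec i} H : 𝓢(Space n, ℂ))
    refine (integral_mul_corr_fderiv (e := stdVec i) (hf i j) (hh.differentiable (by simp)) hMh'
      (Complex.continuous_re.comp (∂_{stdVec i} H : 𝓢(Space n, ℂ)).continuous)
      (fun z => (Complex.abs_re_le_norm _).trans (hM z)) (hKh' _) hcd hcc).trans ?_
    simp only [strMol, mol_eq_corr he]
  have key2 : ∀ i k, ∫ x, c x * corr (fun z => (riesz i k (∂_{stdVec j} H) z).re)
      (fun y => prodCoord w i k (y, s)) x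
      = ∫ x, fderiv ℝ c x (stdVec j) * corr (fun z => (riesz i k H z).re)
        (fun y => prodCoord w i k (y, s)) x := by
    intro i k
    obtain ⟨M, -, hM⟩ := exists_bound_re_riesz (∂_{stdVec j} H : 𝓢(Space n, ℂ)) i k
    obtain ⟨M2, -, hM2⟩ := exists_bound_re_riesz H i k
    exact integral_mul_corr_fderiv (hf i k) (hKr i k) hM2
      (Complex.continuous_re.comp (continuous_riesz i k _)) hM (hKr' i k _) hcd hcc
  -- The part `δₖⱼ ∂ᵢH` of the kernel yields the mollified stress, and the part `-RᵢRₖ∂ⱼH`, summed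
  -- over `i` and `k`, the mollified pressure.
  have hsplit : ∀ i k, ∫ x, c x * corr (fluxKer H j i k) (fun y => prodCoord w i k (y, s)) x
      = (if k = j then ∫ x, fderiv ℝ c x (stdVec i) * strMol h w i j (x, s) else 0)
        - ∫ x, fderiv ℝ c x (stdVec j) * corr (fun z => (riesz i k H z).re)
        (fun y => prodCoord w i k (y, s)) x := by
    intro i k
    obtain ⟨M, -, hM⟩ := exists_bound_re_riesz (∂_{stdVec j} H : 𝓢(Space n, ℂ)) i k
    obtain ⟨M1, -, hM1⟩ := exists_bound_schwartz (∂_{stdVec i} H : 𝓢(Space n, ℂ))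
    have hKc : Continuous fun z => (riesz i k (∂_{stdVec j} H) z).re :=
      Complex.continuous_re.comp (continuous_riesz i k _)
    have hDc : Continuous fun z => ((∂_{stdVec i} H) z).re :=
      Complex.continuous_re.comp (∂_{stdVec i} H : 𝓢(Space n, ℂ)).continuous
    have hDM : ∀ z, |((∂_{stdVec i} H) z).re| ≤ M1 := fun z =>
      (Complex.abs_re_le_norm _).trans (hM1 z)
    rw [← key2]
    split_ifs with hkj
    · subst hkj
      rw [← key1, ← integral_sub (hmul hci (hf i k) hDc hDM) (hmul hci (hf i k) hKc hM)]
      refine integral_congr_ae (ae_of_all _ fun x => ?_)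
      simp only
      rw [← mul_sub]
      congr 1
      simp only [corr, fluxKer, if_true]
      rw [← integral_sub]
      · simp only [mul_sub]
      · exact (hf i k).mul_bdd (c := M1) (hDc.comp (by fun_prop)).aestronglyMeasurable
          (ae_of_all _ fun y => hDM _)
      · exact (hf i k).mul_bdd (c := M) (hKc.comp (by fun_prop)).aestronglyMeasurable
          (ae_of_all _ fun y => hM _)
    · rw [zero_sub, ← integral_neg]
      refine integral_congr_ae (ae_of_all _ fun x => ?_)
      simp only [corr, fluxKer, if_neg hkj, Complex.zero_re, zero_sub, mul_neg, integral_neg]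
  obtain ⟨M, -, hM⟩ := exists_bound_fluxKer H j
  have hint : ∀ i k, Integrable fun x =>
      c x * corr (fluxKer H j i k) (fun y => prodCoord w i k (y, s)) x := fun i k =>
    hmul hci (hf i k) (continuous_fluxKer H j i k) (hM i k)
  simp only [accMol, Finset.mul_sum]
  rw [integral_finsetSum _ fun i _ => integrable_finsetSum _ fun k _ => hint i k]
  simp only [presMol, mul_neg, integral_neg, Finset.mul_sum]
  have hint2 : ∀ i k, Integrable fun x => fderiv ℝ c x (stdVec j) *
      corr (fun z => (riesz i k H z).re) (fun y => prodCoord w i k (y, s)) x := fun i k => by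
    obtain ⟨M2, -, hM2⟩ := exists_bound_re_riesz H i k
    exact hmul (hdi _) (hf i k) (Complex.continuous_re.comp (continuous_riesz i k _)) hM2
  rw [integral_finsetSum _ fun i _ => integrable_finsetSum _ fun k _ => hint2 i k,
    ← sub_eq_add_neg, ← Finset.sum_sub_distrib]
  refine Finset.sum_congr rfl fun i _ => ?_
  rw [integral_finsetSum _ fun k _ => hint i k, integral_finsetSum _ fun k _ => hint2 i k]
  simp only [hsplit, Finset.sum_sub_distrib, Finset.sum_ite_eq', Finset.mem_univ, if_true]

/-- The mollified field is divergence free. -/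
lemma sum_fderiv_velMol_eq_zero {T : ℝ}
    {u₀ : Space n → Space n} {u w : Space n × ℝ → Space n} (hu : IsWeakSolution T u₀ u)
    {h : Space n → ℝ} (hh : ContDiff ℝ ∞ h) (hc : HasCompactSupport h)
    {s : ℝ} (hs : s ∈ Icc (0 : ℝ) T) (hwu : (fun x => w (x, s)) =ᵐ[volume] fun x => u (x, s))
    (x : Space n) : ∑ j, fderiv ℝ (fun y => velMol h w j (y, s)) x (stdVec j) = 0 := by
  have hw2 : MemLp (fun x => w (x, s)) 2 volume := (hu.memLp s hs).ae_eq hwu.symm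
  have hχ : ContDiff ℝ ∞ fun y => h (x - y) := hh.comp (contDiff_const.sub contDiff_id)
  have hχc : HasCompactSupport fun y => h (x - y) :=
    hc.comp_homeomorph (Homeomorph.subLeft x)
  have h0 := hu.div_free s hs _ hχ hχc
  have hg : ∀ y e, fderiv ℝ (fun y => h (x - y)) y e = -fderiv ℝ h (x - y) e := by
    intro y e
    have h1 : HasFDerivAt (fun y : Space n => x - y) (-(ContinuousLinearMap.id ℝ (Space n))) y :=
      (hasFDerivAt_id y).const_sub x
    have h2 := ((hh.differentiable (by simp) (x - y)).hasFDerivAt).comp y h1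
    have h3 : (fun y => h (x - y)) = h ∘ fun y => x - y := rfl
    rw [h3, h2.fderiv]
    simp
  have hin : ∀ y, inner ℝ (u (y, s)) (gradient (fun y => h (x - y)) y)
      = -∑ j, u (y, s) j * fderiv ℝ h (x - y) (stdVec j) := by
    intro y
    rw [real_inner_comm, inner_gradient_left, hg]
    conv_lhs => rw [eq_sum_stdVec (u (y, s))]
    simp
  simp only [hin, integral_neg, neg_eq_zero] at h0
  have hdc : ∀ j, MemLp (fun y => fderiv ℝ h (x - y) (stdVec j)) 2 volume := by
    intro j
    refine Continuous.memLp_of_hasCompactSupport ?_ ?_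
    · exact ((hh.continuous_fderiv (by simp)).comp (by fun_prop)).clm_apply continuous_const
    · exact (hc.fderiv_apply ℝ (stdVec j)).comp_homeomorph (Homeomorph.subLeft x)
  have hi : ∀ j, Integrable fun y => u (y, s) j * fderiv ℝ h (x - y) (stdVec j) := fun j =>
    (memLp_coord (hu.memLp s hs) j).integrable_mul (hdc j)
  rw [integral_finsetSum _ fun j _ => hi j] at h0
  rw [← h0]
  refine Finset.sum_congr rfl fun j _ => ?_
  have := fderiv_mol_apply hh hc (MemLp.locallyIntegrable_two (memLp_coord hw2 j)) x (stdVec j)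
  refine this.trans (integral_congr_ae ?_)
  filter_upwards [hwu] with y hy
  rw [hy]

lemma dt_eq_fderiv {F : Type} [NormedAddCommGroup F] [NormedSpace ℝ F] {φ : Space n × ℝ → F}
    (hφ : Differentiable ℝ φ) (z : Space n × ℝ) : dt φ z = fderiv ℝ φ z (0, 1) := by
  have h1 : HasDerivAt (fun s : ℝ => (z.1, s)) ((0 : Space n), (1 : ℝ)) z.2 :=
    (hasDerivAt_const _ _).prodMk (hasDerivAt_id _)
  exact ((hφ (z.1, z.2)).hasFDerivAt.comp_hasDerivAt z.2 h1).deriv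

lemma fderiv_slice {φ : Space n × ℝ → ℝ} (hφ : Differentiable ℝ φ) (z : Space n × ℝ)
    (e : Space n) : fderiv ℝ (fun y => φ (y, z.2)) z.1 e = fderiv ℝ φ z (e, 0) := by
  have h1 : HasFDerivAt (fun y : Space n => (y, z.2))
      ((ContinuousLinearMap.id ℝ (Space n)).prod 0) z.1 :=
    (hasFDerivAt_id _).prodMk (hasFDerivAt_const _ _)
  have h2 := ((hφ (z.1, z.2)).hasFDerivAt.comp z.1 h1).fderiv
  have h3 : (fun y => φ (y, z.2)) = φ ∘ fun y => (y, z.2) := rfl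
  rw [h3, h2]
  simp

lemma continuous_dt {φ : Space n × ℝ → ℝ} (hφ : ContDiff ℝ ∞ φ) : Continuous (dt φ) := by
  have : dt φ = fun z => fderiv ℝ φ z (0, 1) :=
    funext fun z => dt_eq_fderiv (hφ.differentiable (by simp)) z
  rw [this]
  exact (hφ.continuous_fderiv (by simp)).clm_apply continuous_const

lemma hasCompactSupport_dt {φ : Space n × ℝ → ℝ} (hφ : ContDiff ℝ ∞ φ)
    (hφc : HasCompactSupport φ) : HasCompactSupport (dt φ) := by
  have : dt φ = fun z => fderiv ℝ φ z (0, 1) :=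
    funext fun z => dt_eq_fderiv (hφ.differentiable (by simp)) z
  rw [this]
  exact hφc.fderiv_apply ℝ _

lemma integrable_swap_restrict {Ψ : Space n × ℝ → ℝ} (h : Integrable Ψ) (I : Set ℝ) :
    Integrable (Function.uncurry fun s x => Ψ (x, s)) ((volume.restrict I).prod volume) := by
  have h1 : Integrable (fun z : ℝ × Space n => Ψ (z.2, z.1)) (volume.prod volume) := h.swap
  have e : (volume.restrict I).prod (volume : Measure (Space n))
      = (volume.prod volume).restrict (I ×ˢ univ) := by
    rw [← Measure.prod_restrict, Measure.restrict_univ]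
  rw [e]
  exact h1.restrict

lemma IsVersion.integrable_velMol_energy {T C : ℝ} {u w : Space n × ℝ → Space n}
    (hw : IsVersion T u w C) {h : Space n → ℝ} (hh : Continuous h) (hc : HasCompactSupport h)
    (H : 𝓢(Space n, ℂ)) (j : Fin n) {φ : Space n × ℝ → ℝ} (hφ : ContDiff ℝ ∞ φ)
    (hφc : HasCompactSupport φ) :
    Integrable fun z : Space n × ℝ => velMol h w j z ^ 2 * dt φ z
        + 2 * velMol h w j z * accMol H w j z * φ z := by
  have hL2 : MemLp h 2 volume := hh.memLp_of_hasCompactSupport hc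
  obtain ⟨M, hM0, hM⟩ := hw.exists_bound_velMol hL2 j
  obtain ⟨M', hM'0, hM'⟩ := hw.exists_bound_accMol H j
  have hvm := stronglyMeasurable_velMol hh hw.stronglyMeasurable j
  have ham := stronglyMeasurable_accMol H hw.stronglyMeasurable j
  have hφi : Integrable φ := hφ.continuous.integrable_of_hasCompactSupport hφc
  have hdi : Integrable (dt φ) :=
    (continuous_dt hφ).integrable_of_hasCompactSupport (hasCompactSupport_dt hφ hφc)
  refine Integrable.add (hdi.bdd_mul (c := M ^ 2) (hvm.pow 2).aestronglyMeasurable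
    (ae_of_all _ fun z => ?_)) (hφi.bdd_mul (c := 2 * M * M')
    ((hvm.const_mul 2).mul ham).aestronglyMeasurable (ae_of_all _ fun z => ?_))
  · rw [norm_pow]
    exact pow_le_pow_left₀ (norm_nonneg _) (hM z) 2
  · rw [norm_mul, norm_mul, Real.norm_ofNat]
    exact mul_le_mul (mul_le_mul_of_nonneg_left (hM z) (by norm_num)) (hM' z) (norm_nonneg _)
      (by positivity)

/-- The energy balance of a component of the mollified field, before integration by parts. -/
lemma IsWeakSolution.velMol_sq_sub {T C : ℝ} (hT : 0 ≤ T)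
    {u₀ : Space n → Space n} {u w : Space n × ℝ → Space n} (hu : IsWeakSolution T u₀ u)
    (hw : IsVersion T u w C) {h : Space n → ℝ} (hh : ContDiff ℝ ∞ h) (hc : HasCompactSupport h)
    (he : ∀ z, h (-z) = h z) (j : Fin n) {φ : Space n × ℝ → ℝ} (hφ : ContDiff ℝ ∞ φ)
    (hφc : HasCompactSupport φ) {t' t'' : ℝ} (ht' : t' ∈ Icc (0 : ℝ) T) (ht'' : t'' ∈ Icc (0 : ℝ) T) :
    (∫ x, velMol h u j (x, t'') ^ 2 * φ (x, t'')) - (∫ x, velMol h u j (x, t') ^ 2 * φ (x, t'))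
      = ∫ s in t'..t'', ∫ x, (velMol h w j (x, s) ^ 2 * dt φ (x, s)
        + 2 * velMol h w j (x, s) * accMol (toSchwartz h hc hh) w j (x, s) * φ (x, s)) := by
  set H := toSchwartz h hc hh with hH
  obtain ⟨M', hM'0, hM'⟩ := hw.exists_bound_accMol H j
  have ham := stronglyMeasurable_accMol H hw.stronglyMeasurable j
  have hΨ := hw.integrable_velMol_energy hh.continuous hc H j hφ hφc
  -- With space outside, the mollified velocity at a fixed point is a primitive in time, and the
  -- chain rule applies at each `x` separately.
  rw [intervalIntegral_integral_swap (f := fun s x => velMol h w j (x, s) ^ 2 * dt φ (x, s)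
        + 2 * velMol h w j (x, s) * accMol H w j (x, s) * φ (x, s))
      (integrable_swap_restrict hΨ _)]
  have hi : ∀ t ∈ Icc (0 : ℝ) T, Integrable fun x => velMol h u j (x, t) ^ 2 * φ (x, t) := by
    intro t ht
    refine Continuous.integrable_of_hasCompactSupport ?_ (hasCompactSupport_slice hφc t).mul_left
    exact ((contDiff_velMol hh hc (hu.memLp t ht) j).continuous.pow 2).mul
      (contDiff_slice hφ t).continuous
  rw [← integral_sub (hi t'' ht'') (hi t' ht')]
  refine integral_congr_ae (ae_of_all _ fun x => ?_)
  simp only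
  have hG : LocallyIntegrable fun s => accMol H w j (x, s) := by
    refine (locallyIntegrable_const M').mono
      (ham.comp_measurable measurable_prodMk_left).aestronglyMeasurable (ae_of_all _ fun s => ?_)
    rw [Real.norm_of_nonneg hM'0]
    exact hM' (x, s)
  have hθ : ContDiff ℝ 1 fun s => φ (x, s) :=
    (hφ.of_le (by exact_mod_cast le_top)).comp (contDiff_const.prodMk contDiff_id)
  have key := sq_mul_sub_sq_mul hG (velMol h u j (x, 0)) hθ t' t''
  rw [hu.velMol_eq hT hw hh hc he j x ht'', hu.velMol_eq hT hw hh hc he j x ht', key]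
  refine intervalIntegral.integral_congr_ae ?_
  filter_upwards [(ae_restrict_iff' measurableSet_Icc).1 hw.ae_eq] with s hs hst
  have hsT : s ∈ Icc (0 : ℝ) T := (uIoc_subset_uIcc.trans (uIcc_subset_Icc ht' ht'')) hst
  have e : velMol h w j (x, s) = velMol h u j (x, s) := by
    refine integral_congr_ae ?_
    filter_upwards [hs hsT] with y hy
    rw [hy]
  rw [e, hu.velMol_eq hT hw hh hc he j x hsT]
  rfl

end MollifiedEnergy
end EulerLocal
end

noncomputable section
namespace EulerLocal
open scoped SchwartzMap LineDeriv
open LineDeriv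

section MollifiedEnergy

variable {n : ℕ}

/-- The `i`-th spatial partial derivative of a space-time function. -/
def dx (i : Fin n) (φ : Space n × ℝ → ℝ) (z : Space n × ℝ) : ℝ :=
  fderiv ℝ (fun y => φ (y, z.2)) z.1 (stdVec i)

lemma dx_eq_fderiv (i : Fin n) {φ : Space n × ℝ → ℝ} (hφ : ContDiff ℝ ∞ φ) :
    dx i φ = fun z => fderiv ℝ φ z (stdVec i, 0) :=
  funext fun z => fderiv_slice (hφ.differentiable (by simp)) z (stdVec i)

lemma continuous_dx (i : Fin n) {φ : Space n × ℝ → ℝ} (hφ : ContDiff ℝ ∞ φ) :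
    Continuous (dx i φ) := by
  rw [dx_eq_fderiv i hφ]
  exact (hφ.continuous_fderiv (by simp)).clm_apply continuous_const

lemma hasCompactSupport_dx (i : Fin n) {φ : Space n × ℝ → ℝ} (hφ : ContDiff ℝ ∞ φ)
    (hφc : HasCompactSupport φ) : HasCompactSupport (dx i φ) := by
  rw [dx_eq_fderiv i hφ]
  exact hφc.fderiv_apply ℝ _

lemma IsVersion.exists_bound_presMol {T C : ℝ} {u w : Space n × ℝ → Space n}
    (hw : IsVersion T u w C) (H : 𝓢(Space n, ℂ)) : ∃ M, 0 ≤ M ∧ ∀ z, |presMol H w z| ≤ M := by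
  have hC : 0 ≤ C := (integral_nonneg fun _ => by positivity).trans (hw.energy 0)
  choose M hM0 hM using fun i k => exists_bound_re_riesz H i k
  refine ⟨∑ i, ∑ k, M i k * C, Finset.sum_nonneg fun i _ => Finset.sum_nonneg fun k _ =>
    mul_nonneg (hM0 i k) hC, fun z => ?_⟩
  rw [presMol, abs_neg]
  refine (Finset.abs_sum_le_sum_abs _ _).trans (Finset.sum_le_sum fun i _ => ?_)
  refine (Finset.abs_sum_le_sum_abs _ _).trans (Finset.sum_le_sum fun k _ => ?_)
  refine (abs_corr_le (integrable_prodCoord hw i k z.2) (hM i k) z.1).trans ?_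
  exact mul_le_mul_of_nonneg_left (integral_abs_prodCoord_le hw i k z.2) (hM0 i k)

lemma stronglyMeasurable_presMol (H : 𝓢(Space n, ℂ)) {w : Space n × ℝ → Space n}
    (hw : StronglyMeasurable w) : StronglyMeasurable (presMol H w) :=
  (Finset.stronglyMeasurable_fun_sum _ fun i _ => Finset.stronglyMeasurable_fun_sum _ fun k _ =>
    stronglyMeasurable_corr (Complex.continuous_re.comp (continuous_riesz i k H))
      (stronglyMeasurable_prodCoord hw i k)).neg

lemma stronglyMeasurable_strMol {h : Space n → ℝ} (hh : Continuous h)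
    {w : Space n × ℝ → Space n} (hw : StronglyMeasurable w) (i k : Fin n) :
    StronglyMeasurable (strMol h w i k) :=
  stronglyMeasurable_mol hh (stronglyMeasurable_prodCoord hw i k)

/-- The local energy balance of the mollified field. -/
theorem IsWeakSolution.mollified_energy {T C : ℝ} (hT : 0 ≤ T)
    {u₀ : Space n → Space n} {u w : Space n × ℝ → Space n} (hu : IsWeakSolution T u₀ u)
    (hw : IsVersion T u w C) {h : Space n → ℝ} (hh : ContDiff ℝ ∞ h) (hc : HasCompactSupport h)
    (he : ∀ z, h (-z) = h z) {φ : Space n × ℝ → ℝ} (hφ : ContDiff ℝ ∞ φ)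
    (hφc : HasCompactSupport φ) {t' t'' : ℝ} (ht' : t' ∈ Icc (0 : ℝ) T) (ht'' : t'' ∈ Icc (0 : ℝ) T) :
    (∑ j, ∫ x, velMol h u j (x, t'') ^ 2 * φ (x, t''))
        - ∑ j, ∫ x, velMol h u j (x, t') ^ 2 * φ (x, t')
      = ∫ s in t'..t'', ((∑ j, ∫ x, velMol h w j (x, s) ^ 2 * dt φ (x, s))
        + 2 * (∑ j, ∑ i, ∫ x, (dx i φ (x, s) * velMol h w j (x, s)
            + φ (x, s) * dx i (velMol h w j) (x, s)) * strMol h w i j (x, s))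
        + 2 * ∑ j, ∫ x, dx j φ (x, s) * velMol h w j (x, s)
            * presMol (toSchwartz h hc hh) w (x, s)) := by
  set H := toSchwartz h hc hh with hH
  have hL2 : MemLp h 2 volume := hh.continuous.memLp_of_hasCompactSupport hc
  rw [← Finset.sum_sub_distrib, Finset.sum_congr rfl fun j _ =>
    hu.velMol_sq_sub hT hw hh hc he j hφ hφc ht' ht'']
  rw [← intervalIntegral.integral_finsetSum]
  · refine intervalIntegral.integral_congr_ae ?_
    filter_upwards [(ae_restrict_iff' measurableSet_Icc).1 hw.ae_eq] with s hs hst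
    have hsT : s ∈ Icc (0 : ℝ) T := (uIoc_subset_uIcc.trans (uIcc_subset_Icc ht' ht'')) hst
    have hV : ∀ j, ContDiff ℝ ∞ fun x => velMol h w j (x, s) := fun j =>
      contDiff_velMol hh hc (hw.memLp s) j
    have hφs := contDiff_slice hφ s
    have hφsc := hasCompactSupport_slice hφc s
    have hcd : ∀ j, ContDiff ℝ 1 fun x => φ (x, s) * velMol h w j (x, s) := fun j =>
      (hφs.mul (hV j)).of_le (by exact_mod_cast le_top)
    have hcc : ∀ j, HasCompactSupport fun x => φ (x, s) * velMol h w j (x, s) := fun j =>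
      hφsc.mul_right
    have hder : ∀ j i x, fderiv ℝ (fun x => φ (x, s) * velMol h w j (x, s)) x (stdVec i)
        = dx i φ (x, s) * velMol h w j (x, s) + φ (x, s) * dx i (velMol h w j) (x, s) := by
      intro j i x
      rw [fderiv_fun_mul (hφs.differentiable (by simp) x) ((hV j).differentiable (by simp) x)]
      simp only [dx, add_apply, smul_apply, smul_eq_mul]
      ring
    have hsq : ∀ j, Integrable fun x => velMol h w j (x, s) ^ 2 * dt φ (x, s) := fun j =>
      Continuous.integrable_of_hasCompactSupport (((hV j).continuous.pow 2).mul
        ((continuous_dt hφ).comp (by fun_prop)))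
        (hasCompactSupport_slice (hasCompactSupport_dt hφ hφc) s).mul_left
    have hacc : ∀ j, Integrable fun x => φ (x, s) * velMol h w j (x, s) * accMol H w j (x, s) := by
      intro j
      obtain ⟨M, -, hM⟩ := hw.exists_bound_accMol H j
      exact ((hcd j).continuous.integrable_of_hasCompactSupport (hcc j)).mul_bdd (c := M)
        ((stronglyMeasurable_accMol H hw.stronglyMeasurable j).comp_measurable
          measurable_prodMk_right).aestronglyMeasurable (ae_of_all _ fun x => hM _)
    have hpres : ∀ {b : Space n → ℝ}, Integrable b → Integrable fun x => b x * presMol H w (x, s) := by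
      intro b hb
      obtain ⟨M, -, hM⟩ := hw.exists_bound_presMol H
      exact hb.mul_bdd (c := M) ((stronglyMeasurable_presMol H hw.stronglyMeasurable).comp_measurable
        measurable_prodMk_right).aestronglyMeasurable (ae_of_all _ fun x => hM _)
    have e1 : ∀ j, ∫ x, (velMol h w j (x, s) ^ 2 * dt φ (x, s)
        + 2 * velMol h w j (x, s) * accMol H w j (x, s) * φ (x, s))
        = (∫ x, velMol h w j (x, s) ^ 2 * dt φ (x, s))
          + 2 * ((∑ i, ∫ x, (dx i φ (x, s) * velMol h w j (x, s)
            + φ (x, s) * dx i (velMol h w j) (x, s)) * strMol h w i j (x, s))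
          + ∫ x, (dx j φ (x, s) * velMol h w j (x, s)
            + φ (x, s) * dx j (velMol h w j) (x, s)) * presMol H w (x, s)) := by
      intro j
      have h1 := hw.integral_mul_accMol hh hc he j s (hcd j) (hcc j)
      simp only [hder] at h1
      rw [← h1, ← integral_const_mul, ← integral_add (hsq j) ((hacc j).const_mul 2)]
      refine integral_congr_ae (ae_of_all _ fun x => ?_)
      ring
    simp only [← hH, e1, Finset.sum_add_distrib, ← Finset.mul_sum]
    rw [mul_add, ← add_assoc]
    congr 2
    have hb1 : ∀ j, Integrable fun x => dx j φ (x, s) * velMol h w j (x, s) := fun j =>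
      Continuous.integrable_of_hasCompactSupport (((continuous_dx j hφ).comp (by fun_prop)).mul
        (hV j).continuous) (hasCompactSupport_slice (hasCompactSupport_dx j hφ hφc) s).mul_right
    have hb2 : ∀ j, Integrable fun x => φ (x, s) * dx j (velMol h w j) (x, s) := fun j =>
      Continuous.integrable_of_hasCompactSupport (hφs.continuous.mul
        (((hV j).continuous_fderiv (by simp)).clm_apply continuous_const)) hφsc.mul_right
    -- The derivative falling on the velocity gives its divergence, so only `∇φ` meets the pressure.
    have e2 : ∑ j, ∫ x, φ (x, s) * dx j (velMol h w j) (x, s) * presMol H w (x, s) = 0 := by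
      rw [← integral_finsetSum _ fun j _ => hpres (hb2 j)]
      refine integral_eq_zero_of_ae (ae_of_all _ fun x => ?_)
      simp only [← Finset.sum_mul, ← Finset.mul_sum, dx]
      rw [sum_fderiv_velMol_eq_zero hu hh hc hsT (hs hsT) x]
      simp
    rw [← add_zero (∑ j, ∫ x, dx j φ (x, s) * velMol h w j (x, s) * presMol H w (x, s)), ← e2,
      ← Finset.sum_add_distrib]
    refine Finset.sum_congr rfl fun j _ => ?_
    rw [← integral_add (hpres (hb1 j)) (hpres (hb2 j))]
    refine integral_congr_ae (ae_of_all _ fun x => ?_)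
    simp only
    ring
  · intro j _
    rw [intervalIntegrable_iff]
    exact (integrable_swap_restrict (hw.integrable_velMol_energy hh.continuous hc H j hφ hφc)
      _).integral_prod_left

end MollifiedEnergy
end EulerLocal
end

/-! ### Cubic increments and the Young-type bound. -/

noncomputable section
namespace EulerLocal

section Increments

variable {n : ℕ}

/-- The mean cubic increment of `w` at the scale `ε`. -/
def incr (w : Space n × ℝ → Space n) (ε : ℝ) (z : Space n × ℝ) : ENNReal :=
  ∫⁻ ζ in Metric.closedBall (0 : Space n) 2, ‖w (z.1 - ε • ζ, z.2) - w z‖ₑ ^ 3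

/-- The size of the increments of `w` at the scale `ε`. -/
def amp (w : Space n × ℝ → Space n) (ε : ℝ) (z : Space n × ℝ) : ℝ :=
  (incr w ε z).toReal ^ (1 / 3 : ℝ)

lemma amp_nonneg (w : Space n × ℝ → Space n) (ε : ℝ) (z : Space n × ℝ) : 0 ≤ amp w ε z :=
  Real.rpow_nonneg ENNReal.toReal_nonneg _

lemma amp_pow_three (w : Space n × ℝ → Space n) (ε : ℝ) (z : Space n × ℝ) :
    amp w ε z ^ 3 = (incr w ε z).toReal := by
  rw [amp, ← Real.rpow_natCast, ← Real.rpow_mul ENNReal.toReal_nonneg]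
  norm_num

lemma measurable_incr {w : Space n × ℝ → Space n} (hw : StronglyMeasurable w) (ε : ℝ) :
    Measurable (incr w ε) := by
  refine Measurable.lintegral_prod_right' (f := fun p : (Space n × ℝ) × Space n =>
    ‖w (p.1.1 - ε • p.2, p.1.2) - w p.1‖ₑ ^ 3) ?_
  have h1 : StronglyMeasurable fun p : (Space n × ℝ) × Space n => w (p.1.1 - ε • p.2, p.1.2) :=
    hw.comp_measurable (by fun_prop)
  have h2 : StronglyMeasurable fun p : (Space n × ℝ) × Space n => w p.1 :=
    hw.comp_measurable measurable_fst
  exact (h1.sub h2).enorm.pow_const 3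

lemma measurable_amp {w : Space n × ℝ → Space n} (hw : StronglyMeasurable w) (ε : ℝ) :
    Measurable (amp w ε) :=
  (measurable_incr hw ε).ennreal_toReal.pow_const _

/-- Tonelli: for each `ζ` in the ball the shift `εζ` is at most `2ε` long, so the regularity bound
for single shifts can be integrated over `ζ`. -/
lemma CubicRegularOn.exists_lintegral_incr_le {w : Space n × ℝ → Space n} {K : Set (Space n × ℝ)}
    (hw : StronglyMeasurable w) (hK : CubicRegularOn w K) {η : ℝ} (hη : 0 < η) :
    ∃ r > 0, ∀ ε, 0 < ε → ε < r → ∫⁻ z in K, incr w ε z ≤ ENNReal.ofReal (η * ε) := by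
  have hfin : volume (Metric.closedBall (0 : Space n) 2) < ⊤ := measure_closedBall_lt_top
  set v := (volume (Metric.closedBall (0 : Space n) 2)).toReal with hv
  have hv0 : 0 ≤ v := ENNReal.toReal_nonneg
  -- Compensates the volume `v` of the ball and the length `2ε` of the longest shift; the summand
  -- `1` keeps the denominator positive whatever `v` is.
  obtain ⟨r, hr, h⟩ := hK.2 (η / (2 * v + 1)) (by positivity)
  refine ⟨r / 2, by positivity, fun ε hε hεr => ?_⟩
  have hswap : ∫⁻ z in K, incr w ε z
      = ∫⁻ ζ in Metric.closedBall (0 : Space n) 2, ∫⁻ z in K,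
        ‖w (z.1 - ε • ζ, z.2) - w z‖ₑ ^ 3 := by
    refine lintegral_lintegral_swap ?_
    have h1 : StronglyMeasurable fun p : (Space n × ℝ) × Space n =>
        w (p.1.1 - ε • p.2, p.1.2) := hw.comp_measurable (by fun_prop)
    have h2 : StronglyMeasurable fun p : (Space n × ℝ) × Space n => w p.1 :=
      hw.comp_measurable measurable_fst
    exact ((h1.sub h2).enorm.pow_const 3).aemeasurable
  rw [hswap]
  calc _ ≤ ∫⁻ _ζ in Metric.closedBall (0 : Space n) 2, ENNReal.ofReal (η / (2 * v + 1) * (2 * ε)) := by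
        refine setLIntegral_mono' Metric.isClosed_closedBall.measurableSet fun ζ hζ => ?_
        rw [mem_closedBall_zero_iff] at hζ
        have hn : ‖-(ε • ζ)‖ ≤ 2 * ε := by
          rw [norm_neg, norm_smul, Real.norm_of_nonneg hε.le, mul_comm]
          gcongr
        have := h (-(ε • ζ)) (by linarith)
        simp only [← sub_eq_add_neg] at this
        refine this.trans (ENNReal.ofReal_le_ofReal ?_)
        gcongr
    _ = ENNReal.ofReal (η / (2 * v + 1) * (2 * ε) * v) := by
        rw [setLIntegral_const, ENNReal.ofReal_mul (p := η / (2 * v + 1) * (2 * ε)) (by positivity), hv, ENNReal.ofReal_toReal hfin.ne]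
    _ ≤ _ := by
        refine ENNReal.ofReal_le_ofReal ?_
        rw [div_mul_eq_mul_div, div_mul_eq_mul_div, div_le_iff₀ (by positivity)]
        nlinarith [mul_pos hη hε]

/-- Moments of increments from the cubic moment. -/
lemma setIntegral_norm_le_of_cubic {B : Set (Space n)} (hB : volume B < ⊤)
    {δ : Space n → Space n}
    (hδ : StronglyMeasurable δ) (hfin : ∫⁻ ζ in B, ‖δ ζ‖ₑ ^ 3 < ⊤) {a : ℝ} (ha : 0 ≤ a)
    (haN : a ^ 3 = (∫⁻ ζ in B, ‖δ ζ‖ₑ ^ 3).toReal) :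
    (IntegrableOn (fun ζ => ‖δ ζ‖) B ∧ ∫ ζ in B, ‖δ ζ‖ ≤ (volume.real B + 1) * a) ∧
      (IntegrableOn (fun ζ => ‖δ ζ‖ ^ 2) B ∧ ∫ ζ in B, ‖δ ζ‖ ^ 2 ≤ (volume.real B + 1) * a ^ 2) := by
  have hm3 : StronglyMeasurable fun ζ => ‖δ ζ‖ ^ 3 := hδ.norm.pow 3
  have hI3 : IntegrableOn (fun ζ => ‖δ ζ‖ ^ 3) B := by
    refine ⟨hm3.aestronglyMeasurable, ?_⟩
    rw [hasFiniteIntegral_iff_enorm]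
    simpa [enorm_pow] using hfin
  have h3 : ∫ ζ in B, ‖δ ζ‖ ^ 3 = a ^ 3 := by
    rw [haN, integral_eq_lintegral_of_nonneg_ae (ae_of_all _ fun ζ => by positivity)
      hm3.aestronglyMeasurable]
    congr 1
    refine lintegral_congr fun ζ => ?_
    rw [ENNReal.ofReal_pow (norm_nonneg _), ofReal_norm]
  have hc : ∀ c : ℝ, IntegrableOn (fun _ : Space n => c) B := fun c =>
    integrableOn_const hB.ne
  have hb1 : ∀ ζ, ‖δ ζ‖ ≤ 1 + ‖δ ζ‖ ^ 3 := fun ζ => by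
    nlinarith [norm_nonneg (δ ζ), sq_nonneg (‖δ ζ‖ - 1), mul_nonneg (norm_nonneg (δ ζ)) (sq_nonneg (‖δ ζ‖ - 1))]
  have hb2 : ∀ ζ, ‖δ ζ‖ ^ 2 ≤ 1 + ‖δ ζ‖ ^ 3 := fun ζ => by
    nlinarith [norm_nonneg (δ ζ), sq_nonneg (‖δ ζ‖ - 1), mul_nonneg (norm_nonneg (δ ζ)) (sq_nonneg (‖δ ζ‖ - 1))]
  have hI1 : IntegrableOn (fun ζ => ‖δ ζ‖) B :=
    ((hc 1).add hI3).mono' hδ.norm.aestronglyMeasurable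
      (ae_of_all _ fun ζ => by rw [norm_norm]; exact hb1 ζ)
  have hI2 : IntegrableOn (fun ζ => ‖δ ζ‖ ^ 2) B :=
    ((hc 1).add hI3).mono' (hδ.norm.pow 2).aestronglyMeasurable
      (ae_of_all _ fun ζ => by rw [norm_pow, norm_norm]; exact hb2 ζ)
  refine ⟨⟨hI1, ?_⟩, hI2, ?_⟩
  all_goals rcases ha.eq_or_lt with h0 | hpos
  · have hz : (fun ζ => ‖δ ζ‖ ^ 3) =ᵐ[volume.restrict B] 0 := by
      rw [← integral_eq_zero_iff_of_nonneg (fun ζ => by positivity) hI3, h3, ← h0]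
      norm_num
    rw [← h0, mul_zero, integral_eq_zero_of_ae]
    filter_upwards [hz] with ζ hζ
    simpa using hζ
  -- An elementary substitute for Hölder's inequality: `t ≤ a + t³/a²` for every `t ≥ 0`, and the
  -- integral of the cube is exactly `a³`.
  · have : ∀ ζ, ‖δ ζ‖ ≤ a + (a ^ 2)⁻¹ * ‖δ ζ‖ ^ 3 := fun ζ => by
      rcases le_total ‖δ ζ‖ a with h | h
      · have : 0 ≤ (a ^ 2)⁻¹ * ‖δ ζ‖ ^ 3 := by positivity
        linarith
      · have : ‖δ ζ‖ ≤ (a ^ 2)⁻¹ * ‖δ ζ‖ ^ 3 := by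
          rw [le_inv_mul_iff₀ (by positivity), pow_succ ‖δ ζ‖ 2]
          gcongr
        linarith
    have hs : Integrable (fun ζ => a + (a ^ 2)⁻¹ * ‖δ ζ‖ ^ 3) (volume.restrict B) :=
      (hc a).add (hI3.const_mul _)
    calc _ ≤ ∫ ζ in B, (a + (a ^ 2)⁻¹ * ‖δ ζ‖ ^ 3) := integral_mono hI1 hs this
      _ = _ := by
          rw [integral_add (hc a) (hI3.const_mul _), integral_const_mul, h3, setIntegral_const,
            smul_eq_mul]
          field_simp
  · have hz : (fun ζ => ‖δ ζ‖ ^ 3) =ᵐ[volume.restrict B] 0 := by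
      rw [← integral_eq_zero_iff_of_nonneg (fun ζ => by positivity) hI3, h3, ← h0]
      norm_num
    rw [← h0, zero_pow two_ne_zero, mul_zero, integral_eq_zero_of_ae]
    filter_upwards [hz] with ζ hζ
    simpa using hζ
  · have : ∀ ζ, ‖δ ζ‖ ^ 2 ≤ a ^ 2 + a⁻¹ * ‖δ ζ‖ ^ 3 := fun ζ => by
      rcases le_total ‖δ ζ‖ a with h | h
      · have h1 : 0 ≤ a⁻¹ * ‖δ ζ‖ ^ 3 := by positivity
        have h2 : ‖δ ζ‖ ^ 2 ≤ a ^ 2 := by gcongr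
        linarith
      · have : ‖δ ζ‖ ^ 2 ≤ a⁻¹ * ‖δ ζ‖ ^ 3 := by
          rw [le_inv_mul_iff₀ (by positivity), pow_succ' ‖δ ζ‖ 2]
          gcongr
        have : 0 ≤ a ^ 2 := by positivity
        linarith
    have hs : Integrable (fun ζ => a ^ 2 + a⁻¹ * ‖δ ζ‖ ^ 3) (volume.restrict B) :=
      (hc _).add (hI3.const_mul _)
    calc _ ≤ ∫ ζ in B, (a ^ 2 + a⁻¹ * ‖δ ζ‖ ^ 3) := integral_mono hI2 hs this
      _ = _ := by
          rw [integral_add (hc _) (hI3.const_mul _), integral_const_mul, h3, setIntegral_const,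
            smul_eq_mul]
          field_simp

/-- Young's inequality for the terms of a perturbed cubic expression. -/
lemma cubic_young {F a η : ℝ} (hF : 0 ≤ F) (ha : 0 ≤ a) (hη : 0 < η) (hη1 : η ≤ 1) :
    F ^ 2 * a + F * a ^ 2 + a ^ 3 ≤ 3 * η * F ^ 3 + 3 * (η ^ 2)⁻¹ * a ^ 3 := by
  -- If `a ≤ ηF`, every term is at most `ηF³`; otherwise `F ≤ a/η`, and every term is at most
  -- `a³/η²`.
  rcases le_total a (η * F) with h | h
  · have h1 : a ≤ F := h.trans (mul_le_of_le_one_left hF hη1)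
    have e1 : F ^ 2 * a ≤ η * F ^ 3 := by nlinarith [mul_le_mul_of_nonneg_left h (sq_nonneg F)]
    have e2 : F * a ^ 2 ≤ F ^ 2 * a := by nlinarith [mul_nonneg (mul_nonneg hF ha) (sub_nonneg.2 h1)]
    have e3 : a ^ 3 ≤ F ^ 2 * a := by
      have : a ^ 2 ≤ F ^ 2 := by gcongr
      nlinarith
    have : 0 ≤ 3 * (η ^ 2)⁻¹ * a ^ 3 := by positivity
    linarith
  · have h1 : F ≤ η⁻¹ * a := by rwa [le_inv_mul_iff₀ hη]
    have h2 : (1 : ℝ) ≤ η⁻¹ := (one_le_inv₀ hη).2 hη1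
    have e1 : F ^ 2 * a ≤ (η ^ 2)⁻¹ * a ^ 3 := by
      have : F ^ 2 ≤ (η⁻¹ * a) ^ 2 := by gcongr
      rw [← inv_pow]
      nlinarith
    have e2 : F * a ^ 2 ≤ (η ^ 2)⁻¹ * a ^ 3 := by
      have : η⁻¹ * a ≤ η⁻¹ ^ 2 * a := by
        rw [sq, mul_assoc]
        exact le_mul_of_one_le_left (by positivity) h2
      rw [← inv_pow]
      nlinarith [mul_le_mul_of_nonneg_right (h1.trans this) (sq_nonneg a)]
    have e3 : a ^ 3 ≤ (η ^ 2)⁻¹ * a ^ 3 := by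
      refine le_mul_of_one_le_left (by positivity) ?_
      rw [← inv_pow]
      exact one_le_pow₀ h2
    have : 0 ≤ 3 * η * F ^ 3 := by positivity
    linarith

/-- Convergence in `L¹` from a perturbed cubic bound. -/
lemma tendsto_setIntegral_of_cubic {K : Set (Space n × ℝ)} {F : Space n × ℝ → ℝ}
    (hF0 : ∀ z, 0 ≤ F z) (hF : IntegrableOn (fun z => F z ^ 3) K)
    {a : ℕ → Space n × ℝ → ℝ} (ha0 : ∀ m z, 0 ≤ a m z)
    (ha : ∀ᶠ m in atTop, IntegrableOn (fun z => a m z ^ 3) K)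
    (hlim : Tendsto (fun m => ∫ z in K, a m z ^ 3) atTop (𝓝 0))
    {g : ℕ → Space n × ℝ → ℝ} {c : ℝ} (hc : 0 ≤ c) (hg0 : ∀ m z, 0 ≤ g m z)
    (hg : ∀ᶠ m in atTop, ∀ᵐ z ∂volume.restrict K,
      g m z ≤ c * (F z ^ 2 * a m z + F z * a m z ^ 2 + a m z ^ 3)) :
    Tendsto (fun m => ∫ z in K, g m z) atTop (𝓝 0) := by
  set I := ∫ z in K, F z ^ 3 with hI
  have hI0 : 0 ≤ I := integral_nonneg fun z => pow_nonneg (hF0 z) 3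
  have hle : ∀ η, 0 < η → η ≤ 1 → ∀ᶠ m in atTop,
      ∫ z in K, g m z ≤ c * (3 * η * I + 3 * (η ^ 2)⁻¹ * ∫ z in K, a m z ^ 3) := by
    intro η hη hη1
    filter_upwards [hg, ha] with m hm ham
    calc ∫ z in K, g m z ≤ ∫ z in K, c * (3 * η * F z ^ 3 + 3 * (η ^ 2)⁻¹ * a m z ^ 3) := by
          refine integral_mono_of_nonneg (ae_of_all _ (hg0 m))
            (((hF.const_mul _).add (ham.const_mul _)).const_mul c) ?_
          filter_upwards [hm] with z hz
          exact hz.trans (mul_le_mul_of_nonneg_left (cubic_young (hF0 z) (ha0 m z) hη hη1) hc)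
      _ = _ := by
          rw [integral_const_mul, integral_add (hF.const_mul _) (ham.const_mul _),
            integral_const_mul, integral_const_mul]
  rw [Metric.tendsto_nhds]
  intro κ hκ
  -- Makes the part with `F³` at most `κ/2`; the part with the cube of the perturbation is then
  -- small for large `m`.
  set η := min 1 (κ / (2 * (c * (3 * I) + 1))) with hηdef
  have hη : 0 < η := lt_min one_pos (by positivity)
  have h1 : c * (3 * η * I) ≤ κ / 2 := by
    have : η ≤ κ / (2 * (c * (3 * I) + 1)) := min_le_right _ _
    have h2 : η * (2 * (c * (3 * I) + 1)) ≤ κ := by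
      rwa [le_div_iff₀ (by positivity)] at this
    nlinarith [hη]
  have h3 := (hlim.const_mul (c * (3 * (η ^ 2)⁻¹)))
  rw [mul_zero] at h3
  filter_upwards [hle η hη (min_le_left _ _), h3.eventually (gt_mem_nhds (half_pos hκ))] with m hm hm2
  rw [Real.dist_eq, sub_zero, abs_of_nonneg (integral_nonneg fun z => hg0 m z)]
  nlinarith

end Increments

end EulerLocal
end

/-! ### Mollifiers and the expansion of mollified quantities in increments. -/

noncomputable section
namespace EulerLocal

section Mollifier

variable {n : ℕ}

/-- A standard even mollifier supported in the unit ball. -/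
structure IsMollifier (h : Space n → ℝ) : Prop where
  contDiff : ContDiff ℝ ∞ h
  even : ∀ z, h (-z) = h z
  nonneg : ∀ z, 0 ≤ h z
  integral_eq_one : ∫ z, h z = 1
  eq_zero : ∀ z, 1 < ‖z‖ → h z = 0

lemma exists_isMollifier (n : ℕ) : ∃ h : Space n → ℝ, IsMollifier h := by
  let β : ContDiffBump (0 : Space n) := ⟨1 / 2, 1, by norm_num, by norm_num⟩
  refine ⟨β.normed volume, β.contDiff_normed, fun z => β.normed_neg z, fun z => β.nonneg_normed z,
    β.integral_normed, fun z hz => ?_⟩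
  have : z ∉ Function.support (β.normed volume) := by
    rw [β.support_normed_eq, mem_ball_zero_iff]
    exact not_lt.2 hz.le
  exact Function.notMem_support.1 this

lemma IsMollifier.hasCompactSupport {h : Space n → ℝ} (hh : IsMollifier h) : HasCompactSupport h :=
  HasCompactSupport.intro (isCompact_closedBall (0 : Space n) 1) fun z hz =>
    hh.eq_zero z (by simpa using hz)

/-- The `L¹`-normalized dilation of a kernel. -/
def dil (ε : ℝ) (k : Space n → ℝ) (z : Space n) : ℝ := (ε ^ n)⁻¹ * k (ε⁻¹ • z)

lemma contDiff_dil {k : Space n → ℝ} (hk : ContDiff ℝ ∞ k) (ε : ℝ) : ContDiff ℝ ∞ (dil ε k) :=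
  contDiff_const.mul (hk.comp (contDiff_id.const_smul ε⁻¹))

lemma hasCompactSupport_dil {k : Space n → ℝ} (hk : HasCompactSupport k) {ε : ℝ} (hε : 0 < ε) :
    HasCompactSupport (dil ε k) :=
  (hk.comp_smul (inv_ne_zero hε.ne')).mul_left

lemma dil_neg {k : Space n → ℝ} (hk : ∀ z, k (-z) = k z) (ε : ℝ) (z : Space n) :
    dil ε k (-z) = dil ε k z := by
  rw [dil, dil, smul_neg, hk]

lemma dil_eq_zero {h : Space n → ℝ} (hh : IsMollifier h) {ε : ℝ} (hε : 0 < ε) {z : Space n}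
    (hz : ε < ‖z‖) : dil ε h z = 0 := by
  rw [dil, hh.eq_zero, mul_zero]
  rwa [norm_smul, norm_inv, Real.norm_of_nonneg hε.le, lt_inv_mul_iff₀ hε, mul_one]

lemma mol_dil (k f : Space n → ℝ) {ε : ℝ} (hε : 0 < ε) (x : Space n) :
    mol (dil ε k) f x = ∫ ζ, f (x - ε • ζ) * k ζ := by
  have h1 : mol (dil ε k) f x = ∫ y, f (x - y) * dil ε k y := by
    rw [mol, ← integral_sub_left_eq_self _ volume x]
    simp only [sub_sub_cancel]
  have h2 := Measure.integral_comp_smul (volume : Measure (Space n))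
    (fun y => f (x - y) * k (ε⁻¹ • y)) ε
  simp only [smul_smul, inv_mul_cancel₀ hε.ne', one_smul, finrank_euclideanSpace_fin] at h2
  rw [h1, h2, abs_of_pos (by positivity), smul_eq_mul, ← integral_const_mul]
  refine integral_congr_ae (ae_of_all _ fun y => ?_)
  simp only [dil]
  ring

lemma fderiv_dil {k : Space n → ℝ} (hk : Differentiable ℝ k) (ε : ℝ) (e : Space n) :
    (fun z => fderiv ℝ (dil ε k) z e) = fun z => ε⁻¹ * dil ε (fun y => fderiv ℝ k y e) z := by
  funext z
  have h1 : HasFDerivAt (fun y : Space n => ε⁻¹ • y) (ε⁻¹ • ContinuousLinearMap.id ℝ (Space n)) z :=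
    (hasFDerivAt_id z).const_smul ε⁻¹
  have h2 := (((hk (ε⁻¹ • z)).hasFDerivAt.comp z h1).const_mul (ε ^ n)⁻¹).fderiv
  have h3 : dil ε k = fun y => (ε ^ n)⁻¹ * (k ∘ fun y => ε⁻¹ • y) y := rfl
  rw [h3, h2]
  simp [dil]
  ring

lemma integral_fderiv_eq_zero {k : Space n → ℝ} (hk : ContDiff ℝ ∞ k) (hkc : HasCompactSupport k)
    (e : Space n) : ∫ z, fderiv ℝ k z e = 0 := by
  have hc : Continuous fun z => fderiv ℝ k z e :=
    (hk.continuous_fderiv (by simp)).clm_apply continuous_const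
  have h := integral_mul_fderiv_eq_neg_fderiv_mul_of_integrable (μ := volume)
    (f := fun _ : Space n => (1 : ℝ)) (g := k) (v := e) (by simp)
    (by simpa using hc.integrable_of_hasCompactSupport (hkc.fderiv_apply ℝ e))
    (by simpa using hk.continuous.integrable_of_hasCompactSupport hkc)
    (fun x _ => differentiableAt_const _) (fun x _ => hk.differentiable (by simp) x)
  simpa using h

/-- The constant in the pointwise increment estimates. -/
def ballConst (n : ℕ) : ℝ := volume.real (Metric.closedBall (0 : Space n) 2) + 1

lemma ballConst_pos (n : ℕ) : 0 < ballConst n := by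
  unfold ballConst; positivity

lemma integral_kernel_mul_le {k : Space n → ℝ} (hk : Continuous k) {M : ℝ} (hM : ∀ ζ, |k ζ| ≤ M)
    (hk0 : ∀ ζ, 2 < ‖ζ‖ → k ζ = 0) {g G : Space n → ℝ} (hg : StronglyMeasurable g)
    (hgG : ∀ ζ, |g ζ| ≤ G ζ) (hG : IntegrableOn G (Metric.closedBall (0 : Space n) 2)) :
    Integrable (fun ζ => k ζ * g ζ) ∧
      |∫ ζ, k ζ * g ζ| ≤ M * ∫ ζ in Metric.closedBall (0 : Space n) 2, G ζ := by
  have hM0 : 0 ≤ M := (abs_nonneg _).trans (hM 0)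
  have hle : ∀ ζ, |k ζ * g ζ| ≤ M * G ζ := fun ζ => by
    rw [abs_mul]
    exact mul_le_mul (hM ζ) (hgG ζ) (abs_nonneg _) hM0
  have hon : IntegrableOn (fun ζ => k ζ * g ζ) (Metric.closedBall (0 : Space n) 2) :=
    (hG.const_mul M).mono' (hk.stronglyMeasurable.mul hg).aestronglyMeasurable (ae_of_all _ hle)
  have h0 : ∀ ζ, ζ ∉ Metric.closedBall (0 : Space n) 2 → k ζ * g ζ = 0 := fun ζ hζ => by
    rw [hk0 ζ (by simpa using hζ), zero_mul]
  refine ⟨(integrableOn_iff_integrable_of_support_subset fun ζ hζ => ?_).1 hon, ?_⟩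
  · by_contra hcon
    exact hζ (h0 ζ hcon)
  · rw [← setIntegral_eq_integral_of_forall_compl_eq_zero h0, ← integral_const_mul]
    exact abs_integral_le_integral_abs.trans (integral_mono hon.abs (hG.const_mul M) hle)

lemma norm_increment_moments {w : Space n × ℝ → Space n} (hw : StronglyMeasurable w) {ε : ℝ}
    {z : Space n × ℝ} (hz : incr w ε z < ⊤) :
    (IntegrableOn (fun ζ => ‖w (z.1 - ε • ζ, z.2) - w z‖) (Metric.closedBall (0 : Space n) 2) ∧
      ∫ ζ in Metric.closedBall (0 : Space n) 2, ‖w (z.1 - ε • ζ, z.2) - w z‖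
        ≤ ballConst n * amp w ε z) ∧
    (IntegrableOn (fun ζ => ‖w (z.1 - ε • ζ, z.2) - w z‖ ^ 2) (Metric.closedBall (0 : Space n) 2) ∧
      ∫ ζ in Metric.closedBall (0 : Space n) 2, ‖w (z.1 - ε • ζ, z.2) - w z‖ ^ 2
        ≤ ballConst n * amp w ε z ^ 2) :=
  setIntegral_norm_le_of_cubic measure_closedBall_lt_top
    ((hw.comp_measurable (g := fun ζ : Space n => (z.1 - ε • ζ, z.2))
      (by fun_prop)).sub stronglyMeasurable_const) hz (amp_nonneg w ε z) (amp_pow_three w ε z)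

lemma stronglyMeasurable_increment {w : Space n × ℝ → Space n} (hw : StronglyMeasurable w) (ε : ℝ)
    (z : Space n × ℝ) (j : Fin n) :
    StronglyMeasurable fun ζ : Space n => w (z.1 - ε • ζ, z.2) j - w z j :=
  ((stronglyMeasurable_coord hw j).comp_measurable (g := fun ζ : Space n => (z.1 - ε • ζ, z.2))
    (by fun_prop)).sub stronglyMeasurable_const

lemma increment_moment_one {w : Space n × ℝ → Space n} (hw : StronglyMeasurable w) {ε : ℝ}
    {z : Space n × ℝ} (hz : incr w ε z < ⊤) {k : Space n → ℝ} (hk : Continuous k) {M : ℝ}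
    (hM : ∀ ζ, |k ζ| ≤ M) (hk0 : ∀ ζ, 2 < ‖ζ‖ → k ζ = 0) (j : Fin n) :
    Integrable (fun ζ => k ζ * (w (z.1 - ε • ζ, z.2) j - w z j)) ∧
      |∫ ζ, k ζ * (w (z.1 - ε • ζ, z.2) j - w z j)| ≤ M * (ballConst n * amp w ε z) := by
  obtain ⟨⟨h1, h2⟩, -⟩ := norm_increment_moments hw hz
  obtain ⟨h3, h4⟩ := integral_kernel_mul_le hk hM hk0 (stronglyMeasurable_increment hw ε z j)
    (fun ζ => by simpa using abs_coord_le (w (z.1 - ε • ζ, z.2) - w z) j) h1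
  exact ⟨h3, h4.trans (mul_le_mul_of_nonneg_left h2 ((abs_nonneg _).trans (hM 0)))⟩

lemma increment_moment_two {w : Space n × ℝ → Space n} (hw : StronglyMeasurable w) {ε : ℝ}
    {z : Space n × ℝ} (hz : incr w ε z < ⊤) {k : Space n → ℝ} (hk : Continuous k) {M : ℝ}
    (hM : ∀ ζ, |k ζ| ≤ M) (hk0 : ∀ ζ, 2 < ‖ζ‖ → k ζ = 0) (i j : Fin n) :
    Integrable (fun ζ => k ζ *
        ((w (z.1 - ε • ζ, z.2) i - w z i) * (w (z.1 - ε • ζ, z.2) j - w z j))) ∧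
      |∫ ζ, k ζ * ((w (z.1 - ε • ζ, z.2) i - w z i) * (w (z.1 - ε • ζ, z.2) j - w z j))|
        ≤ M * (ballConst n * amp w ε z ^ 2) := by
  obtain ⟨-, h1, h2⟩ := norm_increment_moments hw hz
  have hm : StronglyMeasurable fun ζ : Space n =>
      (w (z.1 - ε • ζ, z.2) i - w z i) * (w (z.1 - ε • ζ, z.2) j - w z j) :=
    (stronglyMeasurable_increment hw ε z i).mul (stronglyMeasurable_increment hw ε z j)
  obtain ⟨h3, h4⟩ := integral_kernel_mul_le hk hM hk0 hm
    (fun ζ => by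
      rw [abs_mul, sq]
      exact mul_le_mul (by simpa using abs_coord_le (w (z.1 - ε • ζ, z.2) - w z) i)
        (by simpa using abs_coord_le (w (z.1 - ε • ζ, z.2) - w z) j) (abs_nonneg _)
        (norm_nonneg _)) h1
  exact ⟨h3, h4.trans (mul_le_mul_of_nonneg_left h2 ((abs_nonneg _).trans (hM 0)))⟩

lemma IsMollifier.integrable {h : Space n → ℝ} (hh : IsMollifier h) : Integrable h :=
  hh.contDiff.continuous.integrable_of_hasCompactSupport hh.hasCompactSupport

/-- Expansion of the mollified quantities around a point with finite cubic increment. -/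
lemma IsMollifier.exists_expansion {h : Space n → ℝ} (hh : IsMollifier h) :
    ∃ A, 0 < A ∧ ∀ {T C : ℝ} {u w : Space n × ℝ → Space n}, IsVersion T u w C → ∀ {ε : ℝ}, 0 < ε →
      ∀ {z : Space n × ℝ}, incr w ε z < ⊤ →
      ∃ (d : Fin n → ℝ) (e : Fin n → Fin n → ℝ),
        (∀ i, |d i| ≤ A * amp w ε z) ∧ (∀ i j, |e i j| ≤ A * amp w ε z ^ 2) ∧
        (∀ i, velMol (dil ε h) w i z = w z i + d i) ∧
        (∀ i j, strMol (dil ε h) w i j z = w z i * w z j + w z i * d j + w z j * d i + e i j) ∧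
        (∀ i j, |dx i (velMol (dil ε h) w j) z| ≤ A * amp w ε z / ε) ∧
        (∀ j (η : Space n), ‖η‖ ≤ 1 →
          |velMol (dil ε h) w j (z.1 - ε • η, z.2) - w z j| ≤ A * amp w ε z) := by
  have hbd : ∀ {k : Space n → ℝ}, Continuous k → HasCompactSupport k → ∃ M, 0 ≤ M ∧ ∀ z, |k z| ≤ M := by
    intro k hk hkc
    obtain ⟨M, hM⟩ := hkc.exists_bound_of_continuous hk
    exact ⟨M, (norm_nonneg _).trans (hM 0), hM⟩
  have hhc := hh.contDiff.continuous
  obtain ⟨M, hM0, hM⟩ := hbd hhc hh.hasCompactSupport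
  have hDc : ∀ i : Fin n, Continuous fun z => fderiv ℝ h z (stdVec i) := fun i =>
    (hh.contDiff.continuous_fderiv (by simp)).clm_apply continuous_const
  have hDcs : ∀ i : Fin n, HasCompactSupport fun z => fderiv ℝ h z (stdVec i) := fun i =>
    hh.hasCompactSupport.fderiv_apply ℝ _
  choose M' hM'0 hM' using fun i => hbd (hDc i) (hDcs i)
  have hb := (ballConst_pos n).le
  refine ⟨(M + ∑ i, M' i + 1) * ballConst n,
    mul_pos (by have := Finset.sum_nonneg fun i (_ : i ∈ Finset.univ) => hM'0 i; linarith)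
      (ballConst_pos n), ?_⟩
  intro T C u w hw ε hε z hz
  have hsum : 0 ≤ ∑ i, M' i := Finset.sum_nonneg fun i _ => hM'0 i
  have ha := amp_nonneg w ε z
  have hwm := hw.stronglyMeasurable
  have hMA : ∀ X, 0 ≤ X → M * (ballConst n * X) ≤ (M + ∑ i, M' i + 1) * ballConst n * X := by
    intro X hX
    rw [← mul_assoc]
    gcongr
    linarith
  have hh0 : ∀ ζ, 2 < ‖ζ‖ → h ζ = 0 := fun ζ hζ => hh.eq_zero ζ (by linarith)
  have m1 := increment_moment_one hwm hz hhc hM hh0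
  have m2 := increment_moment_two hwm hz hhc hM hh0
  have hd : ∀ i, velMol (dil ε h) w i z
      = w z i + ∫ ζ, h ζ * (w (z.1 - ε • ζ, z.2) i - w z i) := by
    intro i
    rw [velMol, mol_dil h _ hε]
    have e1 : ∀ ζ, w (z.1 - ε • ζ, z.2) i * h ζ
        = w z i * h ζ + h ζ * (w (z.1 - ε • ζ, z.2) i - w z i) := fun ζ => by ring
    simp only [e1]
    rw [integral_add (hh.integrable.const_mul _) (m1 i).1, integral_const_mul, hh.integral_eq_one,
      mul_one]
  refine ⟨fun i => ∫ ζ, h ζ * (w (z.1 - ε • ζ, z.2) i - w z i), fun i j => ∫ ζ, h ζ *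
      ((w (z.1 - ε • ζ, z.2) i - w z i) * (w (z.1 - ε • ζ, z.2) j - w z j)),
    fun i => (m1 i).2.trans (hMA _ ha), fun i j => (m2 i j).2.trans (hMA _ (by positivity)), hd,
    fun i j => ?_, fun i j => ?_, fun j η hη => ?_⟩
  · rw [strMol, mol_dil h _ hε]
    -- The product is expanded exactly about its value at `z`. The first-order terms reproduce those
    -- of the velocity, so they cancel in the covariance of the components, which is quadratic in
    -- the increments.
    have e1 : ∀ ζ, prodCoord w i j (z.1 - ε • ζ, z.2) * h ζ
        = w z i * w z j * h ζ + w z i * (h ζ * (w (z.1 - ε • ζ, z.2) j - w z j))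
          + w z j * (h ζ * (w (z.1 - ε • ζ, z.2) i - w z i))
          + h ζ * ((w (z.1 - ε • ζ, z.2) i - w z i) * (w (z.1 - ε • ζ, z.2) j - w z j)) :=
      fun ζ => by rw [prodCoord]; ring
    simp only [e1]
    have i1 := hh.integrable.const_mul (w z i * w z j)
    have i2 := (m1 j).1.const_mul (w z i)
    have i3 := (m1 i).1.const_mul (w z j)
    have i12 : Integrable fun ζ => w z i * w z j * h ζ
        + w z i * (h ζ * (w (z.1 - ε • ζ, z.2) j - w z j)) := i1.add i2
    have i123 : Integrable fun ζ => w z i * w z j * h ζ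
        + w z i * (h ζ * (w (z.1 - ε • ζ, z.2) j - w z j))
        + w z j * (h ζ * (w (z.1 - ε • ζ, z.2) i - w z i)) := i12.add i3
    rw [integral_add i123 (m2 i j).1, integral_add i12 i3,
      integral_add i1 i2, integral_const_mul, integral_const_mul, integral_const_mul,
      hh.integral_eq_one, mul_one]
  · have m3 := increment_moment_one hwm hz (hDc i) (hM' i) (fun ζ hζ => by
      have : ζ ∉ tsupport h := fun hmem => by
        have := closure_minimal (t := Metric.closedBall (0 : Space n) 1) (fun y hy => by
          by_contra hcon
          exact hy (hh.eq_zero y (by simpa using hcon))) Metric.isClosed_closedBall hmem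
        rw [mem_closedBall_zero_iff] at this
        linarith
      rw [image_eq_zero_of_notMem_tsupport fun hmem => this (tsupport_fderiv_subset ℝ hmem)]
      rfl) j
    -- A derivative of the mollifier has mean zero, so `w z j` may be subtracted. The gradient is
    -- then an average of increments, divided by `ε` from the dilation.
    have h1 : dx i (velMol (dil ε h) w j) z
        = ε⁻¹ * ∫ ζ, fderiv ℝ h ζ (stdVec i) * (w (z.1 - ε • ζ, z.2) j - w z j) := by
      have h2 := fderiv_mol_apply (contDiff_dil hh.contDiff ε) (hasCompactSupport_dil hh.hasCompactSupport hε)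
        (MemLp.locallyIntegrable_two (memLp_coord (hw.memLp z.2) j)) z.1 (stdVec i)
      rw [dx]
      refine h2.trans ?_
      rw [fderiv_dil (hh.contDiff.differentiable (by simp))]
      have h3 : mol (fun y => ε⁻¹ * dil ε (fun y => fderiv ℝ h y (stdVec i)) y)
          (fun y => w (y, z.2) j) z.1
          = ε⁻¹ * mol (dil ε (fun y => fderiv ℝ h y (stdVec i))) (fun y => w (y, z.2) j) z.1 := by
        rw [mol, mol, ← integral_const_mul]
        refine integral_congr_ae (ae_of_all _ fun y => ?_)
        simp only
        ring
      rw [h3, mol_dil _ _ hε]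
      congr 1
      have hDi : Integrable fun ζ => fderiv ℝ h ζ (stdVec i) :=
        (hDc i).integrable_of_hasCompactSupport (hDcs i)
      have e1 : ∀ ζ, w (z.1 - ε • ζ, z.2) j * fderiv ℝ h ζ (stdVec i)
          = w z j * fderiv ℝ h ζ (stdVec i)
            + fderiv ℝ h ζ (stdVec i) * (w (z.1 - ε • ζ, z.2) j - w z j) := fun ζ => by ring
      simp only [e1]
      rw [integral_add (hDi.const_mul _) m3.1, integral_const_mul,
        integral_fderiv_eq_zero hh.contDiff hh.hasCompactSupport, mul_zero, zero_add]
    rw [h1, abs_mul, abs_of_pos (inv_pos.2 hε), div_eq_inv_mul]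
    refine mul_le_mul_of_nonneg_left (m3.2.trans ?_) (inv_pos.2 hε).le
    rw [← mul_assoc]
    gcongr
    linarith [Finset.single_le_sum (fun i _ => hM'0 i) (Finset.mem_univ i)]
  -- Seen from `z`, the mollifier centred at `z.1 - ε • η` is supported within distance `2ε`. Hence
  -- the radius `2` in `incr`.
  · have hk : Continuous fun ζ => h (ζ - η) := hhc.comp (by fun_prop)
    have m4 := increment_moment_one hwm hz hk (fun ζ => hM _) (fun ζ hζ => hh.eq_zero _ (by
      have := norm_sub_norm_le ζ η
      linarith)) j
    have e2 : velMol (dil ε h) w j (z.1 - ε • η, z.2) - w z j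
        = ∫ ζ, h (ζ - η) * (w (z.1 - ε • ζ, z.2) j - w z j) := by
      rw [velMol, mol_dil h _ hε]
      have e3 : ∫ ζ, w (z.1 - ε • η - ε • ζ, z.2) j * h ζ
          = ∫ ζ, w (z.1 - ε • ζ, z.2) j * h (ζ - η) := by
        rw [← integral_sub_right_eq_self _ η]
        refine integral_congr_ae (ae_of_all _ fun ζ => ?_)
        simp only
        have hr : z.1 - ε • η - ε • (ζ - η) = z.1 - ε • ζ := by rw [smul_sub]; abel
        rw [hr]
      simp only
      rw [e3]
      have e1 : ∀ ζ, w (z.1 - ε • ζ, z.2) j * h (ζ - η)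
          = w z j * h (ζ - η) + h (ζ - η) * (w (z.1 - ε • ζ, z.2) j - w z j) := fun ζ => by ring
      simp only [e1]
      rw [integral_add ((hh.integrable.comp_sub_right η).const_mul _) m4.1, integral_const_mul,
        integral_sub_right_eq_self h η, hh.integral_eq_one, mul_one, add_sub_cancel_left]
    rw [e2]
    exact m4.2.trans (hMA _ ha)

end Mollifier
end EulerLocal
end

/-! ### The mollified balance near a regular compact set. -/

noncomputable section
namespace EulerLocal
open scoped SchwartzMap LineDeriv
open LineDeriv

section LocalBalance

variable {n : ℕ}

/-- On a regular compact set the mollified pressure is the mollification of the local pressure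
function. -/
lemma CubicRegularOn.ae_presMol_eq {T C : ℝ} {u w : Space n × ℝ → Space n}
    (hw : IsVersion T u w C) {K : Set (Space n × ℝ)} (hKc : IsCompact K)
    (hK : CubicRegularOn w K) :
    ∀ᵐ t : ℝ, ∀ (h : Space n → ℝ) (hc : HasCompactSupport h) (hh : ContDiff ℝ ∞ h) (x : Space n),
      (∀ y, (y, t) ∉ K → h (y - x) = 0) →
      presMol (toSchwartz h hc hh) w (x, t)
        = corr h (fun y => K.indicator (pressureFn w) (y, t)) x := by
  filter_upwards [hK.ae_pressurePairing hw hKc] with t ht h hc hh x hx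
  -- The pairing with the translated mollifier is computed twice: by Riesz transforms, which gives
  -- the mollified pressure, and by the pressure function.
  have h1 := ht (fun y => h (y - x)) ((toSchwartz h hc hh).compSubConstCLM ℂ x)
    (fun y => by simp [SchwartzMap.compSubConstCLM_apply]) hx
  rw [pressurePairing_eq_riesz (hw.memLp t) _ ((toSchwartz h hc hh).compSubConstCLM ℂ x)
    (fun y => by simp [SchwartzMap.compSubConstCLM_apply])] at h1
  have h2 := congrArg Complex.re h1
  rw [Complex.ofReal_re, Complex.neg_re, Complex.re_sum] at h2
  have h3 : corr h (fun y => K.indicator (pressureFn w) (y, t)) x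
      = ∫ y, pressureFn w (y, t) * h (y - x) := by
    refine integral_congr_ae (ae_of_all _ fun y => ?_)
    by_cases hy : (y, t) ∈ K
    · simp [hy]
    · simp [hx y hy]
  rw [h3, ← h2, presMol]
  congr 1
  refine Finset.sum_congr rfl fun i _ => ?_
  rw [Complex.re_sum]
  refine Finset.sum_congr rfl fun k _ => ?_
  have hint : Integrable fun y => ((w (y, t) i * w (y, t) k : ℝ) : ℂ)
      * riesz i k (toSchwartz h hc hh) (y - x) := by
    obtain ⟨M, hM⟩ : ∃ M, ∀ y, ‖riesz i k (toSchwartz h hc hh) y‖ ≤ M :=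
      ⟨_, norm_riesz_le i k _⟩
    exact ((integrable_prodCoord hw i k t).ofReal).mul_bdd (c := M)
      ((continuous_riesz i k _).comp (by fun_prop)).aestronglyMeasurable
      (ae_of_all _ fun y => hM _)
  have h4 := integral_re hint
  simp only [riesz_compSubConst]
  refine Eq.trans ?_ h4
  refine integral_congr_ae (ae_of_all _ fun y => ?_)
  simp [prodCoord]

lemma CubicRegularOn.integrable_indicator_pressureFn {T C : ℝ} {u w : Space n × ℝ → Space n}
    (hw : IsVersion T u w C) {K : Set (Space n × ℝ)} (hKc : IsCompact K)
    (hK : CubicRegularOn w K) : Integrable (K.indicator (pressureFn w)) := by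
  rw [integrable_indicator_iff hKc.measurableSet]
  have : IsFiniteMeasure (volume.restrict K) := ⟨by simpa using hKc.measure_lt_top⟩
  refine (hK.memLp_pressureFn hw hKc).integrable ?_
  rw [ENNReal.le_div_iff_mul_le (by simp) (by simp)]
  norm_num

/-- Transport of the kinetic energy density by a divergence free field. -/
lemma sum_integral_transport {V : Fin n → Space n → ℝ} (hV : ∀ j, ContDiff ℝ ∞ (V j))
    (hdiv : ∀ x, ∑ i, fderiv ℝ (V i) x (stdVec i) = 0) {g : Space n → ℝ} (hg : ContDiff ℝ ∞ g)
    (hgc : HasCompactSupport g) (j : Fin n) :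
    ∑ i, ∫ x, (fderiv ℝ g x (stdVec i) * (V i x * V j x ^ 2)
      + 2 * (g x * fderiv ℝ (V j) x (stdVec i) * (V i x * V j x))) = 0 := by
  have hd : ∀ {f : Space n → ℝ}, ContDiff ℝ ∞ f → ∀ e, Continuous fun x => fderiv ℝ f x e :=
    fun hf e => (hf.continuous_fderiv (by simp)).clm_apply continuous_const
  have h1 : ∀ i, ∫ x, fderiv ℝ (fun x => g x * (V i x * V j x ^ 2)) x (stdVec i) = 0 := fun i =>
    integral_fderiv_eq_zero (hg.mul ((hV i).mul ((hV j).pow 2))) hgc.mul_right _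
  have h2 : ∀ i x, fderiv ℝ (fun x => g x * (V i x * V j x ^ 2)) x (stdVec i)
      = (fderiv ℝ g x (stdVec i) * (V i x * V j x ^ 2)
      + 2 * (g x * fderiv ℝ (V j) x (stdVec i) * (V i x * V j x)))
      + g x * fderiv ℝ (V i) x (stdVec i) * V j x ^ 2 := by
    intro i x
    have d1 := (hg.differentiable (by simp) x).hasFDerivAt
    have d2 := ((hV i).differentiable (by simp) x).hasFDerivAt
    have d3 := ((hV j).differentiable (by simp) x).hasFDerivAt
    have d4 := (d1.mul (d2.mul (d3.pow 2))).fderiv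
    have d5 : fderiv ℝ (fun x => g x * (V i x * V j x ^ 2)) x = _ := d4
    rw [d5]
    simp
    ring
  have hcs : ∀ {f : Space n → ℝ}, Continuous f → (∀ x, x ∉ tsupport g → f x = 0) → Integrable f :=
    fun hf h0 => hf.integrable_of_hasCompactSupport (HasCompactSupport.intro hgc h0)
  have z1 : ∀ x, x ∉ tsupport g → g x = 0 := fun x => image_eq_zero_of_notMem_tsupport
  have z2 : ∀ e x, x ∉ tsupport g → fderiv ℝ g x e = 0 := fun e x hx => by
    rw [image_eq_zero_of_notMem_tsupport fun hm => hx (tsupport_fderiv_subset ℝ hm)]; rfl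
  have hVc := fun i => (hV i).continuous
  have hi1 : ∀ i, Integrable fun x => fderiv ℝ g x (stdVec i) * (V i x * V j x ^ 2)
      + 2 * (g x * fderiv ℝ (V j) x (stdVec i) * (V i x * V j x)) := fun i =>
    hcs (((hd hg _).mul ((hVc i).mul ((hVc j).pow 2))).add (continuous_const.mul
      ((hg.continuous.mul (hd (hV j) _)).mul ((hVc i).mul (hVc j)))))
      fun x hx => by rw [z1 x hx, z2 _ x hx]; simp
  have hi2 : ∀ i, Integrable fun x => g x * fderiv ℝ (V i) x (stdVec i) * V j x ^ 2 := fun i =>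
    hcs ((hg.continuous.mul (hd (hV i) _)).mul ((hVc j).pow 2)) fun x hx => by rw [z1 x hx]; simp
  have h3 : ∑ i, ∫ x, g x * fderiv ℝ (V i) x (stdVec i) * V j x ^ 2 = 0 := by
    rw [← integral_finsetSum _ fun i _ => hi2 i]
    refine (integral_congr_ae (ae_of_all _ fun x => ?_)).trans (integral_zero' _ _)
    simp only [Pi.zero_apply]
    rw [← Finset.sum_mul, ← Finset.mul_sum, hdiv, mul_zero, zero_mul]
  have h4 := Finset.sum_eq_zero fun i (_ : i ∈ Finset.univ) => h1 i
  simp only [h2] at h4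
  rw [Finset.sum_congr rfl fun i _ => integral_add (hi1 i) (hi2 i), Finset.sum_add_distrib, h3,
    add_zero] at h4
  exact h4

/-- The kinetic part of the density in the mollified local energy balance. -/
def fluxMol (h : Space n → ℝ) (w : Space n × ℝ → Space n) (φ : Space n × ℝ → ℝ)
    (z : Space n × ℝ) : ℝ :=
  ∑ j, (velMol h w j z ^ 2 * dt φ z + ∑ i, (2 * (dx i φ z * velMol h w j z * strMol h w i j z)
    + 2 * (φ z * dx i (velMol h w j) z * (strMol h w i j z - velMol h w i z * velMol h w j z))
    - dx i φ z * (velMol h w i z * velMol h w j z ^ 2)))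

/-- The mollification of `V · ∇φ`, where `V` is the mollification of `w`. -/
def workMol (h : Space n → ℝ) (w : Space n × ℝ → Space n) (φ : Space n × ℝ → ℝ)
    (z : Space n × ℝ) : ℝ :=
  mol h (fun y => ∑ j, dx j φ (y, z.2) * velMol h w j (y, z.2)) z.1

lemma dx_eq_zero (i : Fin n) {φ : Space n × ℝ → ℝ} (hφ : ContDiff ℝ ∞ φ) {z : Space n × ℝ}
    (hz : z ∉ tsupport φ) : dx i φ z = 0 := by
  rw [dx_eq_fderiv i hφ]
  simp only
  rw [image_eq_zero_of_notMem_tsupport fun hm => hz (tsupport_fderiv_subset ℝ hm)]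
  rfl

lemma dt_eq_zero {φ : Space n × ℝ → ℝ} (hφ : ContDiff ℝ ∞ φ) {z : Space n × ℝ}
    (hz : z ∉ tsupport φ) : dt φ z = 0 := by
  rw [dt_eq_fderiv (hφ.differentiable (by simp)),
    image_eq_zero_of_notMem_tsupport fun hm => hz (tsupport_fderiv_subset ℝ hm)]
  rfl

lemma fluxMol_eq_zero (h : Space n → ℝ) (w : Space n × ℝ → Space n) {φ : Space n × ℝ → ℝ}
    (hφ : ContDiff ℝ ∞ φ) {z : Space n × ℝ} (hz : z ∉ tsupport φ) : fluxMol h w φ z = 0 := by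
  simp [fluxMol, dx_eq_zero _ hφ hz, dt_eq_zero hφ hz, image_eq_zero_of_notMem_tsupport hz]

lemma integrable_of_support_subset {φ f : Space n × ℝ → ℝ} (hφc : HasCompactSupport φ) {s : ℝ}
    (hf : Continuous fun x => f (x, s)) (h0 : ∀ z, z ∉ tsupport φ → f z = 0) :
    Integrable fun x => f (x, s) := by
  refine hf.integrable_of_hasCompactSupport (HasCompactSupport.intro (hφc.image continuous_fst)
    fun x hx => h0 _ fun hm => hx ⟨_, hm, rfl⟩)

/-- The energy transport of the mollified divergence-free field integrates to zero, and subtracting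
it replaces `S` by the commutator `S - V ⊗ V` beside the velocity gradient. The gradient has size
`α/ε`, which only a factor quadratic in the increments can compensate. -/
lemma sum_integral_eq_integral_fluxMol {h : Space n → ℝ} (hh : ContDiff ℝ ∞ h)
    (hc : HasCompactSupport h) {w : Space n × ℝ → Space n} {φ : Space n × ℝ → ℝ}
    (hφ : ContDiff ℝ ∞ φ) (hφc : HasCompactSupport φ) {s : ℝ} (hw : MemLp (fun x => w (x, s)) 2)
    (hdiv : ∀ x, ∑ j, fderiv ℝ (fun y => velMol h w j (y, s)) x (stdVec j) = 0) :
    Integrable (fun x => fluxMol h w φ (x, s)) ∧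
    (∑ j, ∫ x, velMol h w j (x, s) ^ 2 * dt φ (x, s))
        + 2 * (∑ j, ∑ i, ∫ x, (dx i φ (x, s) * velMol h w j (x, s)
            + φ (x, s) * dx i (velMol h w j) (x, s)) * strMol h w i j (x, s))
      = ∫ x, fluxMol h w φ (x, s) := by
  have hV : ∀ j, ContDiff ℝ ∞ fun x => velMol h w j (x, s) := contDiff_velMol hh hc hw
  have hVc := fun j => (hV j).continuous
  have hF : ∀ i j, Continuous fun x => strMol h w i j (x, s) := fun i j =>
    (contDiff_mol hh hc (integrable_mul_coord hw i j).locallyIntegrable).continuous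
  have hdV : ∀ i j, Continuous fun x => dx i (velMol h w j) (x, s) := fun i j =>
    ((hV j).continuous_fderiv (by simp)).clm_apply continuous_const
  have hsl : Continuous fun x : Space n => (x, s) := by fun_prop
  have hφs : Continuous fun x => φ (x, s) := hφ.continuous.comp hsl
  have hdφ : ∀ i, Continuous fun x => dx i φ (x, s) := fun i => (continuous_dx i hφ).comp hsl
  have hdt : Continuous fun x => dt φ (x, s) := (continuous_dt hφ).comp hsl
  have z1 : ∀ z, z ∉ tsupport φ → φ z = 0 := fun z => image_eq_zero_of_notMem_tsupport
  have ia : ∀ j, Integrable fun x => velMol h w j (x, s) ^ 2 * dt φ (x, s) := fun j =>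
    integrable_of_support_subset (f := fun z => velMol h w j z ^ 2 * dt φ z) hφc
      (((hVc j).pow 2).mul hdt) fun z hz => by rw [dt_eq_zero hφ hz, mul_zero]
  have ib : ∀ j i, Integrable fun x => (dx i φ (x, s) * velMol h w j (x, s)
      + φ (x, s) * dx i (velMol h w j) (x, s)) * strMol h w i j (x, s) := fun j i =>
    integrable_of_support_subset (f := fun z => (dx i φ z * velMol h w j z
      + φ z * dx i (velMol h w j) z) * strMol h w i j z) hφc
      ((((hdφ i).mul (hVc j)).add (hφs.mul (hdV i j))).mul (hF i j))
      fun z hz => by rw [dx_eq_zero i hφ hz, z1 z hz]; simp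
  have ic : ∀ j i, Integrable fun x => dx i φ (x, s) * (velMol h w i (x, s)
      * velMol h w j (x, s) ^ 2) + 2 * (φ (x, s) * dx i (velMol h w j) (x, s)
      * (velMol h w i (x, s) * velMol h w j (x, s))) := fun j i =>
    integrable_of_support_subset (f := fun z => dx i φ z * (velMol h w i z
      * velMol h w j z ^ 2) + 2 * (φ z * dx i (velMol h w j) z
      * (velMol h w i z * velMol h w j z))) hφc
      (((hdφ i).mul ((hVc i).mul ((hVc j).pow 2))).add (continuous_const.mul
        ((hφs.mul (hdV i j)).mul ((hVc i).mul (hVc j)))))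
      fun z hz => by rw [dx_eq_zero i hφ hz, z1 z hz]; simp
  have hz : ∀ j, ∑ i, ∫ x, (dx i φ (x, s) * (velMol h w i (x, s)
      * velMol h w j (x, s) ^ 2) + 2 * (φ (x, s) * dx i (velMol h w j) (x, s)
      * (velMol h w i (x, s) * velMol h w j (x, s)))) = 0 := fun j =>
    sum_integral_transport hV hdiv (contDiff_slice hφ s) (hasCompactSupport_slice hφc s) j
  have e : ∀ x, fluxMol h w φ (x, s) = ∑ j, (velMol h w j (x, s) ^ 2 * dt φ (x, s)
      + ∑ i, (2 * ((dx i φ (x, s) * velMol h w j (x, s)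
        + φ (x, s) * dx i (velMol h w j) (x, s)) * strMol h w i j (x, s))
        - (dx i φ (x, s) * (velMol h w i (x, s)
      * velMol h w j (x, s) ^ 2) + 2 * (φ (x, s) * dx i (velMol h w j) (x, s)
      * (velMol h w i (x, s) * velMol h w j (x, s)))))) := by
    intro x
    rw [fluxMol]
    refine Finset.sum_congr rfl fun j _ => ?_
    congr 1
    refine Finset.sum_congr rfl fun i _ => ?_
    ring
  have is := fun j => integrable_finsetSum Finset.univ fun i _ => ((ib j i).const_mul 2).sub (ic j i)
  have it : ∀ j, Integrable fun x => velMol h w j (x, s) ^ 2 * dt φ (x, s)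
      + ∑ i, (2 * ((dx i φ (x, s) * velMol h w j (x, s)
        + φ (x, s) * dx i (velMol h w j) (x, s)) * strMol h w i j (x, s))
        - (dx i φ (x, s) * (velMol h w i (x, s)
      * velMol h w j (x, s) ^ 2) + 2 * (φ (x, s) * dx i (velMol h w j) (x, s)
      * (velMol h w i (x, s) * velMol h w j (x, s))))) := fun j => (ia j).add (is j)
  simp only [e]
  refine ⟨integrable_finsetSum _ fun j _ => it j, ?_⟩
  rw [integral_finsetSum _ fun j _ => it j, Finset.mul_sum, ← Finset.sum_add_distrib]
  refine Finset.sum_congr rfl fun j _ => ?_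
  have h1 := integral_add (ia j) (is j)
  refine Eq.trans ?_ h1.symm
  congr 1
  have h2 := integral_finsetSum Finset.univ fun i (_ : i ∈ Finset.univ) =>
    ((ib j i).const_mul 2).sub (ic j i)
  refine Eq.trans ?_ h2.symm
  simp only [Pi.sub_apply]
  rw [Finset.sum_congr rfl fun i _ => integral_sub ((ib j i).const_mul 2) (ic j i),
    Finset.sum_sub_distrib, hz j, sub_zero, Finset.mul_sum]
  exact Finset.sum_congr rfl fun i _ => (integral_const_mul _ _).symm

/-- The density of the mollified local energy balance near a regular compact set. -/
lemma IsWeakSolution.ae_bracket_eq {T C : ℝ} {u₀ : Space n → Space n} {u w : Space n × ℝ → Space n}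
    (hu : IsWeakSolution T u₀ u) (hw : IsVersion T u w C) {h : Space n → ℝ}
    (hh : ContDiff ℝ ∞ h) (hc : HasCompactSupport h) (he : ∀ z, h (-z) = h z)
    {φ : Space n × ℝ → ℝ} (hφ : ContDiff ℝ ∞ φ) (hφc : HasCompactSupport φ)
    {K : Set (Space n × ℝ)} (hKc : IsCompact K) (hK : CubicRegularOn w K)
    (hKφ : ∀ x y s, s ∈ Icc 0 T → (x, s) ∈ tsupport φ → (y, s) ∉ K → h (y - x) = 0) :
    ∀ᵐ s : ℝ, s ∈ Icc 0 T →
      (∑ j, ∫ x, velMol h w j (x, s) ^ 2 * dt φ (x, s))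
        + 2 * (∑ j, ∑ i, ∫ x, (dx i φ (x, s) * velMol h w j (x, s)
            + φ (x, s) * dx i (velMol h w j) (x, s)) * strMol h w i j (x, s))
        + 2 * ∑ j, ∫ x, dx j φ (x, s) * velMol h w j (x, s)
            * presMol (toSchwartz h hc hh) w (x, s)
      = ∫ x, (fluxMol h w φ (x, s)
        + 2 * (K.indicator (pressureFn w) (x, s) * workMol h w φ (x, s))) := by
  filter_upwards [hK.ae_presMol_eq hw hKc, (hK.integrable_indicator_pressureFn hw hKc).prod_left_ae,
    (ae_restrict_iff' measurableSet_Icc).1 hw.ae_eq] with s h1 h2 h3 hs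
  obtain ⟨i1, e1⟩ := sum_integral_eq_integral_fluxMol hh hc hφ hφc (hw.memLp s)
    (sum_fderiv_velMol_eq_zero hu hh hc hs (h3 hs))
  obtain ⟨M, hM⟩ := hc.exists_bound_of_continuous hh.continuous
  have hsl : Continuous fun x : Space n => (x, s) := by fun_prop
  have ib : ∀ j, Integrable fun x => dx j φ (x, s) * velMol h w j (x, s) := fun j =>
    integrable_of_support_subset (f := fun z => dx j φ z * velMol h w j z) hφc
      (((continuous_dx j hφ).comp hsl).mul (contDiff_velMol hh hc (hw.memLp s) j).continuous)
      fun z hz => by rw [dx_eq_zero j hφ hz, zero_mul]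
  have ibs : Integrable fun x => ∑ j, dx j φ (x, s) * velMol h w j (x, s) :=
    integrable_finsetSum _ fun j _ => ib j
  have ibd : ∀ x, |workMol h w φ (x, s)| ≤ M * ∫ y, |∑ j, dx j φ (y, s) * velMol h w j (y, s)| := by
    intro x
    rw [workMol, mol_eq_corr he]
    exact abs_corr_le ibs hM x
  have icont : Continuous fun x => workMol h w φ (x, s) :=
    (contDiff_mol hh hc ibs.locallyIntegrable).continuous
  have i2 : Integrable fun x => K.indicator (pressureFn w) (x, s) * workMol h w φ (x, s) :=
    h2.mul_bdd icont.aestronglyMeasurable (ae_of_all _ fun x => ibd x)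
  rw [e1, integral_add i1 (i2.const_mul 2), integral_const_mul]
  congr 2
  have e2 : ∀ j, ∫ x, dx j φ (x, s) * velMol h w j (x, s) * presMol (toSchwartz h hc hh) w (x, s)
      = ∫ x, dx j φ (x, s) * velMol h w j (x, s)
        * corr h (fun y => K.indicator (pressureFn w) (y, s)) x := by
    intro j
    refine integral_congr_ae (ae_of_all _ fun x => ?_)
    simp only
    by_cases hx : (x, s) ∈ tsupport φ
    · rw [h1 h hc hh x fun y hy => hKφ x y s hs hx hy]
    · rw [dx_eq_zero j hφ hx]; simp
  have ibc : ∀ j, Integrable fun x => dx j φ (x, s) * velMol h w j (x, s)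
        * corr h (fun y => K.indicator (pressureFn w) (y, s)) x := fun j => by
    refine (ib j).mul_bdd (c := M * ∫ y, |K.indicator (pressureFn w) (y, s)|) ?_
      (ae_of_all _ fun x => abs_corr_le h2 hM x)
    rw [← mol_eq_corr he]
    exact (contDiff_mol hh hc h2.locallyIntegrable).continuous.aestronglyMeasurable
  rw [Finset.sum_congr rfl fun j _ => e2 j, ← integral_finsetSum _ fun j _ => ibc j]
  simp only [← Finset.sum_mul]
  -- The mollifier is moved from the pressure to `V · ∇φ`, so that the pressure stays fixed as the
  -- scale changes.
  exact integral_mul_corr_swap h2 hh.continuous hM ibs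

end LocalBalance
end EulerLocal
end

/-! ### Pointwise comparison of the mollified density with its limit. -/

noncomputable section
namespace EulerLocal

section DensityBound

variable {n : ℕ}

lemma IsMollifier.abs_integral_sub_le {h : Space n → ℝ} (hh : IsMollifier h) {f : Space n → ℝ}
    (hf : Continuous f) {c R : ℝ} (hR : ∀ ζ, ‖ζ‖ ≤ 1 → |f ζ - c| ≤ R) :
    |(∫ ζ, f ζ * h ζ) - c| ≤ R := by
  have hi : Integrable fun ζ => f ζ * h ζ :=
    (hf.mul hh.contDiff.continuous).integrable_of_hasCompactSupport hh.hasCompactSupport.mul_left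
  have e : (∫ ζ, f ζ * h ζ) - c = ∫ ζ, (f ζ * h ζ - c * h ζ) := by
    rw [integral_sub hi (hh.integrable.const_mul c), integral_const_mul, hh.integral_eq_one, mul_one]
  have e2 : R = ∫ ζ, R * h ζ := by rw [integral_const_mul, hh.integral_eq_one, mul_one]
  rw [e, e2]
  refine abs_integral_le_integral_abs.trans
    (integral_mono (hi.sub (hh.integrable.const_mul c)).abs (hh.integrable.const_mul R) fun ζ => ?_)
  simp only
  rw [← sub_mul, abs_mul, abs_of_nonneg (hh.nonneg ζ)]
  by_cases hζ : ‖ζ‖ ≤ 1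
  · exact mul_le_mul_of_nonneg_right (hR ζ hζ) (hh.nonneg ζ)
  · rw [hh.eq_zero ζ (not_le.1 hζ), mul_zero, mul_zero]

lemma exists_bound_derivs {φ : Space n × ℝ → ℝ} (hφ : ContDiff ℝ ∞ φ) (hφc : HasCompactSupport φ) :
    ∃ B, 0 ≤ B ∧ (∀ z, |φ z| ≤ B) ∧ (∀ z, |dt φ z| ≤ B) ∧ (∀ i z, |dx i φ z| ≤ B) ∧
      ∀ i (z : Space n × ℝ) (y : Space n), |dx i φ (z.1 - y, z.2) - dx i φ z| ≤ B * ‖y‖ := by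
  have hb : ∀ {F : Type} [NormedAddCommGroup F] {f : Space n × ℝ → F}, Continuous f →
      HasCompactSupport f → ∃ M, 0 ≤ M ∧ ∀ z, ‖f z‖ ≤ M := by
    intro F _ f hf hfc
    obtain ⟨M, hM⟩ := hfc.exists_bound_of_continuous hf
    exact ⟨M, (norm_nonneg _).trans (hM 0), hM⟩
  obtain ⟨B1, h1, hB1⟩ := hb hφ.continuous hφc
  obtain ⟨B2, h2, hB2⟩ := hb (continuous_dt hφ) (hasCompactSupport_dt hφ hφc)
  choose B3 h3 hB3 using fun i => hb (continuous_dx i hφ) (hasCompactSupport_dx i hφ hφc)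
  have hd : ∀ i, ContDiff ℝ 1 (dx i φ) := fun i => by
    rw [dx_eq_fderiv i hφ]
    exact ((hφ.fderiv_right (m := ∞) (by simp)).of_le (by exact_mod_cast le_top)).clm_apply
      contDiff_const
  choose B4 h4 hB4 using fun i => hb ((hd i).continuous_fderiv one_ne_zero)
    ((hasCompactSupport_dx i hφ hφc).fderiv ℝ)
  have s3 : 0 ≤ ∑ i, B3 i := Finset.sum_nonneg fun i _ => h3 i
  have s4 : 0 ≤ ∑ i, B4 i := Finset.sum_nonneg fun i _ => h4 i
  refine ⟨B1 + B2 + ∑ i, B3 i + ∑ i, B4 i, by positivity, fun z => (hB1 z).trans (by linarith),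
    fun z => (hB2 z).trans (by linarith), fun i z => (hB3 i z).trans ?_, fun i z y => ?_⟩
  · linarith [Finset.single_le_sum (fun i _ => h3 i) (Finset.mem_univ i)]
  · have h5 := convex_univ.norm_image_sub_le_of_norm_fderiv_le (𝕜 := ℝ) (f := dx i φ) (C := B4 i)
      (fun x _ => (hd i).differentiable one_ne_zero x) (fun x _ => hB4 i x) (mem_univ z)
      (mem_univ (z.1 - y, z.2))
    have h6 : ‖((z.1 - y, z.2) : Space n × ℝ) - z‖ = ‖y‖ := by
      rw [show ((z.1 - y, z.2) : Space n × ℝ) - z = (-y, 0) from Prod.ext (by simp) (by simp)]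
      simp [Prod.norm_def]
    rw [h6] at h5
    refine h5.trans (mul_le_mul_of_nonneg_right ?_ (norm_nonneg _))
    linarith [Finset.single_le_sum (fun i _ => h4 i) (Finset.mem_univ i)]

/-- The density of the local energy balance. -/
def locDensity (w : Space n × ℝ → Space n) (p : Space n × ℝ → ℝ) (φ : Space n × ℝ → ℝ)
    (z : Space n × ℝ) : ℝ :=
  ∑ j, (w z j ^ 2 * dt φ z + ∑ i, dx i φ z * (w z i * w z j ^ 2))
    + 2 * (p z * ∑ j, dx j φ z * w z j)

/-- Two errors occur: the mollified velocity at nearby points differs from `w z` by at most `R`, and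
the derivatives of `φ` vary by `O(ε)` over the support of the mollifier. The second, multiplied by
`‖w z‖`, is the reason for adding `ε F` to the amplitude later. -/
lemma abs_workMol_sub_le {h : Space n → ℝ} (hh : IsMollifier h) {φ : Space n × ℝ → ℝ}
    (hφ : ContDiff ℝ ∞ φ) {B : ℝ} (hB : 0 ≤ B) (hB1 : ∀ i z, |dx i φ z| ≤ B)
    (hB2 : ∀ i (z : Space n × ℝ) (y : Space n), |dx i φ (z.1 - y, z.2) - dx i φ z| ≤ B * ‖y‖)
    {w : Space n × ℝ → Space n} {z : Space n × ℝ} (hw : MemLp (fun x => w (x, z.2)) 2)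
    {ε R : ℝ} (hε : 0 < ε)
    (hR : ∀ j (η : Space n), ‖η‖ ≤ 1 →
      |velMol (dil ε h) w j (z.1 - ε • η, z.2) - w z j| ≤ R) :
    |workMol (dil ε h) w φ z - ∑ j, dx j φ z * w z j| ≤ n * (B * (R + ε * ‖w z‖)) := by
  rw [workMol, mol_dil h _ hε]
  have hV := contDiff_velMol (contDiff_dil hh.contDiff ε)
    (hasCompactSupport_dil hh.hasCompactSupport hε) hw
  refine hh.abs_integral_sub_le (continuous_finsetSum _ fun j _ => ?_) fun ζ hζ => ?_
  · refine ((continuous_dx j hφ).comp (by fun_prop)).mul ?_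
    exact (hV j).continuous.comp (by fun_prop : Continuous fun ζ : Space n => z.1 - ε • ζ)
  · rw [← Finset.sum_sub_distrib]
    refine (Finset.abs_sum_le_sum_abs _ _).trans ?_
    have : (n : ℝ) * (B * (R + ε * ‖w z‖)) = ∑ _j : Fin n, B * (R + ε * ‖w z‖) := by simp
    rw [this]
    refine Finset.sum_le_sum fun j _ => ?_
    have e : dx j φ (z.1 - ε • ζ, z.2) * velMol (dil ε h) w j (z.1 - ε • ζ, z.2)
        - dx j φ z * w z j
        = dx j φ (z.1 - ε • ζ, z.2) * (velMol (dil ε h) w j (z.1 - ε • ζ, z.2) - w z j)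
          + (dx j φ (z.1 - ε • ζ, z.2) - dx j φ z) * w z j := by ring
    rw [e, mul_add]
    refine (abs_add_le _ _).trans (add_le_add ?_ ?_)
    · rw [abs_mul]
      exact mul_le_mul (hB1 _ _) (hR j ζ hζ) (abs_nonneg _) hB
    · rw [abs_mul, ← mul_assoc]
      refine mul_le_mul ((hB2 j z _).trans ?_) (abs_coord_le _ _) (abs_nonneg _) (by positivity)
      refine mul_le_mul_of_nonneg_left ?_ hB
      rw [norm_smul, Real.norm_of_nonneg hε.le]
      exact mul_le_of_le_one_right hε.le hζ

lemma abs_quadratic_le {A B F α w d τ : ℝ} (hA : 1 ≤ A) (hB : 0 ≤ B) (hF : 1 ≤ F) (hα : 0 ≤ α)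
    (hw : |w| ≤ F) (hd : |d| ≤ A * α) (hτ : |τ| ≤ B) :
    |(w + d) ^ 2 * τ - w ^ 2 * τ| ≤ 2 * (B * A ^ 3 * (F ^ 2 * α + F * α ^ 2 + α ^ 3)) := by
  have e : (w + d) ^ 2 * τ - w ^ 2 * τ = τ * (2 * w * d + d ^ 2) := by ring
  have hA0 : 0 ≤ A := by linarith
  have h1 : |2 * w * d + d ^ 2| ≤ 2 * F * (A * α) + (A * α) ^ 2 := by
    refine (abs_add_le _ _).trans (add_le_add ?_ ?_)
    · rw [abs_mul, abs_mul, abs_two]; gcongr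
    · rw [abs_pow]; gcongr
  have h2 : 2 * F * (A * α) + (A * α) ^ 2 ≤ 2 * (A ^ 3 * (F ^ 2 * α + F * α ^ 2 + α ^ 3)) := by
    have g1 : F * (A * α) ≤ A ^ 3 * (F ^ 2 * α) := by
      have : F * (A * α) = A * (F * α) := by ring
      rw [this]
      have a1 : A ≤ A ^ 3 := le_self_pow₀ hA (by norm_num)
      have a2 : F ≤ F ^ 2 := le_self_pow₀ hF (by norm_num)
      gcongr
    have g2 : (A * α) ^ 2 ≤ A ^ 3 * (F * α ^ 2) := by
      have a1 : A ^ 2 ≤ A ^ 3 := pow_le_pow_right₀ hA (by norm_num)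
      have a2 : α ^ 2 ≤ F * α ^ 2 := le_mul_of_one_le_left (by positivity) hF
      calc (A * α) ^ 2 = A ^ 2 * α ^ 2 := by ring
        _ ≤ A ^ 3 * (F * α ^ 2) := by gcongr
    have g3 : 0 ≤ A ^ 3 * (F * α ^ 2) := by positivity
    have g4 : 0 ≤ A ^ 3 * α ^ 3 := by positivity
    nlinarith
  rw [e, abs_mul]
  calc |τ| * |2 * w * d + d ^ 2| ≤ B * (2 * (A ^ 3 * (F ^ 2 * α + F * α ^ 2 + α ^ 3))) :=
        mul_le_mul hτ (h1.trans h2) (abs_nonneg _) hB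
    _ = _ := by ring

/-- The terms without increments cancel: the stress counts twice, and the transport term and the
limit once each. Every remaining term contains an increment. -/
lemma abs_cubic_le {A B F α wi wj di dj e x : ℝ} (hA : 1 ≤ A) (hB : 0 ≤ B) (hF : 1 ≤ F)
    (hα : 0 ≤ α) (hwi : |wi| ≤ F) (hwj : |wj| ≤ F) (hdi : |di| ≤ A * α) (hdj : |dj| ≤ A * α)
    (he : |e| ≤ A * α ^ 2) (hx : |x| ≤ B) :
    |2 * (x * (wj + dj) * (wi * wj + wi * dj + wj * di + e)) - x * ((wi + di) * (wj + dj) ^ 2)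
      - x * (wi * wj ^ 2)| ≤ 3 * (B * A ^ 3 * (F ^ 2 * α + F * α ^ 2 + α ^ 3)) := by
  have hA0 : 0 ≤ A := by linarith
  have hF0 : 0 ≤ F := by linarith
  have e1 : 2 * (x * (wj + dj) * (wi * wj + wi * dj + wj * di + e)) - x * ((wi + di) * (wj + dj) ^ 2)
      - x * (wi * wj ^ 2)
      = x * (2 * wi * wj * dj + wj ^ 2 * di + 2 * wj * e + wi * dj ^ 2 + 2 * dj * e
        - di * dj ^ 2) := by ring
  have h1 : |2 * wi * wj * dj + wj ^ 2 * di + 2 * wj * e + wi * dj ^ 2 + 2 * dj * e - di * dj ^ 2|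
      ≤ 2 * F * F * (A * α) + F ^ 2 * (A * α) + 2 * F * (A * α ^ 2) + F * (A * α) ^ 2
        + 2 * (A * α) * (A * α ^ 2) + (A * α) * (A * α) ^ 2 := by
    refine (abs_sub _ _).trans (add_le_add ((abs_add_le _ _).trans (add_le_add
      ((abs_add_le _ _).trans (add_le_add ((abs_add_le _ _).trans (add_le_add
      ((abs_add_le _ _).trans (add_le_add ?_ ?_)) ?_)) ?_)) ?_)) ?_)
    all_goals simp only [abs_mul, abs_pow, abs_two]; gcongr
  have a1 : A ≤ A ^ 3 := le_self_pow₀ hA (by norm_num)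
  have a2 : A ^ 2 ≤ A ^ 3 := pow_le_pow_right₀ hA (by norm_num)
  have g1 : A * (F ^ 2 * α) ≤ A ^ 3 * (F ^ 2 * α) := by gcongr
  have g2 : A * (F * α ^ 2) ≤ A ^ 3 * (F * α ^ 2) := by gcongr
  have g3 : A ^ 2 * (F * α ^ 2) ≤ A ^ 3 * (F * α ^ 2) := by gcongr
  have g4 : A ^ 2 * α ^ 3 ≤ A ^ 3 * α ^ 3 := by gcongr
  have h2 : 2 * F * F * (A * α) + F ^ 2 * (A * α) + 2 * F * (A * α ^ 2) + F * (A * α) ^ 2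
        + 2 * (A * α) * (A * α ^ 2) + (A * α) * (A * α) ^ 2
      ≤ 3 * (A ^ 3 * (F ^ 2 * α + F * α ^ 2 + α ^ 3)) := by linarith
  rw [e1, abs_mul]
  calc |x| * _ ≤ B * (3 * (A ^ 3 * (F ^ 2 * α + F * α ^ 2 + α ^ 3))) :=
        mul_le_mul hx (h1.trans h2) (abs_nonneg _) hB
    _ = _ := by ring

/-- The Constantin–E–Titi estimate at a point: a gradient of size `α/ε` times a covariance of size
`α²`. -/
lemma abs_defect_le {A B α ε di dj e f D : ℝ} (hA : 1 ≤ A) (hB : 0 ≤ B) (hα : 0 ≤ α) (hε : 0 < ε)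
    (hdi : |di| ≤ A * α) (hdj : |dj| ≤ A * α) (he : |e| ≤ A * α ^ 2) (hf : |f| ≤ B)
    (hD : |D| ≤ A * α / ε) :
    |2 * (f * D * (e - di * dj))| ≤ 4 * (B * A ^ 4 * (α ^ 3 / ε)) := by
  have hA0 : 0 ≤ A := by linarith
  have h1 : |e - di * dj| ≤ 2 * (A ^ 3 * α ^ 2) := by
    have a1 : A ≤ A ^ 3 := le_self_pow₀ hA (by norm_num)
    have a2 : A ^ 2 ≤ A ^ 3 := pow_le_pow_right₀ hA (by norm_num)
    calc |e - di * dj| ≤ A * α ^ 2 + (A * α) * (A * α) := by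
          refine (abs_sub _ _).trans (add_le_add he ?_)
          rw [abs_mul]; gcongr
      _ = A * α ^ 2 + A ^ 2 * α ^ 2 := by ring
      _ ≤ A ^ 3 * α ^ 2 + A ^ 3 * α ^ 2 := by gcongr
      _ = _ := by ring
  rw [abs_mul, abs_mul, abs_mul, abs_two]
  calc 2 * (|f| * |D| * |e - di * dj|) ≤ 2 * (B * (A * α / ε) * (2 * (A ^ 3 * α ^ 2))) := by gcongr
    _ = _ := by ring

/-- Pointwise comparison of the mollified density with the limit density. -/
lemma IsMollifier.exists_density_bound {h : Space n → ℝ} (hh : IsMollifier h)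
    {φ : Space n × ℝ → ℝ} (hφ : ContDiff ℝ ∞ φ) (hφc : HasCompactSupport φ) :
    ∃ c, 0 ≤ c ∧ ∀ {T C : ℝ} {u w : Space n × ℝ → Space n}, IsVersion T u w C → ∀ {ε : ℝ}, 0 < ε →
      ∀ {z : Space n × ℝ}, incr w ε z < ⊤ → ∀ (p : Space n × ℝ → ℝ) {F : ℝ}, 1 ≤ F → ‖w z‖ ≤ F →
      |p z| ≤ F ^ 2 →
      |fluxMol (dil ε h) w φ z + 2 * (p z * workMol (dil ε h) w φ z) - locDensity w p φ z|
        ≤ c * (F ^ 2 * (amp w ε z + ε * F) + F * (amp w ε z + ε * F) ^ 2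
          + (amp w ε z + ε * F) ^ 3) + c * (amp w ε z ^ 3 / ε) := by
  obtain ⟨A', hA'0, hA'⟩ := hh.exists_expansion
  obtain ⟨B, hB, hB1, hB2, hB3, hB4⟩ := exists_bound_derivs hφ hφc
  -- With `A ≥ 1` and `F ≥ 1` all lower powers are absorbed into the top ones.
  set A := A' + 1 with hAdef
  have hA : 1 ≤ A := by linarith
  have hA0 : 0 ≤ A := by linarith
  refine ⟨(n * (2 * (B * A ^ 3)) + n * (n * (3 * (B * A ^ 3))) + 2 * (n * (B * A)))
    + n * (n * (4 * (B * A ^ 4))), by positivity, ?_⟩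
  intro T C u w hw ε hε z hz p F hF hwF hpF
  obtain ⟨d, e, hd, he, hV, hS, hD, hW⟩ := hA' hw hε hz
  set α := amp w ε z with hα
  have hα0 : 0 ≤ α := amp_nonneg w ε z
  have hAA : ∀ X, 0 ≤ X → A' * X ≤ A * X := fun X hX => by gcongr; linarith
  replace hd : ∀ i, |d i| ≤ A * α := fun i => (hd i).trans (hAA _ hα0)
  replace he : ∀ i j, |e i j| ≤ A * α ^ 2 := fun i j => (he i j).trans (hAA _ (by positivity))
  replace hD : ∀ i j, |dx i (velMol (dil ε h) w j) z| ≤ A * α / ε := fun i j =>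
    (hD i j).trans (by gcongr; linarith)
  have hwi : ∀ i, |w z i| ≤ F := fun i => (abs_coord_le _ _).trans hwF
  have hF0 : 0 ≤ F := by linarith
  -- One perturbation collects the increments of the velocity and the variation of `∇φ`.
  set a := α + ε * F with ha
  have hαa : α ≤ a := by have : 0 ≤ ε * F := by positivity
                         linarith
  set Q := F ^ 2 * α + F * α ^ 2 + α ^ 3 with hQ
  set Qa := F ^ 2 * a + F * a ^ 2 + a ^ 3 with hQa
  have hQQ : Q ≤ Qa := by rw [hQ, hQa]; gcongr
  have hQa0 : 0 ≤ Qa := by have := hα0.trans hαa; positivity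
  have hflux : |fluxMol (dil ε h) w φ z
      - ∑ j, (w z j ^ 2 * dt φ z + ∑ i, dx i φ z * (w z i * w z j ^ 2))|
      ≤ n * (2 * (B * A ^ 3 * Q)) + n * (n * (3 * (B * A ^ 3 * Q) + 4 * (B * A ^ 4 * (α ^ 3 / ε)))) := by
    rw [fluxMol, ← Finset.sum_sub_distrib]
    refine (Finset.abs_sum_le_sum_abs _ _).trans ?_
    have hn : ∀ X : ℝ, (n : ℝ) * X = ∑ _j : Fin n, X := fun X => by simp
    rw [← mul_add, hn]
    refine Finset.sum_le_sum fun j _ => ?_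
    rw [add_sub_add_comm, ← Finset.sum_sub_distrib]
    refine (abs_add_le _ _).trans (add_le_add ?_ ?_)
    · rw [hV]
      exact abs_quadratic_le hA hB hF hα0 (hwi j) (hd j) (hB2 z)
    · refine (Finset.abs_sum_le_sum_abs _ _).trans ?_
      rw [hn]
      refine Finset.sum_le_sum fun i _ => ?_
      have e1 : strMol (dil ε h) w i j z - velMol (dil ε h) w i z * velMol (dil ε h) w j z
          = e i j - d i * d j := by rw [hS, hV, hV]; ring
      rw [e1, hS, hV, hV]
      have e2 : ∀ X Y Z U : ℝ, X + Y - Z - U = (X - Z - U) + Y := fun X Y Z U => by ring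
      rw [e2]
      exact (abs_add_le _ _).trans (add_le_add
        (abs_cubic_le hA hB hF hα0 (hwi i) (hwi j) (hd i) (hd j) (he i j) (hB3 i z))
        (abs_defect_le hA hB hα0 hε (hd i) (hd j) (he i j) (hB1 z) (hD i j)))
  have hwork : |2 * (p z * (workMol (dil ε h) w φ z - ∑ j, dx j φ z * w z j))|
      ≤ 2 * (n * (B * A)) * (F ^ 2 * a) := by
    have h1 := abs_workMol_sub_le hh hφ hB hB3 hB4 (hw.memLp z.2) hε hW
    rw [abs_mul, abs_mul, abs_two]
    have h2 : A' * α + ε * ‖w z‖ ≤ A * a := by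
      have : ε * ‖w z‖ ≤ ε * F := by gcongr
      have h3 : ε * F ≤ A * (ε * F) := le_mul_of_one_le_left (by positivity) hA
      have h4 := hAA α hα0
      rw [ha]; linarith
    calc 2 * (|p z| * |workMol (dil ε h) w φ z - ∑ j, dx j φ z * w z j|)
        ≤ 2 * (F ^ 2 * (n * (B * (A * a)))) := by
          refine mul_le_mul_of_nonneg_left (mul_le_mul hpF (h1.trans ?_) (abs_nonneg _)
            (by positivity)) (by norm_num)
          gcongr
      _ = _ := by ring
  have e3 : fluxMol (dil ε h) w φ z + 2 * (p z * workMol (dil ε h) w φ z) - locDensity w p φ z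
      = (fluxMol (dil ε h) w φ z
        - ∑ j, (w z j ^ 2 * dt φ z + ∑ i, dx i φ z * (w z i * w z j ^ 2)))
        + 2 * (p z * (workMol (dil ε h) w φ z - ∑ j, dx j φ z * w z j)) := by
    rw [locDensity]; ring
  rw [e3]
  refine (abs_add_le _ _).trans ((add_le_add hflux hwork).trans ?_)
  have hFa : F ^ 2 * a ≤ Qa := by
    have := hα0.trans hαa
    have h1 : 0 ≤ F * a ^ 2 := by positivity
    have h2 : 0 ≤ a ^ 3 := by positivity
    rw [hQa]; linarith
  have t1 : (n : ℝ) * (2 * (B * A ^ 3 * Q)) ≤ n * (2 * (B * A ^ 3)) * Qa := by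
    rw [show (n : ℝ) * (2 * (B * A ^ 3 * Q)) = n * (2 * (B * A ^ 3)) * Q by ring]; gcongr
  have t2 : (n : ℝ) * (n * (3 * (B * A ^ 3 * Q))) ≤ n * (n * (3 * (B * A ^ 3))) * Qa := by
    rw [show (n : ℝ) * (n * (3 * (B * A ^ 3 * Q))) = n * (n * (3 * (B * A ^ 3))) * Q by ring]; gcongr
  have t3 : 2 * (n * (B * A)) * (F ^ 2 * a) ≤ 2 * (n * (B * A)) * Qa := by gcongr
  have t4 : 0 ≤ (n : ℝ) * (n * (4 * (B * A ^ 4))) * Qa := by positivity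
  have t5 : 0 ≤ (n * (2 * (B * A ^ 3)) + n * (n * (3 * (B * A ^ 3))) + 2 * (n * (B * A)))
    * (α ^ 3 / ε) := by positivity
  linarith

end DensityBound
end EulerLocal
end

/-! ### Convergence in `L¹` of the mollified densities. -/

noncomputable section
namespace EulerLocal

section DensityLimit

variable {n : ℕ}

/-- Here the full strength `o(|y|)` of the regularity is needed: `O(|y|)` would only bound the
defect. -/
lemma CubicRegularOn.tendsto_integral_amp {w : Space n × ℝ → Space n} {K : Set (Space n × ℝ)}
    (hw : StronglyMeasurable w) (hK : CubicRegularOn w K) {e : ℕ → ℝ} (he0 : ∀ m, 0 < e m)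
    (he : Tendsto e atTop (𝓝 0)) :
    (∀ᶠ m in atTop, (∀ᵐ z ∂volume.restrict K, incr w (e m) z < ⊤) ∧
      IntegrableOn (fun z => amp w (e m) z ^ 3) K) ∧
    Tendsto (fun m => ∫ z in K, amp w (e m) z ^ 3 / e m) atTop (𝓝 0) := by
  have hev : ∀ η, 0 < η → ∀ᶠ m in atTop,
      ∫⁻ z in K, incr w (e m) z ≤ ENNReal.ofReal (η * e m) := by
    intro η hη
    obtain ⟨r, hr, h⟩ := hK.exists_lintegral_incr_le hw hη
    filter_upwards [he.eventually_lt_const hr] with m hm using h _ (he0 m) hm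
  have hint : ∀ m, ∫⁻ z in K, incr w (e m) z < ⊤ →
      (∀ᵐ z ∂volume.restrict K, incr w (e m) z < ⊤) ∧
      IntegrableOn (fun z => amp w (e m) z ^ 3) K ∧
      ∫ z in K, amp w (e m) z ^ 3 = (∫⁻ z in K, incr w (e m) z).toReal := by
    intro m hm
    have hae := ae_lt_top (measurable_incr hw (e m)) hm.ne
    refine ⟨hae, ?_, ?_⟩
    · simp only [amp_pow_three]
      exact integrable_toReal_of_lintegral_ne_top (measurable_incr hw (e m)).aemeasurable hm.ne
    · simp only [amp_pow_three]
      exact integral_toReal (measurable_incr hw (e m)).aemeasurable hae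
  refine ⟨?_, ?_⟩
  · filter_upwards [hev 1 one_pos] with m hm
    have h := hint m (hm.trans_lt ENNReal.ofReal_lt_top)
    exact ⟨h.1, h.2.1⟩
  · rw [Metric.tendsto_atTop']
    intro η hη
    obtain ⟨N, hN⟩ := eventually_atTop.1 (hev (η / 2) (by positivity))
    refine ⟨N, fun m hm => ?_⟩
    have h1 := hN m hm.le
    have h2 := hint m (h1.trans_lt ENNReal.ofReal_lt_top)
    rw [integral_div, h2.2.2, Real.dist_eq, sub_zero,
      abs_of_nonneg (div_nonneg ENNReal.toReal_nonneg (he0 m).le), div_lt_iff₀ (he0 m)]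
    have h3 : (∫⁻ z in K, incr w (e m) z).toReal ≤ η / 2 * e m :=
      ENNReal.toReal_le_of_le_ofReal (by have := he0 m; positivity) h1
    have := mul_pos hη (he0 m)
    linarith

/-- A dominating function for the velocity and the pressure. -/
def envelope (w : Space n × ℝ → Space n) (K : Set (Space n × ℝ)) (z : Space n × ℝ) : ℝ :=
  ‖w z‖ + 1 + |K.indicator (pressureFn w) z| ^ (1 / 2 : ℝ)

lemma one_le_envelope (w : Space n × ℝ → Space n) (K : Set (Space n × ℝ)) (z : Space n × ℝ) :
    1 ≤ envelope w K z := by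
  have : 0 ≤ |K.indicator (pressureFn w) z| ^ (1 / 2 : ℝ) := by positivity
  have := norm_nonneg (w z)
  unfold envelope
  linarith

lemma norm_le_envelope (w : Space n × ℝ → Space n) (K : Set (Space n × ℝ)) (z : Space n × ℝ) :
    ‖w z‖ ≤ envelope w K z := by
  have : 0 ≤ |K.indicator (pressureFn w) z| ^ (1 / 2 : ℝ) := by positivity
  unfold envelope
  linarith

/-- The square root in the envelope puts the pressure, in `L^{3/2}` on `K`, on the same footing as
`|w|²`, while the envelope itself stays in `L³` on `K`. -/
lemma abs_pressure_le_envelope (w : Space n × ℝ → Space n) (K : Set (Space n × ℝ))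
    (z : Space n × ℝ) : |K.indicator (pressureFn w) z| ≤ envelope w K z ^ 2 := by
  have h1 : |K.indicator (pressureFn w) z|
      = (|K.indicator (pressureFn w) z| ^ (1 / 2 : ℝ)) ^ 2 := by
    rw [← Real.rpow_natCast, ← Real.rpow_mul (abs_nonneg _)]
    norm_num
  rw [h1]
  have := norm_nonneg (w z)
  unfold envelope
  gcongr
  linarith

lemma CubicRegularOn.integrableOn_envelope {T C : ℝ} {u w : Space n × ℝ → Space n}
    (hw : IsVersion T u w C) {K : Set (Space n × ℝ)} (hKc : IsCompact K)
    (hK : CubicRegularOn w K) : IntegrableOn (fun z => envelope w K z ^ 3) K := by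
  have : IsFiniteMeasure (volume.restrict K) := ⟨by simpa using hKc.measure_lt_top⟩
  have h1 : MemLp (fun z => ‖w z‖) 3 (volume.restrict K) := by
    refine MemLp.norm ⟨hw.stronglyMeasurable.aestronglyMeasurable, ?_⟩
    rw [eLpNorm_lt_top_iff_lintegral_rpow_enorm_lt_top (by norm_num) (by norm_num)]
    simpa using hK.1
  have h2 : MemLp (fun z => |K.indicator (pressureFn w) z| ^ (1 / 2 : ℝ)) 3
      (volume.restrict K) := by
    have h3 : MemLp (K.indicator (pressureFn w)) (3 / 2) (volume.restrict K) :=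
      (hK.memLp_pressureFn hw hKc).ae_eq (by
        filter_upwards [ae_restrict_mem hKc.measurableSet] with z hz
        rw [indicator_of_mem hz])
    have h4 := h3.norm_rpow_div (1 / 2)
    have e1 : (3 / 2 / (1 / 2) : ENNReal) = 3 := by
      rw [one_div, div_eq_mul_inv, inv_inv]
      exact ENNReal.div_mul_cancel (by simp) (by simp)
    rw [e1] at h4
    simpa using h4
  have h5 : MemLp (envelope w K) 3 (volume.restrict K) := (h1.add (memLp_const 1)).add h2
  have h6 := h5.integrable_norm_pow (by norm_num)
  refine h6.congr (ae_of_all _ fun z => ?_)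
  simp [Real.norm_of_nonneg (zero_le_one.trans (one_le_envelope w K z))]

lemma stronglyMeasurable_fluxMol {h : Space n → ℝ} (hh : ContDiff ℝ ∞ h) (hc : HasCompactSupport h)
    {T C : ℝ} {u w : Space n × ℝ → Space n} (hw : IsVersion T u w C) {φ : Space n × ℝ → ℝ}
    (hφ : ContDiff ℝ ∞ φ) : StronglyMeasurable (fluxMol h w φ) := by
  have hV := stronglyMeasurable_velMol hh.continuous hw.stronglyMeasurable
  have hS := stronglyMeasurable_strMol hh.continuous hw.stronglyMeasurable
  have hx := fun i => (continuous_dx i hφ).stronglyMeasurable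
  have hD : ∀ i j, StronglyMeasurable (dx i (velMol h w j)) := fun i j => by
    have e : dx i (velMol h w j) = fun z : Space n × ℝ =>
        mol (fun y => fderiv ℝ h y (stdVec i)) (fun y => w (y, z.2) j) z.1 := funext fun z =>
      fderiv_mol_apply hh hc (MemLp.locallyIntegrable_two (memLp_coord (hw.memLp z.2) j)) z.1 _
    rw [e]
    exact stronglyMeasurable_mol ((hh.continuous_fderiv (by simp)).clm_apply continuous_const)
      (stronglyMeasurable_coord hw.stronglyMeasurable j)
  refine Finset.stronglyMeasurable_fun_sum _ fun j _ => StronglyMeasurable.add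
    (((hV j).pow 2).mul (continuous_dt hφ).stronglyMeasurable)
    (Finset.stronglyMeasurable_fun_sum _ fun i _ => ?_)
  exact (((((hx i).mul (hV j)).mul (hS i j)).const_mul 2).add
    (((hφ.continuous.stronglyMeasurable.mul (hD i j)).mul
      ((hS i j).sub ((hV i).mul (hV j)))).const_mul 2)).sub ((hx i).mul ((hV i).mul ((hV j).pow 2)))

lemma stronglyMeasurable_workMol {h : Space n → ℝ} (hh : Continuous h)
    {w : Space n × ℝ → Space n} (hw : StronglyMeasurable w) {φ : Space n × ℝ → ℝ}
    (hφ : ContDiff ℝ ∞ φ) : StronglyMeasurable (workMol h w φ) :=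
  stronglyMeasurable_mol hh (f := fun z => ∑ j, dx j φ z * velMol h w j z)
    (Finset.stronglyMeasurable_fun_sum _ fun j _ =>
      (continuous_dx j hφ).stronglyMeasurable.mul (stronglyMeasurable_velMol hh hw j))

lemma stronglyMeasurable_locDensity {w : Space n × ℝ → Space n} (hw : StronglyMeasurable w)
    {p : Space n × ℝ → ℝ} (hp : StronglyMeasurable p) {φ : Space n × ℝ → ℝ}
    (hφ : ContDiff ℝ ∞ φ) : StronglyMeasurable (locDensity w p φ) := by
  have hW := stronglyMeasurable_coord hw
  have hx := fun i => (continuous_dx i hφ).stronglyMeasurable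
  refine StronglyMeasurable.add (Finset.stronglyMeasurable_fun_sum _ fun j _ =>
    StronglyMeasurable.add (((hW j).pow 2).mul (continuous_dt hφ).stronglyMeasurable)
    (Finset.stronglyMeasurable_fun_sum _ fun i _ => (hx i).mul ((hW i).mul ((hW j).pow 2)))) ?_
  exact ((hp.mul (Finset.stronglyMeasurable_fun_sum _ fun j _ => (hx j).mul (hW j)))).const_mul 2

lemma CubicRegularOn.integrableOn_locDensity {T C : ℝ} {u w : Space n × ℝ → Space n}
    (hw : IsVersion T u w C) {K : Set (Space n × ℝ)} (hKc : IsCompact K)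
    (hK : CubicRegularOn w K) {φ : Space n × ℝ → ℝ} (hφ : ContDiff ℝ ∞ φ)
    (hφc : HasCompactSupport φ) :
    IntegrableOn (locDensity w (K.indicator (pressureFn w)) φ) K := by
  obtain ⟨B, hB, -, hB2, hB3, -⟩ := exists_bound_derivs hφ hφc
  refine ((hK.integrableOn_envelope hw hKc).const_mul (n * B + n * (n * B) + 2 * (n * B))).mono'
    (stronglyMeasurable_locDensity hw.stronglyMeasurable ((stronglyMeasurable_pressureFn
      hw.stronglyMeasurable).indicator hKc.measurableSet) hφ).aestronglyMeasurable
    (ae_of_all _ fun z => ?_)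
  set F := envelope w K z with hF
  have hF1 : 1 ≤ F := one_le_envelope w K z
  have hF0 : 0 ≤ F := by linarith
  have hwi : ∀ i, |w z i| ≤ F := fun i => (abs_coord_le _ _).trans (norm_le_envelope w K z)
  have hp : |K.indicator (pressureFn w) z| ≤ F ^ 2 := abs_pressure_le_envelope w K z
  have hn : ∀ X : ℝ, (n : ℝ) * X = ∑ _j : Fin n, X := fun X => by simp
  have hF23 : F ^ 2 ≤ F ^ 3 := pow_le_pow_right₀ hF1 (by norm_num)
  rw [Real.norm_eq_abs, locDensity]
  have e : (n * B + n * (n * B) + 2 * (n * B)) * F ^ 3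
      = n * (B * F ^ 3 + n * (B * F ^ 3)) + 2 * (F ^ 2 * (n * (B * F))) := by ring
  rw [e]
  refine (abs_add_le _ _).trans (add_le_add ?_ ?_)
  · rw [hn]
    refine (Finset.abs_sum_le_sum_abs _ _).trans (Finset.sum_le_sum fun j _ =>
      (abs_add_le _ _).trans (add_le_add ?_ ?_))
    · rw [abs_mul, abs_pow, mul_comm]
      refine mul_le_mul (hB2 z) (le_trans ?_ hF23) (by positivity) hB
      gcongr
      exact hwi j
    · rw [hn]
      refine (Finset.abs_sum_le_sum_abs _ _).trans (Finset.sum_le_sum fun i _ => ?_)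
      rw [abs_mul, abs_mul, abs_pow]
      refine mul_le_mul (hB3 i z) ?_ (by positivity) hB
      calc |w z i| * |w z j| ^ 2 ≤ F * F ^ 2 := by gcongr; exacts [hwi i, hwi j]
        _ = F ^ 3 := by ring
  · rw [abs_mul, abs_mul, abs_two]
    refine mul_le_mul_of_nonneg_left (mul_le_mul hp ?_ (abs_nonneg _) (by positivity)) (by norm_num)
    rw [hn]
    refine (Finset.abs_sum_le_sum_abs _ _).trans (Finset.sum_le_sum fun j _ => ?_)
    rw [abs_mul]
    exact mul_le_mul (hB3 j z) (hwi j) (abs_nonneg _) hB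

/-- `L¹` convergence of the mollified densities on a regular compact set. -/
lemma CubicRegularOn.tendsto_integral_density {T C : ℝ} {u w : Space n × ℝ → Space n}
    (hw : IsVersion T u w C) {K : Set (Space n × ℝ)} (hKc : IsCompact K)
    (hK : CubicRegularOn w K) {h : Space n → ℝ} (hh : IsMollifier h)
    {φ : Space n × ℝ → ℝ} (hφ : ContDiff ℝ ∞ φ) (hφc : HasCompactSupport φ)
    {e : ℕ → ℝ} (he0 : ∀ m, 0 < e m) (he : Tendsto e atTop (𝓝 0)) :
    (∀ᶠ m in atTop, IntegrableOn (fun z => fluxMol (dil (e m) h) w φ z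
      + 2 * (K.indicator (pressureFn w) z * workMol (dil (e m) h) w φ z)
      - locDensity w (K.indicator (pressureFn w)) φ z) K) ∧
    Tendsto (fun m => ∫ z in K, |fluxMol (dil (e m) h) w φ z
      + 2 * (K.indicator (pressureFn w) z * workMol (dil (e m) h) w φ z)
      - locDensity w (K.indicator (pressureFn w)) φ z|) atTop (𝓝 0) := by
  obtain ⟨c, hc, hbd⟩ := hh.exists_density_bound hφ hφc
  set F := envelope w K with hF
  set G : ℕ → Space n × ℝ → ℝ := fun m z => fluxMol (dil (e m) h) w φ z
      + 2 * (K.indicator (pressureFn w) z * workMol (dil (e m) h) w φ z)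
      - locDensity w (K.indicator (pressureFn w)) φ z with hG
  set a : ℕ → Space n × ℝ → ℝ := fun m z => amp w (e m) z + e m * F z with ha
  have hF1 : ∀ z, 1 ≤ F z := one_le_envelope w K
  have hF0 : ∀ z, 0 ≤ F z := fun z => zero_le_one.trans (hF1 z)
  have hF3 : IntegrableOn (fun z => F z ^ 3) K := hK.integrableOn_envelope hw hKc
  have ha0 : ∀ m z, 0 ≤ a m z := fun m z =>
    add_nonneg (amp_nonneg _ _ _) (mul_nonneg (he0 m).le (hF0 z))
  obtain ⟨hev, hlim⟩ := hK.tendsto_integral_amp hw.stronglyMeasurable he0 he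
  have hpm : StronglyMeasurable (K.indicator (pressureFn w)) :=
    (stronglyMeasurable_pressureFn hw.stronglyMeasurable).indicator hKc.measurableSet
  have hFm : StronglyMeasurable F :=
    (hw.stronglyMeasurable.norm.add stronglyMeasurable_const).add
      (hpm.norm.measurable.pow_const _).stronglyMeasurable
  have ham : ∀ m, StronglyMeasurable (a m) := fun m =>
    (measurable_amp hw.stronglyMeasurable (e m)).stronglyMeasurable.add (hFm.const_mul (e m))
  have hGm : ∀ m, StronglyMeasurable (G m) := fun m => by
    have h1 := contDiff_dil hh.contDiff (e m)
    have h2 := hasCompactSupport_dil hh.hasCompactSupport (he0 m)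
    exact ((stronglyMeasurable_fluxMol h1 h2 hw hφ).add ((hpm.mul (stronglyMeasurable_workMol
      h1.continuous hw.stronglyMeasurable hφ)).const_mul 2)).sub
      (stronglyMeasurable_locDensity hw.stronglyMeasurable hpm hφ)
  have hale : ∀ m z, a m z ^ 3 ≤ 4 * (amp w (e m) z ^ 3 + e m ^ 3 * F z ^ 3) := by
    intro m z
    have h1 := amp_nonneg w (e m) z
    have h2 := mul_nonneg (he0 m).le (hF0 z)
    have h3 : 0 ≤ (amp w (e m) z + e m * F z) * (amp w (e m) z - e m * F z) ^ 2 := by positivity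
    simp only [ha]
    nlinarith
  have haI : ∀ᶠ m in atTop, IntegrableOn (fun z => a m z ^ 3) K := by
    filter_upwards [hev] with m hm
    refine Integrable.mono' ((hm.2.add (hF3.const_mul (e m ^ 3))).const_mul 4)
      ((ham m).pow 3).aestronglyMeasurable (ae_of_all _ fun z => ?_)
    rw [Real.norm_of_nonneg (pow_nonneg (ha0 m z) 3)]
    exact hale m z
  have hal : Tendsto (fun m => ∫ z in K, a m z ^ 3) atTop (𝓝 0) := by
    have h1 : Tendsto (fun m => 4 * ((∫ z in K, amp w (e m) z ^ 3 / e m) * e m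
        + e m ^ 3 * ∫ z in K, F z ^ 3)) atTop (𝓝 0) := by
      have := ((hlim.mul he).add ((he.pow 3).mul_const (∫ z in K, F z ^ 3))).const_mul 4
      simpa using this
    refine squeeze_zero' (Eventually.of_forall fun m => integral_nonneg fun z =>
      pow_nonneg (ha0 m z) 3) ?_ h1
    filter_upwards [hev, haI] with m hm hm2
    refine (integral_mono hm2 ((hm.2.add (hF3.const_mul (e m ^ 3))).const_mul 4)
      (hale m)).trans (le_of_eq ?_)
    rw [integral_const_mul]
    congr 1
    have := integral_add hm.2 (hF3.const_mul (e m ^ 3))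
    refine this.trans ?_
    rw [integral_const_mul, integral_div, div_mul_cancel₀ _ (he0 m).ne']
  set Q : ℕ → Space n × ℝ → ℝ := fun m z =>
    c * (F z ^ 2 * a m z + F z * a m z ^ 2 + a m z ^ 3) with hQ
  have hQ0 : ∀ m z, 0 ≤ Q m z := fun m z => by
    have := ha0 m z; have := hF0 z
    simp only [hQ]; positivity
  have hQlim : Tendsto (fun m => ∫ z in K, Q m z) atTop (𝓝 0) :=
    tendsto_setIntegral_of_cubic hF0 hF3 ha0 haI hal hc hQ0
      (Eventually.of_forall fun m => ae_of_all _ fun z => le_rfl)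
  have hQI : ∀ᶠ m in atTop, IntegrableOn (Q m) K := by
    filter_upwards [haI] with m hm
    refine Integrable.mono' (((hF3.const_mul 3).add (hm.const_mul 3)).const_mul c)
      (((((hFm.pow 2).mul (ham m)).add (hFm.mul ((ham m).pow 2))).add
        ((ham m).pow 3)).const_mul c).aestronglyMeasurable (ae_of_all _ fun z => ?_)
    rw [Real.norm_of_nonneg (hQ0 m z)]
    have := cubic_young (hF0 z) (ha0 m z) one_pos le_rfl
    exact mul_le_mul_of_nonneg_left (this.trans (by simp)) hc
  have hbound : ∀ᶠ m in atTop, ∀ᵐ z ∂volume.restrict K,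
      ‖G m z‖ ≤ Q m z + c * (amp w (e m) z ^ 3 / e m) := by
    filter_upwards [hev] with m hm
    filter_upwards [hm.1] with z hz
    exact hbd hw (he0 m) hz _ (hF1 z) (norm_le_envelope w K z) (abs_pressure_le_envelope w K z)
  have hdom : ∀ᶠ m in atTop, IntegrableOn (fun z => Q m z + c * (amp w (e m) z ^ 3 / e m)) K := by
    filter_upwards [hev, hQI] with m hm hm2
    exact hm2.add ((hm.2.div_const _).const_mul c)
  have hGI : ∀ᶠ m in atTop, IntegrableOn (G m) K := by
    filter_upwards [hbound, hdom] with m hm hm2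
    exact hm2.mono' (hGm m).aestronglyMeasurable hm
  refine ⟨hGI, ?_⟩
  have hlim2 : Tendsto (fun m => (∫ z in K, Q m z) + c * ∫ z in K, amp w (e m) z ^ 3 / e m) atTop
      (𝓝 0) := by
    simpa using hQlim.add (hlim.const_mul c)
  refine squeeze_zero' (Eventually.of_forall fun m => integral_nonneg fun z => abs_nonneg _) ?_ hlim2
  filter_upwards [hbound, hdom, hGI, hev, hQI] with m h1 h2 h3 h4 h5
  refine (integral_mono_ae h3.abs h2 h1).trans (le_of_eq ?_)
  rw [integral_add h5 ((h4.2.div_const _).const_mul c)]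
  congr 1
  exact integral_const_mul _ _

end DensityLimit
end EulerLocal
end

/-! ### Convergence of mollified squares at a fixed time. -/

noncomputable section
namespace EulerLocal

section SquareLimit

variable {n : ℕ}

/-- Continuity of translations in `L²`, a case of the continuity of composition with
measure-preserving maps. -/
lemma MemLp.exists_lintegral_translate_le {f : Space n → ℝ} (hf : MemLp f 2 volume) {η : ENNReal}
    (hη : 0 < η) : ∃ r > 0, ∀ y : Space n, ‖y‖ < r → ∫⁻ x, ‖f (x - y) - f x‖ₑ ^ 2 ≤ η := by
  let g : C(Space n, C(Space n, Space n)) :=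
    (ContinuousMap.mk (fun p : Space n × Space n => p.2 - p.1) (by fun_prop)).curry
  have hg : ∀ y, MeasurePreserving (g y) volume volume := fun y => measurePreserving_sub_right _ y
  have hc : Continuous fun y => Lp.compMeasurePreserving (g y) (hg y) (hf.toLp f) :=
    continuous_const.compMeasurePreservingLp g.continuous hg (by simp)
  have hsq : (0 : ENNReal) < η ^ (1 / 2 : ℝ) := ENNReal.rpow_pos_of_nonneg hη (by norm_num)
  have h1 := EMetric.tendsto_nhds.1 (hc.tendsto 0) _ hsq
  obtain ⟨r, hr, h2⟩ := Metric.eventually_nhds_iff.1 h1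
  refine ⟨r, hr, fun y hy => ?_⟩
  have h3 := (h2 (y := y) (by simpa using hy)).le
  rw [Lp.toLp_compMeasurePreserving, Lp.toLp_compMeasurePreserving, Lp.edist_toLp_toLp,
    eLpNorm_eq_lintegral_rpow_enorm_toReal (by norm_num) (by norm_num)] at h3
  rw [ENNReal.toReal_ofNat, ENNReal.rpow_le_rpow_iff (by norm_num)] at h3
  simpa [g] using h3

/-- The error is an average of translation errors over shifts of length at most `ε`. Cauchy–Schwarz
on the unit ball and Tonelli reduce it to continuity of translations. -/
lemma IsMollifier.exists_lintegral_mol_sub_le {h : Space n → ℝ} (hh : IsMollifier h)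
    {f : Space n → ℝ} (hf : MemLp f 2 volume) {η : ENNReal} (hη : 0 < η) :
    ∃ r > 0, ∀ ε, 0 < ε → ε < r → ∫⁻ x, ‖mol (dil ε h) f x - f x‖ₑ ^ 2 ≤ η := by
  wlog hfm : StronglyMeasurable f generalizing f
  -- A strongly measurable representative makes the increments jointly measurable, as Tonelli
  -- requires.
  · obtain ⟨g, hg, hfg⟩ := hf.aestronglyMeasurable
    obtain ⟨r, hr, hb⟩ := this (hf.ae_eq hfg) hg
    refine ⟨r, hr, fun ε h0 h1 => (le_of_eq ?_).trans (hb ε h0 h1)⟩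
    have e : mol (dil ε h) f = mol (dil ε h) g := by
      funext x
      refine integral_congr_ae ?_
      filter_upwards [hfg] with y hy
      rw [hy]
    rw [e]
    refine lintegral_congr_ae ?_
    filter_upwards [hfg] with y hy
    rw [hy]
  obtain ⟨M, hM⟩ := hh.hasCompactSupport.exists_bound_of_continuous hh.contDiff.continuous
  have hM0 : 0 ≤ M := (norm_nonneg _).trans (hM 0)
  set B := Metric.closedBall (0 : Space n) 1 with hB
  have hBf : volume B < ⊤ := measure_closedBall_lt_top
  -- One factor `volume B` comes from Cauchy–Schwarz, the other from the average over shifts; the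
  -- summand `1` makes division safe.
  set c : ENNReal := ENNReal.ofReal M ^ 2 * (volume B * volume B) + 1 with hc
  have hc0 : c ≠ 0 := by rw [hc]; simp
  have hct : c ≠ ⊤ := by
    rw [hc]
    exact ENNReal.add_ne_top.2 ⟨ENNReal.mul_ne_top (by simp) (ENNReal.mul_ne_top hBf.ne hBf.ne),
      by simp⟩
  obtain ⟨r, hr, hb⟩ := MemLp.exists_lintegral_translate_le hf (ENNReal.div_pos hη.ne' hct)
  refine ⟨r, hr, fun ε hε hεr => ?_⟩
  have hmeas : StronglyMeasurable fun p : Space n × Space n => f (p.1 - ε • p.2) - f p.1 :=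
    (hfm.comp_measurable (by fun_prop)).sub (hfm.comp_measurable measurable_fst)
  have hpt : ∀ x, ‖mol (dil ε h) f x - f x‖ₑ ^ 2
      ≤ ENNReal.ofReal M ^ 2 * (volume B * ∫⁻ ζ in B, ‖f (x - ε • ζ) - f x‖ₑ ^ 2) := by
    intro x
    have hi : Integrable fun ζ => f (x - ε • ζ) * h ζ := by
      have h1 : MemLp (fun y => f (x - y)) 2 volume :=
        hf.comp_measurePreserving (Measure.measurePreserving_sub_left volume x)
      have h2 : MemLp (fun y => h (ε⁻¹ • y)) 2 volume :=
        (hh.contDiff.continuous.comp (by fun_prop)).memLp_of_hasCompactSupport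
          (hh.hasCompactSupport.comp_smul (inv_ne_zero hε.ne'))
      have h3 := (h1.integrable_mul h2).comp_smul hε.ne'
      refine h3.congr (ae_of_all _ fun ζ => ?_)
      simp [smul_smul, inv_mul_cancel₀ hε.ne']
    have e1 : mol (dil ε h) f x - f x = ∫ ζ, (f (x - ε • ζ) - f x) * h ζ := by
      rw [mol_dil h f hε]
      simp only [sub_mul]
      rw [integral_sub hi (hh.integrable.const_mul (f x)), integral_const_mul, hh.integral_eq_one,
        mul_one]
    have e2 : ∫ ζ, (f (x - ε • ζ) - f x) * h ζ = ∫ ζ in B, (f (x - ε • ζ) - f x) * h ζ := by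
      refine (setIntegral_eq_integral_of_forall_compl_eq_zero fun ζ hζ => ?_).symm
      rw [hh.eq_zero ζ (by simpa [hB] using hζ), mul_zero]
    have hsm : StronglyMeasurable fun ζ => f (x - ε • ζ) - f x :=
      hmeas.comp_measurable (g := fun ζ => (x, ζ)) (by fun_prop)
    have e3 : ‖mol (dil ε h) f x - f x‖ₑ
        ≤ ENNReal.ofReal M * ∫⁻ ζ in B, ‖f (x - ε • ζ) - f x‖ₑ := by
      rw [e1, e2, ← lintegral_const_mul _ hsm.enorm]
      refine (enorm_integral_le_lintegral_enorm _).trans (lintegral_mono fun ζ => ?_)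
      rw [enorm_mul, mul_comm]
      gcongr
      rw [← ofReal_norm]
      exact ENNReal.ofReal_le_ofReal (hM ζ)
    have e4 := lintegral_rpow_le (volume.restrict B) (g := fun ζ => ‖f (x - ε • ζ) - f x‖ₑ)
      hsm.enorm.aemeasurable Real.HolderConjugate.two_two
    simp only [Measure.restrict_apply_univ, div_self (two_ne_zero' ℝ), ENNReal.rpow_one,
      ENNReal.rpow_ofNat] at e4
    calc ‖mol (dil ε h) f x - f x‖ₑ ^ 2
        ≤ (ENNReal.ofReal M * ∫⁻ ζ in B, ‖f (x - ε • ζ) - f x‖ₑ) ^ 2 := by gcongr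
      _ = ENNReal.ofReal M ^ 2 * (∫⁻ ζ in B, ‖f (x - ε • ζ) - f x‖ₑ) ^ 2 := mul_pow _ _ _
      _ ≤ _ := by gcongr
  have hm2 : Measurable fun p : Space n × Space n => ‖f (p.1 - ε • p.2) - f p.1‖ₑ ^ 2 :=
    hmeas.enorm.pow_const 2
  calc ∫⁻ x, ‖mol (dil ε h) f x - f x‖ₑ ^ 2
      ≤ ∫⁻ x, ENNReal.ofReal M ^ 2 * (volume B * ∫⁻ ζ in B, ‖f (x - ε • ζ) - f x‖ₑ ^ 2) :=
        lintegral_mono hpt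
    _ = ENNReal.ofReal M ^ 2 * (volume B * ∫⁻ ζ in B, ∫⁻ x, ‖f (x - ε • ζ) - f x‖ₑ ^ 2) := by
        rw [lintegral_const_mul' _ _ (by simp), lintegral_const_mul' _ _ hBf.ne,
          lintegral_lintegral_swap hm2.aemeasurable]
    _ ≤ ENNReal.ofReal M ^ 2 * (volume B * ∫⁻ ζ in B, η / c) := by
        gcongr ENNReal.ofReal M ^ 2 * (volume B * ?_)
        refine setLIntegral_mono measurable_const fun ζ hζ => hb _ ?_
        rw [norm_smul, Real.norm_of_nonneg hε.le]
        exact (mul_le_of_le_one_right hε.le (by simpa [hB] using hζ)).trans_lt hεr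
    _ = (ENNReal.ofReal M ^ 2 * (volume B * volume B)) * (η / c) := by
        rw [setLIntegral_const]; ring
    _ ≤ c * (η / c) := by gcongr; exact le_self_add
    _ = η := ENNReal.mul_div_cancel hc0 hct

/-- Mollifications converge in `L²`. -/
lemma IsMollifier.tendsto_integral_mol_sub_sq {h : Space n → ℝ} (hh : IsMollifier h)
    {f : Space n → ℝ} (hf : MemLp f 2 volume) {e : ℕ → ℝ} (he0 : ∀ m, 0 < e m)
    (he : Tendsto e atTop (𝓝 0)) :
    (∀ᶠ m in atTop, MemLp (mol (dil (e m) h) f) 2 volume) ∧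
    Tendsto (fun m => ∫ x, (mol (dil (e m) h) f x - f x) ^ 2) atTop (𝓝 0) := by
  have hae : ∀ m, AEStronglyMeasurable (fun x => mol (dil (e m) h) f x - f x) := fun m =>
    (contDiff_mol (contDiff_dil hh.contDiff _) (hasCompactSupport_dil hh.hasCompactSupport (he0 m))
      (MemLp.locallyIntegrable_two hf)).continuous.aestronglyMeasurable.sub hf.aestronglyMeasurable
  have hev : ∀ η : ENNReal, 0 < η → ∀ᶠ m in atTop,
      ∫⁻ x, ‖mol (dil (e m) h) f x - f x‖ₑ ^ 2 ≤ η := fun η hη => by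
    obtain ⟨r, hr, hb⟩ := hh.exists_lintegral_mol_sub_le hf hη
    filter_upwards [he.eventually_lt_const hr] with m hm using hb _ (he0 m) hm
  refine ⟨?_, ?_⟩
  · filter_upwards [hev 1 one_pos] with m hm
    have h1 : MemLp (fun x => mol (dil (e m) h) f x - f x) 2 volume := by
      refine ⟨hae m, ?_⟩
      rw [eLpNorm_lt_top_iff_lintegral_rpow_enorm_lt_top (by norm_num) (by norm_num)]
      simpa using hm.trans_lt ENNReal.one_lt_top
    refine (h1.add hf).ae_eq (ae_of_all _ fun x => ?_)
    simp
  · have e1 : ∀ m, ∫ x, (mol (dil (e m) h) f x - f x) ^ 2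
        = (∫⁻ x, ‖mol (dil (e m) h) f x - f x‖ₑ ^ 2).toReal := fun m => by
      rw [integral_eq_lintegral_of_nonneg_ae (ae_of_all _ fun x => sq_nonneg _) ((hae m).pow 2)]
      congr 1
      refine lintegral_congr fun x => ?_
      rw [← enorm_pow, Real.enorm_of_nonneg (sq_nonneg _)]
    simp only [e1]
    have h2 : Tendsto (fun m => ∫⁻ x, ‖mol (dil (e m) h) f x - f x‖ₑ ^ 2) atTop (𝓝 0) :=
      ENNReal.tendsto_nhds_zero.2 fun η hη => hev η hη
    simpa [Function.comp_def] using (ENNReal.tendsto_toReal (a := 0) (by simp)).comp h2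

lemma tendsto_integral_sq_mul {V : ℕ → Space n → ℝ} {f g : Space n → ℝ} (hf : MemLp f 2 volume)
    (hV : ∀ᶠ m in atTop, MemLp (V m) 2 volume)
    (hlim : Tendsto (fun m => ∫ x, (V m x - f x) ^ 2) atTop (𝓝 0)) (hg : Continuous g) {B : ℝ}
    (hB : ∀ x, |g x| ≤ B) :
    Tendsto (fun m => ∫ x, V m x ^ 2 * g x) atTop (𝓝 (∫ x, f x ^ 2 * g x)) := by
  have hB0 : 0 ≤ B := (abs_nonneg _).trans (hB 0)
  have hmul : ∀ {k : Space n → ℝ}, Integrable k → Integrable fun x => k x * g x := fun hk =>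
    hk.mul_bdd hg.aestronglyMeasurable (ae_of_all _ hB)
  rw [tendsto_iff_dist_tendsto_zero]
  have hl : Tendsto (fun m => B * ((∫ x, (V m x - f x) ^ 2)
      + 2 * (Real.sqrt (∫ x, (V m x - f x) ^ 2) * Real.sqrt (∫ x, f x ^ 2)))) atTop (𝓝 0) := by
    have h1 := (Real.continuous_sqrt.tendsto 0).comp hlim
    have := (hlim.add ((h1.mul_const (Real.sqrt (∫ x, f x ^ 2))).const_mul 2)).const_mul B
    simpa using this
  refine squeeze_zero' (Eventually.of_forall fun m => dist_nonneg) ?_ hl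
  filter_upwards [hV] with m hm
  have hd : MemLp (fun x => V m x - f x) 2 volume := hm.sub hf
  have i1 : Integrable fun x => (V m x - f x) ^ 2 := hd.integrable_sq
  have i2 : Integrable fun x => |V m x - f x| * |f x| := hd.abs.integrable_mul hf.abs
  rw [Real.dist_eq, ← integral_sub (hmul hm.integrable_sq) (hmul hf.integrable_sq)]
  have h2 : ∫ x, |V m x - f x| * |f x|
      ≤ Real.sqrt (∫ x, (V m x - f x) ^ 2) * Real.sqrt (∫ x, f x ^ 2) := by
    have := (le_abs_self _).trans (abs_integral_mul_le_sqrt hd.abs hf.abs)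
    simpa only [Pi.abs_apply, sq_abs] using this
  have i3 : Integrable fun x => B * ((V m x - f x) ^ 2 + 2 * (|V m x - f x| * |f x|)) :=
    (i1.add (i2.const_mul 2)).const_mul B
  calc |∫ x, (V m x ^ 2 * g x - f x ^ 2 * g x)|
      ≤ ∫ x, B * ((V m x - f x) ^ 2 + 2 * (|V m x - f x| * |f x|)) := by
        refine abs_integral_le_integral_abs.trans (integral_mono
          ((hmul hm.integrable_sq).sub (hmul hf.integrable_sq)).abs i3 fun x => ?_)
        have e : V m x ^ 2 * g x - f x ^ 2 * g x
            = g x * ((V m x - f x) ^ 2 + 2 * ((V m x - f x) * f x)) := by ring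
        simp only
        rw [e, abs_mul]
        refine mul_le_mul (hB x) ((abs_add_le _ _).trans (add_le_add ?_ ?_)) (abs_nonneg _) hB0
        · rw [abs_of_nonneg (sq_nonneg _)]
        · rw [abs_mul, abs_mul, abs_two]
    _ ≤ _ := by
        rw [integral_const_mul, integral_add i1 (i2.const_mul 2), integral_const_mul]
        gcongr

end SquareLimit
end EulerLocal
end

/-! ### Passage to the limit in the local energy balance. -/

noncomputable section
namespace EulerLocal

section LocalEnergy

variable {n : ℕ}

lemma integrable_integral_slice {Ψ : Space n × ℝ → ℝ} (hΨ : Integrable Ψ) :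
    Integrable fun s => ∫ x, Ψ (x, s) :=
  Integrable.integral_prod_right (μ := (volume : Measure (Space n))) (ν := (volume : Measure ℝ)) hΨ

lemma abs_intervalIntegral_slice_le {Ψ : Space n × ℝ → ℝ} (hΨ : Integrable Ψ) (a b : ℝ) :
    |∫ s in a..b, ∫ x, Ψ (x, s)| ≤ ∫ z, |Ψ z| := by
  have h1 := integrable_integral_slice hΨ.abs
  have h2 : ∫ z, |Ψ z| = ∫ s, ∫ x, |Ψ (x, s)| :=
    integral_prod_symm (μ := (volume : Measure (Space n))) (ν := (volume : Measure ℝ)) _ hΨ.abs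
  have h3 := intervalIntegral.norm_integral_le_integral_norm_uIoc (μ := volume) (a := a) (b := b)
    (f := fun s => ∫ x, Ψ (x, s))
  rw [Real.norm_eq_abs] at h3
  refine h3.trans ((setIntegral_le_integral (integrable_integral_slice hΨ).norm
    (ae_of_all _ fun s => norm_nonneg _)).trans ?_)
  rw [h2]
  exact integral_mono (integrable_integral_slice hΨ).norm h1 fun s => abs_integral_le_integral_abs

/-- The local energy balance in terms of a good version of the solution. -/
theorem IsWeakSolution.local_energy_version {T C : ℝ} (hT : 0 ≤ T)
    {u₀ : Space n → Space n} {u w : Space n × ℝ → Space n} (hu : IsWeakSolution T u₀ u)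
    (hw : IsVersion T u w C) {K : Set (Space n × ℝ)} (hKc : IsCompact K)
    (hK : CubicRegularOn w K) {φ : Space n × ℝ → ℝ}
    (hφ : ContDiff ℝ ∞ φ) (hφc : HasCompactSupport φ) {ε₀ : ℝ} (hε₀ : 0 < ε₀)
    (hKφ : ∀ x y s, s ∈ Icc 0 T → (x, s) ∈ tsupport φ → ‖y - x‖ ≤ ε₀ → (y, s) ∈ K)
    {t' t'' : ℝ} (ht' : t' ∈ Icc (0 : ℝ) T) (ht'' : t'' ∈ Icc (0 : ℝ) T) :
    (∑ j, ∫ x, u (x, t'') j ^ 2 * φ (x, t'')) - ∑ j, ∫ x, u (x, t') j ^ 2 * φ (x, t')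
      = ∫ s in t'..t'', ∫ x, K.indicator (locDensity w (K.indicator (pressureFn w)) φ) (x, s) := by
  obtain ⟨h, hh⟩ := exists_isMollifier n
  -- Scales at most `ε₀` keep the mollifiers centred in the support of `φ` inside `K` for every `m`.
  set e : ℕ → ℝ := fun m => ε₀ * (1 / ((m : ℝ) + 1)) with hedef
  have he0 : ∀ m, 0 < e m := fun m => by simp only [hedef]; positivity
  have hele : ∀ m, e m ≤ ε₀ := fun m => by
    refine mul_le_of_le_one_right hε₀.le ?_
    rw [div_le_one (by positivity)]
    linarith [Nat.cast_nonneg (α := ℝ) m]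
  have he : Tendsto e atTop (𝓝 0) := by
    simpa [hedef] using (tendsto_one_div_add_atTop_nhds_zero_nat (𝕜 := ℝ)).const_mul ε₀
  obtain ⟨hI, hlim⟩ := hK.tendsto_integral_density hw hKc hh hφ hφc he0 he
  set p := K.indicator (pressureFn w) with hp
  set J := locDensity w p φ with hJ
  set G : ℕ → Space n × ℝ → ℝ := fun m z =>
    fluxMol (dil (e m) h) w φ z + 2 * (p z * workMol (dil (e m) h) w φ z) with hG
  obtain ⟨B, -, hB, -⟩ := exists_bound_derivs hφ hφc
  -- The terms at fixed times converge at every time, because each slice of `u` itself is in `L²`.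
  have hlhs : ∀ t ∈ Icc 0 T, Tendsto
      (fun m => ∑ j, ∫ x, velMol (dil (e m) h) u j (x, t) ^ 2 * φ (x, t)) atTop
      (𝓝 (∑ j, ∫ x, u (x, t) j ^ 2 * φ (x, t))) := by
    intro t ht
    refine tendsto_finsetSum _ fun j _ => ?_
    have hf := memLp_coord (hu.memLp t ht) j
    obtain ⟨h1, h2⟩ := hh.tendsto_integral_mol_sub_sq hf he0 he
    exact tendsto_integral_sq_mul hf h1 h2 (contDiff_slice hφ t).continuous fun x => hB (x, t)
  have hJI : Integrable (K.indicator J) := by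
    rw [integrable_indicator_iff hKc.measurableSet]
    exact hK.integrableOn_locDensity hw hKc hφ hφc
  have hzero : ∀ m x s, s ∈ Icc 0 T → (x, s) ∉ K → G m (x, s) = 0 := by
    intro m x s hs hx
    have hxφ : (x, s) ∉ tsupport φ := fun hm => hx (hKφ x x s hs hm (by simpa using hε₀.le))
    simp only [hG]
    rw [fluxMol_eq_zero _ _ hφ hxφ, hp, indicator_of_notMem hx]
    simp
  have hrhs : ∀ m, (∑ j, ∫ x, velMol (dil (e m) h) u j (x, t'') ^ 2 * φ (x, t''))
      - ∑ j, ∫ x, velMol (dil (e m) h) u j (x, t') ^ 2 * φ (x, t')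
      = ∫ s in t'..t'', ∫ x, K.indicator (G m) (x, s) := by
    intro m
    have hcs := hasCompactSupport_dil hh.hasCompactSupport (he0 m)
    rw [hu.mollified_energy hT hw (contDiff_dil hh.contDiff (e m)) hcs (dil_neg hh.even _) hφ hφc
      ht' ht'']
    refine intervalIntegral.integral_congr_ae ?_
    filter_upwards [hu.ae_bracket_eq hw (contDiff_dil hh.contDiff (e m)) hcs (dil_neg hh.even _) hφ
      hφc hKc hK fun x y s hs hx hy => dil_eq_zero hh (he0 m) (lt_of_not_ge fun hle =>
        hy (hKφ x y s hs hx (hle.trans (hele m))))] with s h1 hs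
    have hsT : s ∈ Icc (0 : ℝ) T := (uIoc_subset_uIcc.trans (uIcc_subset_Icc ht' ht'')) hs
    rw [h1 hsT]
    refine integral_congr_ae (ae_of_all _ fun x => ?_)
    change G m (x, s) = K.indicator (G m) (x, s)
    by_cases hx : (x, s) ∈ K
    · rw [indicator_of_mem hx]
    · rw [indicator_of_notMem hx]
      exact hzero m x s hsT hx
  -- The difference of the two time integrals is at most the `L¹(K)` distance of the densities,
  -- whatever the order of `t'` and `t''`.
  have hdiff : ∀ᶠ m in atTop, |((∑ j, ∫ x, velMol (dil (e m) h) u j (x, t'') ^ 2 * φ (x, t''))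
      - ∑ j, ∫ x, velMol (dil (e m) h) u j (x, t') ^ 2 * φ (x, t'))
      - ∫ s in t'..t'', ∫ x, K.indicator J (x, s)| ≤ ∫ z in K, |G m z - J z| := by
    filter_upwards [hI] with m hm
    have hΨ : Integrable (K.indicator fun z => G m z - J z) := by
      rw [integrable_indicator_iff hKc.measurableSet]
      exact hm
    have hGe : K.indicator (G m) = fun z => K.indicator (fun z => G m z - J z) z
        + K.indicator J z := by
      funext z
      by_cases hz : z ∈ K
      · simp [hz]
      · simp [hz]
    have hGI : Integrable (K.indicator (G m)) := by rw [hGe]; exact hΨ.add hJI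
    have h1 : (∫ s in t'..t'', ∫ x, K.indicator (G m) (x, s))
        - ∫ s in t'..t'', ∫ x, K.indicator J (x, s)
        = ∫ s in t'..t'', ∫ x, K.indicator (fun z => G m z - J z) (x, s) := by
      rw [← intervalIntegral.integral_sub (integrable_integral_slice hGI).intervalIntegrable
        (integrable_integral_slice hJI).intervalIntegrable]
      refine intervalIntegral.integral_congr_ae ?_
      filter_upwards [hGI.prod_left_ae, hJI.prod_left_ae] with s h1 h2 _
      rw [← integral_sub h1 h2]
      refine integral_congr_ae (ae_of_all _ fun x => ?_)
      simp only [hGe]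
      ring
    rw [hrhs m, h1]
    refine (abs_intervalIntegral_slice_le hΨ t' t'').trans (le_of_eq ?_)
    rw [← integral_indicator hKc.measurableSet]
    refine integral_congr_ae (ae_of_all _ fun z => ?_)
    by_cases hz : z ∈ K
    · simp [hz]
    · simp [hz]
  have hlim2 : Tendsto (fun m => (∑ j, ∫ x, velMol (dil (e m) h) u j (x, t'') ^ 2 * φ (x, t''))
      - ∑ j, ∫ x, velMol (dil (e m) h) u j (x, t') ^ 2 * φ (x, t')) atTop
      (𝓝 (∫ s in t'..t'', ∫ x, K.indicator J (x, s))) := by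
    rw [tendsto_iff_dist_tendsto_zero]
    exact squeeze_zero' (Eventually.of_forall fun m => dist_nonneg) hdiff hlim
  exact tendsto_nhds_unique ((hlhs t'' ht'').sub (hlhs t' ht')) hlim2

lemma inner_gradX (φ : Space n × ℝ → ℝ) (z : Space n × ℝ) (v : Space n) :
    inner ℝ v (gradX φ z) = ∑ j, dx j φ z * v j := by
  rw [real_inner_comm, gradX, inner_gradient_left]
  conv_lhs => rw [eq_sum_stdVec v]
  rw [map_sum]
  refine Finset.sum_congr rfl fun j _ => ?_
  rw [map_smul, smul_eq_mul, mul_comm]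
  rfl

lemma locDensity_eq (w : Space n × ℝ → Space n) (p φ : Space n × ℝ → ℝ) (z : Space n × ℝ) :
    locDensity w p φ z = ‖w z‖ ^ 2 * dt φ z
      + (‖w z‖ ^ 2 + 2 * p z) * inner ℝ (w z) (gradX φ z) := by
  rw [inner_gradX, locDensity, EuclideanSpace.real_norm_sq_eq, Finset.sum_add_distrib,
    ← Finset.sum_mul]
  have : ∑ j, ∑ i, dx i φ z * (w z i * w z j ^ 2) = (∑ j, w z j ^ 2) * ∑ j, dx j φ z * w z j := by
    rw [Finset.sum_mul_sum]
    refine Finset.sum_congr rfl fun j _ => Finset.sum_congr rfl fun i _ => ?_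
    ring
  rw [this]
  ring

/-- The support of a test function on a regular set has a regular compact neighbourhood in `D`. -/
lemma IsRegularSet.exists_compact {T C : ℝ} {u w : Space n × ℝ → Space n} (hw : IsVersion T u w C)
    {D : Set (Space n × ℝ)} (hD : IsRegularSet T u D) {φ : Space n × ℝ → ℝ}
    (hφ : IsTestFunctionOn T D φ) :
    ∃ K, IsCompact K ∧ K ⊆ D ∧ CubicRegularOn w K ∧ ∃ ε > 0, ∀ x y s, s ∈ Icc 0 T →
      (x, s) ∈ tsupport φ → ‖y - x‖ ≤ ε → (y, s) ∈ K := by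
  obtain ⟨O, hO, hDO⟩ := hD.1
  have hsub : tsupport φ ∩ slab n T ⊆ O := hφ.2.2.trans (hDO ▸ inter_subset_left)
  -- The support is thickened inside the open set that cuts out `D`; intersecting with the slab
  -- afterwards keeps the result compact and inside `D`, up to the end times.
  obtain ⟨δ, hδ, hδO⟩ := hφ.isCompact.exists_cthickening_subset_open hO hsub
  have hKD : Metric.cthickening δ (tsupport φ ∩ slab n T) ∩ slab n T ⊆ D :=
    hDO ▸ inter_subset_inter_left _ hδO
  have hKc : IsCompact (Metric.cthickening δ (tsupport φ ∩ slab n T) ∩ slab n T) :=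
    hφ.isCompact.cthickening.inter_right (isClosed_univ.prod isClosed_Icc)
  refine ⟨_, hKc, hKD, hD.cubicRegularOn hw hKc hKD, δ, hδ, fun x y s hs hx hxy => ⟨?_, ?_⟩⟩
  · refine Metric.mem_cthickening_of_dist_le (y, s) (x, s) _ _ ⟨hx, mem_univ _, hs⟩ ?_
    rw [Prod.dist_eq]
    simpa [dist_eq_norm, hδ.le] using hxy
  · exact ⟨mem_univ _, hs⟩

end LocalEnergy
end EulerLocal
end

/-! ### The local energy equality on a regular set. -/

noncomputable section
namespace EulerLocal

section LocalEnergyOn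

variable {n : ℕ}

lemma CubicRegularOn.integrableOn_energy_flux {T C : ℝ} {u w : Space n × ℝ → Space n}
    (hw : IsVersion T u w C) {K : Set (Space n × ℝ)} (hKc : IsCompact K)
    (hK : CubicRegularOn w K) {φ : Space n × ℝ → ℝ}
    (hφ : ContDiff ℝ ∞ φ) (hφc : HasCompactSupport φ) :
    IntegrableOn (fun z => ‖w z‖ ^ 2 * dt φ z) K ∧
    IntegrableOn (fun z => (‖w z‖ ^ 2 + 2 * pressureFn w z) * inner ℝ (w z) (gradX φ z)) K := by
  obtain ⟨B, hB, -, hB2, -, -⟩ := exists_bound_derivs hφ hφc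
  have h1 : IntegrableOn (fun z => ‖w z‖ ^ 2 * dt φ z) K := by
    refine ((hK.integrableOn_envelope hw hKc).mul_const B).mono'
      ((hw.stronglyMeasurable.norm.pow 2).mul
        (continuous_dt hφ).stronglyMeasurable).aestronglyMeasurable (ae_of_all _ fun z => ?_)
    have hF1 := one_le_envelope w K z
    rw [norm_mul, norm_pow, norm_norm]
    refine mul_le_mul ?_ (hB2 z) (norm_nonneg _) (by positivity)
    calc ‖w z‖ ^ 2 ≤ envelope w K z ^ 2 := by gcongr; exact norm_le_envelope w K z
      _ ≤ envelope w K z ^ 3 := pow_le_pow_right₀ hF1 (by norm_num)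
  -- The flux is the full density minus its kinetic part, so its integrability is inherited.
  refine ⟨h1, ((hK.integrableOn_locDensity hw hKc hφ hφc).sub h1).congr ?_⟩
  filter_upwards [ae_restrict_mem hKc.measurableSet] with z hz
  simp only [Pi.sub_apply]
  rw [locDensity_eq, indicator_of_mem hz, add_sub_cancel_left]

lemma gradX_eq_zero {φ : Space n × ℝ → ℝ} (hφ : ContDiff ℝ ∞ φ) {z : Space n × ℝ}
    (hz : z ∉ tsupport φ) (v : Space n) : inner ℝ v (gradX φ z) = 0 := by
  simp [inner_gradX, dx_eq_zero _ hφ hz]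

/-- Integrals over slices of `D` of functions that vanish in the slab off a compact subset. -/
lemma setIntegral_slice_eq {T : ℝ} {D K : Set (Space n × ℝ)} (hKD : K ⊆ D)
    {f g : Space n × ℝ → ℝ} (hf : ∀ z ∈ slab n T, z ∉ K → f z = 0)
    {s : ℝ} (hs : s ∈ Icc 0 T) (hfg : ∀ᵐ x, f (x, s) = g (x, s)) :
    ∫ x in slice D s, f (x, s) = ∫ x, K.indicator g (x, s) := by
  have h0 : ∀ x, x ∉ slice D s → f (x, s) = 0 := fun x hx =>
    hf (x, s) ⟨mem_univ _, hs⟩ fun hm => hx (hKD hm)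
  rw [setIntegral_eq_integral_of_forall_compl_eq_zero h0]
  refine integral_congr_ae ?_
  filter_upwards [hfg] with x hx
  by_cases hz : (x, s) ∈ K
  · rw [indicator_of_mem hz, hx]
  · rw [indicator_of_notMem hz, hf (x, s) ⟨mem_univ _, hs⟩ hz]

/-- The local energy equality on a regular set. -/
theorem IsWeakSolution.local_energy {T C : ℝ} (hT : 0 ≤ T)
    {u₀ : Space n → Space n} {u w : Space n × ℝ → Space n} (hu : IsWeakSolution T u₀ u)
    (hw : IsVersion T u w C) {D : Set (Space n × ℝ)} (hD : IsRegularSet T u D)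
    {φ : Space n × ℝ → ℝ} (hφ : IsTestFunctionOn T D φ) :
    IntegrableOn (fun z => ‖u z‖ ^ 2 * dt φ z) D ∧
    IntegrableOn (fun z => (‖u z‖ ^ 2 + 2 * pressureFn w z) * inner ℝ (u z) (gradX φ z)) D ∧
    ∀ t' ∈ Icc (0 : ℝ) T, ∀ t'' ∈ Icc (0 : ℝ) T,
      (∫ x in slice D t'', ‖u (x, t'')‖ ^ 2 * φ (x, t''))
        - (∫ x in slice D t', ‖u (x, t')‖ ^ 2 * φ (x, t'))
        - (∫ t in t'..t'', ∫ x in slice D t, ‖u (x, t)‖ ^ 2 * dt φ (x, t))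
      = ∫ t in t'..t'', ∫ x in slice D t,
          (‖u (x, t)‖ ^ 2 + 2 * pressureFn w (x, t)) * inner ℝ (u (x, t)) (gradX φ (x, t)) := by
  obtain ⟨K, hKc, hKD, hK, ε, hε, hKφ⟩ := hD.exists_compact hw hφ
  have hsupp : ∀ z ∈ slab n T, z ∉ K → z ∉ tsupport φ := fun z hz hzK hm =>
    hzK (hKφ z.1 z.1 z.2 hz.2 hm (by simpa using hε.le))
  have hDs : D ⊆ slab n T := hD.subset_slab
  obtain ⟨iA, iB⟩ := CubicRegularOn.integrableOn_energy_flux hw hKc hK hφ.1 hφ.2.1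
  set A : Space n × ℝ → ℝ := fun z => ‖w z‖ ^ 2 * dt φ z with hA
  set B : Space n × ℝ → ℝ := fun z =>
    (‖w z‖ ^ 2 + 2 * pressureFn w z) * inner ℝ (w z) (gradX φ z) with hB
  have hzA : ∀ z ∈ slab n T, z ∉ K → ‖u z‖ ^ 2 * dt φ z = 0 := fun z hz hzK => by
    rw [dt_eq_zero hφ.1 (hsupp z hz hzK), mul_zero]
  have hzB : ∀ z ∈ slab n T, z ∉ K →
      (‖u z‖ ^ 2 + 2 * pressureFn w z) * inner ℝ (u z) (gradX φ z) = 0 := fun z hz hzK => by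
    rw [gradX_eq_zero hφ.1 (hsupp z hz hzK), mul_zero]
  have huw : ∀ᵐ z ∂volume.restrict K, w z = u z :=
    ae_restrict_of_ae_restrict_of_subset (hKD.trans hDs) hw.ae_eq_slab
  refine ⟨?_, ?_, fun t' ht' t'' ht'' => ?_⟩
  · refine IntegrableOn.of_forall_sdiff_eq_zero (s := K) (iA.congr ?_) hD.measurableSet
      fun z hz => hzA z (hDs hz.1) hz.2
    filter_upwards [huw] with z hz
    simp only [hA, hz]
  · refine IntegrableOn.of_forall_sdiff_eq_zero (s := K) (iB.congr ?_) hD.measurableSet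
      fun z hz => hzB z (hDs hz.1) hz.2
    filter_upwards [huw] with z hz
    simp only [hB, hz]
  · have hAI : Integrable (K.indicator A) := by rwa [integrable_indicator_iff hKc.measurableSet]
    have hBI : Integrable (K.indicator B) := by rwa [integrable_indicator_iff hKc.measurableSet]
    have hE : ∀ t ∈ Icc 0 T, ∫ x in slice D t, ‖u (x, t)‖ ^ 2 * φ (x, t)
        = ∑ j, ∫ x, u (x, t) j ^ 2 * φ (x, t) := by
      intro t ht
      have h0 : ∀ x, x ∉ slice D t → ‖u (x, t)‖ ^ 2 * φ (x, t) = 0 := fun x hx => by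
        rw [image_eq_zero_of_notMem_tsupport fun hm => hx (hφ.2.2 ⟨hm, mem_univ _, ht⟩), mul_zero]
      rw [setIntegral_eq_integral_of_forall_compl_eq_zero h0]
      obtain ⟨M, -, hM, -⟩ := exists_bound_derivs hφ.1 hφ.2.1
      rw [← integral_finsetSum _ fun j _ =>
        (memLp_coord (hu.memLp t ht) j).integrable_sq.mul_bdd
          (contDiff_slice hφ.1 t).continuous.aestronglyMeasurable (ae_of_all _ fun x => hM (x, t))]
      refine integral_congr_ae (ae_of_all _ fun x => ?_)
      simp only
      rw [EuclideanSpace.real_norm_sq_eq, Finset.sum_mul]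
    have hsub : uIoc t' t'' ⊆ Icc 0 T := uIoc_subset_uIcc.trans (uIcc_subset_Icc ht' ht'')
    have hae : ∀ᵐ s : ℝ, s ∈ uIoc t' t'' → (fun x => w (x, s)) =ᵐ[volume] fun x => u (x, s) := by
      filter_upwards [(ae_restrict_iff' measurableSet_Icc).1 hw.ae_eq] with s hs hst
      exact hs (hsub hst)
    have eA : ∫ t in t'..t'', ∫ x in slice D t, ‖u (x, t)‖ ^ 2 * dt φ (x, t)
        = ∫ t in t'..t'', ∫ x, K.indicator A (x, t) := by
      refine intervalIntegral.integral_congr_ae ?_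
      filter_upwards [hae] with s h1 hs
      refine setIntegral_slice_eq (f := fun z => ‖u z‖ ^ 2 * dt φ z) hKD hzA (hsub hs) ?_
      filter_upwards [h1 hs] with x hx
      simp only [hA, hx]
    have eB : ∫ t in t'..t'', ∫ x in slice D t,
          (‖u (x, t)‖ ^ 2 + 2 * pressureFn w (x, t)) * inner ℝ (u (x, t)) (gradX φ (x, t))
        = ∫ t in t'..t'', ∫ x, K.indicator B (x, t) := by
      refine intervalIntegral.integral_congr_ae ?_
      filter_upwards [hae] with s h1 hs
      refine setIntegral_slice_eq (f := fun z =>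
        (‖u z‖ ^ 2 + 2 * pressureFn w z) * inner ℝ (u z) (gradX φ z)) hKD hzB (hsub hs) ?_
      filter_upwards [h1 hs] with x hx
      simp only [hB, hx]
    rw [hE t'' ht'', hE t' ht', hu.local_energy_version hT hw hKc hK hφ.1 hφ.2.1 hε hKφ ht' ht'',
      eA, eB, sub_eq_iff_eq_add', ← intervalIntegral.integral_add
      (integrable_integral_slice hAI).intervalIntegrable
      (integrable_integral_slice hBI).intervalIntegrable]
    refine intervalIntegral.integral_congr_ae ?_
    filter_upwards [hAI.prod_left_ae, hBI.prod_left_ae] with s h1 h2 _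
    rw [← integral_add h1 h2]
    refine integral_congr_ae (ae_of_all _ fun x => ?_)
    by_cases hx : (x, s) ∈ K
    · simp only [indicator_of_mem hx, locDensity_eq, hA, hB]
    · simp only [indicator_of_notMem hx, add_zero]

end LocalEnergyOn
end EulerLocal
end

theorem lemma2p3 (n : ℕ) (T : ℝ) (hT : 0 < T)
    (u₀ : Space n → Space n) (u : Space n × ℝ → Space n) (hu : IsWeakSolution T u₀ u)
    (D : Set (Space n × ℝ)) (hD : IsRegularSet T u D) :
    ∃ p : Space n × ℝ → ℝ, IsPressureOn T u D p ∧
      ∀ φ : Space n × ℝ → ℝ, IsTestFunctionOn T D φ →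
        IntegrableOn (fun z => ‖u z‖ ^ 2 * dt φ z) D ∧
        IntegrableOn (fun z => (‖u z‖ ^ 2 + 2 * p z) * inner ℝ (u z) (gradX φ z)) D ∧
        ∀ t' ∈ Icc (0 : ℝ) T, ∀ t'' ∈ Icc (0 : ℝ) T,
          (∫ x in slice D t'', ‖u (x, t'')‖ ^ 2 * φ (x, t''))
            - (∫ x in slice D t', ‖u (x, t')‖ ^ 2 * φ (x, t'))
            - (∫ t in t'..t'', ∫ x in slice D t, ‖u (x, t)‖ ^ 2 * dt φ (x, t))
          = ∫ t in t'..t'', ∫ x in slice D t,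
              (‖u (x, t)‖ ^ 2 + 2 * p (x, t)) * inner ℝ (u (x, t)) (gradX φ (x, t)) := by
  obtain ⟨w, C, hw⟩ := hu.exists_version
  exact ⟨pressureFn w, isPressureOn_pressureFn hT.le hw hD, fun φ hφ =>
    hu.local_energy hT.le hw hD hφ⟩
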